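/- Let $c_s>0$, let $I\subset\mathbb R$ be open and $f\in C^2(I;\mathbb R)$, and consider the viscous Jin–Xin model $$\tau_t-u_x=0,\qquad u_t-c_s^2\tau_x=-f(\tau)-u+u_{xx}.$$ Let $(\bar\tau,\bar u)(x-ct)$, $c\in\mathbb R$, be a solitary wave: a nonconstant classical traveling-wave solution whose profile satisfies $(\bar\tau,\bar u)(x)\to(\tau_0,u_0)$ both as $x\to-\infty$ and as $x\to+\infty$, where $\bar\tau$ and $\tau_0$ take values in $I$. Assume that the end state is nondegenerate, $f'(\tau_0)\neq c$. Let $L(\tau,u)=\bigl(c\tau'+u',\; cu'+c_s^2\tau'-f'(\bar\tau)\tau-u+u''\bigr)$ be the linearization in the frame moving with the wave, an operator on $L^2(\mathbb R;\mathbb C^2)$ with domain $H^1\times H^2$. Write $L(\tau,u)=\lambda(\tau,u)$ as the first-order system $W'=A(x,\lambda)W$ with $W=(\tau,u,u')$, $$A(x,\lambda)=\begin{pmatrix}\lambda/c&0&-1/c\\0&0&1\\-c_s^2\lambda/c+f'(\bar\tau(x))&\lambda+1&c_s^2/c-c\end{pmatrix},$$ and let $A_0(\lambda)=\lim_{x\to\pm\infty}A(x,\lambda)$.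 Let $k$ be the dimension of the unstable subspace of $A_0(\lambda)$ for $\lambda$ near $+\infty$. Whenever the $k$ eigenvalues of $A_0(\lambda)$ with largest real parts are separated in real part from the other $3-k$, let $V_1,\dots,V_k$ and $V_{k+1},\dots,V_3$ be bases of the corresponding total eigenspaces, and let $W_j$ be solutions of $W'=AW$ with $W_j(x)=P_-(x)e^{xA_0}V_j$, $P_-(x)\to \mathrm{Id}$ as $x\to-\infty$, for $j\le k$, and $W_j(x)=P_+(x)e^{xA_0}V_j$, $P_+(x)\to \mathrm{Id}$ as $x\to+\infty$, for $j>k$. The Evans function is $$D(\lambda)=\frac{\det(W_1,W_2,W_3)|_{x=0}}{\det(V_1,V_2,V_3)}.$$ The point spectrum is the set of zeros of $D$, and the essential spectrum is the complement of the point spectrum in the $L^2$ spectrum of $L$. Then: 1. $|c|=c_s$ (so $c=c_s$ if $c>0$), and $c f'(\tau_0)<c^2$. 2. If the subcharacteristic condition $|f'(\tau_0)|\le c_s$ holds at the end state, then the essential spectrum is stable: it is contained in $\{\operatorname{Re}\lambda<0\}\cup\{0\}$. 3. In all cases (with or without the subcharacteristic condition) the wave is exponentially unstable: there is a real $\lambda>0$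 with $D(\lambda)=0$, and this $\lambda$ is an eigenvalue of $L$ on $L^2$, i.e. $L(\tau,u)=\lambda(\tau,u)$ for some nonzero $(\tau,u)\in H^1\times H^2$. -/

import Mathlib

open MeasureTheory Filter Topology
open scoped ContDiff Matrix

namespace JinXin

noncomputable section

/-! ### The model and its solitary waves -/

/-- `(T, U)`, functions of time `t` and position `x`, is a classical solution on `ℝ × ℝ` of
`τ_t - u_x = 0`, `u_t - cs² τ_x = -f(τ) - u + u_xx`. -/
def IsClassicalSolution (f : ℝ → ℝ) (cs : ℝ) (T U : ℝ → ℝ → ℝ) : Prop :=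
  ∀ t x : ℝ,
    DifferentiableAt ℝ (fun s => T s x) t ∧ DifferentiableAt ℝ (T t) x ∧
    DifferentiableAt ℝ (fun s => U s x) t ∧ DifferentiableAt ℝ (U t) x ∧
    DifferentiableAt ℝ (deriv (U t)) x ∧
    deriv (fun s => T s x) t - deriv (U t) x = 0 ∧
    deriv (fun s => U s x) t - cs ^ 2 * deriv (T t) x =
      -f (T t x) - U t x + deriv (deriv (U t)) x

/-- `(τ, u)(x - c t)` is a solitary wave with end state `(τ₀, u₀)`: a nonconstant
travelling-wave solution of speed `c` whose profile has the same limit at `-∞` and at `+∞`. -/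
structure IsSolitaryWave (f : ℝ → ℝ) (cs c τ₀ u₀ : ℝ) (τ u : ℝ → ℝ) : Prop where
  solution : IsClassicalSolution f cs (fun t x => τ (x - c * t)) (fun t x => u (x - c * t))
  tendsto_left : Tendsto (fun x => (τ x, u x)) atBot (𝓝 (τ₀, u₀))
  tendsto_right : Tendsto (fun x => (τ x, u x)) atTop (𝓝 (τ₀, u₀))
  nonconstant : ∃ x, (τ x, u x) ≠ (τ₀, u₀)

/-! ### The linearized operator on `L²(ℝ; ℂ²)` and its spectrum -/

/-- The complex Hilbert space `L²(ℝ; ℂ)`. -/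
abbrev L2 : Type := Lp ℂ 2 (volume : Measure ℝ)

/-- `w` is the weak derivative of `v`; both lie in `L²`, so that `v` lies in `H¹`. -/
def HasWeakDeriv (v w : L2) : Prop :=
  ∀ φ : ℝ → ℝ, ContDiff ℝ ∞ φ → HasCompactSupport φ →
    ∫ x, deriv φ x • v x = -∫ x, φ x • w x

/-- The graph of the linearization, in the frame moving with speed `c`,
`L (τ, u) = (c τ' + u', c u' + cs² τ' - b τ - u + u'')`, on the domain `H¹ × H²`.
Here `b` stands for `f'` along the wave. -/
def LinearizedOp (cs c : ℝ) (b : ℝ → ℝ) (v g : L2 × L2) : Prop :=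
  ∃ dτ du ddu : L2, HasWeakDeriv v.1 dτ ∧ HasWeakDeriv v.2 du ∧ HasWeakDeriv du ddu ∧
    (∀ᵐ x, g.1 x = c * dτ x + du x) ∧
    (∀ᵐ x, g.2 x = c * du x + cs ^ 2 * dτ x - b x * v.1 x - v.2 x + ddu x)

/-- `l` is an eigenvalue of the linearized operator in `L²`. -/
def IsL2Eigenvalue (cs c : ℝ) (b : ℝ → ℝ) (l : ℂ) : Prop :=
  ∃ v : L2 × L2, v ≠ 0 ∧ LinearizedOp cs c b v (l • v)

/-- The `L²` resolvent set: `l - L` has a bounded two-sided inverse `R`. -/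
def l2Resolvent (cs c : ℝ) (b : ℝ → ℝ) : Set ℂ :=
  {l | ∃ R : (L2 × L2) →L[ℂ] (L2 × L2),
    (∀ g, LinearizedOp cs c b (R g) (l • R g - g)) ∧
    (∀ v g, LinearizedOp cs c b v g → R (l • v - g) = v)}

/-- The `L²` spectrum of the linearized operator. -/
def l2Spectrum (cs c : ℝ) (b : ℝ → ℝ) : Set ℂ := (l2Resolvent cs c b)ᶜ

/-! ### The Evans function -/

/-- The coefficient matrix of the eigenvalue equation `L (τ, u) = l (τ, u)`, written as the
first-order system `W' = A W` for `W = (τ, u, u')`, at a point where `f'` takes the value `β`. -/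
def evansMatrix (cs c β : ℝ) (l : ℂ) : Matrix (Fin 3) (Fin 3) ℂ :=
  !![l / c, 0, -1 / c;
     0, 0, 1;
     -cs ^ 2 * l / c + β, l + 1, cs ^ 2 / c - c]

/-- The sum of the generalized eigenspaces of `M` for the eigenvalues in `S`. -/
def totalEigenspace (M : Matrix (Fin 3) (Fin 3) ℂ) (S : Set ℂ) : Submodule ℂ (Fin 3 → ℂ) :=
  ⨆ μ ∈ S, Module.End.maxGenEigenspace (Matrix.toLin' M) μ

/-- `M` has no center subspace and its unstable subspace has dimension `k`. -/
def IsHyperbolicSplitting (M : Matrix (Fin 3) (Fin 3) ℂ) (k : ℕ) : Prop :=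
  Module.finrank ℂ (totalEigenspace M {μ | 0 < μ.re}) = k ∧
  Module.finrank ℂ (totalEigenspace M {μ | μ.re < 0}) + k = 3

/-- Bases entering the Evans function of `W' = A(x) W`, `A(x) → A₀` as `x → ±∞`, with `k` growing
modes.  The `V j` with `j < k` span the total eigenspace of the `k` eigenvalues of `A₀` with the
largest real parts, the other `V j` the total eigenspace of the remaining eigenvalues, and the two
groups of eigenvalues are separated by a vertical line `Re μ = σ` (extended consistent splitting;
by `indep` both spans are the full total eigenspaces).  The `W j` are solutions asymptotic to
`exp (x A₀) (V j)`, as `x → -∞` for `j < k` and as `x → +∞` for `j ≥ k`: the two families are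
conjugate by a matrix `P x → 1`.  The quotient `det W(0) / det V` does not depend on the choices. -/
structure EvansFrame (A : ℝ → Matrix (Fin 3) (Fin 3) ℂ) (A₀ : Matrix (Fin 3) (Fin 3) ℂ) (k : ℕ)
    (V : Fin 3 → Fin 3 → ℂ) (W : Fin 3 → ℝ → Fin 3 → ℂ) : Prop where
  indep : LinearIndependent ℂ V
  splitting : ∃ σ : ℝ,
    (∀ j : Fin 3, j.val < k → V j ∈ totalEigenspace A₀ {μ | σ < μ.re}) ∧
    (∀ j : Fin 3, k ≤ j.val → V j ∈ totalEigenspace A₀ {μ | μ.re < σ})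
  solution : ∀ j x, HasDerivAt (W j) (A x *ᵥ W j x) x
  asymptotic_left : ∃ P : ℝ → Matrix (Fin 3) (Fin 3) ℂ, Tendsto P atBot (𝓝 1) ∧
    ∀ j : Fin 3, j.val < k → ∀ x, W j x = P x *ᵥ (NormedSpace.exp (x • A₀) *ᵥ V j)
  asymptotic_right : ∃ P : ℝ → Matrix (Fin 3) (Fin 3) ℂ, Tendsto P atTop (𝓝 1) ∧
    ∀ j : Fin 3, k ≤ j.val → ∀ x, W j x = P x *ᵥ (NormedSpace.exp (x • A₀) *ᵥ V j)

/-- `D(l) = z` for the Evans function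
`D(l) = det (W₁, W₂, W₃)(0) / det (V₁, V₂, V₃)` of the linearized operator, where `b` is `f'` along
the wave and `b₀` its limit.  The number `k` of growing modes is the dimension of the unstable
subspace of the limiting matrix near real plus infinity. -/
def IsEvansValue (cs c : ℝ) (b : ℝ → ℝ) (b₀ : ℝ) (l z : ℂ) : Prop :=
  ∃ (k : ℕ) (V : Fin 3 → Fin 3 → ℂ) (W : Fin 3 → ℝ → Fin 3 → ℂ),
    (∀ᶠ r : ℝ in atTop, IsHyperbolicSplitting (evansMatrix cs c b₀ r) k) ∧
    EvansFrame (fun x => evansMatrix cs c (b x) l) (evansMatrix cs c b₀ l) k V W ∧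
    z = (Matrix.of fun i j => W j 0 i).det / (Matrix.of fun i j => V j i).det

/-- The point spectrum, in the generalized sense: the zeros of the Evans function. -/
def pointSpectrum (cs c : ℝ) (b : ℝ → ℝ) (b₀ : ℝ) : Set ℂ :=
  {l | IsEvansValue cs c b b₀ l 0}

/-- The essential spectrum: the complement of the point spectrum in the `L²` spectrum. -/
def essentialSpectrum (cs c : ℝ) (b : ℝ → ℝ) (b₀ : ℝ) : Set ℂ :=
  l2Spectrum cs c b \ pointSpectrum cs c b b₀

end

end JinXin

/-! Existence of the wave is restrictive. The first profile equation integrates to u = q - cτ, and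
the second becomes c τ'' = h(τ) - (c² - cs²) τ' with h(s) = c s - q - f(s). The energy c τ'²/2 -
H(τ), H' = h, has derivative (cs² - c²) τ'² and the same limit at both ends, so a nonconstant wave
forces c² = cs². The profile equation is then conservative and the wave is a homoclinic orbit. A
nondegenerate end state with a homoclinic orbit is a saddle, which is the inequality c f'(τ₀) < c².
Moreover |τ - τ₀| is positive, decays exponentially, increases near -∞ and decreases near +∞
(`IsSolitaryWave.exists_profile`).

Exponential convergence of the coefficients yields conjugators to the constant-coefficient system at
each end (`exists_local_conjugator`), hence an Evans frame wherever the limiting matrix is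
hyperbolic. If the Evans determinant is nonzero, square integrable solutions vanish
(`eq_zero_of_sq_integrable`) and the inhomogeneous system is solvable in L²
(`exists_isWeakSolution`), so λ lies in the resolvent set (`mem_l2Resolvent`). Under the
subcharacteristic condition the characteristic cubic has no imaginary root for Re λ ≥ 0, λ ≠ 0, so
the splitting known for positive real λ persists by connectedness (`exists_split_roots_complex`).
There every point is a zero of the Evans function or in the resolvent set, and no essential spectrum
is left.

For the instability take c > 0; the case c < 0 follows by reflection. For real λ ≥ 0 one solution
decays at +∞ and one adjoint solution decays at -∞. Their pairing does not depend on x and serves as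
a real Evans function. It is continuous down to λ = 0 although the limiting matrix is not hyperbolic
there (`exists_stable_family`). For large λ it is positive, because an octant is invariant under the
backward flow (`pairing_pos_of_large`). At λ = 0 it vanishes by translation invariance. With Y the
deviation |τ - τ₀| and Y₁ its derivative, its slope there is k k' 2c ∫ Y₁², where k < 0 < k' are the
factors relating the two normalized solutions to the derivative of the wave. Their signs are
opposite because Y₁ has opposite signs at the two ends, so the pairing is negative for small λ > 0
(`pairing_neg_of_small`). The intermediate value theorem gives λ > 0 with vanishing pairing. The
corresponding mode decays at both ends, hence is an L² eigenfunction and forces a zero of the Evans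
function. -/

namespace JinXin

/-! ### Linear equations on the whole line -/

section LinearODE

variable {E : Type*} [NormedAddCommGroup E] [NormedSpace ℝ E]

theorem abs_integral_exp_mul_abs_le {L : ℝ} (hL : 0 < L) (x : ℝ) :
    |∫ s in (0 : ℝ)..x, Real.exp (L * |s|)| ≤ Real.exp (L * |x|) / L := by
  have key : ∀ y : ℝ, 0 ≤ y → ∫ s in (0 : ℝ)..y, Real.exp (L * |s|)
      = (Real.exp (L * y) - 1) / L := by
    intro y hy
    have h1 : ∫ s in (0 : ℝ)..y, Real.exp (L * |s|) = ∫ s in (0 : ℝ)..y, Real.exp (L * s) := by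
      apply intervalIntegral.integral_congr
      intro s hs
      rw [Set.uIcc_of_le hy] at hs
      simp [abs_of_nonneg hs.1]
    rw [h1, intervalIntegral.integral_comp_mul_left (fun s => Real.exp s) hL.ne']
    simp [integral_exp]
    field_simp
  have hpos : ∀ y : ℝ, 0 ≤ y → |(Real.exp (L * y) - 1) / L| ≤ Real.exp (L * y) / L := by
    intro y hy
    have : 1 ≤ Real.exp (L * y) := Real.one_le_exp (by positivity)
    rw [abs_of_nonneg (div_nonneg (by linarith) hL.le)]
    gcongr
    linarith
  rcases le_total 0 x with hx | hx
  · rw [key x hx, abs_of_nonneg hx]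
    exact hpos x hx
  · have h2 : ∫ s in (0 : ℝ)..x, Real.exp (L * |s|)
        = -∫ s in (0 : ℝ)..(-x), Real.exp (L * |s|) := by
      have := intervalIntegral.integral_comp_neg (fun s => Real.exp (L * |s|)) (a := 0) (b := -x)
      simp only [abs_neg, neg_neg, neg_zero] at this
      rw [this, intervalIntegral.integral_symm]
    rw [h2, abs_neg, key (-x) (by linarith), abs_of_nonpos hx]
    exact hpos (-x) (by linarith)

/-- Picard iteration for η = exp(-L|x|) W in the space of bounded continuous functions. Since L > K,
the integral operator has Lipschitz constant K/L < 1, so a single contraction produces the solution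
on the whole line without continuation of local solutions. -/
theorem exists_linear_ode_solution_zero [CompleteSpace E] {A : ℝ → E →L[ℝ] E} (hA : Continuous A)
    {K : ℝ} (hK : ∀ x, ‖A x‖ ≤ K) (w₀ : E) :
    ∃ W : ℝ → E, W 0 = w₀ ∧ ∀ x, HasDerivAt W (A x (W x)) x := by
  have hK0 : 0 ≤ K := (norm_nonneg _).trans (hK 0)
  set L : ℝ := K + 1 with hLdef
  have hL : 0 < L := by positivity
  have hcont : ∀ η : BoundedContinuousFunction ℝ E,
      Continuous fun s => A s (Real.exp (L * |s|) • η s) := fun η =>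
    hA.clm_apply ((Real.continuous_exp.comp (continuous_const.mul continuous_abs)).smul
      η.continuous)
  have hintg : ∀ (η : BoundedContinuousFunction ℝ E) (a b : ℝ),
      IntervalIntegrable (fun s => A s (Real.exp (L * |s|) • η s)) volume a b := fun η a b =>
    (hcont η).intervalIntegrable a b
  have hbound : ∀ (η : BoundedContinuousFunction ℝ E) (x : ℝ),
      ‖Real.exp (-(L * |x|)) • ∫ s in (0 : ℝ)..x, A s (Real.exp (L * |s|) • η s)‖
        ≤ K / L * ‖η‖ := by
    intro η x
    have h1 : ‖∫ s in (0 : ℝ)..x, A s (Real.exp (L * |s|) • η s)‖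
        ≤ |∫ s in (0 : ℝ)..x, K * ‖η‖ * Real.exp (L * |s|)| := by
      apply intervalIntegral.norm_integral_le_abs_of_norm_le
      · filter_upwards with s
        calc ‖A s (Real.exp (L * |s|) • η s)‖ ≤ ‖A s‖ * ‖Real.exp (L * |s|) • η s‖ :=
              (A s).le_opNorm _
          _ ≤ K * (Real.exp (L * |s|) * ‖η‖) := by
              rw [norm_smul, Real.norm_of_nonneg (Real.exp_pos _).le]
              gcongr
              · exact hK s
              · exact η.norm_coe_le_norm s
          _ = _ := by ring
      · exact (Continuous.intervalIntegrable (by fun_prop) _ _)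
    rw [intervalIntegral.integral_const_mul, abs_mul, abs_of_nonneg (by positivity)] at h1
    rw [norm_smul, Real.norm_of_nonneg (Real.exp_pos _).le]
    calc Real.exp (-(L * |x|)) * ‖∫ s in (0 : ℝ)..x, A s (Real.exp (L * |s|) • η s)‖
        ≤ Real.exp (-(L * |x|)) * (K * ‖η‖ * (Real.exp (L * |x|) / L)) := by
          gcongr
          refine h1.trans ?_
          gcongr
          exact abs_integral_exp_mul_abs_le hL x
      _ = (Real.exp (-(L * |x|)) * Real.exp (L * |x|)) * (K / L * ‖η‖) := by ring
      _ = K / L * ‖η‖ := by rw [← Real.exp_add]; simp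
  let T : BoundedContinuousFunction ℝ E → BoundedContinuousFunction ℝ E := fun η =>
    BoundedContinuousFunction.ofNormedAddCommGroup
      (fun x => Real.exp (-(L * |x|)) • (w₀ + ∫ s in (0 : ℝ)..x, A s (Real.exp (L * |s|) • η s)))
      (by
        have : Continuous fun x => ∫ s in (0 : ℝ)..x, A s (Real.exp (L * |s|) • η s) :=
          intervalIntegral.continuous_primitive (hintg η) 0
        fun_prop)
      (‖w₀‖ + K / L * ‖η‖)
      (by
        intro x
        rw [smul_add]
        refine (norm_add_le _ _).trans (add_le_add ?_ (hbound η x))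
        rw [norm_smul, Real.norm_of_nonneg (Real.exp_pos _).le]
        have : Real.exp (-(L * |x|)) ≤ 1 := Real.exp_le_one_iff.2 (by
          have := mul_nonneg hL.le (abs_nonneg x); linarith)
        exact mul_le_of_le_one_left (norm_nonneg _) this)
  have hT : ContractingWith (K / L).toNNReal T := by
    refine ⟨?_, LipschitzWith.of_dist_le_mul fun η ζ => ?_⟩
    · rw [← NNReal.coe_lt_coe, Real.coe_toNNReal _ (by positivity)]
      rw [NNReal.coe_one, div_lt_one hL]; linarith
    · rw [Real.coe_toNNReal _ (by positivity)]
      refine (BoundedContinuousFunction.dist_le (by positivity)).2 fun x => ?_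
      have := hbound (η - ζ) x
      rw [dist_eq_norm, dist_eq_norm]
      refine le_trans (le_of_eq ?_) this
      congr 1
      change Real.exp (-(L * |x|)) • (w₀ + ∫ s in (0 : ℝ)..x, A s (Real.exp (L * |s|) • η s))
        - Real.exp (-(L * |x|)) • (w₀ + ∫ s in (0 : ℝ)..x, A s (Real.exp (L * |s|) • ζ s)) = _
      rw [← smul_sub, add_sub_add_left_eq_sub, ← intervalIntegral.integral_sub (hintg _ _ _)
        (hintg _ _ _)]
      simp [smul_sub]
  set η := ContractingWith.fixedPoint T hT with hη
  have hfix : T η = η := hT.fixedPoint_isFixedPt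
  have hW : ∀ x, Real.exp (L * |x|) • η x
      = w₀ + ∫ s in (0 : ℝ)..x, A s (Real.exp (L * |s|) • η s) := by
    intro x
    conv_lhs => rw [← hfix]
    change Real.exp (L * |x|) • Real.exp (-(L * |x|)) •
      (w₀ + ∫ s in (0 : ℝ)..x, A s (Real.exp (L * |s|) • η s)) = _
    rw [smul_smul, ← Real.exp_add]
    simp
  refine ⟨fun x => Real.exp (L * |x|) • η x, ?_, fun x => ?_⟩
  · simpa using hW 0
  · have h2 : HasDerivAt (fun x => ∫ s in (0 : ℝ)..x, A s (Real.exp (L * |s|) • η s))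
        (A x (Real.exp (L * |x|) • η x)) x :=
      intervalIntegral.integral_hasDerivAt_right (hintg _ _ _)
        ((hcont η).stronglyMeasurableAtFilter _ _) (hcont η).continuousAt
    have h3 := h2.const_add w₀
    exact h3.congr_of_eventuallyEq (Eventually.of_forall hW)

theorem exists_linear_ode_solution [CompleteSpace E] {A : ℝ → E →L[ℝ] E} (hA : Continuous A)
    {K : ℝ} (hK : ∀ x, ‖A x‖ ≤ K) (x₀ : ℝ) (w₀ : E) :
    ∃ W : ℝ → E, W x₀ = w₀ ∧ ∀ x, HasDerivAt W (A x (W x)) x := by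
  obtain ⟨W, h0, hW⟩ := exists_linear_ode_solution_zero (A := fun x => A (x + x₀))
    (hA.comp (by fun_prop)) (fun x => hK _) w₀
  refine ⟨fun x => W (x - x₀), by simpa using h0, fun x => ?_⟩
  have := (hW (x - x₀)).comp_sub_const x x₀
  simpa using this

/-- Grönwall's inequality on both sides of the base point. -/
theorem norm_le_gronwallBound_abs {d d' : ℝ → E} {δ K ε x₀ R : ℝ}
    (hd : ∀ x, HasDerivAt d (d' x) x) (h0 : ‖d x₀‖ ≤ δ)
    (hb : ∀ x, |x - x₀| ≤ R → ‖d' x‖ ≤ K * ‖d x‖ + ε) {x : ℝ} (hx : |x - x₀| ≤ R) :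
    ‖d x‖ ≤ gronwallBound δ K ε |x - x₀| := by
  have hc : Continuous d := continuous_iff_continuousAt.2 fun y => (hd y).continuousAt
  rcases le_total x₀ x with h | h
  · have := norm_le_gronwallBound_of_norm_deriv_right_le (f := d) (f' := d') (δ := δ) (K := K)
      (ε := ε) (a := x₀) (b := x) hc.continuousOn (fun y _ => (hd y).hasDerivWithinAt) h0
      (fun y hy => hb y (by
        rw [abs_of_nonneg (by linarith [hy.1])]
        rw [abs_of_nonneg (by linarith)] at hx
        linarith [hy.2])) x ⟨h, le_rfl⟩
    rwa [abs_of_nonneg (by linarith)]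
  · have hneg : ∀ y, HasDerivAt (fun t => d (2 * x₀ - t)) (-(d' (2 * x₀ - y))) y := by
      intro y
      have := (hd (2 * x₀ - y)).comp_const_sub (2 * x₀) y
      simpa using this
    have := norm_le_gronwallBound_of_norm_deriv_right_le (f := fun t => d (2 * x₀ - t))
      (f' := fun y => -(d' (2 * x₀ - y))) (δ := δ) (K := K)
      (ε := ε) (a := x₀) (b := 2 * x₀ - x)
      (hc.comp (by fun_prop)).continuousOn (fun y _ => (hneg y).hasDerivWithinAt)
      (by convert h0 using 3; ring)
      (fun y hy => by
        rw [norm_neg]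
        exact hb _ (by
          rw [abs_of_nonpos (by linarith [hy.1])]
          rw [abs_of_nonpos (by linarith)] at hx
          linarith [hy.2])) (2 * x₀ - x) ⟨by linarith, le_rfl⟩
    rw [abs_of_nonpos (by linarith)]
    simp only [sub_sub_cancel] at this
    convert this using 2
    ring

end LinearODE

end JinXin

/-! ### Bounded solutions of hyperbolic diagonal systems -/

namespace JinXin

-- For Re d < 0 the kernel exp(d (x - s)) is integrable over s ≤ x with mass at most 1/|Re d| in
-- absolute value. The Duhamel integral from -∞ is therefore a bounded solution, with no initial
-- value to choose.
open BoundedContinuousFunction in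
theorem exists_scalar_solver_neg {d : ℂ} (hd : d.re < 0) :
    ∃ S : BoundedContinuousFunction ℝ ℂ → BoundedContinuousFunction ℝ ℂ,
      (∀ h x, HasDerivAt (S h) (d * S h x + h x) x) ∧
      ∀ h k x, ‖S h x - S k x‖ ≤ ‖h - k‖ / |d.re| := by
  have hint : ∀ (h : BoundedContinuousFunction ℝ ℂ) (x : ℝ),
      IntegrableOn (fun s : ℝ => Complex.exp (-d * s) * h s) (Set.Iic x) := by
    intro h x
    refine Integrable.mono' ((integrableOn_exp_mul_Iic (a := -d.re) (by linarith) x).mul_const ‖h‖)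
      (Continuous.aestronglyMeasurable (by have := h.continuous; fun_prop)) ?_
    filter_upwards with s
    rw [norm_mul, Complex.norm_exp]
    simp only [Complex.mul_re, Complex.neg_re, Complex.ofReal_re, Complex.neg_im,
      Complex.ofReal_im, mul_zero, sub_zero]
    gcongr
    exact h.norm_coe_le_norm s
  have hle : ∀ (h : BoundedContinuousFunction ℝ ℂ) (x : ℝ),
      ‖Complex.exp (d * x) * ∫ s in Set.Iic x, Complex.exp (-d * s) * h s‖
        ≤ ‖h‖ / |d.re| := by
    intro h x
    have h1 : ‖∫ s in Set.Iic x, Complex.exp (-d * s) * h s‖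
        ≤ ∫ s in Set.Iic x, Real.exp (-d.re * s) * ‖h‖ := by
      refine norm_integral_le_of_norm_le
        ((integrableOn_exp_mul_Iic (a := -d.re) (by linarith) x).mul_const ‖h‖) ?_
      filter_upwards with s
      rw [norm_mul, Complex.norm_exp]
      simp only [Complex.mul_re, Complex.neg_re, Complex.ofReal_re, Complex.neg_im,
        Complex.ofReal_im, mul_zero, sub_zero]
      gcongr
      exact h.norm_coe_le_norm s
    rw [integral_mul_const, integral_exp_mul_Iic (by linarith)] at h1
    rw [norm_mul, Complex.norm_exp]
    simp only [Complex.mul_re, Complex.ofReal_re, Complex.ofReal_im, mul_zero, sub_zero]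
    rw [abs_of_neg hd]
    calc Real.exp (d.re * x) * ‖∫ s in Set.Iic x, Complex.exp (-d * s) * h s‖
        ≤ Real.exp (d.re * x) * (Real.exp (-d.re * x) / -d.re * ‖h‖) := by gcongr
      _ = (Real.exp (d.re * x) * Real.exp (-d.re * x)) * (‖h‖ / -d.re) := by ring
      _ = _ := by rw [← Real.exp_add]; simp
  have hder : ∀ (h : BoundedContinuousFunction ℝ ℂ) (x : ℝ), HasDerivAt
      (fun x : ℝ => Complex.exp (d * x) * ∫ s in Set.Iic x, Complex.exp (-d * s) * h s)
      (d * (Complex.exp (d * x) * ∫ s in Set.Iic x, Complex.exp (-d * s) * h s) + h x) x := by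
    intro h x
    have hc : Continuous fun s : ℝ => Complex.exp (-d * s) * h s := by
      have := h.continuous; fun_prop
    have h1 : HasDerivAt (fun x : ℝ => ∫ s in (0 : ℝ)..x, Complex.exp (-d * s) * h s)
        (Complex.exp (-d * x) * h x) x :=
      intervalIntegral.integral_hasDerivAt_right (hc.intervalIntegrable _ _)
        (hc.stronglyMeasurableAtFilter _ _) hc.continuousAt
    have h2 : HasDerivAt (fun x : ℝ => ∫ s in Set.Iic x, Complex.exp (-d * s) * h s)
        (Complex.exp (-d * x) * h x) x := by
      refine (h1.const_add (∫ s in Set.Iic (0 : ℝ), Complex.exp (-d * s) * h s)).congr_of_eventuallyEq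
        (Eventually.of_forall fun y => ?_)
      simp only
      rw [← intervalIntegral.integral_Iic_sub_Iic (hint h 0) (hint h y)]
      ring
    have h3 : HasDerivAt (fun x : ℝ => Complex.exp (d * x)) (Complex.exp (d * x) * d) x := by
      have := ((Complex.ofRealCLM.hasDerivAt (x := x)).const_mul d).cexp
      simpa using this
    refine (h3.mul h2).congr_deriv ?_
    have : Complex.exp (d * x) * (Complex.exp (-d * x) * h x) = h x := by
      rw [← mul_assoc, ← Complex.exp_add]; simp
    rw [this]; ring
  refine ⟨fun h => ofNormedAddCommGroup _ (continuous_iff_continuousAt.2 fun x =>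
    (hder h x).continuousAt) (‖h‖ / |d.re|) (hle h), hder, fun h k x => ?_⟩
  refine le_trans (le_of_eq ?_) (hle (h - k) x)
  simp only [coe_ofNormedAddCommGroup]
  rw [← mul_sub, ← integral_sub (hint h x) (hint k x)]
  simp [mul_sub]

theorem exists_scalar_solver {d : ℂ} (hd : d.re ≠ 0) :
    ∃ S : BoundedContinuousFunction ℝ ℂ → BoundedContinuousFunction ℝ ℂ,
      (∀ h x, HasDerivAt (S h) (d * S h x + h x) x) ∧
      ∀ h k x, ‖S h x - S k x‖ ≤ ‖h - k‖ / |d.re| := by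
  rcases lt_or_gt_of_ne hd with hd | hd
  · exact exists_scalar_solver_neg hd
  · obtain ⟨S, hS, hS'⟩ := exists_scalar_solver_neg (d := -d) (by simpa using hd)
    let neg : C(ℝ, ℝ) := ⟨fun x => -x, continuous_neg⟩
    refine ⟨fun h => -(S (h.compContinuous neg)).compContinuous neg, fun h x => ?_,
      fun h k x => ?_⟩
    · have := ((hS (h.compContinuous neg) (-x)).scomp x (hasDerivAt_neg x)).neg
      refine this.congr_deriv ?_
      simp [neg, BoundedContinuousFunction.compContinuous_apply, add_comm]
    · have := hS' (h.compContinuous neg) (k.compContinuous neg) (-x)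
      have h1 : ‖h.compContinuous neg - k.compContinuous neg‖ ≤ ‖h - k‖ := by
        refine (BoundedContinuousFunction.norm_le (norm_nonneg _)).2 fun y => ?_
        exact (h - k).norm_coe_le_norm (-y)
      simp only [BoundedContinuousFunction.neg_apply, BoundedContinuousFunction.compContinuous_apply]
      rw [neg_sub_neg, norm_sub_rev]
      refine this.trans ?_
      rw [Complex.neg_re, abs_neg]
      gcongr

/-- The scalar solvers invert the diagonal part on bounded functions with norm at most 1/a, whatever
the signs of the real parts. A coupling with Lipschitz constant θ < a then gives a contraction of
ratio θ/a. -/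
theorem exists_bounded_solution {ι : Type*} [Fintype ι] {d : ι → ℂ} {a θ G : ℝ} (hθ0 : 0 ≤ θ)
    (hθ : θ < a) (hd : ∀ i, a ≤ |(d i).re|) {F : ℝ → (ι → ℂ) → ι → ℂ}
    (hFc : Continuous (Function.uncurry F)) (hF : ∀ x u v, ‖F x u - F x v‖ ≤ θ * ‖u - v‖)
    (hG : ∀ x, ‖F x 0‖ ≤ G) :
    ∃ (η : ℝ → ι → ℂ) (C : ℝ), (∀ x, ‖η x‖ ≤ C) ∧
      ∀ x i, HasDerivAt (fun y => η y i) (d i * η x i + F x (η x) i) x := by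
  have ha : 0 < a := hθ0.trans_lt hθ
  choose S hS hS' using fun i => exists_scalar_solver (d := d i)
    (abs_pos.1 (ha.trans_le (hd i)))
  let N : BoundedContinuousFunction ℝ (ι → ℂ) → ι → BoundedContinuousFunction ℝ ℂ := fun η i =>
    BoundedContinuousFunction.ofNormedAddCommGroup (fun x => F x (η x) i)
      ((continuous_apply i).comp (hFc.comp (continuous_id.prodMk η.continuous))) (θ * ‖η‖ + G)
      (fun x => by
        refine (norm_le_pi_norm _ i).trans ?_
        have h1 := hF x (η x) 0
        rw [sub_zero] at h1
        calc ‖F x (η x)‖ = ‖(F x (η x) - F x 0) + F x 0‖ := by rw [sub_add_cancel]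
          _ ≤ ‖F x (η x) - F x 0‖ + ‖F x 0‖ := norm_add_le _ _
          _ ≤ θ * ‖η‖ + G := add_le_add
              (h1.trans (mul_le_mul_of_nonneg_left (η.norm_coe_le_norm x) hθ0)) (hG x))
  have hN : ∀ η ζ i, ‖N η i - N ζ i‖ ≤ θ * ‖η - ζ‖ := by
    intro η ζ i
    refine (BoundedContinuousFunction.norm_le (by positivity)).2 fun x => ?_
    have : (N η i - N ζ i) x = (F x (η x) - F x (ζ x)) i := rfl
    rw [this]
    exact (norm_le_pi_norm _ i).trans ((hF x _ _).trans
      (mul_le_mul_of_nonneg_left ((η - ζ).norm_coe_le_norm x) hθ0))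
  let T : BoundedContinuousFunction ℝ (ι → ℂ) → BoundedContinuousFunction ℝ (ι → ℂ) := fun η =>
    BoundedContinuousFunction.ofNormedAddCommGroup (fun x i => S i (N η i) x)
      (continuous_pi fun i => (S i (N η i)).continuous) (∑ i, ‖S i (N η i)‖) (fun x => by
        refine (pi_norm_le_iff_of_nonneg (Finset.sum_nonneg fun i _ => norm_nonneg _)).2 fun i => ?_
        exact ((S i (N η i)).norm_coe_le_norm x).trans
          (Finset.single_le_sum (f := fun i => ‖S i (N η i)‖) (fun i _ => norm_nonneg _)
            (Finset.mem_univ i)))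
  have hT : ContractingWith (θ / a).toNNReal T := by
    refine ⟨?_, LipschitzWith.of_dist_le_mul fun η ζ => ?_⟩
    · rw [← NNReal.coe_lt_coe, Real.coe_toNNReal _ (by positivity), NNReal.coe_one, div_lt_one ha]
      exact hθ
    · rw [Real.coe_toNNReal _ (by positivity)]
      refine (BoundedContinuousFunction.dist_le (by positivity)).2 fun x => ?_
      rw [dist_eq_norm, dist_eq_norm]
      refine (pi_norm_le_iff_of_nonneg (by positivity)).2 fun i => ?_
      refine (hS' i (N η i) (N ζ i) x).trans ?_
      calc ‖N η i - N ζ i‖ / |(d i).re| ≤ θ * ‖η - ζ‖ / a := by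
            gcongr
            · exact hN η ζ i
            · exact hd i
        _ = θ / a * ‖η - ζ‖ := by ring
  set η := ContractingWith.fixedPoint T hT with hη
  have hfix : T η = η := hT.fixedPoint_isFixedPt
  have hηi : ∀ x i, η x i = S i (N η i) x := fun x i => by
    conv_lhs => rw [← hfix]
    rfl
  refine ⟨η, ‖η‖, fun x => η.norm_coe_le_norm x, fun x i => ?_⟩
  refine ((hS i (N η i) x).congr_of_eventuallyEq
    (Eventually.of_forall fun y => hηi y i)).congr_deriv ?_
  rw [hηi x i]
  rfl

end JinXin

/-! ### Conjugation to constant coefficients -/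

namespace JinXin

/-- A conjugator found only near +∞ solves a linear equation for matrices whose coefficients are
bounded on the whole line. The global solution with the same value at `M + 1` agrees with it from
there on; the extra 1 is needed because the equation for `Q` is known only on the open half-line. -/
theorem exists_sylvester_extension {𝔸 : Type*} [NormedRing 𝔸] [NormedAlgebra ℝ 𝔸] [CompleteSpace 𝔸]
    {A : ℝ → 𝔸} (hA : Continuous A) {K : ℝ} (hK : ∀ x, ‖A x‖ ≤ K) (A₀ : 𝔸) {Q : ℝ → 𝔸} {M : ℝ}
    (hQ : ∀ x > M, HasDerivAt Q (A x * Q x - Q x * A₀) x) :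
    ∃ P : ℝ → 𝔸, (∀ x, HasDerivAt P (A x * P x - P x * A₀) x) ∧ ∀ x, M + 1 ≤ x → Q x = P x := by
  let Φ : ℝ → 𝔸 →L[ℝ] 𝔸 := fun x =>
    ContinuousLinearMap.mul ℝ 𝔸 (A x) - (ContinuousLinearMap.mul ℝ 𝔸).flip A₀
  have hΦa : ∀ x Y, Φ x Y = A x * Y - Y * A₀ := fun x Y => rfl
  have hΦ : Continuous Φ :=
    ((ContinuousLinearMap.mul ℝ 𝔸).continuous.comp hA).sub continuous_const
  have hΦK : ∀ x, ‖Φ x‖ ≤ K + ‖A₀‖ := by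
    intro x
    refine ContinuousLinearMap.opNorm_le_bound _
      (add_nonneg ((norm_nonneg _).trans (hK 0)) (norm_nonneg _)) fun Y => ?_
    rw [hΦa]
    refine (norm_sub_le _ _).trans ?_
    rw [add_mul]
    refine add_le_add ((norm_mul_le _ _).trans ?_) ((norm_mul_le _ _).trans (le_of_eq (mul_comm _ _)))
    gcongr
    exact hK x
  obtain ⟨P, hP0, hP⟩ := exists_linear_ode_solution hΦ hΦK (M + 1) (Q (M + 1))
  refine ⟨P, fun x => hP x, fun x hx => ?_⟩
  have hu := ODE_solution_unique (v := fun x => Φ x) (K := (K + ‖A₀‖).toNNReal) (f := Q) (g := P)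
    (a := M + 1) (b := x) (fun t => (Φ t).lipschitz.weaken (by
      rw [← NNReal.coe_le_coe]
      exact (hΦK t).trans (Real.le_coe_toNNReal _)))
    (fun t ht => (hQ t (by linarith [ht.1])).continuousAt.continuousWithinAt)
    (fun t ht => (hQ t (by linarith [ht.1])).hasDerivWithinAt)
    (fun t ht => (hP t).continuousAt.continuousWithinAt)
    (fun t ht => (hP t).hasDerivWithinAt) hP0.symm
  exact hu ⟨hx, le_rfl⟩

section Conjugator

open scoped Matrix.Norms.Operator

variable {n : Type*} [Fintype n] [DecidableEq n]

/-- `A₀` is similar to matrices arbitrarily close to the diagonal matrix with entries `d`. -/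
def NearlyDiagonalizable (A₀ : Matrix n n ℂ) (d : n → ℂ) : Prop :=
  ∀ δ > 0, ∃ V V' N : Matrix n n ℂ, V * V' = 1 ∧ V' * V = 1 ∧
    A₀ * V = V * (Matrix.diagonal d + N) ∧ ∀ i j, ‖N i j‖ ≤ δ

theorem NearlyDiagonalizable.neg {A₀ : Matrix n n ℂ} {d : n → ℂ}
    (h : NearlyDiagonalizable A₀ d) : NearlyDiagonalizable (-A₀) (-d) := by
  intro δ hδ
  obtain ⟨V, V', N, h1, h2, h3, h4⟩ := h δ hδ
  refine ⟨V, V', -N, h1, h2, ?_, by simpa using h4⟩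
  rw [Matrix.neg_mul, h3, ← Matrix.mul_neg, neg_add, Matrix.diagonal_neg]
  rfl

theorem norm_matrix_mul_apply_le {M Y : Matrix n n ℂ} {a b : ℝ} (hM : ∀ i j, ‖M i j‖ ≤ a)
    (hY : ∀ i j, ‖Y i j‖ ≤ b) (i j : n) : ‖(M * Y) i j‖ ≤ Fintype.card n * (a * b) := by
  rw [Matrix.mul_apply]
  refine (norm_sum_le _ _).trans ?_
  rw [← nsmul_eq_mul]
  refine Finset.sum_le_card_nsmul _ _ _ fun k _ => ?_
  rw [norm_mul]
  exact mul_le_mul (hM i k) (hY k j) (norm_nonneg _) ((norm_nonneg _).trans (hM i k))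

theorem exists_pos_forall_le {ι : Type*} [Finite ι] {f : ι → ℝ} (hf : ∀ i, 0 < f i) :
    ∃ a > 0, ∀ i, a ≤ f i := by
  rcases isEmpty_or_nonempty ι with h | h
  · exact ⟨1, one_pos, fun i => h.elim i⟩
  · obtain ⟨i, hi⟩ := Finite.exists_min f
    exact ⟨f i, hf i, hi⟩

/-- Only the finitely many values -r i are resonant, and an interval is infinite. Nonresonance of β
is what makes a spectral gap condition unnecessary in the construction of conjugators. -/
theorem exists_rate_avoiding {ι : Type*} [Finite ι] (r : ι → ℝ) {κ : ℝ} (hκ : 0 < κ) :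
    ∃ β, 0 < β ∧ β < κ ∧ ∃ a > 0, ∀ i, a ≤ |r i + β| := by
  obtain ⟨β, hβ, hβ'⟩ := (Set.Ioo_infinite hκ).exists_notMem_finite
    (Set.finite_range fun i => -r i)
  refine ⟨β, hβ.1, hβ.2, exists_pos_forall_le fun i => abs_pos.2 fun h => hβ' ⟨i, ?_⟩⟩
  simp only
  linarith

/-- In the basis V the conjugator is sought as 1 + exp(-βx) Y. With R denoting A - A₀ in that basis,
the correction satisfies Y' = [diag d, Y] + βY + [N, Y] + RY + exp(βx) R. The source is bounded
since β < κ, and no Re(d i - d j) + β vanishes, so the entries of Y are obtained as a bounded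
solution. Boundedness of Y makes the correction tend to 0. -/
theorem exists_local_conjugator {A₀ : Matrix n n ℂ} {d : n → ℂ}
    (hd : NearlyDiagonalizable A₀ d) {A : ℝ → Matrix n n ℂ} (hA : Continuous A) {C κ : ℝ}
    (hκ : 0 < κ) (hC : ∀ x, 0 ≤ x → ∀ i j, ‖(A x - A₀) i j‖ ≤ C * Real.exp (-κ * x)) :
    ∃ (P : ℝ → Matrix n n ℂ) (M : ℝ), (∀ x > M, HasDerivAt P (A x * P x - P x * A₀) x) ∧
      Tendsto P atTop (𝓝 1) := by
  obtain ⟨β, hβ0, hβκ, a, ha, hβa⟩ := exists_rate_avoiding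
    (fun p : n × n => (d p.1 - d p.2).re) hκ
  set D : ℝ := (Fintype.card n : ℝ) with hD
  have hD0 : 0 ≤ D := Nat.cast_nonneg _
  -- With entries of this size, each of the products N Y, Y N and R Y costs at most a/8, in total
  -- less than the Lipschitz constant a/2 claimed in `hF`.
  obtain ⟨V, V', N, hV1, hV2, hAV, hN⟩ := hd (a / (8 * (D + 1))) (by positivity)
  set δ := a / (8 * (D + 1)) with hδ
  have hDδ : D * δ ≤ a / 8 := by
    rw [hδ, mul_div_assoc', div_le_div_iff₀ (by positivity) (by norm_num)]
    nlinarith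
  let R : ℝ → Matrix n n ℂ := fun x => V' * (A x - A₀) * V
  have hR : Continuous R := by fun_prop
  have hV2' : A₀ * V = V * (Matrix.diagonal d + N) := hAV
  -- entrywise decay of `R`
  obtain ⟨C', hC'0, hC'⟩ : ∃ C' : ℝ, 0 ≤ C' ∧ ∀ x, 0 ≤ x → ∀ i j,
      ‖R x i j‖ ≤ C' * Real.exp (-κ * x) := by
    have hentry : ∀ W : Matrix n n ℂ, ∃ w : ℝ, 0 ≤ w ∧ ∀ i j, ‖W i j‖ ≤ w := by
      intro W
      obtain ⟨w, hw⟩ := (Set.finite_range fun p : n × n => ‖W p.1 p.2‖).bddAbove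
      exact ⟨max w 0, le_max_right _ _, fun i j => (hw ⟨(i, j), rfl⟩).trans (le_max_left _ _)⟩
    obtain ⟨v, hv0, hv⟩ := hentry V
    obtain ⟨v', hv'0, hv'⟩ := hentry V'
    refine ⟨D * ((D * (v' * |C|)) * v), by positivity, fun x hx i j => ?_⟩
    have h1 : ∀ i j, ‖(A x - A₀) i j‖ ≤ |C| * Real.exp (-κ * x) := fun i j =>
      (hC x hx i j).trans (by gcongr; exact le_abs_self C)
    refine (norm_matrix_mul_apply_le (norm_matrix_mul_apply_le hv' h1) hv i j).trans
      (le_of_eq ?_)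
    rw [← hD]; ring
  have hdecay : Tendsto (fun x : ℝ => C' * Real.exp (-κ * x)) atTop (𝓝 0) := by
    have := (Real.tendsto_exp_atBot.comp
      (tendsto_id.const_mul_atTop_of_neg (neg_lt_zero.2 hκ))).const_mul C'
    simpa using this
  obtain ⟨M, hM0, hM⟩ : ∃ M : ℝ, 0 ≤ M ∧ ∀ x ≥ M, C' * Real.exp (-κ * x) ≤ δ := by
    obtain ⟨M, hM⟩ := eventually_atTop.1 (hdecay.eventually_le_const
      (show (0 : ℝ) < δ by positivity))
    exact ⟨max M 0, le_max_right _ _, fun x hx => hM x ((le_max_left _ _).trans hx)⟩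
  let toM : (n × n → ℂ) → Matrix n n ℂ := fun y => Matrix.of fun i j => y (i, j)
  have htoM : Continuous toM := by
    refine continuous_matrix fun i j => ?_
    exact continuous_apply _
  -- The perturbation is frozen at `M` for x < M, where it need not be small. The conjugation
  -- equation is therefore obtained only for x > M.
  let F : ℝ → (n × n → ℂ) → n × n → ℂ := fun x y p =>
    (N * toM y - toM y * N + R (max x M) * toM y
      + Complex.ofReal (Real.exp (β * max x M)) • R (max x M)) p.1 p.2
  have hFc : Continuous (Function.uncurry F) := by
    refine continuous_pi fun p => ?_
    have h1 : Continuous fun q : ℝ × (n × n → ℂ) => toM q.2 := htoM.comp continuous_snd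
    have h2 : Continuous fun q : ℝ × (n × n → ℂ) => R (max q.1 M) :=
      hR.comp (by fun_prop)
    have h3 : Continuous fun q : ℝ × (n × n → ℂ) =>
        Complex.ofReal (Real.exp (β * max q.1 M)) := by fun_prop
    have h4 : Continuous fun q : ℝ × (n × n → ℂ) =>
        N * toM q.2 - toM q.2 * N + R (max q.1 M) * toM q.2
      + Complex.ofReal (Real.exp (β * max q.1 M)) • R (max q.1 M) :=
      (((continuous_const.mul h1).sub (h1.mul continuous_const)).add (h2.mul h1)).add (h3.smul h2)
    exact h4.matrix_elem p.1 p.2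
  have hRM : ∀ x i j, ‖R (max x M) i j‖ ≤ δ := fun x i j =>
    (hC' _ (hM0.trans (le_max_right _ _)) i j).trans (hM _ (le_max_right _ _))
  have hF : ∀ x u v, ‖F x u - F x v‖ ≤ (a / 2) * ‖u - v‖ := by
    intro x u v
    refine (pi_norm_le_iff_of_nonneg (by positivity)).2 fun p => ?_
    have hY : ∀ i j, ‖toM (u - v) i j‖ ≤ ‖u - v‖ := fun i j => norm_le_pi_norm (u - v) (i, j)
    have hsub : toM (u - v) = toM u - toM v := rfl
    have h0 : (F x u - F x v) p = (N * toM (u - v)) p.1 p.2 - (toM (u - v) * N) p.1 p.2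
        + (R (max x M) * toM (u - v)) p.1 p.2 := by
      rw [hsub]
      simp only [F, Pi.sub_apply, Matrix.add_apply, Matrix.sub_apply, Matrix.mul_sub,
        Matrix.sub_mul]
      ring
    rw [h0]
    have e1 := norm_matrix_mul_apply_le hN hY p.1 p.2
    have e2 := norm_matrix_mul_apply_le hY hN p.1 p.2
    have e3 := norm_matrix_mul_apply_le (hRM x) hY p.1 p.2
    rw [← hD] at e1 e2 e3
    refine (norm_add_le _ _).trans ((add_le_add_left (norm_sub_le _ _) _).trans ?_)
    have : 0 ≤ ‖u - v‖ := norm_nonneg _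
    nlinarith
  have hG : ∀ x, ‖F x 0‖ ≤ C' := by
    intro x
    refine (pi_norm_le_iff_of_nonneg hC'0).2 fun p => ?_
    have h0 : F x 0 p = Complex.ofReal (Real.exp (β * max x M)) * R (max x M) p.1 p.2 := by
      have : toM 0 = 0 := rfl
      simp [F, this]
    rw [h0, norm_mul, Complex.norm_real, Real.norm_of_nonneg (Real.exp_pos _).le]
    have hm : 0 ≤ max x M := hM0.trans (le_max_right _ _)
    calc Real.exp (β * max x M) * ‖R (max x M) p.1 p.2‖
        ≤ Real.exp (β * max x M) * (C' * Real.exp (-κ * max x M)) := by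
          gcongr
          exact hC' _ hm _ _
      _ = C' * Real.exp ((β - κ) * max x M) := by
          rw [mul_left_comm, ← Real.exp_add]; ring_nf
      _ ≤ C' * 1 := by
          gcongr
          exact Real.exp_le_one_iff.2 (mul_nonpos_of_nonpos_of_nonneg (by linarith) hm)
      _ = C' := mul_one _
  obtain ⟨η, K, hK, hη⟩ := exists_bounded_solution (d := fun p : n × n => d p.1 - d p.2 + β)
    (a := a) (θ := a / 2) (by positivity) (by linarith)
    (fun p => by simpa using hβa p) hFc hF hG
  let Y : ℝ → Matrix n n ℂ := fun x => toM (η x)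
  let X : ℝ → Matrix n n ℂ := fun x => 1 + Complex.ofReal (Real.exp (-β * x)) • Y x
  have hY : ∀ x, HasDerivAt Y (Matrix.diagonal d * Y x - Y x * Matrix.diagonal d
      + (β : ℂ) • Y x + toM (F x (η x))) x := by
    intro x
    refine hasDerivAt_pi.2 fun i => hasDerivAt_pi.2 fun j => ?_
    refine (hη x (i, j)).congr_deriv ?_
    simp [Y, toM, Matrix.diagonal_mul, Matrix.mul_diagonal]
    ring
  have hexp : ∀ x : ℝ, HasDerivAt (fun x : ℝ => Complex.ofReal (Real.exp (-β * x)))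
      (-(β : ℂ) * Complex.ofReal (Real.exp (-β * x))) x := by
    intro x
    have := (((hasDerivAt_id x).const_mul (-β)).exp).ofReal_comp
    refine this.congr_deriv ?_
    simp; ring
  have hX : ∀ x > M, HasDerivAt X ((Matrix.diagonal d + N) * X x - X x * (Matrix.diagonal d + N)
      + R x * X x) x := by
    intro x hx
    refine (((hexp x).smul (hY x)).const_add (1 : Matrix n n ℂ)).congr_deriv ?_
    have hFx : toM (F x (η x)) = N * Y x - Y x * N + R x * Y x
        + Complex.ofReal (Real.exp (β * x)) • R x := by
      ext i j
      simp only [toM, F, Matrix.of_apply, max_eq_left hx.le, Y]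
    have hee : Complex.ofReal (Real.exp (-β * x)) * Complex.ofReal (Real.exp (β * x)) = 1 := by
      rw [← Complex.ofReal_mul, ← Real.exp_add]; simp
    rw [hFx]
    simp only [X]
    simp only [Matrix.mul_add, Matrix.add_mul, Matrix.mul_one, Matrix.one_mul, smul_add, smul_sub,
      Matrix.mul_smul, Matrix.smul_mul, smul_smul, hee, one_smul]
    rw [mul_comm (-(β : ℂ)), mul_neg, neg_smul]
    abel
  refine ⟨fun x => V * X x * V', M, fun x hx => ?_, ?_⟩
  · refine (((hX x hx).const_mul V).mul_const V').congr_deriv ?_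
    have e1 : V * ((Matrix.diagonal d + N) * X x) * V' = A₀ * (V * X x * V') := by
      rw [← Matrix.mul_assoc V, ← hAV]; simp only [Matrix.mul_assoc]
    have e2 : V * (X x * (Matrix.diagonal d + N)) * V' = V * X x * V' * A₀ := by
      have : (Matrix.diagonal d + N) * V' = V' * A₀ := by
        calc (Matrix.diagonal d + N) * V' = V' * V * ((Matrix.diagonal d + N) * V') := by
              rw [hV2, Matrix.one_mul]
          _ = V' * (V * (Matrix.diagonal d + N)) * V' := by simp only [Matrix.mul_assoc]
          _ = V' * A₀ := by
              rw [← hAV]; simp only [Matrix.mul_assoc, hV1, Matrix.mul_one]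
      simp only [Matrix.mul_assoc, this]
    have e3 : V * (R x * X x) * V' = (A x - A₀) * (V * X x * V') := by
      simp only [R]
      calc V * (V' * (A x - A₀) * V * X x) * V'
          = (V * V') * ((A x - A₀) * (V * X x * V')) := by simp only [Matrix.mul_assoc]
        _ = _ := by rw [hV1, Matrix.one_mul]
    rw [Matrix.mul_add, Matrix.mul_sub, Matrix.add_mul, Matrix.sub_mul, e1, e2, e3, Matrix.sub_mul]
    abel
  · have h1 : Tendsto (fun x => Complex.ofReal (Real.exp (-β * x)) • Y x) atTop (𝓝 0) := by
      refine tendsto_pi_nhds.2 fun i => tendsto_pi_nhds.2 fun j => ?_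
      have h2 : Tendsto (fun x : ℝ => Real.exp (-β * x) * K) atTop (𝓝 0) := by
        have := (Real.tendsto_exp_atBot.comp
          (tendsto_id.const_mul_atTop_of_neg (neg_lt_zero.2 hβ0))).mul_const K
        simpa using this
      refine squeeze_zero_norm (fun x => ?_) h2
      simp only [Matrix.smul_apply, smul_eq_mul, norm_mul, Complex.norm_real,
        Real.norm_of_nonneg (Real.exp_pos _).le]
      gcongr
      exact (norm_le_pi_norm (η x) (i, j)).trans (hK x)
    have h3 : Tendsto (fun x => V * X x * V') atTop (𝓝 (V * (1 + 0) * V')) :=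
      ((tendsto_const_nhds.add h1).const_mul V).mul_const V'
    simpa [hV1] using h3

theorem exists_conjugator_right {A₀ : Matrix n n ℂ} {d : n → ℂ}
    (hd : NearlyDiagonalizable A₀ d) {A : ℝ → Matrix n n ℂ} (hA : Continuous A) {C κ K : ℝ}
    (hκ : 0 < κ) (hC : ∀ x, 0 ≤ x → ∀ i j, ‖(A x - A₀) i j‖ ≤ C * Real.exp (-κ * x))
    (hK : ∀ x, ‖A x‖ ≤ K) :
    ∃ P : ℝ → Matrix n n ℂ, (∀ x, HasDerivAt P (A x * P x - P x * A₀) x) ∧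
      Tendsto P atTop (𝓝 1) := by
  obtain ⟨Q, M, hQ, hQ1⟩ := exists_local_conjugator hd hA hκ hC
  obtain ⟨P, hP, hPQ⟩ := exists_sylvester_extension hA hK A₀ hQ
  exact ⟨P, hP, hQ1.congr' ((eventually_ge_atTop (M + 1)).mono hPQ)⟩

/-- The reflection x ↦ -x replaces A by -A(-x) and A₀ by -A₀ and exchanges the two ends. -/
theorem exists_conjugator_left {A₀ : Matrix n n ℂ} {d : n → ℂ}
    (hd : NearlyDiagonalizable A₀ d) {A : ℝ → Matrix n n ℂ} (hA : Continuous A) {C κ K : ℝ}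
    (hκ : 0 < κ) (hC : ∀ x, x ≤ 0 → ∀ i j, ‖(A x - A₀) i j‖ ≤ C * Real.exp (κ * x))
    (hK : ∀ x, ‖A x‖ ≤ K) :
    ∃ P : ℝ → Matrix n n ℂ, (∀ x, HasDerivAt P (A x * P x - P x * A₀) x) ∧
      Tendsto P atBot (𝓝 1) := by
  obtain ⟨P, hP, hP1⟩ := exists_conjugator_right hd.neg (A := fun x => -A (-x))
    (hA.comp continuous_neg).neg hκ (C := C) (K := K) (fun x hx i j => by
      have := hC (-x) (by linarith) i j
      rw [← norm_neg] at this
      simp only [Matrix.sub_apply, Matrix.neg_apply, neg_sub] at this ⊢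
      rw [← norm_neg]
      rw [← norm_neg]
      convert this using 1
      · congr 1; ring
      · congr 2; ring) (fun x => by rw [norm_neg]; exact hK _)
  refine ⟨fun x => P (-x), fun x => ?_, hP1.comp tendsto_neg_atBot_atTop⟩
  have := (hP (-x)).scomp x (hasDerivAt_neg x)
  refine this.congr_deriv ?_
  simp
  abel

/-- The defect z - A₀ Z is carried along so that the same formula serves homogeneous solutions,
where it vanishes, and inhomogeneous ones. -/
theorem conjugator_hasDerivAt {A₀ : Matrix n n ℂ} {A P : ℝ → Matrix n n ℂ} {Z : ℝ → n → ℂ} {z : n → ℂ}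
    {x : ℝ} (hP : HasDerivAt P (A x * P x - P x * A₀) x) (hZ : HasDerivAt Z z x) :
    HasDerivAt (fun x => P x *ᵥ Z x) (A x *ᵥ (P x *ᵥ Z x) + P x *ᵥ (z - A₀ *ᵥ Z x)) x := by
  refine hasDerivAt_pi.2 fun i => ?_
  have h1 : ∀ j, HasDerivAt (fun x => P x i j) ((A x * P x - P x * A₀) i j) x := fun j =>
    hasDerivAt_pi.1 (hasDerivAt_pi.1 hP i) j
  have h2 : ∀ j, HasDerivAt (fun x => Z x j) (z j) x := fun j => hasDerivAt_pi.1 hZ j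
  have h3 : HasDerivAt (fun x => ∑ j, P x i j * Z x j)
      (∑ j, ((A x * P x - P x * A₀) i j * Z x j + P x i j * z j)) x :=
    HasDerivAt.fun_sum fun j _ => (h1 j).mul (h2 j)
  refine h3.congr_deriv ?_
  rw [Finset.sum_add_distrib]
  change ((A x * P x - P x * A₀) *ᵥ Z x) i + (P x *ᵥ z) i = _
  simp only [Matrix.sub_mulVec, Pi.add_apply, Matrix.mulVec_sub, Pi.sub_apply, Matrix.mulVec_mulVec]
  ring

theorem hasDerivAt_exp_smul_mulVec (A₀ : Matrix n n ℂ) (v : n → ℂ) (x : ℝ) :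
    HasDerivAt (fun x : ℝ => NormedSpace.exp (x • A₀) *ᵥ v)
      (A₀ *ᵥ (NormedSpace.exp (x • A₀) *ᵥ v)) x := by
  have h := hasDerivAt_exp_smul_const' A₀ x
  refine hasDerivAt_pi.2 fun i => ?_
  have h1 : ∀ j, HasDerivAt (fun x : ℝ => NormedSpace.exp (x • A₀) i j)
      ((A₀ * NormedSpace.exp (x • A₀)) i j) x := fun j =>
    hasDerivAt_pi.1 (hasDerivAt_pi.1 h i) j
  have h3 : HasDerivAt (fun x : ℝ => ∑ j, NormedSpace.exp (x • A₀) i j * v j)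
      (∑ j, ((A₀ * NormedSpace.exp (x • A₀)) i j * v j)) x :=
    HasDerivAt.fun_sum fun j _ => (h1 j).mul_const _
  refine h3.congr_deriv ?_
  rw [Matrix.mulVec_mulVec]
  rfl

theorem mulVec_ode_unique {A : ℝ → Matrix n n ℂ} {K : ℝ} (hK : ∀ x, ‖A x‖ ≤ K)
    {V W : ℝ → n → ℂ} (hV : ∀ x, HasDerivAt V (A x *ᵥ V x) x)
    (hW : ∀ x, HasDerivAt W (A x *ᵥ W x) x) {x₀ : ℝ} (h : V x₀ = W x₀) : V = W := by
  refine ODE_solution_unique_univ (v := fun x y => A x *ᵥ y) (s := fun _ => Set.univ)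
    (K := K.toNNReal) (fun t => (LipschitzWith.of_dist_le_mul fun y z => ?_).lipschitzOnWith)
    (fun t => ⟨hV t, trivial⟩) (fun t => ⟨hW t, trivial⟩) h
  rw [dist_eq_norm, dist_eq_norm, ← Matrix.mulVec_sub]
  refine (Matrix.linfty_opNorm_mulVec _ _).trans ?_
  gcongr
  exact (hK t).trans (Real.le_coe_toNNReal K)

/-- Near the end where P tends to 1 it is invertible. A kernel vector v at x would make P(t) exp((t
- x) A₀) v a solution vanishing at x, hence everywhere; invertibility at a point near the end then
gives v = 0. -/
theorem isUnit_conjugator {A₀ : Matrix n n ℂ} {A P : ℝ → Matrix n n ℂ} {K : ℝ}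
    (hK : ∀ x, ‖A x‖ ≤ K) (hP : ∀ x, HasDerivAt P (A x * P x - P x * A₀) x)
    {l : Filter ℝ} [l.NeBot] (h1 : Tendsto P l (𝓝 1)) (x : ℝ) : IsUnit (P x) := by
  rw [← Matrix.mulVec_injective_iff_isUnit]
  have hev : ∀ᶠ y in l, IsUnit (P y) :=
    h1.eventually (Units.isOpen.mem_nhds isUnit_one)
  obtain ⟨y, hy⟩ := hev.exists
  have hker : ∀ v, P x *ᵥ v = 0 → v = 0 := by
    intro v hv
    let Z : ℝ → n → ℂ := fun t => NormedSpace.exp ((t - x) • A₀) *ᵥ v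
    have hZ : ∀ t, HasDerivAt Z (A₀ *ᵥ Z t) t := fun t => by
      have := (hasDerivAt_exp_smul_mulVec A₀ v (t - x)).comp_sub_const t x
      exact this
    have hZx : Z x = v := by simp [Z]
    have hW : ∀ t, HasDerivAt (fun t => P t *ᵥ Z t) (A t *ᵥ (P t *ᵥ Z t)) t := fun t => by
      have := conjugator_hasDerivAt (hP t) (hZ t)
      simpa using this
    have h0 := mulVec_ode_unique hK hW (W := fun _ => 0)
      (fun t => by simpa using hasDerivAt_const t (0 : n → ℂ)) (x₀ := x) (by simp [hZx, hv])
    have hy0 : P y *ᵥ Z y = 0 := congrFun h0 y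
    have hZy : Z y = 0 :=
      (Matrix.mulVec_injective_iff_isUnit.2 hy) (by simpa using hy0)
    have h2 := mulVec_ode_unique (A := fun _ => A₀) (fun _ => le_rfl) hZ (W := fun _ => 0)
      (fun t => by simpa using hasDerivAt_const t (0 : n → ℂ)) (x₀ := y) hZy
    rw [← hZx, h2]
  intro v w hvw
  have := hker (v - w) (by rw [Matrix.mulVec_sub, sub_eq_zero]; exact hvw)
  exact sub_eq_zero.1 this

end Conjugator

end JinXin

/-! ### Total eigenspaces and block forms -/

namespace JinXin

section TotalEigenspace

variable (M : Matrix (Fin 3) (Fin 3) ℂ)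

theorem totalEigenspace_sup_compl (S : Set ℂ) :
    totalEigenspace M S ⊔ totalEigenspace M Sᶜ = ⊤ := by
  rw [eq_top_iff, ← Module.End.iSup_maxGenEigenspace_eq_top (Matrix.toLin' M)]
  refine iSup_le fun μ => ?_
  by_cases h : μ ∈ S
  · exact (le_iSup₂ (f := fun μ (_ : μ ∈ S) => Module.End.maxGenEigenspace (Matrix.toLin' M) μ)
      μ h).trans le_sup_left
  · exact (le_iSup₂ (f := fun μ (_ : μ ∈ Sᶜ) => Module.End.maxGenEigenspace (Matrix.toLin' M) μ)
      μ h).trans le_sup_right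

theorem disjoint_totalEigenspace {S T : Set ℂ} (h : Disjoint S T) :
    Disjoint (totalEigenspace M S) (totalEigenspace M T) :=
  (Module.End.independent_maxGenEigenspace (Matrix.toLin' M)).disjoint_biSup_biSup h

theorem toLin'_mem_totalEigenspace {S : Set ℂ} {x : Fin 3 → ℂ} (hx : x ∈ totalEigenspace M S) :
    Matrix.toLin' M x ∈ totalEigenspace M S := by
  have : totalEigenspace M S ≤ (totalEigenspace M S).comap (Matrix.toLin' M) := by
    refine iSup₂_le fun μ hμ y hy => ?_
    exact (le_iSup₂ (f := fun μ (_ : μ ∈ S) => Module.End.maxGenEigenspace (Matrix.toLin' M) μ)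
      μ hμ) (Module.End.mapsTo_maxGenEigenspace_of_comm (Commute.refl (Matrix.toLin' M)) μ hy)
  exact this hx

/-- Split x along the total eigenspaces of S and of its complement. The image of the second part
under M - d lies in both spaces, so it is 0. That part is then an eigenvector or zero for d ∈ S and
belongs to the first space too. -/
theorem mem_totalEigenspace_of_sub {S : Set ℂ} {d : ℂ} (hd : d ∈ S) {x : Fin 3 → ℂ}
    (hx : M *ᵥ x - d • x ∈ totalEigenspace M S) : x ∈ totalEigenspace M S := by
  have htop : x ∈ totalEigenspace M S ⊔ totalEigenspace M Sᶜ := by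
    rw [totalEigenspace_sup_compl]; trivial
  obtain ⟨y, hy, z, hz, rfl⟩ := Submodule.mem_sup.1 htop
  have hdis := disjoint_totalEigenspace M (disjoint_compl_right (a := S))
  have h1 : M *ᵥ y - d • y ∈ totalEigenspace M S :=
    Submodule.sub_mem _ (toLin'_mem_totalEigenspace M hy) (Submodule.smul_mem _ _ hy)
  have h2 : M *ᵥ z - d • z ∈ totalEigenspace M Sᶜ :=
    Submodule.sub_mem _ (toLin'_mem_totalEigenspace M hz) (Submodule.smul_mem _ _ hz)
  have h3 : M *ᵥ z - d • z ∈ totalEigenspace M S := by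
    have := Submodule.sub_mem _ hx h1
    rw [Matrix.mulVec_add, smul_add] at this
    convert this using 1
    abel
  have h4 : M *ᵥ z - d • z = 0 := Submodule.disjoint_def.1 hdis _ h3 h2
  have h5 : z ∈ totalEigenspace M S := by
    refine (le_iSup₂ (f := fun μ (_ : μ ∈ S) => Module.End.maxGenEigenspace (Matrix.toLin' M) μ)
      d hd) ?_
    have : z ∈ Module.End.eigenspace (Matrix.toLin' M) d := by
      rw [Module.End.mem_eigenspace_iff, Matrix.toLin'_apply]
      exact sub_eq_zero.1 h4
    exact Module.End.genEigenspace_le_maximal _ _ 1 this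
  exact Submodule.add_mem _ hy h5

end TotalEigenspace

/-- `A₀ = V (diag d + N) V⁻¹` with `N` of size at most `δ`, strictly upper triangular and respecting
the splitting of the indices into `j < k`, where `Re (d j) > 0`, and `k ≤ j`, where `Re (d j) < 0`. -/
structure IsBlockForm (A₀ : Matrix (Fin 3) (Fin 3) ℂ) (k : ℕ) (d : Fin 3 → ℂ) (δ : ℝ)
    (V V' N : Matrix (Fin 3) (Fin 3) ℂ) : Prop where
  pos : ∀ j, j.val < k → 0 < (d j).re
  neg : ∀ j, k ≤ j.val → (d j).re < 0
  mul_inv : V * V' = 1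
  inv_mul : V' * V = 1
  conj : A₀ * V = V * (Matrix.diagonal d + N)
  small : ∀ i j, ‖N i j‖ ≤ δ
  upper : ∀ i j, N i j ≠ 0 → i < j ∧ (i.val < k ↔ j.val < k)

/-- `A₀` has block forms with arbitrarily small nilpotent part. -/
def HyperbolicForm (A₀ : Matrix (Fin 3) (Fin 3) ℂ) (k : ℕ) (d : Fin 3 → ℂ) : Prop :=
  ∀ δ > 0, ∃ V V' N, IsBlockForm A₀ k d δ V V' N

namespace IsBlockForm

variable {A₀ V V' N : Matrix (Fin 3) (Fin 3) ℂ} {k : ℕ} {d : Fin 3 → ℂ} {δ : ℝ}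

theorem mulVec_col (h : IsBlockForm A₀ k d δ V V' N) (j : Fin 3) :
    A₀ *ᵥ (fun i => V i j) - d j • (fun i => V i j) = ∑ i, N i j • (fun a => V a i) := by
  ext a
  have h1 := congrFun (congrFun h.conj a) j
  simp only [Matrix.mul_add, Matrix.add_apply, Matrix.mul_diagonal] at h1
  simp only [Pi.sub_apply, Pi.smul_apply, smul_eq_mul, Finset.sum_apply]
  rw [Matrix.mul_apply, Matrix.mul_apply] at h1
  rw [Matrix.mulVec, dotProduct, h1, mul_comm (V a j), add_sub_cancel_left]
  exact Finset.sum_congr rfl fun i _ => mul_comm _ _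

/-- Because N is strictly upper triangular, A₀ - d j maps column j to a combination of earlier
columns, all with index in T. Membership thus propagates by induction on the index. -/
theorem col_mem_of (h : IsBlockForm A₀ k d δ V V' N) (S : Set ℂ) (T : Set (Fin 3))
    (hT : ∀ j ∈ T, d j ∈ S) (hN : ∀ i j, N i j ≠ 0 → j ∈ T → i ∈ T) :
    ∀ j ∈ T, (fun i => V i j) ∈ totalEigenspace A₀ S := by
  intro j
  induction j using WellFoundedLT.induction with
  | ind j ih =>
    intro hj
    refine mem_totalEigenspace_of_sub A₀ (hT j hj) ?_
    rw [h.mulVec_col j]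
    refine Submodule.sum_mem _ fun i _ => ?_
    by_cases hij : N i j = 0
    · rw [hij, zero_smul]; exact Submodule.zero_mem _
    · exact Submodule.smul_mem _ _ (ih i (h.upper i j hij).1 (hN i j hij hj))

theorem col_mem_pos (h : IsBlockForm A₀ k d δ V V' N) {j : Fin 3} (hj : j.val < k) :
    (fun i => V i j) ∈ totalEigenspace A₀ {μ | 0 < μ.re} :=
  h.col_mem_of _ {j | j.val < k} (fun j hj => h.pos j hj) (fun i j hij hj => (h.upper i j hij).2.2 hj)
    j hj

theorem col_mem_neg (h : IsBlockForm A₀ k d δ V V' N) {j : Fin 3} (hj : k ≤ j.val) :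
    (fun i => V i j) ∈ totalEigenspace A₀ {μ | μ.re < 0} :=
  h.col_mem_of _ {j | k ≤ j.val} (fun j hj => h.neg j hj) (fun i j hij hj => by
    have := (h.upper i j hij).2
    simp only [Set.mem_ofPred_eq] at hj ⊢
    omega) j hj

theorem linearIndependent (h : IsBlockForm A₀ k d δ V V' N) :
    LinearIndependent ℂ fun j i => V i j := by
  have h1 : IsUnit Vᵀ := (Matrix.isUnit_transpose V).2 ⟨⟨V, V', h.mul_inv, h.inv_mul⟩, rfl⟩
  exact Matrix.linearIndependent_rows_iff_isUnit.2 h1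

/-- The columns give k independent vectors in the unstable space and 3 - k in the stable one. The
two spaces are disjoint in dimension 3, so neither can be larger. -/
theorem isHyperbolicSplitting (h : IsBlockForm A₀ k d δ V V' N) (hk : k ≤ 3) :
    IsHyperbolicSplitting A₀ k := by
  have hli := h.linearIndependent
  have hcard1 : Fintype.card {j : Fin 3 // j.val < k} = k := by
    interval_cases k <;> decide
  have hcard2 : Fintype.card {j : Fin 3 // k ≤ j.val} + k = 3 := by
    interval_cases k <;> decide
  have h1 : k ≤ Module.finrank ℂ (totalEigenspace A₀ {μ | 0 < μ.re}) := by
    have hl : LinearIndependent ℂ fun j : {j : Fin 3 // j.val < k} =>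
        (⟨fun i => V i j, h.col_mem_pos j.2⟩ : totalEigenspace A₀ {μ | 0 < μ.re}) :=
      LinearIndependent.of_comp (Submodule.subtype _)
        (hli.comp (fun j : {j : Fin 3 // j.val < k} => j.1) Subtype.val_injective)
    have := hl.fintype_card_le_finrank
    rwa [hcard1] at this
  have h2 : 3 ≤ Module.finrank ℂ (totalEigenspace A₀ {μ | μ.re < 0}) + k := by
    have hl : LinearIndependent ℂ fun j : {j : Fin 3 // k ≤ j.val} =>
        (⟨fun i => V i j, h.col_mem_neg j.2⟩ : totalEigenspace A₀ {μ | μ.re < 0}) :=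
      LinearIndependent.of_comp (Submodule.subtype _)
        (hli.comp (fun j : {j : Fin 3 // k ≤ j.val} => j.1) Subtype.val_injective)
    have := hl.fintype_card_le_finrank
    omega
  have hdis : Disjoint (totalEigenspace A₀ {μ | 0 < μ.re}) (totalEigenspace A₀ {μ | μ.re < 0}) :=
    disjoint_totalEigenspace _ (Set.disjoint_left.2 fun μ (h1 : 0 < μ.re) (h2 : μ.re < 0) =>
      lt_asymm h1 h2)
  have h3 := Submodule.finrank_add_finrank_le_of_disjoint hdis
  have h4 : Module.finrank ℂ (Fin 3 → ℂ) = 3 := by simp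
  constructor <;> omega

end IsBlockForm

end JinXin

/-! ### Triangular systems with constant coefficients -/

namespace JinXin

section Triangular

variable {d : Fin 3 → ℂ} {N : Matrix (Fin 3) (Fin 3) ℂ}

theorem hasDerivAt_cexp_mul_ofReal (a : ℂ) (x : ℝ) :
    HasDerivAt (fun x : ℝ => Complex.exp (a * x)) (a * Complex.exp (a * x)) x := by
  have := ((Complex.ofRealCLM.hasDerivAt (x := x)).const_mul a).cexp
  refine (HasDerivAt.congr_deriv this ?_)
  simp [mul_comm]

theorem eq_cexp_of_hasDerivAt {y : ℝ → ℂ} {a : ℂ} (hy : ∀ x, HasDerivAt y (a * y x) x) (x : ℝ) :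
    y x = Complex.exp (a * x) * y 0 := by
  have h1 : ∀ x : ℝ, HasDerivAt (fun x : ℝ => Complex.exp (-a * x) * y x) 0 x := fun x => by
    refine ((hasDerivAt_cexp_mul_ofReal (-a) x).mul (hy x)).congr_deriv ?_
    ring
  have h2 := is_const_of_deriv_eq_zero (fun x => (h1 x).differentiableAt) (fun x => (h1 x).deriv) x 0
  simp only [Complex.ofReal_zero, mul_zero, Complex.exp_zero, one_mul] at h2
  rw [← h2, ← mul_assoc, ← Complex.exp_add]
  simp

theorem triangular_mulVec_apply (v : Fin 3 → ℂ) (i : Fin 3) :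
    ((Matrix.diagonal d + N) *ᵥ v) i = d i * v i + ∑ j, N i j * v j := by
  rw [Matrix.add_mulVec, Pi.add_apply, Matrix.mulVec_diagonal]
  rfl

/-- Back substitution from the last index: once the later components in T vanish, component j solves
a scalar equation and is a pure exponential. The hypothesis `hT` is the place where a growth or
integrability argument enters. -/
theorem triangular_eq_zero {Y : ℝ → Fin 3 → ℂ}
    (hY : ∀ x, HasDerivAt Y ((Matrix.diagonal d + N) *ᵥ Y x) x) {T : Set (Fin 3)}
    (hN : ∀ i j, N i j ≠ 0 → i < j ∧ (i ∈ T → j ∈ T))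
    (hT : ∀ j ∈ T, ∀ a : ℂ, (∀ x : ℝ, Y x j = Complex.exp (d j * x) * a) → a = 0) :
    ∀ j ∈ T, ∀ x, Y x j = 0 := by
  intro j
  induction j using WellFoundedGT.induction with
  | ind j ih =>
    intro hj
    have h1 : ∀ x, HasDerivAt (fun x => Y x j) (d j * Y x j) x := fun x => by
      refine (hasDerivAt_pi.1 (hY x) j).congr_deriv ?_
      rw [triangular_mulVec_apply, Finset.sum_eq_zero, add_zero]
      intro i _
      by_cases hji : N j i = 0
      · rw [hji, zero_mul]
      · rw [ih i (hN j i hji).1 ((hN j i hji).2 hj) x, mul_zero]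
    have h2 := eq_cexp_of_hasDerivAt h1
    have h3 := hT j hj (Y 0 j) h2
    intro x
    rw [h2, h3, mul_zero]

/-- Writing Y = exp(-βx) η shifts every d j by β. The bound β ≤ r/2 leaves |Re(d j) + β| ≥ r/2,
while δ ≤ r/12 makes the coupling at most 3δ ≤ r/4, so η is found as a bounded solution. -/
theorem exists_decaying_particular {r δ β C : ℝ} (hr : 0 < r) (hd : ∀ j, r ≤ |(d j).re|)
    (hδ : δ ≤ r / 12) (hN : ∀ i j, ‖N i j‖ ≤ δ) (hβ : 0 < β) (hβr : β ≤ r / 2)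
    {h : ℝ → Fin 3 → ℂ} (hh : ContinuousOn h (Set.Ici 0))
    (hC : ∀ x, 0 ≤ x → ‖h x‖ ≤ C * Real.exp (-β * x)) :
    ∃ (Y : ℝ → Fin 3 → ℂ) (C' : ℝ), ∀ x, 0 ≤ x →
      HasDerivAt Y ((Matrix.diagonal d + N) *ᵥ Y x + h x) x ∧ ‖Y x‖ ≤ C' * Real.exp (-β * x) := by
  have hmax : Continuous fun x : ℝ => max x 0 := by fun_prop
  have hh' : Continuous fun x : ℝ => h (max x 0) :=
    hh.comp_continuous hmax fun x => Set.mem_Ici.2 (le_max_right _ _)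
  let F : ℝ → (Fin 3 → ℂ) → Fin 3 → ℂ := fun x y =>
    N *ᵥ y + Complex.ofReal (Real.exp (β * max x 0)) • h (max x 0)
  have hδ0 : 0 ≤ δ := (norm_nonneg _).trans (hN 0 0)
  obtain ⟨η, K, hK, hη⟩ := exists_bounded_solution (d := fun j => d j + β) (a := r / 2)
    (θ := r / 4) (F := F) (G := C) (by positivity) (by linarith) (fun j => by
      have h1 := hd j
      have h2 := abs_sub_abs_le_abs_sub (d j).re (-β)
      rw [abs_neg, abs_of_pos hβ, sub_neg_eq_add] at h2
      simp only [Complex.add_re, Complex.ofReal_re]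
      linarith)
    (by
      have h1 : Continuous fun p : ℝ × (Fin 3 → ℂ) => N *ᵥ p.2 :=
        Continuous.matrix_mulVec continuous_const continuous_snd
      have h2 : Continuous fun p : ℝ × (Fin 3 → ℂ) => h (max p.1 0) := hh'.comp continuous_fst
      have h3 : Continuous fun p : ℝ × (Fin 3 → ℂ) => Complex.ofReal (Real.exp (β * max p.1 0)) := by
        fun_prop
      exact h1.add (h3.smul h2))
    (by
      intro x u v
      have : F x u - F x v = N *ᵥ (u - v) := by simp only [F, Matrix.mulVec_sub]; abel
      rw [this]
      refine (pi_norm_le_iff_of_nonneg (by positivity)).2 fun i => ?_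
      calc ‖∑ j, N i j * (u - v) j‖ ≤ ∑ j, ‖N i j * (u - v) j‖ := norm_sum_le _ _
        _ ≤ ∑ _j : Fin 3, δ * ‖u - v‖ := Finset.sum_le_sum fun j _ => by
            rw [norm_mul]
            exact mul_le_mul (hN i j) (norm_le_pi_norm _ j) (norm_nonneg _) hδ0
        _ = 3 * (δ * ‖u - v‖) := by simp
        _ ≤ r / 4 * ‖u - v‖ := by nlinarith [norm_nonneg (u - v)])
    (by
      intro x
      simp only [F, Matrix.mulVec_zero, zero_add]
      rw [norm_smul, Complex.norm_real, Real.norm_of_nonneg (Real.exp_pos _).le]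
      calc Real.exp (β * max x 0) * ‖h (max x 0)‖
          ≤ Real.exp (β * max x 0) * (C * Real.exp (-β * max x 0)) := by
            gcongr; exact hC _ (le_max_right _ _)
        _ = C * (Real.exp (β * max x 0) * Real.exp (-β * max x 0)) := by ring
        _ = C := by rw [← Real.exp_add]; simp)
  have hexp : ∀ x : ℝ, HasDerivAt (fun x : ℝ => Complex.ofReal (Real.exp (-β * x)))
      (-(β : ℂ) * Complex.ofReal (Real.exp (-β * x))) x := by
    intro x
    have := (((hasDerivAt_id x).const_mul (-β)).exp).ofReal_comp
    refine this.congr_deriv ?_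
    simp; ring
  refine ⟨fun x => Complex.ofReal (Real.exp (-β * x)) • η x, K, fun x hx => ⟨?_, ?_⟩⟩
  · refine hasDerivAt_pi.2 fun i => ?_
    refine ((hexp x).mul (hη x i)).congr_deriv ?_
    have hee : Complex.ofReal (Real.exp (-β * x)) * Complex.ofReal (Real.exp (β * x)) = 1 := by
      rw [← Complex.ofReal_mul, ← Real.exp_add]; simp
    rw [Matrix.mulVec_smul, Pi.add_apply, Pi.smul_apply, triangular_mulVec_apply]
    simp only [F, Pi.add_apply, Pi.smul_apply, smul_eq_mul, max_eq_left hx]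
    have hNi : (N *ᵥ η x) i = ∑ j, N i j * η x j := rfl
    rw [hNi]
    linear_combination (h x i) * hee
  · rw [norm_smul, Complex.norm_real, Real.norm_of_nonneg (Real.exp_pos _).le, mul_comm]
    gcongr
    exact hK x

/-- Energy estimate for ∑ |Y i|². The diagonal contributes a rate at most -2r and the coupling at
most 6δ ≤ r/2, so the sum decays at least like exp(-rx) and the norm at half that rate. Smallness of
N replaces any discussion of Jordan blocks. -/
theorem triangular_decay {r δ : ℝ} (hr : 0 < r) {T : Set (Fin 3)} (hd : ∀ j ∈ T, (d j).re ≤ -r)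
    (hδ : δ ≤ r / 12) (hN : ∀ i j, ‖N i j‖ ≤ δ) (hNT : ∀ i j, N i j ≠ 0 → (i ∈ T ↔ j ∈ T))
    {Y : ℝ → Fin 3 → ℂ} (hY : ∀ x, HasDerivAt Y ((Matrix.diagonal d + N) *ᵥ Y x) x)
    (hY0 : ∀ i ∉ T, Y 0 i = 0) :
    ∃ C, ∀ x, 0 ≤ x → ‖Y x‖ ≤ C * Real.exp (-(r / 2) * x) := by
  classical
  have hδ0 : 0 ≤ δ := (norm_nonneg _).trans (hN 0 0)
  -- the components outside `T` vanish
  have hout : ∀ x, ∀ i ∉ T, Y x i = 0 := by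
    -- Discarding the components outside T gives another solution, since N does not couple T with
    -- its complement. It has the same initial value, so it is Y itself.
    let Z : ℝ → Fin 3 → ℂ := fun x i => if i ∈ T then Y x i else 0
    have hZ : ∀ x, HasDerivAt Z ((Matrix.diagonal d + N) *ᵥ Z x) x := by
      intro x
      refine hasDerivAt_pi.2 fun i => ?_
      rw [triangular_mulVec_apply]
      by_cases hi : i ∈ T
      · have h1 := hasDerivAt_pi.1 (hY x) i
        rw [triangular_mulVec_apply] at h1
        have h2 : (fun x => Z x i) = fun x => Y x i := by funext x; simp [Z, hi]
        rw [h2]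
        refine h1.congr_deriv ?_
        have h3 : Z x i = Y x i := by simp [Z, hi]
        rw [h3]
        congr 1
        refine Finset.sum_congr rfl fun j _ => ?_
        by_cases hij : N i j = 0
        · simp [hij]
        · have : j ∈ T := (hNT i j hij).1 hi
          simp [Z, this]
      · have h2 : (fun x => Z x i) = fun _ => 0 := by funext x; simp [Z, hi]
        rw [h2]
        refine (hasDerivAt_const x (0 : ℂ)).congr_deriv ?_
        have h3 : Z x i = 0 := by simp [Z, hi]
        rw [h3, mul_zero, zero_add, Finset.sum_eq_zero]
        intro j _
        by_cases hij : N i j = 0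
        · simp [hij]
        · have : j ∉ T := fun hj => hi ((hNT i j hij).2 hj)
          simp [Z, this]
    have hZY : Z = Y := by
      open scoped Matrix.Norms.Operator in
      refine mulVec_ode_unique (A := fun _ => Matrix.diagonal d + N) (fun _ => le_rfl) hZ hY
        (x₀ := 0) ?_
      funext i
      by_cases hi : i ∈ T
      · simp [Z, hi]
      · simp [Z, hi, hY0 i hi]
    intro x i hi
    rw [← hZY]; simp [Z, hi]
  let S : ℝ → ℝ := fun x => ∑ i, ‖Y x i‖ ^ 2
  have hS : ∀ x, HasDerivAt S (∑ i, 2 * inner ℝ (Y x i) (d i * Y x i + ∑ j, N i j * Y x j)) x := by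
    intro x
    refine HasDerivAt.fun_sum fun i _ => ?_
    have h1 := hasDerivAt_pi.1 (hY x) i
    rw [triangular_mulVec_apply] at h1
    exact h1.norm_sq
  have hbd : ∀ x, ∑ i, 2 * inner ℝ (Y x i) (d i * Y x i + ∑ j, N i j * Y x j) ≤ -r * S x := by
    intro x
    have h1 : ∀ i, 2 * inner ℝ (Y x i) (d i * Y x i + ∑ j, N i j * Y x j)
        ≤ -2 * r * ‖Y x i‖ ^ 2 + ∑ j, δ * (‖Y x i‖ ^ 2 + ‖Y x j‖ ^ 2) := by
      intro i
      rw [inner_add_right, inner_sum]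
      have h2 : inner ℝ (Y x i) (d i * Y x i) = (d i).re * ‖Y x i‖ ^ 2 := by
        rw [Complex.inner, ← Complex.normSq_eq_norm_sq, Complex.normSq_apply]
        simp
        ring
      have h3 : (d i).re * ‖Y x i‖ ^ 2 ≤ -r * ‖Y x i‖ ^ 2 := by
        by_cases hi : i ∈ T
        · gcongr; exact hd i hi
        · simp [hout x i hi]
      have h4 : ∀ j, 2 * inner ℝ (Y x i) (N i j * Y x j) ≤ δ * (‖Y x i‖ ^ 2 + ‖Y x j‖ ^ 2) := by
        intro j
        have h5 := real_inner_le_norm (Y x i) (N i j * Y x j)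
        rw [norm_mul] at h5
        have h6 : ‖Y x i‖ * (‖N i j‖ * ‖Y x j‖) ≤ ‖Y x i‖ * (δ * ‖Y x j‖) := by
          gcongr; exact hN i j
        nlinarith [sq_nonneg (‖Y x i‖ - ‖Y x j‖), mul_nonneg hδ0
          (sq_nonneg (‖Y x i‖ - ‖Y x j‖))]
      rw [h2, mul_add, Finset.mul_sum]
      exact add_le_add (by linarith) (Finset.sum_le_sum fun j _ => h4 j)
    refine (Finset.sum_le_sum fun i _ => h1 i).trans ?_
    simp only [S, Fin.sum_univ_three]
    have := sq_nonneg ‖Y x 0‖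
    have := sq_nonneg ‖Y x 1‖
    have := sq_nonneg ‖Y x 2‖
    nlinarith
  have hmono : ∀ x, 0 ≤ x → Real.exp (r * x) * S x ≤ S 0 := by
    have hd' : ∀ x, HasDerivAt (fun x => Real.exp (r * x) * S x) (Real.exp (r * x) * r * S x +
        Real.exp (r * x) * ∑ i, 2 * inner ℝ (Y x i) (d i * Y x i + ∑ j, N i j * Y x j)) x := by
      intro x
      have h1 : HasDerivAt (fun x => Real.exp (r * x)) (Real.exp (r * x) * r) x := by
        simpa using ((hasDerivAt_id x).const_mul r).exp
      exact h1.mul (hS x)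
    have hanti : Antitone fun x => Real.exp (r * x) * S x := by
      refine antitone_of_deriv_nonpos (fun x => (hd' x).differentiableAt) fun x => ?_
      rw [(hd' x).deriv]
      have := mul_le_mul_of_nonneg_left (hbd x) (Real.exp_pos (r * x)).le
      nlinarith
    intro x hx
    simpa using hanti hx
  refine ⟨√(S 0), fun x hx => ?_⟩
  refine (pi_norm_le_iff_of_nonneg (by positivity)).2 fun i => ?_
  have h1 : ‖Y x i‖ ^ 2 ≤ S x :=
    Finset.single_le_sum (f := fun i => ‖Y x i‖ ^ 2) (fun i _ => sq_nonneg _) (Finset.mem_univ i)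
  have h2 : S x ≤ S 0 * Real.exp (-r * x) := by
    have := mul_le_mul_of_nonneg_right (hmono x hx) (Real.exp_pos (-r * x)).le
    rwa [mul_right_comm, ← Real.exp_add, show r * x + -r * x = 0 by ring, Real.exp_zero,
      one_mul] at this
  refine abs_le_of_sq_le_sq' ?_ (by positivity) |>.2
  rw [mul_pow, Real.sq_sqrt (Finset.sum_nonneg fun i _ => sq_nonneg _), ← Real.exp_nat_mul]
  refine (h1.trans h2).trans (le_of_eq ?_)
  congr 2
  push_cast; ring

end Triangular

end JinXin

/-! ### Evans frames and uniqueness of square integrable solutions -/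

namespace JinXin

open scoped Matrix.Norms.Operator

/-- `P` conjugates `W' = A W` to `Z' = A₀ Z` and tends to the identity along `l`. -/
structure IsConjugator (A : ℝ → Matrix (Fin 3) (Fin 3) ℂ) (A₀ : Matrix (Fin 3) (Fin 3) ℂ)
    (l : Filter ℝ) (P : ℝ → Matrix (Fin 3) (Fin 3) ℂ) : Prop where
  deriv : ∀ x, HasDerivAt P (A x * P x - P x * A₀) x
  lim : Tendsto P l (𝓝 1)
  isUnit : ∀ x, IsUnit (P x)

/-- The coefficients are continuous and converge exponentially fast at both ends. -/
structure ExpAsymptotic (A : ℝ → Matrix (Fin 3) (Fin 3) ℂ) (A₀ : Matrix (Fin 3) (Fin 3) ℂ)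
    (C κ : ℝ) : Prop where
  cont : Continuous A
  rate_pos : 0 < κ
  decay : ∀ x i j, ‖(A x - A₀) i j‖ ≤ C * Real.exp (-κ * |x|)

theorem norm_le_of_entries {M : Matrix (Fin 3) (Fin 3) ℂ} {C : ℝ} (h : ∀ i j, ‖M i j‖ ≤ C) :
    ‖M‖ ≤ ∑ i : Fin 3, ∑ j : Fin 3, C * ‖Matrix.single i j (1 : ℂ)‖ := by
  conv_lhs => rw [Matrix.matrix_eq_sum_single M]
  refine (norm_sum_le _ _).trans (Finset.sum_le_sum fun i _ =>
    (norm_sum_le _ _).trans (Finset.sum_le_sum fun j _ => ?_))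
  have : Matrix.single i j (M i j) = M i j • Matrix.single i j (1 : ℂ) := by simp
  rw [this, norm_smul]
  gcongr
  exact h i j

namespace ExpAsymptotic

variable {A : ℝ → Matrix (Fin 3) (Fin 3) ℂ} {A₀ : Matrix (Fin 3) (Fin 3) ℂ} {C κ : ℝ}

theorem exists_norm_le (h : ExpAsymptotic A A₀ C κ) : ∃ K, ∀ x, ‖A x‖ ≤ K := by
  refine ⟨(∑ i : Fin 3, ∑ j : Fin 3, |C| * ‖Matrix.single i j (1 : ℂ)‖) + ‖A₀‖, fun x => ?_⟩
  have h1 : ‖A x - A₀‖ ≤ ∑ i : Fin 3, ∑ j : Fin 3, |C| * ‖Matrix.single i j (1 : ℂ)‖ := by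
    refine norm_le_of_entries fun i j => (h.decay x i j).trans ?_
    have : Real.exp (-κ * |x|) ≤ 1 := Real.exp_le_one_iff.2 (by
      have := mul_nonneg h.rate_pos.le (abs_nonneg x); linarith)
    calc C * Real.exp (-κ * |x|) ≤ |C| * Real.exp (-κ * |x|) := by gcongr; exact le_abs_self C
      _ ≤ |C| * 1 := by gcongr
      _ = |C| := mul_one _
  calc ‖A x‖ = ‖(A x - A₀) + A₀‖ := by rw [sub_add_cancel]
    _ ≤ _ := (norm_add_le _ _).trans (by gcongr)

theorem exists_conjugator_atTop (h : ExpAsymptotic A A₀ C κ) {d : Fin 3 → ℂ}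
    (hd : NearlyDiagonalizable A₀ d) : ∃ P, IsConjugator A A₀ atTop P := by
  obtain ⟨K, hK⟩ := h.exists_norm_le
  obtain ⟨P, hP, h1⟩ := exists_conjugator_right hd h.cont h.rate_pos (C := C)
    (fun x hx i j => by simpa [abs_of_nonneg hx] using h.decay x i j) hK
  exact ⟨P, hP, h1, isUnit_conjugator hK hP h1⟩

theorem exists_conjugator_atBot (h : ExpAsymptotic A A₀ C κ) {d : Fin 3 → ℂ}
    (hd : NearlyDiagonalizable A₀ d) : ∃ P, IsConjugator A A₀ atBot P := by
  obtain ⟨K, hK⟩ := h.exists_norm_le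
  obtain ⟨P, hP, h1⟩ := exists_conjugator_left hd h.cont h.rate_pos (C := C)
    (fun x hx i j => by simpa [abs_of_nonpos hx] using h.decay x i j) hK
  exact ⟨P, hP, h1, isUnit_conjugator hK hP h1⟩

end ExpAsymptotic

theorem HyperbolicForm.nearlyDiagonalizable {A₀ : Matrix (Fin 3) (Fin 3) ℂ} {k : ℕ}
    {d : Fin 3 → ℂ} (h : HyperbolicForm A₀ k d) : NearlyDiagonalizable A₀ d := by
  intro δ hδ
  obtain ⟨V, V', N, hV⟩ := h δ hδ
  exact ⟨V, V', N, hV.mul_inv, hV.inv_mul, hV.conj, hV.small⟩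

/-- The solutions entering the Evans function built from two conjugators. -/
noncomputable def frameSolution (A₀ V : Matrix (Fin 3) (Fin 3) ℂ)
    (Pl Pr : ℝ → Matrix (Fin 3) (Fin 3) ℂ) (k : ℕ) (j : Fin 3) (x : ℝ) : Fin 3 → ℂ :=
  (if j.val < k then Pl x else Pr x) *ᵥ (NormedSpace.exp (x • A₀) *ᵥ fun i => V i j)

section Frame

variable {A : ℝ → Matrix (Fin 3) (Fin 3) ℂ} {A₀ V V' N : Matrix (Fin 3) (Fin 3) ℂ} {C κ : ℝ}
  {k : ℕ} {d : Fin 3 → ℂ} {δ : ℝ} {Pl Pr : ℝ → Matrix (Fin 3) (Fin 3) ℂ}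

theorem evansFrame_frameSolution (h : IsBlockForm A₀ k d δ V V' N)
    (hl : IsConjugator A A₀ atBot Pl) (hr : IsConjugator A A₀ atTop Pr) :
    EvansFrame A A₀ k (fun j i => V i j) (frameSolution A₀ V Pl Pr k) where
  indep := h.linearIndependent
  splitting := ⟨0, fun _ hj => h.col_mem_pos hj, fun _ hj => h.col_mem_neg hj⟩
  solution := fun j x => by
    unfold frameSolution
    have hz := hasDerivAt_exp_smul_mulVec A₀ (fun i => V i j) x
    by_cases hj : j.val < k
    · simp only [if_pos hj]
      simpa using conjugator_hasDerivAt (hl.deriv x) hz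
    · simp only [if_neg hj]
      simpa using conjugator_hasDerivAt (hr.deriv x) hz
  asymptotic_left := ⟨Pl, hl.lim, fun j hj x => by simp [frameSolution, hj]⟩
  asymptotic_right := ⟨Pr, hr.lim, fun j hj x => by simp [frameSolution, not_lt.2 hj]⟩

/-- The solution `W` in the coordinates in which the system has constant triangular coefficients. -/
theorem exists_triangular_coordinates (hA : ExpAsymptotic A A₀ C κ)
    (h : IsBlockForm A₀ k d δ V V' N) {l : Filter ℝ} {P : ℝ → Matrix (Fin 3) (Fin 3) ℂ}
    (hP : IsConjugator A A₀ l P) {W : ℝ → Fin 3 → ℂ} (hW : ∀ x, HasDerivAt W (A x *ᵥ W x) x) :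
    ∃ Y : ℝ → Fin 3 → ℂ, (∀ x, HasDerivAt Y ((Matrix.diagonal d + N) *ᵥ Y x) x) ∧
      ∀ x, W x = P x *ᵥ (V *ᵥ Y x) := by
  obtain ⟨K, hK⟩ := hA.exists_norm_le
  obtain ⟨u, hu⟩ := hP.isUnit 0
  let z : Fin 3 → ℂ := (↑u⁻¹ : Matrix (Fin 3) (Fin 3) ℂ) *ᵥ W 0
  have hz : P 0 *ᵥ z = W 0 := by
    simp only [z, ← hu, Matrix.mulVec_mulVec]
    rw [Units.mul_inv, Matrix.one_mulVec]
  let Y : ℝ → Fin 3 → ℂ := fun x => V' *ᵥ (NormedSpace.exp (x • A₀) *ᵥ z)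
  have hVY : ∀ x, V *ᵥ Y x = NormedSpace.exp (x • A₀) *ᵥ z := fun x => by
    simp only [Y, Matrix.mulVec_mulVec, ← Matrix.mul_assoc, h.mul_inv, Matrix.one_mul]
  have hconj : V' * A₀ = (Matrix.diagonal d + N) * V' := by
    calc V' * A₀ = V' * (A₀ * V) * V' := by
          simp only [Matrix.mul_assoc, h.mul_inv, Matrix.mul_one]
      _ = _ := by rw [h.conj, ← Matrix.mul_assoc, h.inv_mul, Matrix.one_mul]
  refine ⟨Y, fun x => ?_, fun x => ?_⟩
  · have h1 := hasDerivAt_exp_smul_mulVec A₀ z x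
    have h2 : HasDerivAt Y (V' *ᵥ (A₀ *ᵥ (NormedSpace.exp (x • A₀) *ᵥ z))) x :=
      ((Matrix.mulVecLin V').restrictScalars ℝ).toContinuousLinearMap.hasFDerivAt.comp_hasDerivAt
        x h1
    refine h2.congr_deriv ?_
    simp only [Y, Matrix.mulVec_mulVec, ← Matrix.mul_assoc, hconj]
  · have h1 : ∀ t, HasDerivAt (fun t => P t *ᵥ (V *ᵥ Y t)) (A t *ᵥ (P t *ᵥ (V *ᵥ Y t))) t := by
      intro t
      simp only [hVY]
      simpa using conjugator_hasDerivAt (hP.deriv t) (hasDerivAt_exp_smul_mulVec A₀ z t)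
    have h2 := mulVec_ode_unique hK hW h1 (x₀ := 0) (by simp only [hVY]; simp [hz])
    exact congrFun h2 x

/-- Once ‖P x - 1‖ < 1/2 the map P x is bounded below, so bounds and integrability of a solution
pass to its triangular coordinates. -/
theorem eventually_norm_le_of_conjugator (h : IsBlockForm A₀ k d δ V V' N) {l : Filter ℝ}
    {P : ℝ → Matrix (Fin 3) (Fin 3) ℂ} (hP : IsConjugator A A₀ l P) :
    ∃ B, ∀ᶠ x in l, ∀ y : Fin 3 → ℂ, ‖y‖ ≤ B * ‖P x *ᵥ (V *ᵥ y)‖ := by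
  refine ⟨‖V'‖ * 2, ?_⟩
  have h1 : ∀ᶠ x in l, ‖P x - 1‖ < 1 / 2 := by
    have := (tendsto_iff_norm_sub_tendsto_zero.1 hP.lim)
    exact this.eventually_lt_const (by norm_num)
  filter_upwards [h1] with x hx y
  have h2 : ‖V *ᵥ y‖ ≤ 2 * ‖P x *ᵥ (V *ᵥ y)‖ := by
    have h3 : V *ᵥ y = P x *ᵥ (V *ᵥ y) - (P x - 1) *ᵥ (V *ᵥ y) := by
      rw [Matrix.sub_mulVec, Matrix.one_mulVec]; abel
    have h4 : ‖(P x - 1) *ᵥ (V *ᵥ y)‖ ≤ 1 / 2 * ‖V *ᵥ y‖ :=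
      (Matrix.linfty_opNorm_mulVec _ _).trans (by gcongr)
    have h5 : ‖V *ᵥ y‖ ≤ ‖P x *ᵥ (V *ᵥ y)‖ + ‖(P x - 1) *ᵥ (V *ᵥ y)‖ := by
      conv_lhs => rw [h3]
      exact norm_sub_le _ _
    linarith
  calc ‖y‖ = ‖V' *ᵥ (V *ᵥ y)‖ := by rw [Matrix.mulVec_mulVec, h.inv_mul, Matrix.one_mulVec]
    _ ≤ ‖V'‖ * ‖V *ᵥ y‖ := Matrix.linfty_opNorm_mulVec _ _
    _ ≤ ‖V'‖ * (2 * ‖P x *ᵥ (V *ᵥ y)‖) := by gcongr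
    _ = _ := by ring

/-- A growing exponential is not square integrable. -/
theorem eq_zero_of_cexp_sq_integrable {S : Set ℝ} (hS : MeasurableSet S) (hvol : volume S = ⊤)
    {W Y : ℝ → Fin 3 → ℂ} (hW : IntegrableOn (fun x => ‖W x‖ ^ 2) S) {B : ℝ}
    (hB : ∀ x ∈ S, ‖Y x‖ ≤ B * ‖W x‖) {j : Fin 3} {a μ : ℂ} (hμ : ∀ x ∈ S, 0 ≤ μ.re * x)
    (ha : ∀ x : ℝ, Y x j = Complex.exp (μ * x) * a) : a = 0 := by
  have h1 : IntegrableOn (fun _ : ℝ => ‖a‖ ^ 2) S := by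
    refine Integrable.mono' (hW.const_mul (B ^ 2)) aestronglyMeasurable_const ?_
    refine (ae_restrict_iff' hS).2 (Eventually.of_forall fun x hx => ?_)
    have h2 : ‖a‖ ≤ ‖Y x‖ := by
      refine le_trans ?_ (norm_le_pi_norm (Y x) j)
      rw [ha x, norm_mul, Complex.norm_exp]
      have : 1 ≤ Real.exp (μ * x).re := Real.one_le_exp (by simpa using hμ x hx)
      exact le_mul_of_one_le_left (norm_nonneg _) this
    rw [Real.norm_of_nonneg (by positivity), ← mul_pow]
    gcongr
    exact h2.trans (hB x hx)
  rw [integrableOn_const_iff] at h1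
  rcases h1 with h1 | h1
  · exact norm_eq_zero.1 (by simpa using h1)
  · rw [hvol] at h1; exact absurd h1 (lt_irrefl _)

theorem frameSolution_zero (j : Fin 3) :
    frameSolution A₀ V Pl Pr k j 0 = (if j.val < k then Pl 0 else Pr 0) *ᵥ fun i => V i j := by
  simp [frameSolution]

/-- If the Evans determinant does not vanish, a square integrable solution vanishes. -/
theorem eq_zero_of_sq_integrable (hA : ExpAsymptotic A A₀ C κ) (h : IsBlockForm A₀ k d δ V V' N)
    (hl : IsConjugator A A₀ atBot Pl) (hr : IsConjugator A A₀ atTop Pr)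
    (hdet : (Matrix.of fun i j => frameSolution A₀ V Pl Pr k j 0 i).det ≠ 0)
    {W : ℝ → Fin 3 → ℂ} (hW : ∀ x, HasDerivAt W (A x *ᵥ W x) x)
    (hint : Integrable fun x => ‖W x‖ ^ 2) : W = 0 := by
  obtain ⟨Y, hY, hWY⟩ := exists_triangular_coordinates hA h hr hW
  obtain ⟨Z, hZ, hWZ⟩ := exists_triangular_coordinates hA h hl hW
  obtain ⟨B, hB⟩ := eventually_norm_le_of_conjugator h hr
  obtain ⟨B', hB'⟩ := eventually_norm_le_of_conjugator h hl
  obtain ⟨X, hX⟩ := eventually_atTop.1 hB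
  obtain ⟨X', hX'⟩ := eventually_atBot.1 hB'
  -- Square integrability at +∞ excludes the growing modes in the right coordinates Y. At -∞ it
  -- likewise excludes the modes with Re (d j) < 0 in the left coordinates Z.
  have hY0 : ∀ j ∈ {j : Fin 3 | j.val < k}, ∀ x, Y x j = 0 := by
    refine triangular_eq_zero hY (fun i j hij => ⟨(h.upper i j hij).1, (h.upper i j hij).2.1⟩)
      fun j hj a ha => ?_
    refine eq_zero_of_cexp_sq_integrable (S := Set.Ioi (max X 0)) measurableSet_Ioi (by simp)
      hint.integrableOn (B := B) (Y := Y) (fun x hx => ?_) (fun x hx => ?_) ha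
    · rw [hWY x]; exact hX x ((le_max_left _ _).trans (le_of_lt hx)) _
    · exact mul_nonneg (h.pos j hj).le ((le_max_right _ _).trans (le_of_lt hx))
  have hZ0 : ∀ j ∈ {j : Fin 3 | k ≤ j.val}, ∀ x, Z x j = 0 := by
    refine triangular_eq_zero hZ (fun i j hij => ⟨(h.upper i j hij).1, fun hi => ?_⟩)
      fun j hj a ha => ?_
    · exact not_lt.1 fun hj => (not_lt.2 hi) ((h.upper i j hij).2.2 hj)
    refine eq_zero_of_cexp_sq_integrable (S := Set.Iio (min X' 0)) measurableSet_Iio (by simp)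
      hint.integrableOn (B := B') (Y := Z) (fun x hx => ?_) (fun x hx => ?_) ha
    · rw [hWZ x]; exact hX' x ((le_of_lt hx).trans (min_le_left _ _)) _
    · exact mul_nonneg_of_nonpos_of_nonpos (h.neg j hj).le ((le_of_lt hx).trans (min_le_right _ _))
  have hcol : ∀ (P : Matrix (Fin 3) (Fin 3) ℂ) (y : Fin 3 → ℂ),
      P *ᵥ (V *ᵥ y) = ∑ j, y j • (P *ᵥ fun i => V i j) := by
    intro P y
    have : V *ᵥ y = ∑ j, y j • fun i => V i j := by
      ext i
      simp [Matrix.mulVec, dotProduct, mul_comm]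
    rw [this, Matrix.mulVec_sum]
    simp only [Matrix.mulVec_smul]
  -- The vector W 0 is a combination of right solutions with coefficients Y 0 and of left ones with
  -- coefficients Z 0, so the difference of the coefficients lies in the kernel of the Evans matrix.
  -- As the two vectors have complementary supports, a trivial kernel forces both to vanish.
  have hker : (Matrix.of fun i j => frameSolution A₀ V Pl Pr k j 0 i) *ᵥ (Z 0 - Y 0) = 0 := by
    have h1 : W 0 = ∑ j, Y 0 j • (Pr 0 *ᵥ fun i => V i j) := by rw [hWY 0, hcol]
    have h2 : W 0 = ∑ j, Z 0 j • (Pl 0 *ᵥ fun i => V i j) := by rw [hWZ 0, hcol]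
    have h3 : (Matrix.of fun i j => frameSolution A₀ V Pl Pr k j 0 i) *ᵥ (Z 0 - Y 0)
        = (∑ j, Z 0 j • (Pl 0 *ᵥ fun i => V i j)) - ∑ j, Y 0 j • (Pr 0 *ᵥ fun i => V i j) := by
      rw [← Finset.sum_sub_distrib]
      ext i
      simp only [Matrix.mulVec, dotProduct, Matrix.of_apply, Finset.sum_apply]
      refine Finset.sum_congr rfl fun j _ => ?_
      rw [frameSolution_zero]
      by_cases hj : j.val < k
      · rw [if_pos hj]
        simp [hY0 j hj, Matrix.mulVec, dotProduct, mul_comm]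
      · rw [if_neg hj]
        simp [hZ0 j (not_lt.1 hj), Matrix.mulVec, dotProduct, mul_comm]
    rw [h3, ← h1, ← h2, sub_self]
  have hzero := Matrix.eq_zero_of_mulVec_eq_zero hdet hker
  have hYz : Y 0 = 0 := by
    ext j
    have h1 := congrFun hzero j
    by_cases hj : j.val < k
    · exact hY0 j hj 0
    · have h2 := hZ0 j (not_lt.1 hj) 0
      simpa [h2] using h1
  obtain ⟨K, hK⟩ := hA.exists_norm_le
  refine mulVec_ode_unique hK hW (W := 0)
    (fun t => by simp) (x₀ := 0) ?_
  rw [hWY 0, hYz]; simp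

end Frame

end JinXin

/-! ### Exponentially decaying solutions of the inhomogeneous system -/

namespace JinXin

open scoped Matrix.Norms.Operator

theorem exists_bound_Ici {f : ℝ → ℝ} (hf : Continuous f) {L : ℝ} (hL : Tendsto f atTop (𝓝 L)) :
    ∃ B, 0 ≤ B ∧ ∀ x, 0 ≤ x → f x ≤ B := by
  obtain ⟨X, hX⟩ := eventually_atTop.1 (hL.eventually_le_const (lt_add_one L))
  obtain ⟨B, hB⟩ := (isCompact_Icc (a := (0 : ℝ)) (b := X)).bddAbove_image hf.continuousOn
  refine ⟨max (max B (L + 1)) 0, le_max_right _ _, fun x hx => le_trans ?_ (le_max_left _ _)⟩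
  rcases le_total x X with h | h
  · exact (hB ⟨x, ⟨hx, h⟩, rfl⟩).trans (le_max_left _ _)
  · exact (hX x h).trans (le_max_right _ _)

theorem continuous_matrix_inv {P : ℝ → Matrix (Fin 3) (Fin 3) ℂ} (hP : Continuous P)
    (hu : ∀ x, IsUnit (P x)) : Continuous fun x => (P x)⁻¹ := by
  have h1 : ∀ x, (P x).det ≠ 0 := fun x =>
    ((Matrix.isUnit_iff_isUnit_det _).1 (hu x)).ne_zero
  have h2 : (fun x => (P x)⁻¹) = fun x => ((P x).det)⁻¹ • (P x).adjugate := by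
    funext x
    rw [Matrix.inv_def, Ring.inverse_eq_inv']
  rw [h2]
  exact (hP.matrix_det.inv₀ h1).smul hP.matrix_adjugate

theorem tendsto_matrix_inv_one {P : ℝ → Matrix (Fin 3) (Fin 3) ℂ} {l : Filter ℝ}
    (h : Tendsto P l (𝓝 1)) : Tendsto (fun x => (P x)⁻¹) l (𝓝 1) := by
  have h2 : (fun x => (P x)⁻¹) = fun x => ((P x).det)⁻¹ • (P x).adjugate := by
    funext x
    rw [Matrix.inv_def, Ring.inverse_eq_inv']
  have hd : Tendsto (fun x => (P x).det) l (𝓝 1) := by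
    have := (continuous_id.matrix_det (n := Fin 3) (R := ℂ)).tendsto 1
    simp only [id, Matrix.det_one] at this
    exact this.comp h
  have ha : Tendsto (fun x => (P x).adjugate) l (𝓝 1) := by
    have := (continuous_id.matrix_adjugate (n := Fin 3) (R := ℂ)).tendsto 1
    simp only [id, Matrix.adjugate_one] at this
    exact this.comp h
  rw [h2]
  have := (hd.inv₀ one_ne_zero).smul ha
  simpa using this

/-- Solutions of the inhomogeneous system that decay on the right half-line, with the components
along the decaying modes prescribed. -/
theorem exists_decaying_right {A P : ℝ → Matrix (Fin 3) (Fin 3) ℂ}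
    {A₀ V V' N : Matrix (Fin 3) (Fin 3) ℂ} {d : Fin 3 → ℂ} {r δ β C : ℝ}
    (hPd : ∀ x, HasDerivAt P (A x * P x - P x * A₀) x) (hPl : Tendsto P atTop (𝓝 1))
    (hPu : ∀ x, IsUnit (P x)) (hV1 : V * V' = 1) (hV2 : V' * V = 1)
    (hconj : A₀ * V = V * (Matrix.diagonal d + N)) (hr : 0 < r) (hd : ∀ j, r ≤ |(d j).re|)
    (hδ : δ ≤ r / 12) (hN : ∀ i j, ‖N i j‖ ≤ δ) {T : Set (Fin 3)} (hdT : ∀ j ∈ T, (d j).re < 0)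
    (hNT : ∀ i j, N i j ≠ 0 → (i ∈ T ↔ j ∈ T)) (hβ : 0 < β) (hβr : β ≤ r / 2)
    {G : ℝ → Fin 3 → ℂ} (hG : Continuous G) (hC : ∀ x, 0 ≤ x → ‖G x‖ ≤ C * Real.exp (-β * x)) :
    ∃ w : Fin 3 → ℂ, ∀ α : Fin 3 → ℂ, (∀ i ∉ T, α i = 0) →
      ∃ (W : ℝ → Fin 3 → ℂ) (C' : ℝ), W 0 = w + P 0 *ᵥ (V *ᵥ α) ∧ ∀ x, 0 ≤ x →
        HasDerivAt W (A x *ᵥ W x + G x) x ∧ ‖W x‖ ≤ C' * Real.exp (-β * x) := by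
  have hPc : Continuous P := continuous_iff_continuousAt.2 fun x => (hPd x).continuousAt
  have hPic := continuous_matrix_inv hPc hPu
  obtain ⟨B, hB0, hB⟩ := exists_bound_Ici hPc.norm hPl.norm
  obtain ⟨B', hB'0, hB'⟩ := exists_bound_Ici hPic.norm (tendsto_matrix_inv_one hPl).norm
  have hPinv : ∀ x, P x * (P x)⁻¹ = 1 := fun x =>
    Matrix.mul_nonsing_inv _ ((Matrix.isUnit_iff_isUnit_det _).1 (hPu x))
  let h : ℝ → Fin 3 → ℂ := fun x => V' *ᵥ ((P x)⁻¹ *ᵥ G x)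
  have hh : Continuous h :=
    Continuous.matrix_mulVec continuous_const (hPic.matrix_mulVec hG)
  obtain ⟨Y, C₁, hY⟩ := exists_decaying_particular (h := h) (C := ‖V'‖ * (B' * C)) hr hd hδ hN hβ hβr
    hh.continuousOn (fun x hx => by
      calc ‖h x‖ ≤ ‖V'‖ * (‖(P x)⁻¹‖ * ‖G x‖) :=
            (Matrix.linfty_opNorm_mulVec _ _).trans (by
              gcongr; exact Matrix.linfty_opNorm_mulVec _ _)
        _ ≤ ‖V'‖ * (B' * (C * Real.exp (-β * x))) := by
            gcongr
            · exact hB' x hx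
            · exact hC x hx
        _ = _ := by ring)
  refine ⟨P 0 *ᵥ (V *ᵥ Y 0), fun α hα => ?_⟩
  -- The free part carries the prescribed data α. The particular solution Y does not depend on α,
  -- which allows `w` to be fixed before α.
  let Z : ℝ → Fin 3 → ℂ := fun x => V' *ᵥ (NormedSpace.exp (x • A₀) *ᵥ (V *ᵥ α))
  have hVinv : V' * A₀ = (Matrix.diagonal d + N) * V' := by
    calc V' * A₀ = V' * (A₀ * V) * V' := by
          simp only [Matrix.mul_assoc, hV1, Matrix.mul_one]
      _ = _ := by rw [hconj, ← Matrix.mul_assoc, hV2, Matrix.one_mul]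
  have hZ : ∀ x, HasDerivAt Z ((Matrix.diagonal d + N) *ᵥ Z x) x := by
    intro x
    have h1 := hasDerivAt_exp_smul_mulVec A₀ (V *ᵥ α) x
    have h2 : HasDerivAt Z (V' *ᵥ (A₀ *ᵥ (NormedSpace.exp (x • A₀) *ᵥ (V *ᵥ α)))) x :=
      ((Matrix.mulVecLin V').restrictScalars ℝ).toContinuousLinearMap.hasFDerivAt.comp_hasDerivAt
        x h1
    refine h2.congr_deriv ?_
    simp only [Z, Matrix.mulVec_mulVec, ← Matrix.mul_assoc, hVinv]
  have hZ0 : Z 0 = α := by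
    simp only [Z, zero_smul, NormedSpace.exp_zero, Matrix.one_mulVec]
    rw [Matrix.mulVec_mulVec, hV2, Matrix.one_mulVec]
  obtain ⟨C₂, hC₂⟩ := triangular_decay (T := T) hr (fun j hj => by
    have h1 := hd j
    rw [abs_of_neg (hdT j hj)] at h1
    linarith) hδ hN hNT hZ (by rwa [hZ0])
  have hC₂0 : 0 ≤ C₂ := by
    have := (norm_nonneg _).trans (hC₂ 0 le_rfl)
    simpa using this
  refine ⟨fun x => P x *ᵥ (V *ᵥ (Y x + Z x)), B * (‖V‖ * (C₁ + C₂)), ?_, fun x hx => ⟨?_, ?_⟩⟩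
  · simp only [hZ0, Matrix.mulVec_add]
  · have h1 := (hY x hx).1.add (hZ x)
    have h2 : HasDerivAt (fun x => V *ᵥ (Y x + Z x))
        (V *ᵥ (((Matrix.diagonal d + N) *ᵥ Y x + h x) + (Matrix.diagonal d + N) *ᵥ Z x)) x :=
      ((Matrix.mulVecLin V).restrictScalars ℝ).toContinuousLinearMap.hasFDerivAt.comp_hasDerivAt
        x h1
    refine (conjugator_hasDerivAt (hPd x) h2).congr_deriv ?_
    have h3 : V *ᵥ (((Matrix.diagonal d + N) *ᵥ Y x + h x) + (Matrix.diagonal d + N) *ᵥ Z x)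
        - A₀ *ᵥ (V *ᵥ (Y x + Z x)) = V *ᵥ h x := by
      have h5 : A₀ *ᵥ (V *ᵥ (Y x + Z x)) = V *ᵥ ((Matrix.diagonal d + N) *ᵥ (Y x + Z x)) := by
        rw [Matrix.mulVec_mulVec, hconj, ← Matrix.mulVec_mulVec]
      rw [h5]
      generalize Z x = z
      simp only [Matrix.mulVec_add]
      abel
    have h4 : P x *ᵥ (V *ᵥ h x) = G x := by
      simp only [h, Matrix.mulVec_mulVec]
      rw [← Matrix.mul_assoc V, hV1, Matrix.one_mul, hPinv, Matrix.one_mulVec]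
    rw [h3, h4]
  · have h1 : ‖Z x‖ ≤ C₂ * Real.exp (-β * x) := (hC₂ x hx).trans (by
      gcongr)
    calc ‖P x *ᵥ (V *ᵥ (Y x + Z x))‖ ≤ ‖P x‖ * (‖V‖ * ‖Y x + Z x‖) :=
          (Matrix.linfty_opNorm_mulVec _ _).trans (by
              gcongr; exact Matrix.linfty_opNorm_mulVec _ _)
      _ ≤ B * (‖V‖ * (C₁ * Real.exp (-β * x) + C₂ * Real.exp (-β * x))) := by
          gcongr
          · exact hB x hx
          · exact (norm_add_le _ _).trans (add_le_add (hY x hx).2 h1)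
      _ = _ := by ring

theorem hasDerivAt_of_left_right {E : Type*} [NormedAddCommGroup E] [NormedSpace ℝ E] {U V : ℝ → E}
    {u : E} (hU : HasDerivAt U u 0) (hV : HasDerivAt V u 0) (h0 : U 0 = V 0) :
    HasDerivAt (fun x => if x < 0 then U x else V x) u 0 := by
  have h1 : HasDerivWithinAt (fun x => if x < 0 then U x else V x) u (Set.Iic 0) 0 := by
    refine hU.hasDerivWithinAt.congr (fun x hx => ?_) (by simp [h0])
    rcases lt_or_eq_of_le (Set.mem_Iic.1 hx) with h | h
    · simp [h]
    · simp [h, h0]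
  have h2 : HasDerivWithinAt (fun x => if x < 0 then U x else V x) u (Set.Ici 0) 0 := by
    refine hV.hasDerivWithinAt.congr (fun x hx => ?_) (by simp)
    simp [not_lt.2 (Set.mem_Ici.1 hx)]
  have h3 := h1.union h2
  rwa [Set.Iic_union_Ici, hasDerivWithinAt_univ] at h3

/-- If the Evans determinant does not vanish, the inhomogeneous system with exponentially decaying
right-hand side has an exponentially decaying solution. -/
theorem exists_decaying_solution {A Pl Pr : ℝ → Matrix (Fin 3) (Fin 3) ℂ}
    {A₀ V V' N : Matrix (Fin 3) (Fin 3) ℂ} {k : ℕ} {d : Fin 3 → ℂ} {r δ β C : ℝ}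
    (h : IsBlockForm A₀ k d δ V V' N)
    (hl : IsConjugator A A₀ atBot Pl) (hr : IsConjugator A A₀ atTop Pr)
    (hdet : (Matrix.of fun i j => frameSolution A₀ V Pl Pr k j 0 i).det ≠ 0)
    (hr0 : 0 < r) (hd : ∀ j, r ≤ |(d j).re|) (hδ : δ ≤ r / 12) (hβ : 0 < β) (hβr : β ≤ r / 2)
    {G : ℝ → Fin 3 → ℂ} (hG : Continuous G) (hC : ∀ x, ‖G x‖ ≤ C * Real.exp (-β * |x|)) :
    ∃ (W : ℝ → Fin 3 → ℂ) (C' : ℝ), ∀ x,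
      HasDerivAt W (A x *ᵥ W x + G x) x ∧ ‖W x‖ ≤ C' * Real.exp (-β * |x|) := by
  obtain ⟨wr, hwr⟩ := exists_decaying_right (T := {j | k ≤ j.val}) hr.deriv hr.lim hr.isUnit
    h.mul_inv h.inv_mul h.conj hr0 hd hδ h.small (fun j hj => h.neg j hj) (fun i j hij => by
      have := (h.upper i j hij).2
      rw [Set.mem_ofPred_eq, Set.mem_ofPred_eq]
      omega) hβ hβr hG (C := C) (fun x hx => by simpa [abs_of_nonneg hx] using hC x)
  -- The left half-line is the right half-line of the reflected system, in which the modes j < k are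
  -- the decaying ones.
  obtain ⟨wl, hwl⟩ := exists_decaying_right (A := fun x => -A (-x)) (P := fun x => Pl (-x))
    (A₀ := -A₀) (V := V) (V' := V') (N := -N) (d := -d) (T := {j | j.val < k})
    (fun x => by
      refine ((hl.deriv (-x)).scomp x (hasDerivAt_neg x)).congr_deriv ?_
      simp
      abel)
    (hl.lim.comp tendsto_neg_atTop_atBot) (fun x => hl.isUnit _)
    h.mul_inv h.inv_mul (by
      rw [Matrix.neg_mul, h.conj, ← Matrix.mul_neg, neg_add, Matrix.diagonal_neg]; rfl)
    hr0 (fun j => by simpa using hd j) hδ (fun i j => by simpa using h.small i j)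
    (fun j hj => by simpa using h.pos j hj) (fun i j hij => (h.upper i j (by simpa using hij)).2)
    hβ hβr (G := fun x => -G (-x)) (hG.comp continuous_neg).neg (C := C)
    (fun x hx => by
      have := hC (-x)
      rw [norm_neg]
      simpa [abs_of_nonneg hx] using this)
  let M : Matrix (Fin 3) (Fin 3) ℂ := Matrix.of fun i j => frameSolution A₀ V Pl Pr k j 0 i
  -- Continuity at 0 is the linear system M y = wl - wr, in which right modes enter with
  -- coefficients y and left modes with -y. A nonzero Evans determinant solves it.
  let y : Fin 3 → ℂ := M⁻¹ *ᵥ (wl - wr)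
  have hy : M *ᵥ y = wl - wr := by
    simp only [y, Matrix.mulVec_mulVec]
    rw [Matrix.mul_nonsing_inv _ (Ne.isUnit hdet), Matrix.one_mulVec]
  let αl : Fin 3 → ℂ := fun j => if j.val < k then -y j else 0
  let αr : Fin 3 → ℂ := fun j => if j.val < k then 0 else y j
  have hcol : ∀ (P : Matrix (Fin 3) (Fin 3) ℂ) (y : Fin 3 → ℂ),
      P *ᵥ (V *ᵥ y) = ∑ j, y j • (P *ᵥ fun i => V i j) := by
    intro P y
    have : V *ᵥ y = ∑ j, y j • fun i => V i j := by
      ext i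
      simp [Matrix.mulVec, dotProduct, mul_comm]
    rw [this, Matrix.mulVec_sum]
    simp only [Matrix.mulVec_smul]
  have hmatch : wl + Pl 0 *ᵥ (V *ᵥ αl) = wr + Pr 0 *ᵥ (V *ᵥ αr) := by
    have h1 : M *ᵥ y = Pr 0 *ᵥ (V *ᵥ αr) - Pl 0 *ᵥ (V *ᵥ αl) := by
      rw [hcol, hcol, ← Finset.sum_sub_distrib]
      ext i
      simp only [Matrix.mulVec, dotProduct, M, Matrix.of_apply, Finset.sum_apply]
      refine Finset.sum_congr rfl fun j _ => ?_
      rw [frameSolution_zero]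
      by_cases hj : j.val < k
      · rw [if_pos hj]
        simp [αl, αr, hj, Matrix.mulVec, dotProduct, mul_comm]
      · rw [if_neg hj]
        simp [αl, αr, hj, Matrix.mulVec, dotProduct, mul_comm]
    rw [hy] at h1
    have h2 : wl = wr + (Pr 0 *ᵥ (V *ᵥ αr) - Pl 0 *ᵥ (V *ᵥ αl)) := by rw [← h1]; abel
    rw [h2]; abel
  obtain ⟨Wr, Cr, hWr0, hWr⟩ := hwr αr (fun i hi => by
    have : i.val < k := not_le.1 hi
    simp [αr, this])
  obtain ⟨Wl, Cl, hWl0, hWl⟩ := hwl αl (fun i hi => by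
    have : ¬ i.val < k := hi
    simp [αl, this])
  have hWl' : ∀ x, x ≤ 0 → HasDerivAt (fun x => Wl (-x)) (A x *ᵥ Wl (-x) + G x) x ∧
      ‖Wl (-x)‖ ≤ Cl * Real.exp (-β * |x|) := by
    intro x hx
    have h1 := hWl (-x) (by linarith)
    refine ⟨(h1.1.scomp x (hasDerivAt_neg x)).congr_deriv ?_, ?_⟩
    · simp [Matrix.neg_mulVec]
    · rw [abs_of_nonpos hx]; exact h1.2
  have h00 : Wl (-0) = Wr 0 := by
    rw [hWr0, neg_zero, hWl0, neg_zero]; exact hmatch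
  refine ⟨fun x => if x < 0 then Wl (-x) else Wr x, max Cl Cr, fun x => ⟨?_, ?_⟩⟩
  · rcases lt_trichotomy x 0 with hx | hx | hx
    · simp only [if_pos hx]
      refine (hWl' x hx.le).1.congr_of_eventuallyEq ?_
      filter_upwards [gt_mem_nhds hx] with y hy
      simp [hy]
    · subst hx
      have h1 := (hWl' 0 le_rfl).1
      have h2 := (hWr 0 le_rfl).1
      simp only [lt_irrefl, if_false]
      exact hasDerivAt_of_left_right (by rw [← h00]; exact h1) h2 h00
    · simp only [if_neg (not_lt.2 hx.le)]
      refine (hWr x hx.le).1.congr_of_eventuallyEq ?_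
      filter_upwards [lt_mem_nhds hx] with y hy
      simp [not_lt.2 (le_of_lt hy)]
  · by_cases hx : x < 0
    · simp only [if_pos hx]
      refine (hWl' x hx.le).2.trans ?_
      gcongr
      exact le_max_left _ _
    · simp only [if_neg hx]
      have h1 := (hWr x (not_lt.1 hx)).2
      rw [abs_of_nonneg (not_lt.1 hx)]
      refine h1.trans ?_
      gcongr
      exact le_max_right _ _

end JinXin

namespace JinXin

/-! ### The eigenvalues of the limiting matrix -/

/-- `m` lists the roots of `c m³ - l m² + (b - c - 2 c l) m + l (l + 1)`. -/
structure IsCharRoots (c b : ℝ) (l : ℂ) (m : Fin 3 → ℂ) : Prop where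
  sum : c * (m 0 + m 1 + m 2) = l
  pairs : c * (m 0 * m 1 + m 0 * m 2 + m 1 * m 2) = b - c - 2 * c * l
  prod : c * (m 0 * m 1 * m 2) = -(l * (l + 1))

theorem IsCharRoots.eval {c b : ℝ} {l : ℂ} {m : Fin 3 → ℂ} (h : IsCharRoots c b l m) (i : Fin 3) :
    c * m i ^ 3 - l * m i ^ 2 + (b - c - 2 * c * l) * m i + l * (l + 1) = 0 := by
  have h1 := h.sum
  have h2 := h.pairs
  have h3 := h.prod
  fin_cases i
  · simp only [Fin.zero_eta]
    linear_combination (m 0) ^ 2 * h1 - m 0 * h2 + h3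
  · simp only [Fin.mk_one]
    linear_combination (m 1) ^ 2 * h1 - m 1 * h2 + h3
  · simp only [Fin.reduceFinMk]
    linear_combination (m 2) ^ 2 * h1 - m 2 * h2 + h3

theorem exists_add_mul_eq (s t : ℂ) : ∃ x y : ℂ, x + y = s ∧ x * y = t := by
  obtain ⟨w, hw⟩ := IsAlgClosed.exists_eq_mul_self (s ^ 2 - 4 * t)
  exact ⟨(s + w) / 2, (s - w) / 2, by ring, by linear_combination hw / 4⟩

theorem exists_isCharRoots_of_root {c : ℝ} (hc : c ≠ 0) (b : ℝ) (l z : ℂ)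
    (hz : c * z ^ 3 - l * z ^ 2 + (b - c - 2 * c * l) * z + l * (l + 1) = 0) :
    ∃ x y, IsCharRoots c b l ![x, y, z] ∧ x + y = l / c - z ∧
      x * y = (b - c - 2 * c * l) / c - z * (l / c - z) := by
  obtain ⟨x, y, h1, h2⟩ := exists_add_mul_eq (l / c - z) ((b - c - 2 * c * l) / c - z * (l / c - z))
  have hc' : (c : ℂ) ≠ 0 := by exact_mod_cast hc
  refine ⟨x, y, ⟨?_, ?_, ?_⟩, h1, h2⟩
  · simp only [Matrix.cons_val]
    rw [h1]; field_simp; ring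
  · simp only [Matrix.cons_val]
    have : x * y + x * z + y * z = x * y + z * (x + y) := by ring
    rw [this, h1, h2]; field_simp; ring
  · simp only [Matrix.cons_val]
    rw [h2]; field_simp; linear_combination hz

theorem exists_isCharRoots {c : ℝ} (hc : c ≠ 0) (b : ℝ) (l : ℂ) : ∃ m, IsCharRoots c b l m := by
  have hc' : (c : ℂ) ≠ 0 := by exact_mod_cast hc
  obtain ⟨z, hz⟩ := IsAlgClosed.exists_root
    (Polynomial.C (c : ℂ) * Polynomial.X ^ 3 + Polynomial.C (-l) * Polynomial.X ^ 2 +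
      Polynomial.C (b - c - 2 * c * l) * Polynomial.X + Polynomial.C (l * (l + 1)))
    (by rw [Polynomial.degree_cubic hc']; decide)
  obtain ⟨x, y, h, -⟩ := exists_isCharRoots_of_root hc b l z (by
    have : _ = (0 : ℂ) := hz
    simp only [Polynomial.eval_add, Polynomial.eval_mul, Polynomial.eval_C, Polynomial.eval_pow,
      Polynomial.eval_X] at this
    linear_combination this)
  exact ⟨_, h⟩

theorem IsCharRoots.neg {c b : ℝ} {l : ℂ} {m : Fin 3 → ℂ} (h : IsCharRoots c b l m) :
    IsCharRoots (-c) (-b) l (-m) := by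
  have h1 := h.sum
  have h2 := h.pairs
  have h3 := h.prod
  refine ⟨?_, ?_, ?_⟩ <;> simp only [Pi.neg_apply, Complex.ofReal_neg]
  · linear_combination h1
  · linear_combination -h2
  · linear_combination h3

/-- Up to sign this is the characteristic cubic at -n. It is negative at n = 0, and X is chosen so
large that r n² dominates the linear and constant terms. -/
theorem exists_neg_root {c : ℝ} (hc : 0 < c) (b : ℝ) {r : ℝ} (hr : 0 < r) :
    ∃ n : ℝ, 0 < n ∧ c * n ^ 3 + r * n ^ 2 + (b - c - 2 * c * r) * n - r * (r + 1) = 0 := by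
  let g : ℝ → ℝ := fun n => c * n ^ 3 + r * n ^ 2 + (b - c - 2 * c * r) * n - r * (r + 1)
  have hg : Continuous g := by fun_prop
  let X := 1 + (|b - c - 2 * c * r| + r * (r + 1)) / r
  have hX1 : 1 ≤ X := by
    have : 0 ≤ (|b - c - 2 * c * r| + r * (r + 1)) / r := by positivity
    simp only [X]; linarith
  have hgX : 0 ≤ g X := by
    have h1 : r * X = r + (|b - c - 2 * c * r| + r * (r + 1)) := by
      simp only [X]; field_simp
    have h2 : r * X ^ 2 = (r + (|b - c - 2 * c * r| + r * (r + 1))) * X := by rw [← h1]; ring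
    have h3 : 0 ≤ (|b - c - 2 * c * r| + (b - c - 2 * c * r)) * X :=
      mul_nonneg (by linarith [neg_abs_le (b - c - 2 * c * r)]) (by linarith)
    have h4 : 0 ≤ r * (r + 1) * (X - 1) := mul_nonneg (by positivity) (by linarith)
    have h5 : 0 ≤ c * X ^ 3 := by positivity
    have h6 : 0 ≤ r * X := by positivity
    simp only [g]
    nlinarith
  have hg0 : g 0 < 0 := by simp only [g]; nlinarith
  obtain ⟨n, hn, hgn⟩ := intermediate_value_Icc (by linarith : (0 : ℝ) ≤ X) hg.continuousOn
    ⟨hg0.le, hgX⟩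
  refine ⟨n, lt_of_le_of_ne hn.1 fun h => ?_, hgn⟩
  rw [← h] at hgn
  exact hg0.ne hgn

/-- The number x is a root of z² - s z + t. A nonreal root has real part s/2, and a real one
satisfies s x = x² + t > 0. -/
theorem re_pos_of_add_mul {x y : ℂ} {s t : ℝ} (hs : 0 < s) (ht : 0 < t) (h1 : x + y = s)
    (h2 : x * y = t) : 0 < x.re := by
  have h3 : x * x = s * x - t := by rw [← h1, ← h2]; ring
  have hr := congrArg Complex.re h3
  have hi := congrArg Complex.im h3
  simp at hr hi
  have hi' : x.im * (2 * x.re - s) = 0 := by linarith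
  rcases mul_eq_zero.1 hi' with h | h
  · rw [h] at hr
    nlinarith
  · linarith

/-- For positive real spectral parameter two eigenvalues have positive and one has negative real
part. -/
theorem exists_split_roots_real {c : ℝ} (hc : 0 < c) (b : ℝ) {r : ℝ} (hr : 0 < r) :
    ∃ m, IsCharRoots c b r m ∧ 0 < (m 0).re ∧ 0 < (m 1).re ∧ (m 2).re < 0 := by
  obtain ⟨n, hn, hroot⟩ := exists_neg_root hc b hr
  obtain ⟨x, y, h, h1, h2⟩ := exists_isCharRoots_of_root hc.ne' b r (-n : ℝ) (by
    have := congrArg (fun x : ℝ => (x : ℂ)) hroot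
    push_cast at this ⊢
    linear_combination -this)
  -- Dividing out the negative root leaves a quadratic with positive sum and positive product of
  -- roots.
  have hs : x + y = ((r / c + n : ℝ) : ℂ) := by rw [h1]; push_cast; ring
  have ht : x * y = ((r * (r + 1) / (c * n) : ℝ) : ℂ) := by
    rw [h2]
    have : (b - c - 2 * c * r) / c + n * (r / c + n) = r * (r + 1) / (c * n) := by
      field_simp
      linear_combination hroot
    rw [← this]; push_cast; ring
  refine ⟨_, h, ?_, ?_, ?_⟩
  · exact re_pos_of_add_mul (by positivity) (by positivity) hs ht
  · exact re_pos_of_add_mul (x := y) (y := x) (by positivity) (by positivity)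
      ((add_comm _ _).trans hs) ((mul_comm _ _).trans ht)
  · simpa using hn

/-- Under the subcharacteristic condition there are no purely imaginary eigenvalues. -/
theorem IsCharRoots.re_ne_zero {c b : ℝ} (hc : c ≠ 0) (hb : |b| ≤ |c|) {l : ℂ} (hl : 0 ≤ l.re)
    (hl0 : l ≠ 0) {m : Fin 3 → ℂ} (h : IsCharRoots c b l m) (i : Fin 3) : (m i).re ≠ 0 := by
  intro h0
  have h1 := h.eval i
  obtain ⟨ξ, hξ⟩ : ∃ ξ : ℝ, m i = ξ * Complex.I := ⟨(m i).im, by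
    apply Complex.ext <;> simp [h0]⟩
  -- The shift l - icξ = x + iy removes the motion of the frame. The cubic at iξ becomes a quadratic
  -- dispersion relation whose imaginary part is y (2x + 1 + ξ²) = -bξ.
  obtain ⟨x, y, hxy⟩ : ∃ x y : ℝ, l = (x : ℂ) + (y + c * ξ) * Complex.I :=
    ⟨l.re, l.im - c * ξ, by apply Complex.ext <;> simp⟩
  have hx : 0 ≤ x := by rw [hxy] at hl; simpa using hl
  rw [hξ] at h1
  have h2 : (l - c * ξ * Complex.I) ^ 2 + (1 + ξ ^ 2) * (l - c * ξ * Complex.I) + c ^ 2 * ξ ^ 2 +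
      b * ξ * Complex.I = 0 := by
    linear_combination h1 + (-(c : ℂ) * ξ ^ 3 * Complex.I + l * ξ ^ 2 + c ^ 2 * ξ ^ 2)
      * Complex.I_sq
  have h3 : l - c * ξ * Complex.I = x + y * Complex.I := by rw [hxy]; ring
  rw [h3] at h2
  have hre := congrArg Complex.re h2
  have him := congrArg Complex.im h2
  simp [pow_two] at hre him
  have hb2 : b ^ 2 ≤ c ^ 2 := sq_le_sq.2 hb
  by_cases hξ0 : ξ = 0
  · subst hξ0
    simp at hre him
    have hy : y * (2 * x + 1) = 0 := by linarith
    rcases mul_eq_zero.1 hy with h | h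
    · subst h
      have : x * (x + 1) = 0 := by linarith
      rcases mul_eq_zero.1 this with h | h
      · subst h; apply hl0; rw [hxy]; simp
      · linarith
    · linarith
  · have hξp : 0 < ξ ^ 2 := by positivity
    have h4 : y * (2 * x + 1 + ξ ^ 2) = -(b * ξ) := by linarith
    have h5 : y ^ 2 * (2 * x + 1 + ξ ^ 2) ^ 2 = b ^ 2 * ξ ^ 2 := by
      rw [← mul_pow, h4]; ring
    have h6 : y ^ 2 = x ^ 2 + (1 + ξ ^ 2) * x + c ^ 2 * ξ ^ 2 := by linarith
    -- The real part gives y² ≥ c²ξ² > 0. The imaginary part, with a factor 2x + 1 + ξ² > 1, gives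
    -- y² < b²ξ². This contradicts |b| ≤ |c|.
    have h7 : c ^ 2 * ξ ^ 2 ≤ y ^ 2 := by rw [h6]; nlinarith [mul_nonneg hξp.le hx]
    have hc2 : 0 < c ^ 2 * ξ ^ 2 := by positivity
    have h8 : 1 < (2 * x + 1 + ξ ^ 2) ^ 2 := by nlinarith
    have h9 : b ^ 2 * ξ ^ 2 ≤ c ^ 2 * ξ ^ 2 := by gcongr
    nlinarith

/-- Cauchy's bound for the roots; it confines the root lists to a compact ball along the path used
in `exists_split_roots_complex`. -/
theorem IsCharRoots.norm_le {c b : ℝ} (hc : c ≠ 0) {l : ℂ} {m : Fin 3 → ℂ}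
    (h : IsCharRoots c b l m) {B : ℝ} (hB : ‖l‖ + ‖(b - c - 2 * c * l : ℂ)‖ + ‖l * (l + 1)‖ ≤ B) :
    m ∈ Metric.closedBall (0 : Fin 3 → ℂ) (1 + B / |c|) := by
  have hB0 : 0 ≤ B := le_trans (by positivity) hB
  have hcp : 0 < |c| := abs_pos.2 hc
  rw [mem_closedBall_zero_iff, pi_norm_le_iff_of_nonneg (by positivity)]
  intro i
  by_contra! hlt
  have h1 : 1 ≤ ‖m i‖ := by
    have : 0 ≤ B / |c| := by positivity
    linarith
  have h2 : (c : ℂ) * m i ^ 3 = l * m i ^ 2 + -(b - c - 2 * c * l) * m i + -(l * (l + 1)) := by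
    linear_combination h.eval i
  have h3 : |c| * ‖m i‖ ^ 3 ≤ B * ‖m i‖ ^ 2 := by
    calc |c| * ‖m i‖ ^ 3 = ‖(c : ℂ) * m i ^ 3‖ := by simp
      _ ≤ ‖l‖ * ‖m i‖ ^ 2 + ‖(b - c - 2 * c * l : ℂ)‖ * ‖m i‖ + ‖l * (l + 1)‖ := by
        rw [h2]
        refine (norm_add₃_le).trans ?_
        simp only [norm_mul, norm_neg, norm_pow]
        exact le_rfl
      _ ≤ ‖l‖ * ‖m i‖ ^ 2 + ‖(b - c - 2 * c * l : ℂ)‖ * ‖m i‖ ^ 2 +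
          ‖l * (l + 1)‖ * ‖m i‖ ^ 2 := by
        gcongr
        · nlinarith
        · exact le_mul_of_one_le_right (norm_nonneg _) (one_le_pow₀ h1)
      _ = (‖l‖ + ‖(b - c - 2 * c * l : ℂ)‖ + ‖l * (l + 1)‖) * ‖m i‖ ^ 2 := by ring
      _ ≤ _ := by gcongr
  have h4 : 0 < ‖m i‖ ^ 2 := by positivity
  have h5 : |c| * ‖m i‖ ≤ B := le_of_mul_le_mul_right (by linarith) h4
  have h6 : ‖m i‖ ≤ B / |c| := by rw [le_div_iff₀ hcp]; linarith
  linarith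

theorem IsCharRoots.card_filter_eq {c b : ℝ} (hc : c ≠ 0) {l : ℂ} {m m' : Fin 3 → ℂ}
    (h : IsCharRoots c b l m) (h' : IsCharRoots c b l m') (p : ℂ → Prop) [DecidablePred p] :
    (Finset.univ.filter fun i => p (m i)).card = (Finset.univ.filter fun i => p (m' i)).card := by
  have hc' : (c : ℂ) ≠ 0 := by exact_mod_cast hc
  have h1 : m 0 + m 1 + m 2 = m' 0 + m' 1 + m' 2 :=
    mul_left_cancel₀ hc' (h.sum.trans h'.sum.symm)
  have h2 : m 0 * m 1 + m 0 * m 2 + m 1 * m 2 = m' 0 * m' 1 + m' 0 * m' 2 + m' 1 * m' 2 :=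
    mul_left_cancel₀ hc' (h.pairs.trans h'.pairs.symm)
  have h3 : m 0 * m 1 * m 2 = m' 0 * m' 1 * m' 2 := mul_left_cancel₀ hc' (h.prod.trans h'.prod.symm)
  have hpoly : ∏ i, (Polynomial.X - Polynomial.C (m i)) =
      ∏ i, (Polynomial.X - Polynomial.C (m' i)) := by
    have e1 := congrArg Polynomial.C h1
    have e2 := congrArg Polynomial.C h2
    have e3 := congrArg Polynomial.C h3
    simp only [map_add, map_mul] at e1 e2 e3
    simp only [Fin.prod_univ_three]
    linear_combination -Polynomial.X ^ 2 * e1 + Polynomial.X * e2 - e3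
  have hroots : Finset.univ.val.map m = Finset.univ.val.map m' := by
    have hm : ∀ m : Fin 3 → ℂ, (∏ i, (Polynomial.X - Polynomial.C (m i))).roots =
        Finset.univ.val.map m := fun m => by
      rw [← Polynomial.roots_multiset_prod_X_sub_C (Finset.univ.val.map m), Multiset.map_map]
      rfl
    rw [← hm, ← hm, hpoly]
  have := congrArg (Multiset.countP p) hroots
  rwa [Multiset.countP_map, Multiset.countP_map] at this


/-- Under the subcharacteristic condition the splitting found for positive real spectral
parameters persists in the closed right half-plane except at the origin. -/
theorem exists_split_roots_complex {c b : ℝ} (hc : 0 < c) (hb : |b| ≤ |c|) {l : ℂ} (hl : 0 ≤ l.re)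
    (hl0 : l ≠ 0) :
    ∃ m, IsCharRoots c b l m ∧ 0 < (m 0).re ∧ 0 < (m 1).re ∧ (m 2).re < 0 := by
  -- The segment from l to 1 stays in the closed right half-plane away from the origin, so no root
  -- meets the imaginary axis along it. At 1 the number of roots with positive real part is known.
  let L : ℝ → ℂ := fun t => (1 - t) * l + t
  have hL : Continuous L := by fun_prop
  have hLre : ∀ t ∈ Set.Icc (0 : ℝ) 1, 0 ≤ (L t).re ∧ L t ≠ 0 := by
    intro t ht
    have h1 : (L t).re = (1 - t) * l.re + t := by simp [L]
    have h2 : 0 ≤ (1 - t) * l.re := mul_nonneg (by linarith [ht.2]) hl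
    refine ⟨by rw [h1]; linarith [ht.1], fun h0 => ?_⟩
    rcases ht.1.eq_or_lt with h | h
    · rw [← h] at h0
      simp [L] at h0
      exact hl0 h0
    · rw [h0] at h1
      simp at h1
      linarith
  obtain ⟨B, hB⟩ := (isCompact_Icc (a := (0 : ℝ)) (b := 1)).bddAbove_image
    (f := fun t => ‖L t‖ + ‖(b - c - 2 * c * L t : ℂ)‖ + ‖L t * (L t + 1)‖)
    (by fun_prop : Continuous _).continuousOn
  let Kset : Set (ℝ × (Fin 3 → ℂ)) :=
    Set.Icc (0 : ℝ) 1 ×ˢ Metric.closedBall (0 : Fin 3 → ℂ) (1 + B / |c|)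
  have hK : IsCompact Kset := isCompact_Icc.prod (isCompact_closedBall _ _)
  -- Weak inequalities make `Q P` closed. As real parts never vanish along the segment, they are
  -- strict there and `P` is exactly the set of indices with positive real part.
  let Q : Finset (Fin 3) → Set (ℝ × (Fin 3 → ℂ)) := fun P =>
    {q | IsCharRoots c b (L q.1) q.2 ∧ ∀ i, if i ∈ P then 0 ≤ (q.2 i).re else (q.2 i).re ≤ 0}
  have hQ : ∀ P, IsClosed (Q P) := by
    intro P
    have h1 : Q P = {q | (c : ℂ) * (q.2 0 + q.2 1 + q.2 2) = L q.1} ∩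
        {q | (c : ℂ) * (q.2 0 * q.2 1 + q.2 0 * q.2 2 + q.2 1 * q.2 2) =
          b - c - 2 * c * L q.1} ∩
        {q | (c : ℂ) * (q.2 0 * q.2 1 * q.2 2) = -(L q.1 * (L q.1 + 1))} ∩
        ⋂ i, {q | if i ∈ P then 0 ≤ (q.2 i).re else (q.2 i).re ≤ 0} := by
      ext q
      simp only [Q, Set.mem_ofPred_eq, Set.mem_inter_iff, Set.mem_iInter]
      exact ⟨fun h => ⟨⟨⟨h.1.sum, h.1.pairs⟩, h.1.prod⟩, h.2⟩,
        fun h => ⟨⟨h.1.1.1, h.1.1.2, h.1.2⟩, h.2⟩⟩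
    rw [h1]
    refine (((isClosed_eq (by fun_prop) (by fun_prop)).inter
      (isClosed_eq (by fun_prop) (by fun_prop))).inter
      (isClosed_eq (by fun_prop) (by fun_prop))).inter (isClosed_iInter fun i => ?_)
    by_cases hi : i ∈ P
    · simp only [hi, if_true]
      exact isClosed_le (by fun_prop) (by fun_prop)
    · simp only [hi, if_false]
      exact isClosed_le (by fun_prop) (by fun_prop)
  let S : Finset (Fin 3) → Set ℝ := fun P => Prod.fst '' (Kset ∩ Q P)
  have hS : ∀ P, IsClosed (S P) := fun P =>
    ((hK.inter_right (hQ P)).image continuous_fst).isClosed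
  have hmem : ∀ t ∈ Set.Icc (0 : ℝ) 1, ∀ m, IsCharRoots c b (L t) m →
      t ∈ S (Finset.univ.filter fun i => 0 < (m i).re) := by
    intro t ht m hm
    refine ⟨(t, m), ⟨⟨ht, hm.norm_le hc.ne' (hB ⟨t, ht, rfl⟩)⟩, hm, fun i => ?_⟩, rfl⟩
    by_cases hi : 0 < (m i).re
    · simp [hi, hi.le]
    · simp [hi, not_lt.1 hi]
  have hcard : ∀ t ∈ Set.Icc (0 : ℝ) 1, ∀ P, t ∈ S P → ∃ m, IsCharRoots c b (L t) m ∧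
      P = Finset.univ.filter fun i => 0 < (m i).re := by
    rintro t ht P ⟨⟨t', m⟩, ⟨-, hm, hP⟩, rfl⟩
    refine ⟨m, hm, ?_⟩
    ext i
    have h1 := hP i
    have h2 := hm.re_ne_zero hc.ne' hb (hLre _ ht).1 (hLre _ ht).2 i
    by_cases hi : i ∈ P
    · simp only [hi, if_true] at h1
      simpa [hi] using lt_of_le_of_ne h1 h2.symm
    · simp only [hi, if_false] at h1
      simpa [hi] using h1
  have hclosed : ∀ F : Finset (Finset (Fin 3)), IsClosed (⋃ P ∈ F, S P) := fun F =>
    Set.Finite.isClosed_biUnion F.finite_toSet fun P _ => hS P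
  -- The parameters with two positive real parts and those with another number form two closed sets
  -- covering [0, 1]. A common parameter would give two root lists of one cubic with different
  -- counts, so connectedness decides.
  have key : (0 : ℝ) ∈ ⋃ P ∈ Finset.univ.filter (fun P : Finset (Fin 3) => P.card = 2), S P := by
    by_contra hnot
    have hcov : ∀ t ∈ Set.Icc (0 : ℝ) 1, ∃ P, t ∈ S P := fun t ht => by
      obtain ⟨m, hm⟩ := exists_isCharRoots hc.ne' b (L t)
      exact ⟨_, hmem t ht m hm⟩
    obtain ⟨t, ht, ht1, ht2⟩ := isPreconnected_closed_iff.1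
      (isPreconnected_Icc (a := (0 : ℝ)) (b := 1)) _ _
      (hclosed (Finset.univ.filter fun P : Finset (Fin 3) => P.card = 2))
      (hclosed (Finset.univ.filter fun P : Finset (Fin 3) => P.card ≠ 2))
      (fun t ht => by
        obtain ⟨P, hP⟩ := hcov t ht
        by_cases hcP : P.card = 2
        · exact Or.inl (Set.mem_biUnion (by simpa using hcP) hP)
        · exact Or.inr (Set.mem_biUnion (by simpa using hcP) hP))
      ⟨1, by simp, by
        obtain ⟨m, hm, h0, h1, h2⟩ := exists_split_roots_real hc b one_pos
        have hL1 : L 1 = (1 : ℝ) := by simp [L]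
        refine Set.mem_biUnion ?_ (hmem 1 (by simp) m (hL1 ▸ hm))
        have : (Finset.univ.filter fun i => 0 < (m i).re) = {0, 1} := by
          ext i
          fin_cases i <;> simp [h0, h1, h2.le]
        simp [this]⟩
      ⟨0, by simp, by
        obtain ⟨P, hP⟩ := hcov 0 (by simp)
        refine Set.mem_biUnion ?_ hP
        by_contra hcP
        exact hnot (Set.mem_biUnion (by simpa using hcP) hP)⟩
    obtain ⟨P, hP2, hP⟩ := Set.mem_iUnion₂.1 ht1
    obtain ⟨P', hP2', hP'⟩ := Set.mem_iUnion₂.1 ht2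
    obtain ⟨m, hm, rfl⟩ := hcard t ht P hP
    obtain ⟨m', hm', rfl⟩ := hcard t ht P' hP'
    have := hm.card_filter_eq hc.ne' hm' fun z => 0 < z.re
    simp only [Finset.mem_filter, Finset.mem_univ, true_and] at hP2 hP2'
    exact hP2' (this ▸ hP2)
  obtain ⟨P, hP2, hP⟩ := Set.mem_iUnion₂.1 key
  obtain ⟨m, hm, hPm⟩ := hcard 0 (by simp) P hP
  have hL0 : L 0 = l := by simp [L]
  rw [hL0] at hm
  have hpos : ∀ i, 0 < (m i).re ↔ i ∈ P := fun i => by simp [hPm]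
  have hneg : ∀ i, i ∉ P → (m i).re < 0 := fun i hi =>
    lt_of_le_of_ne (not_lt.1 fun h => hi ((hpos i).1 h)) (hm.re_ne_zero hc.ne' hb hl hl0 i)
  simp only [Finset.mem_filter, Finset.mem_univ, true_and] at hP2
  have hcases : P = {0, 1} ∨ P = {0, 2} ∨ P = {1, 2} := by
    clear * - hP2
    revert hP2; revert P; decide
  have h1 := hm.sum
  have h2 := hm.pairs
  have h3 := hm.prod
  rcases hcases with h | h | h
  · exact ⟨m, hm, (hpos 0).2 (by simp [h]), (hpos 1).2 (by simp [h]), hneg 2 (by simp [h])⟩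
  · refine ⟨![m 0, m 2, m 1], ⟨?_, ?_, ?_⟩, (hpos 0).2 (by simp [h]), (hpos 2).2 (by simp [h]),
      hneg 1 (by simp [h])⟩ <;> simp only [Matrix.cons_val]
    · linear_combination h1
    · linear_combination h2
    · linear_combination h3
  · refine ⟨![m 1, m 2, m 0], ⟨?_, ?_, ?_⟩, (hpos 1).2 (by simp [h]), (hpos 2).2 (by simp [h]),
      hneg 0 (by simp [h])⟩ <;> simp only [Matrix.cons_val]
    · linear_combination h1
    · linear_combination h2
    · linear_combination h3

/-! ### The limiting matrix in block form -/

theorem evansMatrix_eq {cs c : ℝ} (hc : c ≠ 0) (h : cs ^ 2 = c ^ 2) (β : ℝ) (l : ℂ) :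
    evansMatrix cs c β l = !![l / c, 0, -1 / c; 0, 0, 1; β - c * l, l + 1, 0] := by
  have hc' : (c : ℂ) ≠ 0 := by exact_mod_cast hc
  have h' : (cs : ℂ) ^ 2 = c ^ 2 := by exact_mod_cast h
  have h1 : -(cs : ℂ) ^ 2 * l / c + β = β - c * l := by rw [h']; field_simp; ring
  have h2 : (cs : ℂ) ^ 2 / c - c = 0 := by rw [h']; field_simp; ring
  rw [evansMatrix, h1, h2]

theorem exists_inverse_of_det_ne_zero {V : Matrix (Fin 3) (Fin 3) ℂ} (h : V.det ≠ 0) :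
    ∃ V', V * V' = 1 ∧ V' * V = 1 :=
  ⟨V⁻¹, Matrix.mul_nonsing_inv _ (Ne.isUnit h), Matrix.nonsing_inv_mul _ (Ne.isUnit h)⟩

/-- The limiting matrix is conjugate to an arbitrarily small triangular perturbation of a diagonal
matrix. -/
theorem exists_conj_evansMatrix {cs c b : ℝ} (hc : c ≠ 0) (h : cs ^ 2 = c ^ 2) {l : ℂ}
    (hl : l ≠ -1) {m : Fin 3 → ℂ} (hm : IsCharRoots c b l m) (h20 : m 2 - m 0 ≠ 0)
    (h21 : m 2 - m 1 ≠ 0) {δ : ℝ} (hδ : 0 < δ) :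
    ∃ V V' : Matrix (Fin 3) (Fin 3) ℂ, V * V' = 1 ∧ V' * V = 1 ∧
      evansMatrix cs c b l * V = V * (Matrix.diagonal m + !![0, (δ : ℂ), 0; 0, 0, 0; 0, 0, 0]) := by
  have hc' : (c : ℂ) ≠ 0 := by exact_mod_cast hc
  have hl' : l + 1 ≠ 0 := fun h => hl (eq_neg_of_add_eq_zero_left h)
  have hδ' : (δ : ℂ) ≠ 0 := by exact_mod_cast hδ.ne'
  have e1 := hm.sum
  have e2 := hm.pairs
  have e3 := hm.prod
  have r0 := hm.eval 0
  have r2 := hm.eval 2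
  -- `v z` is the eigenvector for a root z. The middle column of `V` is δ times the divided
  -- difference of v at m 0 and m 1, simplified by c (m 0 + m 1 + m 2) = l; it therefore remains
  -- valid in the Jordan case m 0 = m 1.
  let v : ℂ → Fin 3 → ℂ := fun z => ![l + 1, -c * z ^ 2 + l * z - b + c * l, (l + 1) * (l - c * z)]
  let V : Matrix (Fin 3) (Fin 3) ℂ :=
    !![v (m 0) 0, 0, v (m 2) 0;
       v (m 0) 1, δ * (c * m 2), v (m 2) 1;
       v (m 0) 2, -(δ * (c * (l + 1))), v (m 2) 2]
  have hdet : V.det ≠ 0 := by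
    have : V.det = δ * (l + 1) ^ 2 * c ^ 2 * ((m 2 - m 0) * (m 2 - m 1)) * (-1) := by
      rw [Matrix.det_fin_three]
      simp only [V, v, Matrix.of_apply, Matrix.cons_val]
      linear_combination -(δ * c * (l + 1) ^ 2 * (m 2 - m 0)) * e1
    rw [this]
    simp only [ne_eq, mul_eq_zero, not_or, pow_eq_zero_iff, two_ne_zero, not_false_eq_true,
      neg_eq_zero, one_ne_zero, and_true]
    exact ⟨⟨⟨hδ', hl'⟩, hc'⟩, h20, h21⟩
  obtain ⟨V', hV1, hV2⟩ := exists_inverse_of_det_ne_zero hdet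
  refine ⟨V, V', hV1, hV2, ?_⟩
  rw [evansMatrix_eq hc h]
  ext i j
  rw [Matrix.mul_apply, Matrix.mul_apply, Fin.sum_univ_three, Fin.sum_univ_three]
  fin_cases i <;> fin_cases j <;>
    simp [V, v, Matrix.diagonal] <;> field_simp
  · ring
  · ring
  · linear_combination r0
  · linear_combination m 0 * e1 - e2
  · linear_combination r2
  · ring
  · linear_combination e1
  · ring

theorem hyperbolicForm_two {cs c b : ℝ} (hc : c ≠ 0) (h : cs ^ 2 = c ^ 2) {l : ℂ} (hl : l ≠ -1)
    {m : Fin 3 → ℂ} (hm : IsCharRoots c b l m) (h0 : 0 < (m 0).re) (h1 : 0 < (m 1).re)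
    (h2 : (m 2).re < 0) : HyperbolicForm (evansMatrix cs c b l) 2 m := by
  intro δ hδ
  obtain ⟨V, V', hV1, hV2, hV⟩ := exists_conj_evansMatrix hc h hl hm
    (fun h => by have := congrArg Complex.re h; simp at this; linarith)
    (fun h => by have := congrArg Complex.re h; simp at this; linarith) hδ
  refine ⟨V, V', _, ?_, ?_, hV1, hV2, hV, ?_, ?_⟩
  · intro j hj; fin_cases j <;> simp_all
  · intro j hj; fin_cases j <;> simp_all
  · intro i j
    fin_cases i <;> fin_cases j <;> simp [abs_of_pos hδ, hδ.le]
  · intro i j hij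
    fin_cases i <;> fin_cases j <;> simp_all

theorem hyperbolicForm_one {cs c b : ℝ} (hc : c ≠ 0) (h : cs ^ 2 = c ^ 2) {l : ℂ} (hl : l ≠ -1)
    {m : Fin 3 → ℂ} (hm : IsCharRoots c b l m) (h0 : (m 0).re < 0) (h1 : (m 1).re < 0)
    (h2 : 0 < (m 2).re) : HyperbolicForm (evansMatrix cs c b l) 1 ![m 2, m 0, m 1] := by
  intro δ hδ
  obtain ⟨V, V', hV1, hV2, hV⟩ := exists_conj_evansMatrix hc h hl hm
    (fun h => by have := congrArg Complex.re h; simp at this; linarith)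
    (fun h => by have := congrArg Complex.re h; simp at this; linarith) hδ
  -- The permutation moves the single growing root to the front. The coupling of m 0 with m 1 then
  -- sits in position (1, 2), inside the decaying block.
  let σ : Fin 3 ≃ Fin 3 := ⟨![2, 0, 1], ![1, 2, 0], by decide, by decide⟩
  refine ⟨V.submatrix id σ, V'.submatrix σ id, !![0, 0, 0; 0, 0, (δ : ℂ); 0, 0, 0],
    ?_, ?_, ?_, ?_, ?_, ?_, ?_⟩
  · intro j hj; fin_cases j <;> simp_all
  · intro j hj; fin_cases j <;> simp_all
  · rw [Matrix.submatrix_mul_equiv, hV1]; rfl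
  · rw [← Matrix.submatrix_mul V' V σ id σ Function.bijective_id, hV2, Matrix.submatrix_one_equiv]
  · have h1 : evansMatrix cs c b l * V.submatrix id σ =
        (evansMatrix cs c b l * V).submatrix id σ := by
      ext i j; simp [Matrix.mul_apply]
    have h2 : Matrix.diagonal ![m 2, m 0, m 1] + !![0, 0, 0; 0, 0, (δ : ℂ); 0, 0, 0] =
        (Matrix.diagonal m + !![0, (δ : ℂ), 0; 0, 0, 0; 0, 0, 0]).submatrix σ σ := by
      ext i j
      simp only [Matrix.submatrix_apply, Matrix.add_apply, Matrix.diagonal_apply]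
      fin_cases i <;> fin_cases j <;> simp [σ]
    rw [h1, hV, h2, Matrix.submatrix_mul_equiv]
  · intro i j
    fin_cases i <;> fin_cases j <;> simp [abs_of_pos hδ, hδ.le]
  · intro i j hij
    fin_cases i <;> fin_cases j <;> simp_all

/-- The number of growing modes of the eigenvalue equation. -/
noncomputable def growingModes (c : ℝ) : ℕ := if 0 < c then 2 else 1

theorem growingModes_le (c : ℝ) : growingModes c ≤ 3 := by
  unfold growingModes; split_ifs <;> norm_num

theorem exists_hyperbolicForm_of_split {cs c b : ℝ} (hc : c ≠ 0) (h : cs ^ 2 = c ^ 2) {l : ℂ}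
    (hl : l ≠ -1)
    (hpos : 0 < c → ∃ m, IsCharRoots c b l m ∧ 0 < (m 0).re ∧ 0 < (m 1).re ∧ (m 2).re < 0)
    (hneg : 0 < -c → ∃ m, IsCharRoots (-c) (-b) l m ∧ 0 < (m 0).re ∧ 0 < (m 1).re ∧ (m 2).re < 0) :
    ∃ d, HyperbolicForm (evansMatrix cs c b l) (growingModes c) d := by
  rcases hc.lt_or_gt with hc0 | hc0
  · obtain ⟨m, hm, h0, h1, h2⟩ := hneg (by linarith)
    have hm' := hm.neg
    rw [neg_neg, neg_neg] at hm'
    rw [growingModes, if_neg hc0.not_gt]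
    exact ⟨_, hyperbolicForm_one hc h hl hm' (by simpa using h0) (by simpa using h1)
      (by simpa using h2)⟩
  · obtain ⟨m, hm, h0, h1, h2⟩ := hpos hc0
    rw [growingModes, if_pos hc0]
    exact ⟨_, hyperbolicForm_two hc h hl hm h0 h1 h2⟩

theorem exists_hyperbolicForm_real {cs c b : ℝ} (hc : c ≠ 0) (h : cs ^ 2 = c ^ 2) {r : ℝ}
    (hr : 0 < r) : ∃ d, HyperbolicForm (evansMatrix cs c b r) (growingModes c) d :=
  exists_hyperbolicForm_of_split hc h
    (fun h => by have := congrArg Complex.re h; simp at this; linarith)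
    (fun hc0 => exists_split_roots_real hc0 b hr) (fun hc0 => exists_split_roots_real hc0 (-b) hr)

theorem exists_hyperbolicForm_complex {cs c b : ℝ} (hc : c ≠ 0) (h : cs ^ 2 = c ^ 2)
    (hb : |b| ≤ |c|) {l : ℂ} (hl : 0 ≤ l.re) (hl0 : l ≠ 0) :
    ∃ d, HyperbolicForm (evansMatrix cs c b l) (growingModes c) d :=
  exists_hyperbolicForm_of_split hc h
    (fun h => by have := congrArg Complex.re h; simp at this; linarith)
    (fun hc0 => exists_split_roots_complex hc0 hb hl hl0)
    (fun hc0 => exists_split_roots_complex hc0 (by simpa using hb) hl hl0)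

theorem eventually_isHyperbolicSplitting {cs c : ℝ} (b : ℝ) (hc : c ≠ 0) (h : cs ^ 2 = c ^ 2) :
    ∀ᶠ r : ℝ in atTop, IsHyperbolicSplitting (evansMatrix cs c b r) (growingModes c) := by
  filter_upwards [eventually_gt_atTop 0] with r hr
  obtain ⟨d, hd⟩ := exists_hyperbolicForm_real (b := b) hc h hr
  obtain ⟨V, V', N, hV⟩ := hd 1 one_pos
  exact hV.isHyperbolicSplitting (growingModes_le c)

end JinXin

namespace JinXin

/-! ### Stable solutions depending on a parameter -/

section StableFamily

variable {E F : Type*} [NormedAddCommGroup E] [NormedSpace ℝ E]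
  [NormedAddCommGroup F] [InnerProductSpace ℝ F]

/-- Backward growth estimate for perturbations of a system with a Lyapunov function. -/
theorem lyapunov_growth {L : E →L[ℝ] F} {N : E →L[ℝ] E} {k₁ k₂ : ℝ}
    (hk₁ : ∀ w, ‖w‖ ≤ k₁ * ‖L w‖) (hk₂ : ∀ w, ‖L w‖ ≤ k₂ * ‖w‖) (hk₂0 : 0 ≤ k₂) (hk₁0 : 0 ≤ k₁)
    (hN : ∀ w, 0 ≤ inner ℝ (L w) (L (N w))) {z f : ℝ → E} {ε κ m : ℝ} (hε : 0 ≤ ε) (hκ : 0 < κ)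
    (hz : ∀ x, HasDerivAt z (N (z x) + f x) x)
    (hf : ∀ x, 0 ≤ x → ‖f x‖ ≤ ε * Real.exp (-κ * x) * (‖z x‖ + m)) {x X : ℝ} (hx : 0 ≤ x)
    (hxX : x ≤ X) :
    ‖L (z x)‖ ^ 2 + m ^ 2 ≤
      (‖L (z X)‖ ^ 2 + m ^ 2) * Real.exp (2 * k₂ * ε * (k₁ + 1) / κ * Real.exp (-κ * x)) := by
  set K := 2 * k₂ * ε * (k₁ + 1) with hK
  have hK0 : 0 ≤ K := by positivity
  -- Adding m² absorbs the inhomogeneous part of the bound on f, so that P' ≥ -K exp(-κx) P closes.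
  let P : ℝ → ℝ := fun x => ‖L (z x)‖ ^ 2 + m ^ 2
  have hP : ∀ x, HasDerivAt P (2 * inner ℝ (L (z x)) (L (N (z x) + f x))) x := fun x => by
    have := ((L.hasFDerivAt.comp_hasDerivAt x (hz x)).norm_sq).add_const (m ^ 2)
    exact this
  have hPge : ∀ x, 0 ≤ x → -(K * Real.exp (-κ * x)) * P x ≤
      2 * inner ℝ (L (z x)) (L (N (z x) + f x)) := by
    intro x hx
    have h1 : |inner ℝ (L (z x)) (L (f x))| ≤
        ‖L (z x)‖ * (k₂ * (ε * Real.exp (-κ * x) * (k₁ * ‖L (z x)‖ + m))) := by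
      refine (abs_real_inner_le_norm _ _).trans ?_
      gcongr
      refine (hk₂ _).trans ?_
      gcongr
      refine (hf x hx).trans ?_
      gcongr
      exact hk₁ _
    have h2 : ‖L (z x)‖ * (k₁ * ‖L (z x)‖ + m) ≤ (k₁ + 1) * P x := by
      have : ‖L (z x)‖ * m ≤ P x := by
        simp only [P]; nlinarith [sq_nonneg (‖L (z x)‖ - m), sq_nonneg ‖L (z x)‖, sq_nonneg m]
      have h3 : k₁ * ‖L (z x)‖ ^ 2 ≤ k₁ * P x := by
        simp only [P]; gcongr; nlinarith [sq_nonneg m]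
      nlinarith
    have h3 : 2 * (‖L (z x)‖ * (k₂ * (ε * Real.exp (-κ * x) * (k₁ * ‖L (z x)‖ + m)))) ≤
        K * Real.exp (-κ * x) * P x := by
      have h4 : 0 ≤ 2 * k₂ * ε * Real.exp (-κ * x) := by positivity
      have := mul_le_mul_of_nonneg_left h2 h4
      simp only [hK]
      nlinarith
    have h5 := neg_abs_le (inner ℝ (L (z x)) (L (f x)))
    rw [map_add, inner_add_right]
    have h6 := hN (z x)
    linarith
  -- Integrating factor for the differential inequality. Since exp(-κx) is integrable at +∞, the
  -- factor stays bounded and the resulting estimate does not deteriorate with X.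
  let G : ℝ → ℝ := fun x => P x * Real.exp (-(K / κ * Real.exp (-κ * x)))
  have hG : ∀ x, HasDerivAt G ((2 * inner ℝ (L (z x)) (L (N (z x) + f x)) +
      K * Real.exp (-κ * x) * P x) * Real.exp (-(K / κ * Real.exp (-κ * x)))) x := by
    intro x
    have h1 : HasDerivAt (fun x => -(K / κ * Real.exp (-κ * x))) (K * Real.exp (-κ * x)) x := by
      have := ((((hasDerivAt_id x).const_mul (-κ)).exp).const_mul (K / κ)).neg
      refine this.congr_deriv ?_
      simp only [id]
      field_simp
    refine ((hP x).mul h1.exp).congr_deriv ?_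
    ring
  have hmono : MonotoneOn G (Set.Ici 0) := by
    refine monotoneOn_of_deriv_nonneg (convex_Ici 0)
      (fun x _ => (hG x).continuousAt.continuousWithinAt)
      (fun x _ => (hG x).differentiableAt.differentiableWithinAt) fun x hx => ?_
    rw [interior_Ici] at hx
    rw [(hG x).deriv]
    refine mul_nonneg ?_ (Real.exp_pos _).le
    linarith [hPge x (le_of_lt hx)]
  have h1 : G x ≤ G X := hmono hx (hx.trans hxX : (0 : ℝ) ≤ X) hxX
  have h2 : G X ≤ P X := by
    refine mul_le_of_le_one_right (by simp only [P]; positivity) ?_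
    rw [Real.exp_le_one_iff]
    have : 0 ≤ K / κ * Real.exp (-κ * X) := by positivity
    linarith
  calc P x = G x * Real.exp (K / κ * Real.exp (-κ * x)) := by
        simp only [G]; rw [mul_assoc, ← Real.exp_add]; simp
    _ ≤ P X * Real.exp (K / κ * Real.exp (-κ * x)) := by
        gcongr; exact h1.trans h2

/-- Continuous dependence of solutions of linear equations on a parameter. -/
theorem continuousOn_linear_ode {S : Set ℝ} {A : ℝ → ℝ → E →L[ℝ] E} {K : ℝ}
    (hK : ∀ l ∈ S, ∀ x, ‖A l x‖ ≤ K)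
    (hA : ∀ l₀ ∈ S, ∀ ε > 0, ∀ᶠ l in 𝓝[S] l₀, ∀ x, ‖A l x - A l₀ x‖ ≤ ε)
    {W : ℝ → ℝ → E} (hW : ∀ l ∈ S, ∀ x, HasDerivAt (W l) (A l x (W l x)) x) {x₀ : ℝ}
    (h₀ : ContinuousOn (fun l => W l x₀) S) (x : ℝ) : ContinuousOn (fun l => W l x) S := by
  intro l₀ hl₀
  have hcont : Continuous (W l₀) :=
    continuous_iff_continuousAt.2 fun x => (hW l₀ hl₀ x).continuousAt
  obtain ⟨B, hB⟩ := (isCompact_closedBall x₀ |x - x₀|).exists_bound_of_continuousOn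
    hcont.continuousOn
  have hB0 : 0 ≤ B := (norm_nonneg _).trans (hB x₀ (Metric.mem_closedBall_self (abs_nonneg _)))
  rw [ContinuousWithinAt, tendsto_iff_norm_sub_tendsto_zero]
  have hlim : Tendsto (fun ε : ℝ => gronwallBound ε K (ε * B) |x - x₀|) (𝓝 0) (𝓝 0) := by
    have hc : Continuous fun ε : ℝ => gronwallBound ε K (ε * B) |x - x₀| := by
      by_cases hK0 : K = 0
      · subst hK0
        simp only [gronwallBound_K0]
        fun_prop
      · simp only [gronwallBound_of_K_ne_0 hK0]
        fun_prop
    have := hc.tendsto 0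
    simpa [gronwallBound_ε0_δ0] using this
  rw [Metric.tendsto_nhds]
  intro η hη
  obtain ⟨ε, hε0, hε⟩ := ((hlim.eventually_lt_const hη).filter_mono nhdsWithin_le_nhds).and
    (self_mem_nhdsWithin (s := Set.Ioi (0 : ℝ))) |>.exists
  have h1 := (tendsto_iff_norm_sub_tendsto_zero.1 (h₀ l₀ hl₀)).eventually_le_const
    (show (0 : ℝ) < ε from hε)
  filter_upwards [h1, hA l₀ hl₀ ε hε, self_mem_nhdsWithin] with l hl1 hl2 hlS
  have := norm_le_gronwallBound_abs (d := fun x => W l x - W l₀ x)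
    (d' := fun x => A l x (W l x) - A l₀ x (W l₀ x)) (x₀ := x₀) (K := K) (ε := ε * B)
    (R := |x - x₀|) (δ := ε)
    (fun x => (hW l hlS x).sub (hW l₀ hl₀ x)) hl1 (fun y hy => by
      have h3 : A l y (W l y) - A l₀ y (W l₀ y) =
          A l y (W l y - W l₀ y) + (A l y - A l₀ y) (W l₀ y) := by
        simp
      rw [h3]
      refine (norm_add_le _ _).trans (add_le_add ?_ ?_)
      · exact ((A l y).le_opNorm _).trans (by gcongr; exact hK l hlS y)
      · refine ((A l y - A l₀ y).le_opNorm _).trans ?_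
        gcongr
        · exact hl2 y
        · exact hB y (by rwa [Metric.mem_closedBall, Real.dist_eq])) (x := x) le_rfl
  rw [dist_zero_right, norm_norm]
  exact this.trans_lt hε0

theorem exp_sub_one_le_mul {K t : ℝ} (hK : 0 ≤ K) (ht0 : 0 ≤ t) (ht1 : t ≤ 1) :
    Real.exp (K * t) ≤ 1 + K * Real.exp K * t := by
  have h1 := Real.add_one_le_exp (-(K * t))
  have h2 : Real.exp (K * t) * Real.exp (-(K * t)) = 1 := by rw [← Real.exp_add]; simp
  have h3 : Real.exp (K * t) ≤ Real.exp K := Real.exp_le_exp.2 (by nlinarith)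
  have h4 : Real.exp (K * t) * (1 - K * t) ≤ 1 := by
    rw [← h2]
    exact mul_le_mul_of_nonneg_left (by linarith) (Real.exp_pos _).le
  have h5 : K * t * Real.exp (K * t) ≤ K * t * Real.exp K := by gcongr
  nlinarith

/-- Solutions of `w' = (N + β R) w` tending to a given equilibrium of `N` at `+∞`, depending
continuously on a parameter. -/
theorem exists_stable_family [CompleteSpace E] {S : Set ℝ} {N R : ℝ → E →L[ℝ] E}
    {L : ℝ → E →L[ℝ] F} {β : ℝ → ℝ} {k₁ k₂ B C κ : ℝ} {v : E} (hk₁0 : 0 ≤ k₁) (hk₂0 : 0 ≤ k₂)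
    (hk₁ : ∀ l ∈ S, ∀ w, ‖w‖ ≤ k₁ * ‖L l w‖) (hk₂ : ∀ l ∈ S, ∀ w, ‖L l w‖ ≤ k₂ * ‖w‖)
    (hN : ∀ l ∈ S, ∀ w, 0 ≤ inner ℝ (L l w) (L l (N l w))) (hv : ∀ l ∈ S, N l v = 0)
    (hNc : ContinuousOn N S) (hRc : ContinuousOn R S) (hB0 : 0 ≤ B) (hNB : ∀ l ∈ S, ‖N l‖ ≤ B)
    (hRB : ∀ l ∈ S, ‖R l‖ ≤ B) (hβ : Continuous β) (hβB : ∀ x, |β x| ≤ B) (hκ : 0 < κ)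
    (hβC : ∀ x, 0 ≤ x → |β x| ≤ C * Real.exp (-κ * x)) :
    ∃ (W : ℝ → ℝ → E) (K : ℝ),
      (∀ l ∈ S, ∀ x, HasDerivAt (W l) (N l (W l x) + β x • R l (W l x)) x) ∧
      (∀ l ∈ S, ∀ x, 0 ≤ x → ‖W l x - v‖ ≤ K * Real.exp (-(κ / 2) * x)) ∧
      ∀ x, ContinuousOn (fun l => W l x) S := by
  have hC0 : 0 ≤ C := by
    have := (abs_nonneg _).trans (hβC 0 le_rfl)
    simpa using this
  let A : ℝ → ℝ → E →L[ℝ] E := fun l x => N l + β x • R l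
  have hAc : ∀ l, Continuous (A l) := fun l => continuous_const.add (hβ.smul continuous_const)
  have hAK : ∀ l ∈ S, ∀ x, ‖A l x‖ ≤ B + B * B := fun l hl x =>
    (norm_add_le _ _).trans (add_le_add (hNB l hl) (by
      rw [norm_smul]
      exact mul_le_mul (hβB x) (hRB l hl) (norm_nonneg _) hB0))
  have hAunif : ∀ l₀ ∈ S, ∀ ε > 0, ∀ᶠ l in 𝓝[S] l₀, ∀ x, ‖A l x - A l₀ x‖ ≤ ε := by
    intro l₀ hl₀ ε hε
    have h1 := (tendsto_iff_norm_sub_tendsto_zero.1 (hNc l₀ hl₀)).add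
      ((tendsto_iff_norm_sub_tendsto_zero.1 (hRc l₀ hl₀)).const_mul B)
    rw [mul_zero, add_zero] at h1
    filter_upwards [h1.eventually_le_const hε] with l hl x
    have h2 : A l x - A l₀ x = (N l - N l₀) + β x • (R l - R l₀) := by
      simp only [A, smul_sub]; abel
    rw [h2]
    refine (norm_add_le _ _).trans (le_trans (add_le_add le_rfl ?_) hl)
    rw [norm_smul]
    exact mul_le_mul_of_nonneg_right (hβB x) (norm_nonneg _)
  have hsol : ∀ X l : ℝ, ∀ w₀ : E, ∃ W : ℝ → E, l ∈ S →
      W X = w₀ ∧ ∀ x, HasDerivAt W (A l x (W x)) x := by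
    intro X l w₀
    by_cases hl : l ∈ S
    · obtain ⟨W, hW⟩ := exists_linear_ode_solution (hAc l) (hAK l hl) X w₀
      exact ⟨W, fun _ => hW⟩
    · exact ⟨0, fun h => absurd h hl⟩
  -- `Φ X l w₀` is the solution with value w₀ at x = X. The desired family is the limit of `Φ k l v`
  -- as k → ∞.
  choose Φ hΦ using hsol
  set K' := 2 * k₂ * (C * B) * (k₁ + 1) / κ with hK'
  have hK'0 : 0 ≤ K' := by positivity
  let K₁ : ℝ := k₁ * Real.sqrt (‖v‖ ^ 2 * (K' * Real.exp K'))
  let K₂ : ℝ := k₁ * (k₂ * Real.sqrt (Real.exp K'))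
  have hK₁0 : 0 ≤ K₁ := by positivity
  have hK₂0 : 0 ≤ K₂ := by positivity
  -- The difference from v vanishes at X, so the Lyapunov estimate bounds its square by a multiple
  -- of exp(-κx) on [0, X], uniformly in X and l. The square root halves the rate.
  have est1 : ∀ X, ∀ l ∈ S, ∀ x, 0 ≤ x → x ≤ X →
      ‖Φ X l v x - v‖ ≤ K₁ * Real.exp (-(κ / 2) * x) := by
    intro X l hl x hx hxX
    obtain ⟨h0, hd⟩ := hΦ X l v hl
    have hg := lyapunov_growth (z := fun x => Φ X l v x - v) (f := fun x => β x • R l (Φ X l v x))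
      (m := ‖v‖) (ε := C * B) (κ := κ) (hk₁ l hl) (hk₂ l hl) hk₂0 hk₁0 (hN l hl) (by positivity) hκ
      (fun x => ((hd x).sub_const v).congr_deriv (by simp [A, hv l hl]))
      (fun x hx => by
        rw [norm_smul]
        calc ‖β x‖ * ‖R l (Φ X l v x)‖ ≤ (C * Real.exp (-κ * x)) * (B * ‖Φ X l v x‖) := by
              refine mul_le_mul (hβC x hx) ?_ (norm_nonneg _) (by positivity)
              exact ((R l).le_opNorm _).trans (by gcongr; exact hRB l hl)
          _ ≤ (C * Real.exp (-κ * x)) * (B * (‖Φ X l v x - v‖ + ‖v‖)) := by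
              gcongr
              calc ‖Φ X l v x‖ = ‖(Φ X l v x - v) + v‖ := by simp
                _ ≤ _ := norm_add_le _ _
          _ = _ := by ring) hx hxX
    rw [← hK', h0, sub_self, map_zero, norm_zero] at hg
    have hexp := exp_sub_one_le_mul hK'0 (Real.exp_pos (-κ * x)).le
      (Real.exp_le_one_iff.2 (by nlinarith))
    have h1 : ‖L l (Φ X l v x - v)‖ ^ 2 ≤
        ‖v‖ ^ 2 * (K' * Real.exp K') * Real.exp (-κ * x) := by
      have := mul_le_mul_of_nonneg_left hexp (sq_nonneg ‖v‖)
      nlinarith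
    have h2 : ‖L l (Φ X l v x - v)‖ ≤
        Real.sqrt (‖v‖ ^ 2 * (K' * Real.exp K')) * Real.exp (-(κ / 2) * x) := by
      refine abs_le_of_sq_le_sq' ?_ (by positivity) |>.2
      rw [mul_pow, Real.sq_sqrt (by positivity), ← Real.exp_nat_mul]
      rw [show ((2 : ℕ) : ℝ) * (-(κ / 2) * x) = -κ * x by push_cast; ring]
      exact h1
    calc ‖Φ X l v x - v‖ ≤ k₁ * ‖L l (Φ X l v x - v)‖ := hk₁ l hl _
      _ ≤ k₁ * (Real.sqrt (‖v‖ ^ 2 * (K' * Real.exp K')) * Real.exp (-(κ / 2) * x)) := by gcongr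
      _ = _ := by simp only [K₁]; ring
  -- Backward stability of the homogeneous equation, with a constant independent of l and of the
  -- interval.
  have est2 : ∀ l ∈ S, ∀ z : ℝ → E, (∀ x, HasDerivAt z (A l x (z x)) x) → ∀ x X, 0 ≤ x → x ≤ X →
      ‖z x‖ ≤ K₂ * ‖z X‖ := by
    intro l hl z hz x X hx hxX
    have hg := lyapunov_growth (z := z) (f := fun x => β x • R l (z x))
      (m := 0) (ε := C * B) (κ := κ) (hk₁ l hl) (hk₂ l hl) hk₂0 hk₁0 (hN l hl) (by positivity) hκ
      (fun x => (hz x).congr_deriv (by simp [A]))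
      (fun x hx => by
        rw [norm_smul]
        calc ‖β x‖ * ‖R l (z x)‖ ≤ (C * Real.exp (-κ * x)) * (B * ‖z x‖) := by
              refine mul_le_mul (hβC x hx) ?_ (norm_nonneg _) (by positivity)
              exact ((R l).le_opNorm _).trans (by gcongr; exact hRB l hl)
          _ = _ := by ring) hx hxX
    rw [← hK'] at hg
    have h1 : Real.exp (K' * Real.exp (-κ * x)) ≤ Real.exp K' := Real.exp_le_exp.2
      (mul_le_of_le_one_right hK'0 (Real.exp_le_one_iff.2 (by nlinarith)))
    have h2 : ‖L l (z x)‖ ^ 2 ≤ ‖L l (z X)‖ ^ 2 * Real.exp K' := by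
      have := mul_le_mul_of_nonneg_left h1 (sq_nonneg ‖L l (z X)‖)
      simp only [ne_eq, OfNat.ofNat_ne_zero, not_false_eq_true, zero_pow, add_zero] at hg
      linarith
    have h3 : ‖L l (z x)‖ ≤ ‖L l (z X)‖ * Real.sqrt (Real.exp K') := by
      refine abs_le_of_sq_le_sq' ?_ (by positivity) |>.2
      rwa [mul_pow, Real.sq_sqrt (by positivity)]
    calc ‖z x‖ ≤ k₁ * ‖L l (z x)‖ := hk₁ l hl _
      _ ≤ k₁ * ((k₂ * ‖z X‖) * Real.sqrt (Real.exp K')) := by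
        gcongr
        exact h3.trans (by gcongr; exact hk₂ l hl _)
      _ = _ := by simp only [K₂]; ring
  -- At x = j the two solutions differ by the amount in `est1`, and `est2` transports this to x = 0.
  -- The rate is uniform in l, so the limit of the initial values is uniform and continuous in l.
  have hdist : ∀ l ∈ S, ∀ j k : ℕ, j ≤ k →
      dist (Φ j l v 0) (Φ k l v 0) ≤ K₂ * (K₁ * Real.exp (-(κ / 2) * j)) := by
    intro l hl j k hjk
    have hjk' : (j : ℝ) ≤ k := by exact_mod_cast hjk
    have h1 := est2 l hl (fun x => Φ k l v x - Φ j l v x)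
      (fun x => (((hΦ k l v hl).2 x).sub ((hΦ j l v hl).2 x)).congr_deriv (by simp)) 0 j le_rfl
      (Nat.cast_nonneg j)
    rw [dist_comm, dist_eq_norm]
    refine h1.trans ?_
    gcongr
    rw [(hΦ j l v hl).1]
    exact est1 k l hl j (Nat.cast_nonneg j) hjk'
  have hrate : Tendsto (fun j : ℕ => K₂ * (K₁ * Real.exp (-(κ / 2) * j))) atTop (𝓝 0) := by
    have h1 : Tendsto (fun x : ℝ => Real.exp (-(κ / 2) * x)) atTop (𝓝 0) :=
      Real.tendsto_exp_atBot.comp (tendsto_id.const_mul_atTop_of_neg (by linarith))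
    have := ((h1.comp tendsto_natCast_atTop_atTop).const_mul K₁).const_mul K₂
    simpa using this
  have hlim : ∀ l, ∃ w, l ∈ S → Tendsto (fun k : ℕ => Φ k l v 0) atTop (𝓝 w) := by
    intro l
    by_cases hl : l ∈ S
    · obtain ⟨w, hw⟩ := cauchySeq_tendsto_of_complete
        (cauchySeq_of_le_tendsto_0' _ (fun j k hjk => hdist l hl j k hjk) hrate)
      exact ⟨w, fun _ => hw⟩
    · exact ⟨0, fun h => absurd h hl⟩
  choose w hw using hlim
  have hunif : TendstoUniformlyOn (fun (k : ℕ) l => Φ k l v 0) w atTop S := by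
    rw [Metric.tendstoUniformlyOn_iff]
    intro ε hε
    filter_upwards [hrate.eventually_lt_const hε] with j hj l hl
    rw [dist_comm]
    refine lt_of_le_of_lt ?_ hj
    exact le_of_tendsto (tendsto_const_nhds.dist (hw l hl))
      (eventually_atTop.2 ⟨j, fun k hk => hdist l hl j k hk⟩)
  have hwc : ContinuousOn w S := hunif.continuousOn (Frequently.of_forall fun k =>
    continuousOn_linear_ode hAK hAunif (fun l hl x => (hΦ k l v hl).2 x) (x₀ := k)
      (continuousOn_const.congr fun l hl => (hΦ k l v hl).1) 0)
  refine ⟨fun l => Φ 0 l (w l), K₁, fun l hl x => ?_, fun l hl x hx => ?_, fun x => ?_⟩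
  · exact ((hΦ 0 l (w l) hl).2 x).congr_deriv (by simp [A])
  · have hconv : Tendsto (fun k : ℕ => Φ k l v x) atTop (𝓝 (Φ 0 l (w l) x)) := by
      rw [tendsto_iff_norm_sub_tendsto_zero]
      have h1 := (tendsto_iff_norm_sub_tendsto_zero.1 (hw l hl)).mul_const
        (Real.exp ((B + B * B) * |x - 0|))
      rw [zero_mul] at h1
      refine squeeze_zero (fun _ => norm_nonneg _) (fun k => ?_) h1
      have := norm_le_gronwallBound_abs (d := fun x => Φ k l v x - Φ 0 l (w l) x)
        (d' := fun x => A l x (Φ k l v x) - A l x (Φ 0 l (w l) x)) (x₀ := 0) (K := B + B * B)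
        (ε := 0) (R := |x - 0|) (δ := ‖Φ k l v 0 - w l‖)
        (fun x => ((hΦ k l v hl).2 x).sub ((hΦ 0 l (w l) hl).2 x))
        (by rw [(hΦ 0 l (w l) hl).1]) (fun y _ => by
          rw [← map_sub, add_zero]
          exact ((A l y).le_opNorm _).trans (by gcongr; exact hAK l hl y)) (x := x) le_rfl
      rwa [gronwallBound_ε0] at this
    refine le_of_tendsto ((hconv.sub_const v).norm) ?_
    filter_upwards [tendsto_natCast_atTop_atTop.eventually_ge_atTop x] with k hk
    exact est1 k l hl x hx hk
  · exact continuousOn_linear_ode hAK hAunif (fun l hl x => (hΦ 0 l (w l) hl).2 x) (x₀ := 0)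
      (hwc.congr fun l hl => (hΦ 0 l (w l) hl).1) x

end StableFamily

end JinXin

/-! ### The Lyapunov function of the rescaled problem -/

namespace JinXin

/-- The linear combinations whose squares add up to a Lyapunov function of
`diag(0, (n, p; q, S))`. -/
noncomputable def blockLyapunov (n p q S : ℝ) : (Fin 3 → ℝ) →L[ℝ] EuclideanSpace ℝ (Fin 5) :=
  LinearMap.toContinuousLinearMap
    { toFun := fun w => WithLp.toLp 2 ![w 0, Real.sqrt (n * S - p * q) * w 1,
        Real.sqrt (n * S - p * q) * w 2, S * w 1 - p * w 2, n * w 2 - q * w 1]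
      map_add' := fun v w => by
        ext i; fin_cases i <;> simp <;> ring
      map_smul' := fun a w => by
        ext i; fin_cases i <;> simp <;> ring }

theorem blockLyapunov_apply (n p q S : ℝ) (w : Fin 3 → ℝ) :
    blockLyapunov n p q S w = WithLp.toLp 2 ![w 0, Real.sqrt (n * S - p * q) * w 1,
        Real.sqrt (n * S - p * q) * w 2, S * w 1 - p * w 2, n * w 2 - q * w 1] := rfl

theorem norm_le_blockLyapunov {n p q S d : ℝ} (hd0 : 0 < d) (hd : d ≤ n * S - p * q)
    (w : Fin 3 → ℝ) : ‖w‖ ≤ (1 + 1 / Real.sqrt d) * ‖blockLyapunov n p q S w‖ := by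
  have hs := Real.sqrt_pos.2 hd0
  have hs2 := Real.sqrt_le_sqrt hd
  have key : ∀ i, |(blockLyapunov n p q S w) i| ≤ ‖blockLyapunov n p q S w‖ := fun i =>
    PiLp.norm_apply_le (blockLyapunov n p q S w) i
  have h0 := norm_nonneg (blockLyapunov n p q S w)
  have hbig : ∀ t : ℝ, Real.sqrt (n * S - p * q) * |t| ≤ ‖blockLyapunov n p q S w‖ →
      |t| ≤ (1 + 1 / Real.sqrt d) * ‖blockLyapunov n p q S w‖ := by
    intro t ht
    have h1 : Real.sqrt d * |t| ≤ ‖blockLyapunov n p q S w‖ := le_trans (by gcongr) ht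
    have h2 : |t| ≤ 1 / Real.sqrt d * ‖blockLyapunov n p q S w‖ := by
      rw [one_div, inv_mul_eq_div, le_div_iff₀ hs]; linarith
    linarith
  rw [pi_norm_le_iff_of_nonneg (by positivity)]
  intro i
  fin_cases i
  · have h1 : |w 0| ≤ ‖blockLyapunov n p q S w‖ := key 0
    have h2 : 0 ≤ 1 / Real.sqrt d * ‖blockLyapunov n p q S w‖ := by positivity
    simp only [Real.norm_eq_abs, Fin.zero_eta]
    linarith
  · refine hbig _ ?_
    have h1 := key 1
    rw [blockLyapunov_apply] at h1 ⊢
    simp only [Matrix.cons_val] at h1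
    rwa [abs_mul, abs_of_nonneg (Real.sqrt_nonneg _)] at h1
  · refine hbig _ ?_
    have h1 := key 2
    rw [blockLyapunov_apply] at h1 ⊢
    simp only [Matrix.cons_val] at h1
    rwa [abs_mul, abs_of_nonneg (Real.sqrt_nonneg _)] at h1

theorem blockLyapunov_le {n p q S B : ℝ} (hB : 1 ≤ B) (hn : |n| ≤ B) (hp : |p| ≤ B) (hq : |q| ≤ B)
    (hS : |S| ≤ B) (w : Fin 3 → ℝ) : ‖blockLyapunov n p q S w‖ ≤ (10 * B) * ‖w‖ := by
  have hw : ∀ i, |w i| ≤ ‖w‖ := fun i => norm_le_pi_norm w i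
  have hsq : Real.sqrt (n * S - p * q) ≤ 2 * B := by
    rw [Real.sqrt_le_left (by linarith)]
    have h1 : |n * S| ≤ B * B := by rw [abs_mul]; gcongr
    have h2 : |p * q| ≤ B * B := by rw [abs_mul]; gcongr
    nlinarith [abs_le.1 h1, abs_le.1 h2]
  have hmul : ∀ a t : ℝ, |a| ≤ B → |t| ≤ ‖w‖ → |a * t| ≤ B * ‖w‖ := fun a t ha ht => by
    rw [abs_mul]; gcongr
  have hi : ∀ i, ‖(blockLyapunov n p q S w) i‖ ≤ 2 * B * ‖w‖ := by
    intro i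
    rw [Real.norm_eq_abs, blockLyapunov_apply]
    have h1 : 0 ≤ ‖w‖ := norm_nonneg w
    have hs : ∀ t, |t| ≤ ‖w‖ → |Real.sqrt (n * S - p * q) * t| ≤ 2 * B * ‖w‖ := fun t ht => by
      rw [abs_mul, abs_of_nonneg (Real.sqrt_nonneg _)]; gcongr
    fin_cases i <;> simp only [Matrix.cons_val, Fin.zero_eta, Fin.mk_one, Fin.reduceFinMk]
    · have := hw 0; nlinarith
    · exact hs _ (hw 1)
    · exact hs _ (hw 2)
    · exact (abs_sub _ _).trans (by linarith [hmul S _ hS (hw 1), hmul p _ hp (hw 2)])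
    · exact (abs_sub _ _).trans (by linarith [hmul n _ hn (hw 2), hmul q _ hq (hw 1)])
  refine abs_le_of_sq_le_sq' ?_ (by positivity) |>.2
  rw [EuclideanSpace.norm_sq_eq]
  have hi2 : ∀ i, ‖(blockLyapunov n p q S w) i‖ ^ 2 ≤ (2 * B * ‖w‖) ^ 2 := fun i => by
    gcongr; exact hi i
  refine (Finset.sum_le_card_nsmul _ _ _ fun i _ => hi2 i).trans ?_
  simp only [Finset.card_univ, Fintype.card_fin, nsmul_eq_mul]
  push_cast
  nlinarith [sq_nonneg (B * ‖w‖)]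

theorem inner_blockLyapunov {n p q S : ℝ} (hd : 0 ≤ n * S - p * q) (ht : 0 ≤ n + S)
    (w : Fin 3 → ℝ) : 0 ≤ inner ℝ (blockLyapunov n p q S w)
      (blockLyapunov n p q S (!![0, 0, 0; 0, n, p; 0, q, S] *ᵥ w)) := by
  -- For the lower block B the last two components are adj(B) applied to (w 1, w 2). The identities
  -- adj(B) B = det B and B + adj(B) = tr B collapse the expression to det times trace times w 1² +
  -- w 2².
  have h1 : inner ℝ (blockLyapunov n p q S w)
      (blockLyapunov n p q S (!![0, 0, 0; 0, n, p; 0, q, S] *ᵥ w)) =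
      (n * S - p * q) * (n + S) * (w 1 ^ 2 + w 2 ^ 2) := by
    have hs := Real.mul_self_sqrt hd
    simp only [blockLyapunov_apply, PiLp.inner_apply, Fin.sum_univ_five, Matrix.mulVec, dotProduct,
      Fin.sum_univ_three, Matrix.of_apply, Matrix.cons_val, RCLike.inner_apply, conj_trivial]
    linear_combination ((n * w 1 + p * w 2) * w 1 + (q * w 1 + S * w 2) * w 2) * hs
  rw [h1]
  positivity

/-- The continuous linear map given by a matrix, as a linear function of the matrix. -/
noncomputable def matrixCLM :
    Matrix (Fin 3) (Fin 3) ℝ →ₗ[ℝ] ((Fin 3 → ℝ) →L[ℝ] (Fin 3 → ℝ)) :=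
  LinearMap.toContinuousLinearMap.toLinearMap.comp (Matrix.toLin' (R := ℝ)).toLinearMap

theorem matrixCLM_apply (M : Matrix (Fin 3) (Fin 3) ℝ) (w : Fin 3 → ℝ) :
    matrixCLM M w = M *ᵥ w := rfl

theorem continuous_matrixCLM : Continuous matrixCLM :=
  LinearMap.continuous_of_finiteDimensional _

/-- Stable solutions for perturbations of a block `diag(0, (n, p; q, S))` whose lower block has
positive trace and determinant. -/
theorem exists_block_stable_family {Λ : ℝ} {n p q S : ℝ → ℝ} {R : ℝ → Matrix (Fin 3) (Fin 3) ℝ}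
    (hnc : ContinuousOn n (Set.Icc 0 Λ)) (hpc : ContinuousOn p (Set.Icc 0 Λ))
    (hqc : ContinuousOn q (Set.Icc 0 Λ)) (hSc : ContinuousOn S (Set.Icc 0 Λ))
    (hRc : ContinuousOn R (Set.Icc 0 Λ)) (htr : ∀ l ∈ Set.Icc 0 Λ, 0 ≤ n l + S l)
    (hdet : ∀ l ∈ Set.Icc 0 Λ, 0 < n l * S l - p l * q l) {β : ℝ → ℝ} (hβ : Continuous β)
    {C κ : ℝ} (hκ : 0 < κ) (hβC : ∀ x, |β x| ≤ C * Real.exp (-κ * |x|)) :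
    ∃ (W : ℝ → ℝ → Fin 3 → ℝ) (K : ℝ),
      (∀ l ∈ Set.Icc 0 Λ, ∀ x, HasDerivAt (W l)
        (!![0, 0, 0; 0, n l, p l; 0, q l, S l] *ᵥ W l x + β x • (R l *ᵥ W l x)) x) ∧
      (∀ l ∈ Set.Icc 0 Λ, ∀ x, 0 ≤ x → ‖W l x - ![1, 0, 0]‖ ≤ K * Real.exp (-(κ / 2) * x)) ∧
      ∀ x, ContinuousOn (fun l => W l x) (Set.Icc 0 Λ) := by
  have hbd : ∀ f : ℝ → ℝ, ContinuousOn f (Set.Icc 0 Λ) → ∃ B, ∀ l ∈ Set.Icc 0 Λ, |f l| ≤ B :=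
    fun f hf => isCompact_Icc.exists_bound_of_continuousOn hf
  obtain ⟨Bn, hBn⟩ := hbd n hnc
  obtain ⟨Bp, hBp⟩ := hbd p hpc
  obtain ⟨Bq, hBq⟩ := hbd q hqc
  obtain ⟨BS, hBS⟩ := hbd S hSc
  obtain ⟨d, hd0, hd⟩ : ∃ d, 0 < d ∧ ∀ l ∈ Set.Icc 0 Λ, d ≤ n l * S l - p l * q l := by
    rcases (Set.Icc 0 Λ).eq_empty_or_nonempty with he | hne
    · exact ⟨1, one_pos, by simp [he]⟩
    · obtain ⟨l, hl, hmin⟩ := isCompact_Icc.exists_isMinOn hne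
        ((hnc.mul hSc).sub (hpc.mul hqc))
      exact ⟨_, hdet l hl, fun l' hl' => hmin hl'⟩
  let N : ℝ → (Fin 3 → ℝ) →L[ℝ] (Fin 3 → ℝ) := fun l =>
    matrixCLM !![0, 0, 0; 0, n l, p l; 0, q l, S l]
  have hNc : ContinuousOn N (Set.Icc 0 Λ) := by
    refine continuous_matrixCLM.comp_continuousOn ?_
    refine continuousOn_pi.2 fun i => continuousOn_pi.2 fun j => ?_
    fin_cases i <;> fin_cases j <;> simp <;> first | exact continuousOn_const | assumption
  have hRc' : ContinuousOn (fun l => matrixCLM (R l)) (Set.Icc 0 Λ) :=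
    continuous_matrixCLM.comp_continuousOn hRc
  obtain ⟨BN, hBN⟩ := isCompact_Icc.exists_bound_of_continuousOn hNc
  obtain ⟨BR, hBR⟩ := isCompact_Icc.exists_bound_of_continuousOn hRc'
  have hC0 : 0 ≤ C := by
    have := (abs_nonneg _).trans (hβC 0)
    simpa using this
  have hβ1 : ∀ x, |β x| ≤ C := fun x => (hβC x).trans (mul_le_of_le_one_right hC0
    (Real.exp_le_one_iff.2 (by have := mul_nonneg hκ.le (abs_nonneg x); linarith)))
  set B := 1 + |Bn| + |Bp| + |Bq| + |BS| + |BN| + |BR| + C with hB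
  have ha := fun x : ℝ => abs_nonneg x
  have hle := fun x : ℝ => le_abs_self x
  have hB1 : 1 ≤ B := by linarith [ha Bn, ha Bp, ha Bq, ha BS, ha BN, ha BR]
  obtain ⟨W, K, h1, h2, h3⟩ := exists_stable_family (S := Set.Icc 0 Λ) (N := N)
    (R := fun l => matrixCLM (R l)) (L := fun l => blockLyapunov (n l) (p l) (q l) (S l))
    (β := β) (k₁ := 1 + 1 / Real.sqrt d) (k₂ := 10 * B) (B := B) (C := C) (κ := κ)
    (v := ![1, 0, 0]) (by positivity) (by linarith)
    (fun l hl w => norm_le_blockLyapunov hd0 (hd l hl) w)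
    (fun l hl w => blockLyapunov_le hB1
      (by linarith [hBn l hl, ha Bn, ha Bp, ha Bq, ha BS, ha BN, ha BR, hle Bn])
      (by linarith [hBp l hl, ha Bn, ha Bp, ha Bq, ha BS, ha BN, ha BR, hle Bp])
      (by linarith [hBq l hl, ha Bn, ha Bp, ha Bq, ha BS, ha BN, ha BR, hle Bq])
      (by linarith [hBS l hl, ha Bn, ha Bp, ha Bq, ha BS, ha BN, ha BR, hle BS]) w)
    (fun l hl w => inner_blockLyapunov (hdet l hl).le (htr l hl) w)
    (fun l hl => by
      simp only [N, matrixCLM_apply]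
      ext i
      fin_cases i <;> simp [Matrix.mulVec, dotProduct, Fin.sum_univ_three])
    hNc hRc' (by linarith)
    (fun l hl => by linarith [hBN l hl, ha Bn, ha Bp, ha Bq, ha BS, ha BN, ha BR, hle BN])
    (fun l hl => by linarith [hBR l hl, ha Bn, ha Bp, ha Bq, ha BS, ha BN, ha BR, hle BR])
    hβ (fun x => by linarith [hβ1 x, ha Bn, ha Bp, ha Bq, ha BS, ha BN, ha BR]) hκ
    (fun x hx => by simpa [abs_of_nonneg hx] using hβC x)
  exact ⟨W, K, fun l hl x => (h1 l hl x).congr_deriv rfl, h2, h3⟩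

/-! ### The stable rate -/

/-- `n` is the decay rate of the stable mode for the real spectral parameter `l`. -/
structure IsStableRate (c b₀ l n : ℝ) : Prop where
  pos : 0 < n
  root : c * n ^ 3 + l * n ^ 2 = (c - b₀ + 2 * c * l) * n + l * (l + 1)

/-- After division by the variable, the difference of the two sides is c x² + l x minus a constant
minus l (l + 1)/x, which is strictly increasing. Hence the positive root is unique and the sign at a
trial point locates it. -/
theorem stableRate_mono {c b₀ l x y : ℝ} (hc : 0 < c) (hl : 0 ≤ l) (hx : 0 < x) (hxy : x < y)
    (h : (c - b₀ + 2 * c * l) * x + l * (l + 1) ≤ c * x ^ 3 + l * x ^ 2) :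
    (c - b₀ + 2 * c * l) * y + l * (l + 1) < c * y ^ 3 + l * y ^ 2 := by
  have hy : 0 < y := hx.trans hxy
  have h1 : y * ((c - b₀ + 2 * c * l) * x + l * (l + 1)) ≤ y * (c * x ^ 3 + l * x ^ 2) := by gcongr
  have h2 : 0 < c * (x * y) * ((y - x) * (y + x)) := by
    have : 0 < y - x := by linarith
    positivity
  have h3 : 0 ≤ l * (x * y) * (y - x) := by
    have : 0 < y - x := by linarith
    positivity
  have h4 : 0 ≤ l * (l + 1) * (y - x) := by
    have : 0 < y - x := by linarith
    positivity
  have h5 : 0 < x * (c * y ^ 3 + l * y ^ 2 - ((c - b₀ + 2 * c * l) * y + l * (l + 1))) := by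
    nlinarith
  have := (mul_pos_iff_of_pos_left hx).1 h5
  linarith

theorem exists_stableRate {c b₀ : ℝ} (hc : 0 < c) (hb : b₀ < c) {l : ℝ} (hl : 0 ≤ l) :
    ∃ n, IsStableRate c b₀ l n := by
  rcases hl.eq_or_lt with rfl | hl
  · refine ⟨Real.sqrt (1 - b₀ / c), Real.sqrt_pos.2 ?_, ?_⟩
    · rw [sub_pos, div_lt_one hc]; exact hb
    · have h0 : 0 ≤ 1 - b₀ / c := by
        rw [sub_nonneg, div_le_one hc]; exact hb.le
      have h1 := Real.sq_sqrt h0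
      have h2 : c * (1 - b₀ / c) = c - b₀ := by field_simp
      calc c * Real.sqrt (1 - b₀ / c) ^ 3 + 0 * Real.sqrt (1 - b₀ / c) ^ 2
          = c * Real.sqrt (1 - b₀ / c) ^ 2 * Real.sqrt (1 - b₀ / c) := by ring
        _ = _ := by rw [h1, h2]; ring
  · obtain ⟨n, hn, h⟩ := exists_neg_root hc b₀ hl
    exact ⟨n, hn, by linarith⟩

/-- By `stableRate_mono` the sign of the cubic at a fixed point a decides whether the root lies
above or below a. This sign is stable under small changes of l, which gives continuity up to l = 0.
-/
theorem exists_continuous_stableRate {c b₀ : ℝ} (hc : 0 < c) (hb : b₀ < c) :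
    ∃ n : ℝ → ℝ, ContinuousOn n (Set.Ici 0) ∧ ∀ l, 0 ≤ l → IsStableRate c b₀ l (n l) := by
  have : ∀ l : ℝ, ∃ n, 0 ≤ l → IsStableRate c b₀ l n := fun l => by
    by_cases hl : 0 ≤ l
    · obtain ⟨n, hn⟩ := exists_stableRate hc hb hl
      exact ⟨n, fun _ => hn⟩
    · exact ⟨0, fun h => absurd h hl⟩
  choose n hn using this
  refine ⟨n, fun l₀ hl₀ => ?_, hn⟩
  have h0 := hn l₀ hl₀
  rw [ContinuousWithinAt, tendsto_order]
  refine ⟨fun a ha => ?_, fun a ha => ?_⟩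
  · rcases le_or_gt a 0 with ha0 | ha0
    · filter_upwards [self_mem_nhdsWithin] with l hl
      exact ha0.trans_lt (hn l hl).pos
    · have h1 : c * a ^ 3 + l₀ * a ^ 2 < (c - b₀ + 2 * c * l₀) * a + l₀ * (l₀ + 1) := by
        by_contra! hcon
        have := stableRate_mono hc hl₀ ha0 ha hcon
        linarith [h0.root]
      have h2 : ∀ᶠ l in 𝓝 l₀, c * a ^ 3 + l * a ^ 2 < (c - b₀ + 2 * c * l) * a + l * (l + 1) :=
        (continuous_const.add (continuous_id.mul continuous_const)).continuousAt.eventually_lt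
          (by fun_prop : Continuous fun l : ℝ =>
            (c - b₀ + 2 * c * l) * a + l * (l + 1)).continuousAt h1
      filter_upwards [h2.filter_mono nhdsWithin_le_nhds, self_mem_nhdsWithin] with l hl hl0
      by_contra! hcon
      rcases hcon.eq_or_lt with h | h
      · have := (hn l hl0).root
        rw [h] at this
        linarith
      · have := stableRate_mono hc hl0 (hn l hl0).pos h (hn l hl0).root.ge
        linarith
  · have ha0 : 0 < a := h0.pos.trans ha
    have h1 := stableRate_mono hc hl₀ h0.pos ha h0.root.ge
    have h2 : ∀ᶠ l in 𝓝 l₀, (c - b₀ + 2 * c * l) * a + l * (l + 1) < c * a ^ 3 + l * a ^ 2 :=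
      (by fun_prop : Continuous fun l : ℝ =>
        (c - b₀ + 2 * c * l) * a + l * (l + 1)).continuousAt.eventually_lt
        (continuous_const.add (continuous_id.mul continuous_const)).continuousAt h1
    filter_upwards [h2.filter_mono nhdsWithin_le_nhds, self_mem_nhdsWithin] with l hl hl0
    by_contra! hcon
    rcases hcon.eq_or_lt with h | h
    · have := (hn l hl0).root
      rw [← h] at this
      linarith
    · have := stableRate_mono hc hl0 ha0 h hl.le
      linarith [(hn l hl0).root]

end JinXin

/-! ### Real modes and adjoint modes decaying at one end -/

namespace JinXin

/-- `(τ, u, p)` is a real solution of the eigenvalue equation with spectral parameter `l`. -/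
structure IsRealMode (c : ℝ) (b : ℝ → ℝ) (l : ℝ) (τ u p : ℝ → ℝ) : Prop where
  deriv_fst : ∀ x, HasDerivAt τ ((l * τ x - p x) / c) x
  deriv_snd : ∀ x, HasDerivAt u (p x) x
  deriv_trd : ∀ x, HasDerivAt p ((l + 1) * u x + (b x - c * l) * τ x) x

/-- `(η₁, η₂, η₃)` is a real solution of the adjoint eigenvalue equation. -/
structure IsRealAdjointMode (c : ℝ) (b : ℝ → ℝ) (l : ℝ) (η₁ η₂ η₃ : ℝ → ℝ) : Prop where
  deriv_fst : ∀ x, HasDerivAt η₁ (-(l / c * η₁ x + (b x - c * l) * η₃ x)) x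
  deriv_snd : ∀ x, HasDerivAt η₂ (-((l + 1) * η₃ x)) x
  deriv_trd : ∀ x, HasDerivAt η₃ (η₁ x / c - η₂ x) x

/-- The last component of the left eigenvector for the stable rate `n`. -/
noncomputable def leftCoeff (c l n : ℝ) : ℝ := n ^ 2 / (l * n ^ 2 + 2 * c * n ^ 3 + l * (l + 1))

theorem leftCoeff_pos {c l n : ℝ} (hc : 0 < c) (hl : 0 ≤ l) (hn : 0 < n) :
    0 < leftCoeff c l n := by unfold leftCoeff; positivity

theorem leftCoeff_spec {c l n : ℝ} (hc : 0 < c) (hl : 0 ≤ l) (hn : 0 < n) :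
    leftCoeff c l n * (l / c + 2 * n) + leftCoeff c l n * (l + 1) / n * (l / (c * n)) = 1 / c := by
  have : l * n ^ 2 + 2 * c * n ^ 3 + l * (l + 1) ≠ 0 := by positivity
  unfold leftCoeff
  field_simp

/-- After removal of exp(-nx), the vector (1, -(c + l/n), l + c n) is an equilibrium of the limiting
system. Here w 0 is the coordinate along the left null vector and w 1, w 2 are taken modulo the
equilibrium, so the limiting matrix becomes block diagonal. The relations for α and γ state that (1,
α, γ) is that left null vector in these coordinates. -/
theorem isRealMode_of_block {c b₀ l n : ℝ} {b : ℝ → ℝ} (hc : 0 < c)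
    (hr : IsStableRate c b₀ l n) {α γ : ℝ} (hα : α * n = -(γ * (l + 1)))
    (hγ : γ * (l / c + 2 * n) - α * (l / (c * n)) = 1 / c) {w : ℝ → Fin 3 → ℝ}
    (hw : ∀ x, HasDerivAt w (!![0, 0, 0; 0, n, -(l / (c * n)); 0, l + 1, l / c + 2 * n] *ᵥ w x +
      (b x - b₀) • (!![γ, -(γ * α), -(γ * γ); 0, 0, 0; 1, -α, -γ] *ᵥ w x)) x) :
    IsRealMode c b l (fun x => Real.exp (-n * x) * (w x 0 - α * w x 1 - γ * w x 2))
      (fun x => Real.exp (-n * x) * (w x 1 - (c + l / n) * (w x 0 - α * w x 1 - γ * w x 2)))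
      (fun x => Real.exp (-n * x) * (w x 2 + (l + c * n) * (w x 0 - α * w x 1 - γ * w x 2))) := by
  have hn := hr.pos
  have hroot := hr.root
  have hd : ∀ x i, HasDerivAt (fun x => w x i) _ x := fun x i => hasDerivAt_pi.1 (hw x) i
  have h0 := fun x => hd x 0
  have h1 := fun x => hd x 1
  have h2 := fun x => hd x 2
  simp only [Pi.add_apply, Pi.smul_apply, smul_eq_mul, Matrix.mulVec, dotProduct,
    Fin.sum_univ_three, Matrix.of_apply, Matrix.cons_val] at h0 h1 h2
  have hexp : ∀ x, HasDerivAt (fun x => Real.exp (-n * x)) (-n * Real.exp (-n * x)) x := fun x => by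
    have := ((hasDerivAt_id x).const_mul (-n)).exp
    refine this.congr_deriv ?_
    simp only [id]; ring
  have hθ : ∀ x, HasDerivAt (fun x => w x 0 - α * w x 1 - γ * w x 2) (-(w x 2) / c) x := fun x => by
    refine (((h0 x).sub ((h1 x).const_mul α)).sub ((h2 x).const_mul γ)).congr_deriv ?_
    linear_combination (-w x 1) * hα - w x 2 * hγ
  refine ⟨fun x => ?_, fun x => ?_, fun x => ?_⟩
  · refine ((hexp x).mul (hθ x)).congr_deriv ?_
    field_simp
    ring
  · refine ((hexp x).mul ((h1 x).sub ((hθ x).const_mul (c + l / n)))).congr_deriv ?_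
    simp only [Pi.sub_apply]
    field_simp
    ring
  · refine ((hexp x).mul ((h2 x).add ((hθ x).const_mul (l + c * n)))).congr_deriv ?_
    simp only [Pi.add_apply]
    field_simp
    linear_combination (-c * (w x 0 - α * w x 1 - γ * w x 2)) * hroot

/-- The same change of variables transposed and read along -x: the block and the perturbation are
the transposes of those in `isRealMode_of_block`. -/
theorem isRealAdjointMode_of_block {c b₀ l n : ℝ} {b : ℝ → ℝ} (hc : 0 < c)
    (hr : IsStableRate c b₀ l n) {α γ : ℝ} (hα : α * n = -(γ * (l + 1)))
    (hγ : γ * (l / c + 2 * n) - α * (l / (c * n)) = 1 / c) {w : ℝ → Fin 3 → ℝ}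
    (hw : ∀ x, HasDerivAt w (!![0, 0, 0; 0, n, l + 1; 0, -(l / (c * n)), l / c + 2 * n] *ᵥ w x +
      (b (-x) - b₀) • (!![γ, 0, 1; -(α * γ), 0, -α; -(γ * γ), 0, -γ] *ᵥ w x)) x) :
    IsRealAdjointMode c b l
      (fun x => Real.exp (n * x) * (w (-x) 0 + (w (-x) 1 + α * w (-x) 0) * (c + l / n) -
        (w (-x) 2 + γ * w (-x) 0) * (l + c * n)))
      (fun x => Real.exp (n * x) * (w (-x) 1 + α * w (-x) 0))
      (fun x => Real.exp (n * x) * (w (-x) 2 + γ * w (-x) 0)) := by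
  have hn := hr.pos
  have hroot := hr.root
  have hd : ∀ x i, HasDerivAt (fun x => w (-x) i) _ x := fun x i =>
    hasDerivAt_pi.1 ((hw (-x)).scomp x (hasDerivAt_neg x)) i
  have h0 := fun x => hd x 0
  have h1 := fun x => hd x 1
  have h2 := fun x => hd x 2
  simp only [Pi.add_apply, Pi.smul_apply, smul_eq_mul, Matrix.mulVec, dotProduct,
    Fin.sum_univ_three, Matrix.of_apply, Matrix.cons_val, neg_neg] at h0 h1 h2
  have hexp : ∀ x, HasDerivAt (fun x => Real.exp (n * x)) (n * Real.exp (n * x)) x := fun x => by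
    have := ((hasDerivAt_id x).const_mul n).exp
    refine this.congr_deriv ?_
    simp only [id]; ring
  have hω1 : ∀ x, HasDerivAt (fun x => w (-x) 1 + α * w (-x) 0)
      (-(n * (w (-x) 1 + α * w (-x) 0) + (l + 1) * (w (-x) 2 + γ * w (-x) 0))) x := fun x => by
    refine ((h1 x).add ((h0 x).const_mul α)).congr_deriv ?_
    linear_combination w (-x) 0 * hα
  have hω2 : ∀ x, HasDerivAt (fun x => w (-x) 2 + γ * w (-x) 0)
      (-(-(l / (c * n)) * (w (-x) 1 + α * w (-x) 0) +
        (l / c + 2 * n) * (w (-x) 2 + γ * w (-x) 0) - w (-x) 0 / c)) x := fun x => by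
    refine ((h2 x).add ((h0 x).const_mul γ)).congr_deriv ?_
    linear_combination w (-x) 0 * hγ
  refine ⟨fun x => ?_, fun x => ?_, fun x => ?_⟩
  · refine ((hexp x).mul (((h0 x).add ((hω1 x).mul_const (c + l / n))).sub
      ((hω2 x).mul_const (l + c * n)))).congr_deriv ?_
    simp only [Pi.sub_apply, Pi.add_apply]
    field_simp
    linear_combination c * (w (-x) 2 + γ * w (-x) 0) * hroot
  · refine ((hexp x).mul (hω1 x)).congr_deriv ?_
    ring
  · refine ((hexp x).mul (hω2 x)).congr_deriv ?_
    field_simp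
    ring

/-- Solutions `(T l, U l, P l)` decaying at `+∞`, normalized by `exp (n x) T → 1`. -/
structure IsRightFamily (c : ℝ) (b n : ℝ → ℝ) (Λ K ν : ℝ) (T U P : ℝ → ℝ → ℝ) : Prop where
  mode : ∀ l ∈ Set.Icc 0 Λ, IsRealMode c b l (T l) (U l) (P l)
  rate_pos : 0 < ν
  bound : ∀ l ∈ Set.Icc 0 Λ, ∀ x, 0 ≤ x → |T l x| ≤ K * Real.exp (-ν * x) ∧
    |U l x| ≤ K * Real.exp (-ν * x) ∧ |P l x| ≤ K * Real.exp (-ν * x)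
  lim : ∀ l ∈ Set.Icc 0 Λ, Tendsto (fun x => Real.exp (n l * x) * T l x) atTop (𝓝 1) ∧
    Tendsto (fun x => Real.exp (n l * x) * U l x) atTop (𝓝 (-(c + l / n l))) ∧
    Tendsto (fun x => Real.exp (n l * x) * P l x) atTop (𝓝 (l + c * n l))
  cont : ∀ x, ContinuousOn (fun l => T l x) (Set.Icc 0 Λ) ∧
    ContinuousOn (fun l => U l x) (Set.Icc 0 Λ) ∧ ContinuousOn (fun l => P l x) (Set.Icc 0 Λ)

/-- Solutions of the adjoint equation decaying at `-∞`. -/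
structure IsLeftFamily (c : ℝ) (b n : ℝ → ℝ) (Λ K ν : ℝ) (E₁ E₂ E₃ : ℝ → ℝ → ℝ) : Prop where
  mode : ∀ l ∈ Set.Icc 0 Λ, IsRealAdjointMode c b l (E₁ l) (E₂ l) (E₃ l)
  rate_pos : 0 < ν
  bound : ∀ l ∈ Set.Icc 0 Λ, ∀ x, x ≤ 0 → |E₁ l x| ≤ K * Real.exp (ν * x) ∧
    |E₂ l x| ≤ K * Real.exp (ν * x) ∧ |E₃ l x| ≤ K * Real.exp (ν * x)
  lim : ∀ l ∈ Set.Icc 0 Λ,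
    Tendsto (fun x => Real.exp (-n l * x) * E₁ l x) atBot
      (𝓝 (leftCoeff c l (n l) * c * (n l ^ 2 - (l + 1)) / n l)) ∧
    Tendsto (fun x => Real.exp (-n l * x) * E₂ l x) atBot
      (𝓝 (-(leftCoeff c l (n l) * (l + 1) / n l))) ∧
    Tendsto (fun x => Real.exp (-n l * x) * E₃ l x) atBot (𝓝 (leftCoeff c l (n l)))
  cont : ∀ x, ContinuousOn (fun l => E₁ l x) (Set.Icc 0 Λ) ∧
    ContinuousOn (fun l => E₂ l x) (Set.Icc 0 Λ) ∧ ContinuousOn (fun l => E₃ l x) (Set.Icc 0 Λ)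

section Families

variable {c b₀ Λ C κ : ℝ} {b n : ℝ → ℝ}

theorem continuousOn_leftCoeff (hc : 0 < c) (hnc : ContinuousOn n (Set.Icc 0 Λ))
    (hn : ∀ l, 0 ≤ l → IsStableRate c b₀ l (n l)) :
    ContinuousOn (fun l => leftCoeff c l (n l)) (Set.Icc 0 Λ) := by
  refine ContinuousOn.div (by fun_prop) (by fun_prop) fun l hl => ?_
  have := (hn l hl.1).pos
  have := hl.1
  positivity

theorem exists_rate_lower_bound (hnc : ContinuousOn n (Set.Icc 0 Λ))
    (hn : ∀ l, 0 ≤ l → IsStableRate c b₀ l (n l)) :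
    ∃ ν, 0 < ν ∧ ∀ l ∈ Set.Icc 0 Λ, ν ≤ n l := by
  rcases (Set.Icc 0 Λ).eq_empty_or_nonempty with he | hne
  · exact ⟨1, one_pos, by simp [he]⟩
  · obtain ⟨l, hl, hmin⟩ := isCompact_Icc.exists_isMinOn hne hnc
    exact ⟨_, (hn l hl.1).pos, fun l' hl' => hmin hl'⟩

theorem tendsto_apply_of_norm_le {w : ℝ → Fin 3 → ℝ} {v : Fin 3 → ℝ} {K δ : ℝ} (hδ : 0 < δ)
    (h : ∀ x, 0 ≤ x → ‖w x - v‖ ≤ K * Real.exp (-δ * x)) (i : Fin 3) :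
    Tendsto (fun x => w x i) atTop (𝓝 (v i)) := by
  have h1 : Tendsto (fun x : ℝ => K * Real.exp (-δ * x)) atTop (𝓝 0) := by
    have := (Real.tendsto_exp_atBot.comp
      (tendsto_id.const_mul_atTop_of_neg (by linarith : -δ < 0))).const_mul K
    simpa using this
  have h2 : Tendsto w atTop (𝓝 v) := by
    rw [tendsto_iff_norm_sub_tendsto_zero]
    refine squeeze_zero' (Eventually.of_forall fun _ => norm_nonneg _) ?_ h1
    filter_upwards [eventually_ge_atTop 0] with x hx using h x hx
  exact (tendsto_pi_nhds.1 h2) i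

theorem abs_apply_le_of_norm_sub_le {w : ℝ → Fin 3 → ℝ} {K δ : ℝ} (hδ : 0 < δ)
    (h : ∀ x, 0 ≤ x → ‖w x - ![1, 0, 0]‖ ≤ K * Real.exp (-δ * x)) {x : ℝ} (hx : 0 ≤ x) (i : Fin 3) :
    |w x i| ≤ 1 + |K| := by
  have h1 : ‖w x - ![1, 0, 0]‖ ≤ |K| := (h x hx).trans (by
    calc K * Real.exp (-δ * x) ≤ |K| * 1 := by
          gcongr
          · exact le_abs_self K
          · exact Real.exp_le_one_iff.2 (by nlinarith)
      _ = |K| := mul_one _)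
  have h2 := (norm_le_pi_norm (w x - ![1, 0, 0]) i).trans h1
  have h3 : |(![1, 0, 0] : Fin 3 → ℝ) i| ≤ 1 := by fin_cases i <;> simp
  rw [Pi.sub_apply, Real.norm_eq_abs] at h2
  have := abs_sub_abs_le_abs_sub (w x i) ((![1, 0, 0] : Fin 3 → ℝ) i)
  linarith

/-- After rescaling, the lower block has positive trace and determinant also at l = 0, where the
original limiting matrix has the eigenvalue 0. The Lyapunov construction thus works on the closed
interval, and compactness makes all bounds uniform in l. -/
theorem exists_rightFamily (hc : 0 < c) (hnc : ContinuousOn n (Set.Icc 0 Λ))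
    (hn : ∀ l, 0 ≤ l → IsStableRate c b₀ l (n l)) (hb : Continuous b) (hκ : 0 < κ)
    (hbC : ∀ x, |b x - b₀| ≤ C * Real.exp (-κ * |x|)) :
    ∃ T U P K ν, IsRightFamily c b n Λ K ν T U P := by
  obtain ⟨ν, hν, hνn⟩ := exists_rate_lower_bound hnc hn
  have hpos : ∀ l ∈ Set.Icc 0 Λ, 0 < n l := fun l hl => (hn l hl.1).pos
  have hne : ∀ l ∈ Set.Icc 0 Λ, n l ≠ 0 := fun l hl => (hpos l hl).ne'
  have hγc := continuousOn_leftCoeff hc hnc hn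
  let γ : ℝ → ℝ := fun l => leftCoeff c l (n l)
  let α : ℝ → ℝ := fun l => -(leftCoeff c l (n l) * (l + 1) / n l)
  have hαc : ContinuousOn α (Set.Icc 0 Λ) :=
    ((hγc.mul (by fun_prop)).div hnc hne).neg
  have hec : ContinuousOn (fun l => l / (c * n l)) (Set.Icc 0 Λ) :=
    ContinuousOn.div (by fun_prop) (by fun_prop) fun l hl => mul_ne_zero hc.ne' (hne l hl)
  have hqc : ContinuousOn (fun l => c + l / n l) (Set.Icc 0 Λ) :=
    continuousOn_const.add (continuousOn_id.div hnc hne)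
  have hrc : ContinuousOn (fun l => l + c * n l) (Set.Icc 0 Λ) := by fun_prop
  have hα : ∀ l ∈ Set.Icc 0 Λ, α l * n l = -(γ l * (l + 1)) := fun l hl => by
    have := hne l hl
    simp only [α, γ]; field_simp
  have hγ : ∀ l ∈ Set.Icc 0 Λ, γ l * (l / c + 2 * n l) - α l * (l / (c * n l)) = 1 / c :=
    fun l hl => by
      have := leftCoeff_spec hc hl.1 (hpos l hl)
      simp only [α, γ]; linarith
  obtain ⟨W, K, hW, hWK, hWc⟩ := exists_block_stable_family (Λ := Λ) (n := n)
    (p := fun l => -(l / (c * n l))) (q := fun l => l + 1) (S := fun l => l / c + 2 * n l)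
    (R := fun l => !![γ l, -(γ l * α l), -(γ l * γ l); 0, 0, 0; 1, -α l, -γ l])
    (β := fun x => b x - b₀) (C := C) (κ := κ) hnc hec.neg (by fun_prop) (by fun_prop)
    (by
      refine continuousOn_pi.2 fun i => continuousOn_pi.2 fun j => ?_
      fin_cases i <;> fin_cases j <;> simp <;> fun_prop)
    (fun l hl => by
      have := hpos l hl
      have := hl.1
      positivity)
    (fun l hl => by
      have h1 := hpos l hl
      have h2 := hl.1
      have h3 : 0 ≤ l / (c * n l) * (l + 1) := by positivity
      have h4 : 0 < n l * (l / c + 2 * n l) := by positivity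
      linarith) (hb.sub continuous_const) hκ hbC
  obtain ⟨Bα, hBα⟩ := isCompact_Icc.exists_bound_of_continuousOn hαc
  obtain ⟨Bγ, hBγ⟩ := isCompact_Icc.exists_bound_of_continuousOn hγc
  obtain ⟨Bq, hBq⟩ := isCompact_Icc.exists_bound_of_continuousOn hqc
  obtain ⟨Br, hBr⟩ := isCompact_Icc.exists_bound_of_continuousOn hrc
  let θ : ℝ → ℝ → ℝ := fun l x => W l x 0 - α l * W l x 1 - γ l * W l x 2
  have hcomp : ∀ x i, ContinuousOn (fun l => W l x i) (Set.Icc 0 Λ) := fun x i =>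
    (continuous_apply i).comp_continuousOn (hWc x)
  have hθc : ∀ x, ContinuousOn (fun l => θ l x) (Set.Icc 0 Λ) := fun x =>
    ((hcomp x 0).sub (hαc.mul (hcomp x 1))).sub (hγc.mul (hcomp x 2))
  have hexpc : ∀ x : ℝ, ContinuousOn (fun l => Real.exp (-n l * x)) (Set.Icc 0 Λ) := fun x => by
    fun_prop
  let B₀ := 1 + |K|
  let B₁ := B₀ + |Bα| * B₀ + |Bγ| * B₀
  have hB0 : 0 ≤ B₀ := by positivity
  have hB1 : 0 ≤ B₁ := by positivity
  have hWb : ∀ l ∈ Set.Icc 0 Λ, ∀ x, 0 ≤ x → ∀ i, |W l x i| ≤ B₀ := fun l hl x hx i =>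
    abs_apply_le_of_norm_sub_le (by positivity) (hWK l hl) hx i
  have hθb : ∀ l ∈ Set.Icc 0 Λ, ∀ x, 0 ≤ x → |θ l x| ≤ B₁ := fun l hl x hx => by
    refine (abs_sub _ _).trans (add_le_add ((abs_sub _ _).trans (add_le_add ?_ ?_)) ?_)
    · exact hWb l hl x hx 0
    · rw [abs_mul]
      exact mul_le_mul ((hBα l hl).trans (le_abs_self _)) (hWb l hl x hx 1) (abs_nonneg _)
        (abs_nonneg _)
    · rw [abs_mul]
      exact mul_le_mul ((hBγ l hl).trans (le_abs_self _)) (hWb l hl x hx 2) (abs_nonneg _)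
        (abs_nonneg _)
  have hdecay : ∀ l ∈ Set.Icc 0 Λ, ∀ x, 0 ≤ x → ∀ y M : ℝ, |y| ≤ M →
      M ≤ B₁ + B₀ + |Bq| * B₁ + |Br| * B₁ →
      |Real.exp (-n l * x) * y| ≤ (B₁ + B₀ + |Bq| * B₁ + |Br| * B₁) * Real.exp (-ν * x) := by
    intro l hl x hx y M hy hM
    rw [abs_mul, abs_of_pos (Real.exp_pos _), mul_comm]
    refine mul_le_mul (hy.trans hM) (Real.exp_le_exp.2 ?_) (Real.exp_pos _).le (by positivity)
    have := hνn l hl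
    nlinarith
  have hq0 : 0 ≤ |Bq| * B₁ := by positivity
  have hr0 : 0 ≤ |Br| * B₁ := by positivity
  have hcancel : ∀ a x y : ℝ, Real.exp (a * x) * (Real.exp (-a * x) * y) = y := fun a x y => by
    rw [← mul_assoc, ← Real.exp_add]; simp
  refine ⟨fun l x => Real.exp (-n l * x) * θ l x,
    fun l x => Real.exp (-n l * x) * (W l x 1 - (c + l / n l) * θ l x),
    fun l x => Real.exp (-n l * x) * (W l x 2 + (l + c * n l) * θ l x),
    B₁ + B₀ + |Bq| * B₁ + |Br| * B₁, ν, fun l hl => ?_, hν, fun l hl x hx => ⟨?_, ?_, ?_⟩,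
    fun l hl => ?_, fun x => ⟨?_, ?_, ?_⟩⟩
  · exact isRealMode_of_block hc (hn l hl.1) (hα l hl) (hγ l hl) (hW l hl)
  · exact hdecay l hl x hx _ B₁ (hθb l hl x hx) (by linarith)
  · refine hdecay l hl x hx _ (B₀ + |Bq| * B₁) ?_ (by linarith)
    refine (abs_sub _ _).trans (add_le_add (hWb l hl x hx 1) ?_)
    rw [abs_mul]
    exact mul_le_mul ((hBq l hl).trans (le_abs_self _)) (hθb l hl x hx) (abs_nonneg _)
      (abs_nonneg _)
  · refine hdecay l hl x hx _ (B₀ + |Br| * B₁) ?_ (by linarith)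
    refine (abs_add_le _ _).trans (add_le_add (hWb l hl x hx 2) ?_)
    rw [abs_mul]
    exact mul_le_mul ((hBr l hl).trans (le_abs_self _)) (hθb l hl x hx) (abs_nonneg _)
      (abs_nonneg _)
  · have ht := fun i => tendsto_apply_of_norm_le (by positivity) (hWK l hl) i
    have h0 := ht 0
    have h1 := ht 1
    have h2 := ht 2
    simp only [Matrix.cons_val] at h0 h1 h2
    have hθ : Tendsto (θ l) atTop (𝓝 1) := by
      have := (h0.sub (h1.const_mul (α l))).sub (h2.const_mul (γ l))
      simpa using this
    simp only [hcancel]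
    refine ⟨hθ, ?_, ?_⟩
    · have := h1.sub (hθ.const_mul (c + l / n l))
      simpa using this
    · have := h2.add (hθ.const_mul (l + c * n l))
      simpa using this
  · exact (hexpc x).mul (hθc x)
  · exact (hexpc x).mul ((hcomp x 1).sub (hqc.mul (hθc x)))
  · exact (hexpc x).mul ((hcomp x 2).add (hrc.mul (hθc x)))

theorem exists_leftFamily (hc : 0 < c) (hnc : ContinuousOn n (Set.Icc 0 Λ))
    (hn : ∀ l, 0 ≤ l → IsStableRate c b₀ l (n l)) (hb : Continuous b) (hκ : 0 < κ)
    (hbC : ∀ x, |b x - b₀| ≤ C * Real.exp (-κ * |x|)) :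
    ∃ E₁ E₂ E₃ K ν, IsLeftFamily c b n Λ K ν E₁ E₂ E₃ := by
  obtain ⟨ν, hν, hνn⟩ := exists_rate_lower_bound hnc hn
  have hpos : ∀ l ∈ Set.Icc 0 Λ, 0 < n l := fun l hl => (hn l hl.1).pos
  have hne : ∀ l ∈ Set.Icc 0 Λ, n l ≠ 0 := fun l hl => (hpos l hl).ne'
  have hγc := continuousOn_leftCoeff hc hnc hn
  let γ : ℝ → ℝ := fun l => leftCoeff c l (n l)
  let α : ℝ → ℝ := fun l => -(leftCoeff c l (n l) * (l + 1) / n l)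
  have hαc : ContinuousOn α (Set.Icc 0 Λ) :=
    ((hγc.mul (by fun_prop)).div hnc hne).neg
  have hec : ContinuousOn (fun l => l / (c * n l)) (Set.Icc 0 Λ) :=
    ContinuousOn.div (by fun_prop) (by fun_prop) fun l hl => mul_ne_zero hc.ne' (hne l hl)
  have hqc : ContinuousOn (fun l => c + l / n l) (Set.Icc 0 Λ) :=
    continuousOn_const.add (continuousOn_id.div hnc hne)
  have hrc : ContinuousOn (fun l => l + c * n l) (Set.Icc 0 Λ) := by fun_prop
  have hα : ∀ l ∈ Set.Icc 0 Λ, α l * n l = -(γ l * (l + 1)) := fun l hl => by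
    have := hne l hl
    simp only [α, γ]; field_simp
  have hγ : ∀ l ∈ Set.Icc 0 Λ, γ l * (l / c + 2 * n l) - α l * (l / (c * n l)) = 1 / c :=
    fun l hl => by
      have := leftCoeff_spec hc hl.1 (hpos l hl)
      simp only [α, γ]; linarith
  obtain ⟨W, K, hW, hWK, hWc⟩ := exists_block_stable_family (Λ := Λ) (n := n)
    (p := fun l => l + 1) (q := fun l => -(l / (c * n l))) (S := fun l => l / c + 2 * n l)
    (R := fun l => !![γ l, 0, 1; -(α l * γ l), 0, -α l; -(γ l * γ l), 0, -γ l])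
    (β := fun x => b (-x) - b₀) (C := C) (κ := κ) hnc (by fun_prop) hec.neg (by fun_prop)
    (by
      refine continuousOn_pi.2 fun i => continuousOn_pi.2 fun j => ?_
      fin_cases i <;> fin_cases j <;> simp <;> fun_prop)
    (fun l hl => by
      have := hpos l hl
      have := hl.1
      positivity)
    (fun l hl => by
      have h1 := hpos l hl
      have h2 := hl.1
      have h3 : 0 ≤ l / (c * n l) * (l + 1) := by positivity
      have h4 : 0 < n l * (l / c + 2 * n l) := by positivity
      linarith) ((hb.comp continuous_neg).sub continuous_const) hκ
    (fun x => by simpa using hbC (-x))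
  obtain ⟨Bα, hBα⟩ := isCompact_Icc.exists_bound_of_continuousOn hαc
  obtain ⟨Bγ, hBγ⟩ := isCompact_Icc.exists_bound_of_continuousOn hγc
  obtain ⟨Bq, hBq⟩ := isCompact_Icc.exists_bound_of_continuousOn hqc
  obtain ⟨Br, hBr⟩ := isCompact_Icc.exists_bound_of_continuousOn hrc
  let ω₁ : ℝ → ℝ → ℝ := fun l x => W l (-x) 1 + α l * W l (-x) 0
  let ω₂ : ℝ → ℝ → ℝ := fun l x => W l (-x) 2 + γ l * W l (-x) 0
  have hcomp : ∀ x i, ContinuousOn (fun l => W l x i) (Set.Icc 0 Λ) := fun x i =>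
    (continuous_apply i).comp_continuousOn (hWc x)
  have hω₁c : ∀ x, ContinuousOn (fun l => ω₁ l x) (Set.Icc 0 Λ) := fun x =>
    (hcomp (-x) 1).add (hαc.mul (hcomp (-x) 0))
  have hω₂c : ∀ x, ContinuousOn (fun l => ω₂ l x) (Set.Icc 0 Λ) := fun x =>
    (hcomp (-x) 2).add (hγc.mul (hcomp (-x) 0))
  have hexpc : ∀ x : ℝ, ContinuousOn (fun l => Real.exp (n l * x)) (Set.Icc 0 Λ) := fun x => by
    fun_prop
  let B₀ := 1 + |K|
  let B₁ := B₀ + |Bα| * B₀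
  let B₂ := B₀ + |Bγ| * B₀
  have hB0 : 0 ≤ B₀ := by positivity
  have hB1 : 0 ≤ B₁ := by positivity
  have hB2 : 0 ≤ B₂ := by positivity
  have hWb : ∀ l ∈ Set.Icc 0 Λ, ∀ x, x ≤ 0 → ∀ i, |W l (-x) i| ≤ B₀ := fun l hl x hx i =>
    abs_apply_le_of_norm_sub_le (by positivity) (hWK l hl) (by linarith) i
  have hω₁b : ∀ l ∈ Set.Icc 0 Λ, ∀ x, x ≤ 0 → |ω₁ l x| ≤ B₁ := fun l hl x hx => by
    refine (abs_add_le _ _).trans (add_le_add (hWb l hl x hx 1) ?_)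
    rw [abs_mul]
    exact mul_le_mul ((hBα l hl).trans (le_abs_self _)) (hWb l hl x hx 0) (abs_nonneg _)
      (abs_nonneg _)
  have hω₂b : ∀ l ∈ Set.Icc 0 Λ, ∀ x, x ≤ 0 → |ω₂ l x| ≤ B₂ := fun l hl x hx => by
    refine (abs_add_le _ _).trans (add_le_add (hWb l hl x hx 2) ?_)
    rw [abs_mul]
    exact mul_le_mul ((hBγ l hl).trans (le_abs_self _)) (hWb l hl x hx 0) (abs_nonneg _)
      (abs_nonneg _)
  have hq0 : 0 ≤ B₁ * |Bq| := by positivity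
  have hr0 : 0 ≤ B₂ * |Br| := by positivity
  have hdecay : ∀ l ∈ Set.Icc 0 Λ, ∀ x, x ≤ 0 → ∀ y M : ℝ, |y| ≤ M →
      M ≤ B₀ + B₁ + B₂ + B₁ * |Bq| + B₂ * |Br| →
      |Real.exp (n l * x) * y| ≤
        (B₀ + B₁ + B₂ + B₁ * |Bq| + B₂ * |Br|) * Real.exp (ν * x) := by
    intro l hl x hx y M hy hM
    rw [abs_mul, abs_of_pos (Real.exp_pos _), mul_comm]
    refine mul_le_mul (hy.trans hM) (Real.exp_le_exp.2 ?_) (Real.exp_pos _).le (by positivity)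
    have := hνn l hl
    nlinarith
  have hcancel : ∀ a x y : ℝ, Real.exp (-a * x) * (Real.exp (a * x) * y) = y := fun a x y => by
    rw [← mul_assoc, ← Real.exp_add]; simp
  refine ⟨fun l x => Real.exp (n l * x) *
      (W l (-x) 0 + ω₁ l x * (c + l / n l) - ω₂ l x * (l + c * n l)),
    fun l x => Real.exp (n l * x) * ω₁ l x, fun l x => Real.exp (n l * x) * ω₂ l x,
    B₀ + B₁ + B₂ + B₁ * |Bq| + B₂ * |Br|, ν, fun l hl => ?_, hν, fun l hl x hx => ⟨?_, ?_, ?_⟩,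
    fun l hl => ?_, fun x => ⟨?_, ?_, ?_⟩⟩
  · exact isRealAdjointMode_of_block hc (hn l hl.1) (hα l hl) (hγ l hl) (hW l hl)
  · refine hdecay l hl x hx _ (B₀ + B₁ * |Bq| + B₂ * |Br|) ?_ (by linarith)
    refine (abs_sub _ _).trans (add_le_add ((abs_add_le _ _).trans (add_le_add ?_ ?_)) ?_)
    · exact hWb l hl x hx 0
    · rw [abs_mul]
      exact mul_le_mul (hω₁b l hl x hx) ((hBq l hl).trans (le_abs_self _)) (abs_nonneg _) hB1
    · rw [abs_mul]
      exact mul_le_mul (hω₂b l hl x hx) ((hBr l hl).trans (le_abs_self _)) (abs_nonneg _) hB2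
  · exact hdecay l hl x hx _ B₁ (hω₁b l hl x hx) (by linarith)
  · exact hdecay l hl x hx _ B₂ (hω₂b l hl x hx) (by linarith)
  · have ht := fun i =>
      (tendsto_apply_of_norm_le (by positivity) (hWK l hl) i).comp tendsto_neg_atBot_atTop
    have h0 := ht 0
    have h1 := ht 1
    have h2 := ht 2
    simp only [Matrix.cons_val, Function.comp_def] at h0 h1 h2
    have hω₁ : Tendsto (ω₁ l) atBot (𝓝 (α l)) := by
      have := h1.add (h0.const_mul (α l))
      simpa using this
    have hω₂ : Tendsto (ω₂ l) atBot (𝓝 (γ l)) := by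
      have := h2.add (h0.const_mul (γ l))
      simpa using this
    simp only [hcancel]
    refine ⟨?_, hω₁, hω₂⟩
    -- The limit is 1 + α (c + l/n) - γ (l + c n); the relation `hγ` turns it into the closed form,
    -- whose sign is read off from n² - (l + 1).
    have h3 := (h0.add (hω₁.mul_const (c + l / n l))).sub (hω₂.mul_const (l + c * n l))
    convert h3 using 2
    have h4 := hα l hl
    have h5 := hγ l hl
    have h6 := hne l hl
    have h7 : α l = -(γ l * (l + 1) / n l) := rfl
    rw [h7] at h5 ⊢
    change γ l * c * (n l ^ 2 - (l + 1)) / n l = _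
    field_simp at h5 ⊢
    linear_combination h5
  · exact (hexpc x).mul (((hcomp (-x) 0).add ((hω₁c x).mul hqc)).sub ((hω₂c x).mul hrc))
  · exact (hexpc x).mul (hω₁c x)
  · exact (hexpc x).mul (hω₂c x)

end Families

end JinXin

/-! ### The pairing and its sign for large spectral parameter -/

namespace JinXin

section RealModes

variable {c b₀ l : ℝ} {b : ℝ → ℝ} {τ u p η₁ η₂ η₃ : ℝ → ℝ}

theorem IsRealMode.norm_le (h : IsRealMode c b l τ u p) (hc : 0 < c) {B L : ℝ}
    (hb : ∀ x, |b x| ≤ B) (hl0 : 0 ≤ l) (hl : l ≤ L) (x y : ℝ) :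
    ‖(τ x, u x, p x)‖ ≤ ‖(τ y, u y, p y)‖ *
      Real.exp (((L + 1) / c + 1 + (L + 1) + (B + c * L)) * |x - y|) := by
  have hB : 0 ≤ B := (abs_nonneg _).trans (hb 0)
  have hd : ∀ x, HasDerivAt (fun x => (τ x, u x, p x))
      ((l * τ x - p x) / c, p x, (l + 1) * u x + (b x - c * l) * τ x) x := fun x =>
    (h.deriv_fst x).prodMk ((h.deriv_snd x).prodMk (h.deriv_trd x))
  have := norm_le_gronwallBound_abs (x₀ := y)
    (K := (L + 1) / c + 1 + (L + 1) + (B + c * L)) (ε := 0) (R := |x - y|)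
    (δ := ‖(τ y, u y, p y)‖) hd le_rfl (fun z _ => by
      set N := ‖(τ z, u z, p z)‖ with hN
      have h1 : |τ z| ≤ N := norm_fst_le (τ z, u z, p z)
      have h2 : |u z| ≤ N := (norm_fst_le (u z, p z)).trans (norm_snd_le (τ z, u z, p z))
      have h3 : |p z| ≤ N := (norm_snd_le (u z, p z)).trans (norm_snd_le (τ z, u z, p z))
      have hN0 : 0 ≤ N := norm_nonneg _
      have hL : 0 ≤ L := hl0.trans hl
      have p1 : 0 ≤ (L + 1) / c * N := by positivity
      have p2 : 0 ≤ (L + 1) * N := by positivity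
      have p3 : 0 ≤ (B + c * L) * N := by positivity
      have e1 : |(l * τ z - p z) / c| ≤ (L + 1) / c * N := by
        rw [abs_div, abs_of_pos hc, div_mul_eq_mul_div, div_le_div_iff_of_pos_right hc]
        refine (abs_sub _ _).trans ?_
        rw [abs_mul, abs_of_nonneg hl0]
        nlinarith [mul_le_mul hl h1 (abs_nonneg _) hL]
      have e3 : |(l + 1) * u z + (b z - c * l) * τ z| ≤ (L + 1) * N + (B + c * L) * N := by
        refine (abs_add_le _ _).trans (add_le_add ?_ ?_)
        · rw [abs_mul, abs_of_nonneg (by linarith)]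
          exact mul_le_mul (by linarith) h2 (abs_nonneg _) (by linarith)
        · rw [abs_mul]
          refine mul_le_mul ?_ h1 (abs_nonneg _) (by positivity)
          refine (abs_sub _ _).trans (add_le_add (hb z) ?_)
          rw [abs_of_nonneg (by positivity)]
          gcongr
      rw [add_zero, Prod.norm_def, Prod.norm_def]
      refine max_le ?_ (max_le ?_ ?_) <;> simp only [Real.norm_eq_abs] <;> linarith) (x := x) le_rfl
  rwa [gronwallBound_ε0] at this

theorem IsRealMode.eq_zero (h : IsRealMode c b l τ u p) (hc : 0 < c) {B : ℝ}
    (hb : ∀ x, |b x| ≤ B) (hl0 : 0 ≤ l) {y : ℝ} (h1 : τ y = 0) (h2 : u y = 0) (h3 : p y = 0)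
    (x : ℝ) : τ x = 0 ∧ u x = 0 ∧ p x = 0 := by
  have := h.norm_le hc hb hl0 le_rfl x y
  rw [h1, h2, h3] at this
  simp only [Prod.mk_zero_zero, norm_zero, zero_mul] at this
  have h0 := norm_eq_zero.1 (le_antisymm this (norm_nonneg _))
  simpa [Prod.ext_iff] using h0

theorem IsRealMode.sub_smul {τ' u' p' : ℝ → ℝ} (h : IsRealMode c b l τ u p)
    (h' : IsRealMode c b l τ' u' p') (k : ℝ) :
    IsRealMode c b l (fun x => τ x - k * τ' x) (fun x => u x - k * u' x)
      (fun x => p x - k * p' x) where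
  deriv_fst x := ((h.deriv_fst x).sub ((h'.deriv_fst x).const_mul k)).congr_deriv (by ring)
  deriv_snd x := ((h.deriv_snd x).sub ((h'.deriv_snd x).const_mul k)).congr_deriv (by ring)
  deriv_trd x := ((h.deriv_trd x).sub ((h'.deriv_trd x).const_mul k)).congr_deriv (by ring)

/-- The pairing of solutions with adjoint solutions for different spectral parameters. -/
theorem hasDerivAt_pairing {l' : ℝ} (hη : IsRealAdjointMode c b l η₁ η₂ η₃)
    (h : IsRealMode c b l' τ u p) (x : ℝ) :
    HasDerivAt (fun x => η₁ x * τ x + η₂ x * u x + η₃ x * p x)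
      ((l' - l) * (η₁ x * τ x / c + η₃ x * (u x - c * τ x))) x := by
  refine ((((hη.deriv_fst x).mul (h.deriv_fst x)).add
    ((hη.deriv_snd x).mul (h.deriv_snd x))).add
    ((hη.deriv_trd x).mul (h.deriv_trd x))).congr_deriv ?_
  ring

/-- Independence of x makes the pairing of the two decaying families a function of l alone; it takes
the place of the Evans function and makes sense down to l = 0. -/
theorem pairing_eq (hη : IsRealAdjointMode c b l η₁ η₂ η₃) (h : IsRealMode c b l τ u p) (x y : ℝ) :
    η₁ x * τ x + η₂ x * u x + η₃ x * p x = η₁ y * τ y + η₂ y * u y + η₃ y * p y :=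
  is_const_of_deriv_eq_zero (f := fun x => η₁ x * τ x + η₂ x * u x + η₃ x * p x)
    (fun x => (hasDerivAt_pairing hη h x).differentiableAt)
    (fun x => by rw [(hasDerivAt_pairing hη h x).deriv]; simp) x y

/-- For large spectral parameter an octant is invariant under the backward flow. -/
theorem IsRealMode.octant (h : IsRealMode c b l τ u p) (hc : 0 < c) (hl0 : 0 ≤ l)
    (hlb : ∀ x, b x < c * l) {X : ℝ} (h1 : 0 < τ X) (h2 : u X < 0) (h3 : 0 < p X) {y : ℝ}
    (hy : y ≤ X) : 0 < τ y ∧ u y < 0 ∧ 0 < p y := by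
  have hτ : Continuous τ := continuous_iff_continuousAt.2 fun x => (h.deriv_fst x).continuousAt
  have hu : Continuous u := continuous_iff_continuousAt.2 fun x => (h.deriv_snd x).continuousAt
  have hp : Continuous p := continuous_iff_continuousAt.2 fun x => (h.deriv_trd x).continuousAt
  by_contra hcon
  let S : Set ℝ := {x | 0 < τ x ∧ u x < 0 ∧ 0 < p x}
  have hS : IsOpen S := (isOpen_lt continuous_const hτ).inter
    ((isOpen_lt hu continuous_const).inter (isOpen_lt continuous_const hp))
  have hK : IsCompact (Set.Icc y X ∩ Sᶜ) := isCompact_Icc.inter_right hS.isClosed_compl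
  have hne : (Set.Icc y X ∩ Sᶜ).Nonempty := ⟨y, ⟨le_rfl, hy⟩, hcon⟩
  -- `z` is the last point up to X outside the open octant. Between z and X the sign conditions make
  -- u increasing and both p and exp(-lx/c) τ decreasing, so all strict signs survive at z, a
  -- contradiction.
  set z := sSup (Set.Icc y X ∩ Sᶜ) with hz
  have hzmem : z ∈ Set.Icc y X ∩ Sᶜ := hK.sSup_mem hne
  have hpos : ∀ x, z < x → x ≤ X → x ∈ S := by
    intro x hzx hxX
    by_contra hxS
    have : x ≤ z := le_csSup hK.bddAbove ⟨⟨hzmem.1.1.trans hzx.le, hxX⟩, hxS⟩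
    linarith
  have hzX : z ≤ X := hzmem.1.2
  have hint : ∀ x ∈ interior (Set.Icc z X), x ∈ S := fun x hx => by
    rw [interior_Icc] at hx
    exact hpos x hx.1 hx.2.le
  have hmem1 : z ∈ Set.Icc z X := ⟨le_rfl, hzX⟩
  have hmem2 : X ∈ Set.Icc z X := ⟨hzX, le_rfl⟩
  have hu1 : u z ≤ u X := monotoneOn_of_deriv_nonneg (convex_Icc z X) hu.continuousOn
    (fun x _ => (h.deriv_snd x).differentiableAt.differentiableWithinAt)
    (fun x hx => by rw [(h.deriv_snd x).deriv]; exact (hint x hx).2.2.le) hmem1 hmem2 hzX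
  have hp1 : p X ≤ p z := antitoneOn_of_deriv_nonpos (convex_Icc z X) hp.continuousOn
    (fun x _ => (h.deriv_trd x).differentiableAt.differentiableWithinAt)
    (fun x hx => by
      rw [(h.deriv_trd x).deriv]
      have h4 := hint x hx
      have h5 : (b x - c * l) * τ x ≤ 0 :=
        mul_nonpos_of_nonpos_of_nonneg (by linarith [hlb x]) h4.1.le
      have h6 : (l + 1) * u x ≤ 0 := mul_nonpos_of_nonneg_of_nonpos (by linarith) h4.2.1.le
      linarith) hmem1 hmem2 hzX
  have hg : ∀ x, HasDerivAt (fun x => Real.exp (-(l / c) * x) * τ x)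
      (-(Real.exp (-(l / c) * x) * p x / c)) x := fun x => by
    have h7 := ((hasDerivAt_id x).const_mul (-(l / c))).exp
    refine (h7.mul (h.deriv_fst x)).congr_deriv ?_
    simp only [id]
    field_simp
    ring
  have hτ1 : Real.exp (-(l / c) * X) * τ X ≤ Real.exp (-(l / c) * z) * τ z :=
    antitoneOn_of_deriv_nonpos (convex_Icc z X)
      (fun x _ => (hg x).continuousAt.continuousWithinAt)
      (fun x _ => (hg x).differentiableAt.differentiableWithinAt)
      (fun x hx => by
        rw [(hg x).deriv, neg_nonpos]
        have := (hint x hx).2.2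
        positivity) hmem1 hmem2 hzX
  have hτz : 0 < Real.exp (-(l / c) * z) * τ z :=
    lt_of_lt_of_le (mul_pos (Real.exp_pos _) h1) hτ1
  exact hzmem.2 ⟨(mul_pos_iff_of_pos_left (Real.exp_pos _)).1 hτz, hu1.trans_lt h2,
    h3.trans_le hp1⟩

/-- At s = √(l + 1) the left side of the cubic relation minus the right side is (b₀ - c l) s < 0, so
the root lies beyond s. This fixes the sign of the first component of the left eigenvector. -/
theorem stableRate_sq_gt {n : ℝ} (hc : 0 < c) (hl : 0 ≤ l) (h : IsStableRate c b₀ l n)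
    (hb : b₀ < c * l) : l + 1 < n ^ 2 := by
  by_contra! hcon
  have hs : Real.sqrt (l + 1) ^ 2 = l + 1 := Real.sq_sqrt (by linarith)
  have hs0 : 0 < Real.sqrt (l + 1) := Real.sqrt_pos.2 (by linarith)
  have h1 : c * Real.sqrt (l + 1) ^ 3 + l * Real.sqrt (l + 1) ^ 2 <
      (c - b₀ + 2 * c * l) * Real.sqrt (l + 1) + l * (l + 1) := by
    have : c * Real.sqrt (l + 1) ^ 3 = c * Real.sqrt (l + 1) ^ 2 * Real.sqrt (l + 1) := by ring
    rw [this, hs]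
    nlinarith
  have h2 : n ≤ Real.sqrt (l + 1) := Real.le_sqrt_of_sq_le hcon
  rcases h2.eq_or_lt with h3 | h3
  · rw [← h3] at h1
    linarith [h.root]
  · linarith [stableRate_mono hc hl h.pos h3 h.root.ge]

theorem pos_of_tendsto_exp_mul {f : ℝ → ℝ} {F : Filter ℝ} {a L : ℝ}
    (h : Tendsto (fun x => Real.exp (a * x) * f x) F (𝓝 L)) (hL : 0 < L) : ∀ᶠ x in F, 0 < f x := by
  filter_upwards [h.eventually_const_lt hL] with x hx
  exact (mul_pos_iff_of_pos_left (Real.exp_pos _)).1 hx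

theorem neg_of_tendsto_exp_mul {f : ℝ → ℝ} {F : Filter ℝ} {a L : ℝ}
    (h : Tendsto (fun x => Real.exp (a * x) * f x) F (𝓝 L)) (hL : L < 0) : ∀ᶠ x in F, f x < 0 := by
  have := pos_of_tendsto_exp_mul (f := fun x => -f x) (a := a) (L := -L)
    (by simpa using h.neg) (by linarith)
  filter_upwards [this] with x hx using by linarith

end RealModes

/-- The pairing of the families is positive for large spectral parameter. -/
theorem pairing_pos_of_large {c b₀ Λ K K' ν ν' : ℝ} {b n : ℝ → ℝ} {T U P E₁ E₂ E₃ : ℝ → ℝ → ℝ}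
    (hc : 0 < c) (hn : ∀ l, 0 ≤ l → IsStableRate c b₀ l (n l))
    (hR : IsRightFamily c b n Λ K ν T U P) (hL : IsLeftFamily c b n Λ K' ν' E₁ E₂ E₃) (hΛ : 0 < Λ)
    (hb : ∀ x, b x < c * Λ) (hb₀ : b₀ < c * Λ) (y : ℝ) :
    0 < E₁ Λ y * T Λ y + E₂ Λ y * U Λ y + E₃ Λ y * P Λ y := by
  have hmem : Λ ∈ Set.Icc 0 Λ := ⟨hΛ.le, le_rfl⟩
  have hn0 := (hn Λ hΛ.le).pos
  have hmode := hR.mode Λ hmem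
  obtain ⟨r1, r2, r3⟩ := hR.lim Λ hmem
  obtain ⟨l1, l2, l3⟩ := hL.lim Λ hmem
  have hγ := leftCoeff_pos hc hΛ.le hn0
  have hsq := stableRate_sq_gt hc hΛ.le (hn Λ hΛ.le) hb₀
  -- Near +∞ the mode has signs (+, -, +), and near -∞ the adjoint mode has the same signs. Backward
  -- invariance of the octant brings the mode to a point where both sign patterns hold, and each
  -- term of the pairing is positive.
  obtain ⟨X, h1, h2, h3⟩ := ((pos_of_tendsto_exp_mul r1 one_pos).and
    ((neg_of_tendsto_exp_mul r2 (by have : 0 < c + Λ / n Λ := by positivity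
                                    linarith)).and
    (pos_of_tendsto_exp_mul r3 (by positivity)))).exists
  obtain ⟨z, h4, h5, h6, hzX⟩ := ((pos_of_tendsto_exp_mul l1 (by
      have : 0 < n Λ ^ 2 - (Λ + 1) := by linarith
      positivity)).and
    ((neg_of_tendsto_exp_mul l2 (by
      rw [neg_lt_zero]; positivity)).and
    ((pos_of_tendsto_exp_mul l3 hγ).and (eventually_le_atBot X)))).exists
  obtain ⟨h7, h8, h9⟩ := hmode.octant hc hΛ.le hb h1 h2 h3 hzX
  rw [pairing_eq (hL.mode Λ hmem) hmode y z]
  have e1 := mul_pos h4 h7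
  have e2 := mul_pos_of_neg_of_neg h5 h8
  have e3 := mul_pos h6 h9
  linarith

end JinXin

/-! ### The translation mode at vanishing spectral parameter -/

namespace JinXin

theorem integrable_exp_neg_mul_abs {κ : ℝ} (hκ : 0 < κ) :
    Integrable fun x : ℝ => Real.exp (-κ * |x|) := by
  rw [← integrableOn_univ, ← Set.Iic_union_Ioi (a := (0 : ℝ))]
  refine IntegrableOn.union ?_ ?_
  · refine (integrableOn_exp_mul_Iic hκ 0).congr_fun (fun x hx => ?_) measurableSet_Iic
    simp only [abs_of_nonpos (Set.mem_Iic.1 hx), neg_mul_neg]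
  · refine (integrableOn_exp_mul_Ioi (neg_neg_of_pos hκ) 0).congr_fun (fun x hx => ?_)
      measurableSet_Ioi
    simp only [abs_of_pos (Set.mem_Ioi.1 hx)]

theorem tendsto_exp_neg_mul_abs_atTop {κ : ℝ} (hκ : 0 < κ) (C : ℝ) :
    Tendsto (fun x : ℝ => C * Real.exp (-κ * |x|)) atTop (𝓝 0) := by
  have := (Real.tendsto_exp_atBot.comp (tendsto_abs_atTop_atTop.const_mul_atTop_of_neg
    (neg_neg_of_pos hκ))).const_mul C
  simpa using this

theorem tendsto_exp_neg_mul_abs_atBot {κ : ℝ} (hκ : 0 < κ) (C : ℝ) :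
    Tendsto (fun x : ℝ => C * Real.exp (-κ * |x|)) atBot (𝓝 0) := by
  have := (Real.tendsto_exp_atBot.comp (tendsto_abs_atBot_atTop.const_mul_atTop_of_neg
    (neg_neg_of_pos hκ))).const_mul C
  simpa using this

theorem tendsto_zero_of_abs_le {f g : ℝ → ℝ} {F : Filter ℝ} (h : ∀ᶠ x in F, |f x| ≤ g x)
    (hg : Tendsto g F (𝓝 0)) : Tendsto f F (𝓝 0) :=
  squeeze_zero_norm' h hg

/-- The deviation `Y` of a solitary wave from its end state, with its derivatives. -/
structure IsWaveProfile (c : ℝ) (b : ℝ → ℝ) (C κ M : ℝ) (Y Y₁ Y₂ : ℝ → ℝ) : Prop where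
  deriv_fst : ∀ x, HasDerivAt Y (Y₁ x) x
  deriv_snd : ∀ x, HasDerivAt Y₁ (Y₂ x) x
  deriv_trd : ∀ x, HasDerivAt Y₂ ((1 - b x / c) * Y₁ x) x
  rate_pos : 0 < κ
  bound : ∀ x, |Y x| ≤ C * Real.exp (-κ * |x|) ∧ |Y₁ x| ≤ C * Real.exp (-κ * |x|) ∧
    |Y₂ x| ≤ C * Real.exp (-κ * |x|)
  increasing : ∀ x, x ≤ -M → 0 < Y₁ x
  decreasing : ∀ x, M ≤ x → Y₁ x < 0

namespace IsWaveProfile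

variable {c b₀ C κ M Λ K ν : ℝ} {b n Y Y₁ Y₂ : ℝ → ℝ} {T U P E₁ E₂ E₃ : ℝ → ℝ → ℝ}

/-- Translation invariance of the model: the derivative of the wave lies in the kernel of the
linearization. -/
theorem mode (h : IsWaveProfile c b C κ M Y Y₁ Y₂) (hc : 0 < c) :
    IsRealMode c b 0 Y₁ (fun x => -c * Y₁ x) (fun x => -c * Y₂ x) where
  deriv_fst x := (h.deriv_snd x).congr_deriv (by field_simp; ring)
  deriv_snd x := (h.deriv_snd x).const_mul (-c)
  deriv_trd x := ((h.deriv_trd x).const_mul (-c)).congr_deriv (by field_simp; ring)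

theorem tendsto_atTop (h : IsWaveProfile c b C κ M Y Y₁ Y₂) :
    Tendsto Y atTop (𝓝 0) ∧ Tendsto Y₁ atTop (𝓝 0) ∧ Tendsto Y₂ atTop (𝓝 0) :=
  have ht := tendsto_exp_neg_mul_abs_atTop h.rate_pos C
  ⟨tendsto_zero_of_abs_le (Eventually.of_forall fun x => (h.bound x).1) ht,
    tendsto_zero_of_abs_le (Eventually.of_forall fun x => (h.bound x).2.1) ht,
    tendsto_zero_of_abs_le (Eventually.of_forall fun x => (h.bound x).2.2) ht⟩

theorem tendsto_atBot (h : IsWaveProfile c b C κ M Y Y₁ Y₂) :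
    Tendsto Y atBot (𝓝 0) ∧ Tendsto Y₁ atBot (𝓝 0) ∧ Tendsto Y₂ atBot (𝓝 0) :=
  have ht := tendsto_exp_neg_mul_abs_atBot h.rate_pos C
  ⟨tendsto_zero_of_abs_le (Eventually.of_forall fun x => (h.bound x).1) ht,
    tendsto_zero_of_abs_le (Eventually.of_forall fun x => (h.bound x).2.1) ht,
    tendsto_zero_of_abs_le (Eventually.of_forall fun x => (h.bound x).2.2) ht⟩

theorem continuous_fst (h : IsWaveProfile c b C κ M Y Y₁ Y₂) : Continuous Y :=
  continuous_iff_continuousAt.2 fun x => (h.deriv_fst x).continuousAt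

theorem continuous_snd (h : IsWaveProfile c b C κ M Y Y₁ Y₂) : Continuous Y₁ :=
  continuous_iff_continuousAt.2 fun x => (h.deriv_snd x).continuousAt

theorem continuous_trd (h : IsWaveProfile c b C κ M Y Y₁ Y₂) : Continuous Y₂ :=
  continuous_iff_continuousAt.2 fun x => (h.deriv_trd x).continuousAt

end IsWaveProfile

theorem IsRightFamily.tendsto {c Λ K ν : ℝ} {b n : ℝ → ℝ} {T U P : ℝ → ℝ → ℝ}
    (hR : IsRightFamily c b n Λ K ν T U P) {l : ℝ} (hl : l ∈ Set.Icc 0 Λ) :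
    Tendsto (T l) atTop (𝓝 0) ∧ Tendsto (U l) atTop (𝓝 0) ∧ Tendsto (P l) atTop (𝓝 0) := by
  have ht : Tendsto (fun x : ℝ => K * Real.exp (-ν * x)) atTop (𝓝 0) := by
    have := (Real.tendsto_exp_atBot.comp (tendsto_id.const_mul_atTop_of_neg
      (neg_neg_of_pos hR.rate_pos))).const_mul K
    simpa using this
  refine ⟨tendsto_zero_of_abs_le ?_ ht, tendsto_zero_of_abs_le ?_ ht,
    tendsto_zero_of_abs_le ?_ ht⟩
  · filter_upwards [eventually_ge_atTop 0] with x hx using (hR.bound l hl x hx).1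
  · filter_upwards [eventually_ge_atTop 0] with x hx using (hR.bound l hl x hx).2.1
  · filter_upwards [eventually_ge_atTop 0] with x hx using (hR.bound l hl x hx).2.2

theorem IsLeftFamily.tendsto {c Λ K ν : ℝ} {b n : ℝ → ℝ} {E₁ E₂ E₃ : ℝ → ℝ → ℝ}
    (hL : IsLeftFamily c b n Λ K ν E₁ E₂ E₃) {l : ℝ} (hl : l ∈ Set.Icc 0 Λ) :
    Tendsto (E₁ l) atBot (𝓝 0) ∧ Tendsto (E₂ l) atBot (𝓝 0) ∧ Tendsto (E₃ l) atBot (𝓝 0) := by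
  have ht : Tendsto (fun x : ℝ => K * Real.exp (ν * x)) atBot (𝓝 0) := by
    have := (Real.tendsto_exp_atBot.comp (tendsto_id.const_mul_atBot hL.rate_pos)).const_mul K
    simpa using this
  refine ⟨tendsto_zero_of_abs_le ?_ ht, tendsto_zero_of_abs_le ?_ ht,
    tendsto_zero_of_abs_le ?_ ht⟩
  · filter_upwards [eventually_le_atBot 0] with x hx using (hL.bound l hl x hx).1
  · filter_upwards [eventually_le_atBot 0] with x hx using (hL.bound l hl x hx).2.1
  · filter_upwards [eventually_le_atBot 0] with x hx using (hL.bound l hl x hx).2.2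

section AtZero

variable {c b₀ C κ M Λ K ν : ℝ} {b n Y Y₁ Y₂ : ℝ → ℝ} {T U P E₁ E₂ E₃ : ℝ → ℝ → ℝ}

/-- The stable solution for vanishing spectral parameter is a multiple of the derivative of the
wave. -/
theorem IsRightFamily.eq_at_zero (hR : IsRightFamily c b n Λ K ν T U P) (hc : 0 < c)
    (hΛ : 0 ≤ Λ) {B : ℝ} (hb : ∀ x, |b x| ≤ B) (h : IsWaveProfile c b C κ M Y Y₁ Y₂) :
    ∃ k, k < 0 ∧ ∀ x, T 0 x = k * Y₁ x ∧ U 0 x = k * (-c * Y₁ x) ∧ P 0 x = k * (-c * Y₂ x) := by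
  have hmem : (0 : ℝ) ∈ Set.Icc 0 Λ := ⟨le_rfl, hΛ⟩
  have hmode := hR.mode 0 hmem
  obtain ⟨t1, t2, t3⟩ := hR.tendsto hmem
  obtain ⟨y0, y1, y2⟩ := h.tendsto_atTop
  -- At l = 0 the first equation is a conservation law, so u + cτ is constant, and decay makes it
  -- zero.
  have hφd : ∀ x, HasDerivAt (fun x => U 0 x + c * T 0 x) 0 x := fun x =>
    ((hmode.deriv_snd x).add ((hmode.deriv_fst x).const_mul c)).congr_deriv (by field_simp; ring)
  have hconst : ∀ f : ℝ → ℝ, (∀ x, HasDerivAt f 0 x) → Tendsto f atTop (𝓝 0) → ∀ x, f x = 0 := by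
    intro f hf ht x
    have : f = fun _ => f x := funext fun y => is_const_of_deriv_eq_zero
      (fun z => (hf z).differentiableAt) (fun z => (hf z).deriv) y x
    rw [this] at ht
    exact tendsto_nhds_unique tendsto_const_nhds ht
  have hφ := hconst _ hφd (by simpa using t2.add (t1.const_mul c))
  -- A Wronskian with the translation mode. It vanishes by decay, so the two solutions are
  -- proportional at one point and hence everywhere.
  have hgd : ∀ x, HasDerivAt (fun x => Y₁ x * P 0 x + c * Y₂ x * T 0 x) 0 x := fun x => by
    refine (((h.deriv_snd x).mul (hmode.deriv_trd x)).add
      (((h.deriv_trd x).const_mul c).mul (hmode.deriv_fst x))).congr_deriv ?_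
    field_simp
    linear_combination (Y₁ x) * hφ x
  have hg := hconst _ hgd (by simpa using (y1.mul t3).add ((y2.const_mul c).mul t1))
  have hY : 0 < Y₁ (-M) := h.increasing _ le_rfl
  set k := T 0 (-M) / Y₁ (-M) with hk
  have hkY : k * Y₁ (-M) = T 0 (-M) := div_mul_cancel₀ _ hY.ne'
  have hzero := (hmode.sub_smul (h.mode hc) k).eq_zero hc hb le_rfl (y := -M)
    (by rw [hkY, sub_self])
    (by
      have := hφ (-M)
      linear_combination this + c * hkY)
    (by
      have h1 := hg (-M)
      have h2 : Y₁ (-M) * (P 0 (-M) - k * (-c * Y₂ (-M))) = 0 := by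
        linear_combination h1 + c * Y₂ (-M) * hkY
      exact (mul_eq_zero.1 h2).resolve_left hY.ne')
  have heq : ∀ x, T 0 x = k * Y₁ x ∧ U 0 x = k * (-c * Y₁ x) ∧ P 0 x = k * (-c * Y₂ x) := fun x =>
    ⟨sub_eq_zero.1 (hzero x).1, sub_eq_zero.1 (hzero x).2.1, sub_eq_zero.1 (hzero x).2.2⟩
  refine ⟨k, ?_, heq⟩
  -- The family is normalized to be positive near +∞, where the derivative of the wave is negative.
  obtain ⟨x, hx, hxM⟩ := ((pos_of_tendsto_exp_mul (hR.lim 0 hmem).1 one_pos).and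
    (eventually_ge_atTop M)).exists
  rw [(heq x).1] at hx
  have := h.decreasing x hxM
  by_contra! hk0
  nlinarith

/-- The decaying adjoint solution for vanishing spectral parameter near `-∞`. -/
theorem IsLeftFamily.eq_at_zero (hL : IsLeftFamily c b n Λ K ν E₁ E₂ E₃) (hc : 0 < c)
    (hn : ∀ l, 0 ≤ l → IsStableRate c b₀ l (n l))
    (hΛ : 0 ≤ Λ) (h : IsWaveProfile c b C κ M Y Y₁ Y₂) :
    ∃ k, 0 < k ∧ ∀ x, x < -M → E₁ 0 x = k * (c * Y₂ x - c * Y x) ∧ E₂ 0 x = k * -Y x ∧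
      E₃ 0 x = k * Y₁ x := by
  have hmem : (0 : ℝ) ∈ Set.Icc 0 Λ := ⟨le_rfl, hΛ⟩
  have hmode := hL.mode 0 hmem
  obtain ⟨t1, t2, t3⟩ := hL.tendsto hmem
  obtain ⟨y0, y1, y2⟩ := h.tendsto_atBot
  -- The pairing with the translation mode is constant and tends to 0 at -∞. It expresses E₁ through
  -- E₂ and E₃ and reduces the adjoint system to quadratures wherever Y₁ ≠ 0, which is why only x <
  -- -M is treated.
  have hpair : ∀ x, E₁ 0 x * Y₁ x - c * E₂ 0 x * Y₁ x - c * E₃ 0 x * Y₂ x = 0 := by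
    intro x
    have ht := ((t1.mul y1).add (t2.mul (y1.const_mul (-c)))).add (t3.mul (y2.const_mul (-c)))
    have : (fun x => E₁ 0 x * Y₁ x + E₂ 0 x * (-c * Y₁ x) + E₃ 0 x * (-c * Y₂ x)) =
        fun _ => E₁ 0 x * Y₁ x + E₂ 0 x * (-c * Y₁ x) + E₃ 0 x * (-c * Y₂ x) :=
      funext fun y => pairing_eq hmode (h.mode hc) y x
    rw [this] at ht
    have := tendsto_nhds_unique tendsto_const_nhds ht
    simp only [mul_zero, add_zero] at this
    linarith
  have hpos : ∀ x ∈ Set.Iio (-M), 0 < Y₁ x := fun x hx => h.increasing x (le_of_lt hx)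
  have hE1 : ∀ x ∈ Set.Iio (-M), E₁ 0 x = c * E₂ 0 x + c * E₃ 0 x * Y₂ x / Y₁ x := fun x hx => by
    have := (hpos x hx).ne'
    field_simp
    linear_combination hpair x
  have hq : ∀ x ∈ Set.Iio (-M), HasDerivAt (fun x => E₃ 0 x / Y₁ x) 0 x := fun x hx => by
    have hne := (hpos x hx).ne'
    refine ((hmode.deriv_trd x).div (h.deriv_snd x) hne).congr_deriv ?_
    rw [hE1 x hx]
    field_simp
    ring
  have hx₀ : -M - 1 ∈ Set.Iio (-M) := by simp
  set k := E₃ 0 (-M - 1) / Y₁ (-M - 1) with hk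
  have hE3 : ∀ x ∈ Set.Iio (-M), E₃ 0 x = k * Y₁ x := fun x hx => by
    have := isOpen_Iio.is_const_of_deriv_eq_zero isPreconnected_Iio
      (fun y hy => (hq y hy).differentiableAt.differentiableWithinAt)
      (fun y hy => (hq y hy).deriv) hx hx₀
    rw [← hk] at this
    rw [← this, div_mul_cancel₀ _ (hpos x hx).ne']
  have hs : ∀ x ∈ Set.Iio (-M), HasDerivAt (fun x => E₂ 0 x + k * Y x) 0 x := fun x hx => by
    refine ((hmode.deriv_snd x).add ((h.deriv_fst x).const_mul k)).congr_deriv ?_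
    rw [hE3 x hx]; ring
  have hE2 : ∀ x ∈ Set.Iio (-M), E₂ 0 x = k * -Y x := fun x hx => by
    have ht := t2.add (y0.const_mul k)
    have h1 : (fun x => E₂ 0 x + k * Y x) =ᶠ[atBot] fun _ => E₂ 0 x + k * Y x := by
      filter_upwards [eventually_lt_atBot (-M)] with y hy
      exact isOpen_Iio.is_const_of_deriv_eq_zero isPreconnected_Iio
        (fun y hy => (hs y hy).differentiableAt.differentiableWithinAt)
        (fun y hy => (hs y hy).deriv) hy hx
    have h2 := tendsto_nhds_unique tendsto_const_nhds (ht.congr' h1)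
    linarith
  refine ⟨k, ?_, fun x hx => ⟨?_, hE2 x hx, hE3 x hx⟩⟩
  · obtain ⟨x, hx, hxM⟩ := ((pos_of_tendsto_exp_mul (hL.lim 0 hmem).2.2
      (leftCoeff_pos hc le_rfl (hn 0 le_rfl).pos)).and (eventually_lt_atBot (-M))).exists
    rw [hE3 x hxM] at hx
    exact (mul_pos_iff_of_pos_right (hpos x hxM)).1 hx
  · rw [hE1 x hx, hE2 x hx, hE3 x hx]
    have := (hpos x hx).ne'
    field_simp
    ring

end AtZero

end JinXin

/-! ### Small spectral parameter and the intermediate value argument -/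

namespace JinXin

section SmallParameter

variable {c b₀ C κ M Λ K ν K' ν' : ℝ} {b n Y Y₁ Y₂ : ℝ → ℝ} {T U P E₁ E₂ E₃ : ℝ → ℝ → ℝ}

theorem exp_neg_mul_abs_le_one {κ : ℝ} (hκ : 0 < κ) (x : ℝ) : Real.exp (-κ * |x|) ≤ 1 :=
  Real.exp_le_one_iff.2 (by have := mul_nonneg hκ.le (abs_nonneg x); linarith)

/-- Grönwall's inequality extends the uniform decay from [0, ∞) to the left up to x₀. The loss on
the bounded interval goes into the constant, and the result supplies the dominating function on (x₀,
∞). -/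
theorem IsRightFamily.bound_Ici (hR : IsRightFamily c b n Λ K ν T U P) (hc : 0 < c) {B : ℝ}
    (hb : ∀ x, |b x| ≤ B) (x₀ : ℝ) : ∃ K₁, ∀ l ∈ Set.Icc 0 Λ, ∀ x, x₀ ≤ x →
      |T l x| ≤ K₁ * Real.exp (-ν * |x|) ∧ |U l x| ≤ K₁ * Real.exp (-ν * |x|) ∧
      |P l x| ≤ K₁ * Real.exp (-ν * |x|) := by
  set G := (Λ + 1) / c + 1 + (Λ + 1) + (B + c * Λ) with hG
  have hν := hR.rate_pos
  refine ⟨|K| * Real.exp (|G| * |x₀|) * Real.exp (ν * |x₀|), fun l hl x hx => ?_⟩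
  have h1 : ‖(T l x, U l x, P l x)‖ ≤
      |K| * Real.exp (|G| * |x₀|) * Real.exp (ν * |x₀|) * Real.exp (-ν * |x|) := by
    have key : ∀ y, 0 ≤ y → ‖(T l y, U l y, P l y)‖ ≤ |K| * Real.exp (-ν * y) := fun y hy => by
      obtain ⟨e1, e2, e3⟩ := hR.bound l hl y hy
      have hK : K * Real.exp (-ν * y) ≤ |K| * Real.exp (-ν * y) := by gcongr; exact le_abs_self K
      rw [Prod.norm_def, Prod.norm_def]
      exact max_le (e1.trans hK) (max_le (e2.trans hK) (e3.trans hK))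
    rcases le_total 0 x with h0 | h0
    · refine (key x h0).trans ?_
      rw [abs_of_nonneg h0]
      have e1 : 1 ≤ Real.exp (|G| * |x₀|) := Real.one_le_exp (by positivity)
      have e2 : 1 ≤ Real.exp (ν * |x₀|) := Real.one_le_exp (by positivity)
      gcongr
      have : |K| * 1 * 1 ≤ |K| * Real.exp (|G| * |x₀|) * Real.exp (ν * |x₀|) := by gcongr
      linarith
    · have hxx : |x| ≤ |x₀| := by
        rw [abs_of_nonpos h0, abs_of_nonpos (hx.trans h0)]; linarith
      refine ((hR.mode l hl).norm_le hc hb hl.1 hl.2 x 0).trans ?_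
      have h2 := key 0 le_rfl
      rw [mul_zero, Real.exp_zero, mul_one] at h2
      rw [← hG, sub_zero, mul_assoc (|K| * _), ← Real.exp_add]
      calc ‖(T l 0, U l 0, P l 0)‖ * Real.exp (G * |x|) ≤ |K| * Real.exp (|G| * |x₀|) := by
            gcongr
            exact le_abs_self G
        _ ≤ |K| * Real.exp (|G| * |x₀|) * Real.exp (ν * |x₀| + -ν * |x|) := by
            refine le_mul_of_one_le_right (by positivity) (Real.one_le_exp ?_)
            nlinarith
  exact ⟨(norm_fst_le (T l x, U l x, P l x)).trans h1,
    ((norm_fst_le (U l x, P l x)).trans (norm_snd_le (T l x, U l x, P l x))).trans h1,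
    ((norm_snd_le (U l x, P l x)).trans (norm_snd_le (T l x, U l x, P l x))).trans h1⟩

theorem tendsto_zero_right_of_continuousOn {f : ℝ → ℝ} (hΛ : 0 < Λ)
    (hf : ContinuousOn f (Set.Icc 0 Λ)) : Tendsto f (𝓝[>] 0) (𝓝 (f 0)) :=
  (hf 0 ⟨le_rfl, hΛ.le⟩).mono_left (nhdsWithin_le_of_mem (Icc_mem_nhdsGT hΛ))

/-- The weight in the derivative of the pairing. -/
theorem IsWaveProfile.integral_pairing (h : IsWaveProfile c b C κ M Y Y₁ Y₂) (x₀ : ℝ) (hc : 0 < c) :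
    0 < -((∫ x in Set.Iic x₀, ((Y₂ x - Y x) * Y₁ x - 2 * c * Y₁ x ^ 2)) +
      ∫ x in Set.Ioi x₀, ((Y₂ x - Y x) * Y₁ x - 2 * c * Y₁ x ^ 2)) := by
  have hC : 0 ≤ C := by
    have := (abs_nonneg _).trans (h.bound 0).1
    simpa using this
  have hint : ∀ f g : ℝ → ℝ, Continuous f → Continuous g →
      (∀ x, |f x| ≤ C * Real.exp (-κ * |x|)) → (∀ x, |g x| ≤ C * Real.exp (-κ * |x|)) →
      Integrable fun x => f x * g x := fun f g hf hg hfb hgb => by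
    refine ((integrable_exp_neg_mul_abs h.rate_pos).const_mul (C * C)).mono'
      (hf.mul hg).aestronglyMeasurable (Eventually.of_forall fun x => ?_)
    rw [Real.norm_eq_abs, abs_mul]
    have h1 : |g x| ≤ C := (hgb x).trans
      (mul_le_of_le_one_right hC (exp_neg_mul_abs_le_one h.rate_pos x))
    calc |f x| * |g x| ≤ (C * Real.exp (-κ * |x|)) * C :=
          mul_le_mul (hfb x) h1 (abs_nonneg _) (by positivity)
      _ = _ := by ring
  have i1 := hint Y₂ Y₁ h.continuous_trd h.continuous_snd (fun x => (h.bound x).2.2)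
    (fun x => (h.bound x).2.1)
  have i2 := hint Y Y₁ h.continuous_fst h.continuous_snd (fun x => (h.bound x).1)
    (fun x => (h.bound x).2.1)
  have i3 := hint Y₁ Y₁ h.continuous_snd h.continuous_snd (fun x => (h.bound x).2.1)
    (fun x => (h.bound x).2.1)
  have i12 : Integrable fun x => (Y₂ x - Y x) * Y₁ x :=
     (i1.sub i2).congr (Eventually.of_forall fun x => by simp only [Pi.sub_apply]; ring)
  have i3' : Integrable fun x => 2 * c * Y₁ x ^ 2 := by
    simpa only [sq] using i3.const_mul (2 * c)
  -- The integrand is the derivative of (Y₁² - Y²)/2, so only -2c ∫ Y₁² survives in the whole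
  -- integral.
  have hF : ∫ x, (Y₂ x - Y x) * Y₁ x = 0 := by
    obtain ⟨a0, a1, a2⟩ := h.tendsto_atTop
    obtain ⟨b0, b1, b2⟩ := h.tendsto_atBot
    rw [integral_of_hasDerivAt_of_tendsto (f := fun x => (Y₁ x ^ 2 - Y x ^ 2) / 2) (m := 0) (n := 0)
      (fun x => ((((h.deriv_snd x).pow 2).sub ((h.deriv_fst x).pow 2)).div_const 2).congr_deriv
        (by push_cast; ring)) i12 (by simpa using ((b1.pow 2).sub (b0.pow 2)).div_const 2)
      (by simpa using ((a1.pow 2).sub (a0.pow 2)).div_const 2), sub_zero]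
  have hpos : 0 < ∫ x, 2 * c * Y₁ x ^ 2 := by
    rw [integral_pos_iff_support_of_nonneg (fun x => by positivity) i3']
    have hcont : Continuous fun x => 2 * c * Y₁ x ^ 2 :=
      continuous_const.mul (h.continuous_snd.pow 2)
    refine hcont.isOpen_support.measure_pos volume ⟨-M, ?_⟩
    have := h.increasing (-M) le_rfl
    rw [Function.mem_support]
    positivity
  have hdiff : Integrable fun x => (Y₂ x - Y x) * Y₁ x - 2 * c * Y₁ x ^ 2 := i12.sub i3'
  rw [← setIntegral_union (Set.Iic_disjoint_Ioi le_rfl) measurableSet_Ioi hdiff.integrableOn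
    hdiff.integrableOn, Set.Iic_union_Ioi, setIntegral_univ, integral_sub i12 i3', hF]
  linarith

/-- The pairing of the families is negative for small positive spectral parameter. -/
theorem pairing_neg_of_small (hc : 0 < c) (hn : ∀ l, 0 ≤ l → IsStableRate c b₀ l (n l))
    (hR : IsRightFamily c b n Λ K ν T U P) (hL : IsLeftFamily c b n Λ K' ν' E₁ E₂ E₃) (hΛ : 0 < Λ)
    {B : ℝ} (hb : ∀ x, |b x| ≤ B) (hM : 0 ≤ M) (h : IsWaveProfile c b C κ M Y Y₁ Y₂) :
    ∀ᶠ l in 𝓝[>] 0, ∀ y, E₁ l y * T l y + E₂ l y * U l y + E₃ l y * P l y < 0 := by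
  obtain ⟨k, hk, hk0⟩ := hR.eq_at_zero hc hΛ.le hb h
  obtain ⟨k', hk', hk0'⟩ := hL.eq_at_zero hc hn hΛ.le h
  set x₀ := -M - 1 with hx₀
  have hx₀M : x₀ < -M := by linarith
  have hx₀0 : x₀ ≤ 0 := by linarith
  have hY : 0 < Y₁ x₀ := h.increasing x₀ hx₀M.le
  have hC : 0 ≤ C := by
    have := (abs_nonneg _).trans (h.bound 0).1
    simpa using this
  have hYb : ∀ x, |Y x| ≤ C ∧ |Y₁ x| ≤ C ∧ |Y₂ x| ≤ C := fun x =>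
    have h1 : C * Real.exp (-κ * |x|) ≤ C :=
      mul_le_of_le_one_right hC (exp_neg_mul_abs_le_one h.rate_pos x)
    ⟨(h.bound x).1.trans h1, (h.bound x).2.1.trans h1, (h.bound x).2.2.trans h1⟩
  obtain ⟨K₁, hK₁⟩ := hR.bound_Ici hc hb x₀
  have hν := hR.rate_pos
  have hν' := hL.rate_pos
  have hev : ∀ᶠ l in 𝓝[>] (0 : ℝ), l ∈ Set.Icc 0 Λ := Icc_mem_nhdsGT hΛ
  have hTl := fun x => tendsto_zero_right_of_continuousOn hΛ (hR.cont x).1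
  have hUl := fun x => tendsto_zero_right_of_continuousOn hΛ (hR.cont x).2.1
  have hPl := fun x => tendsto_zero_right_of_continuousOn hΛ (hR.cont x).2.2
  have hE1l := fun x => tendsto_zero_right_of_continuousOn hΛ (hL.cont x).1
  have hE2l := fun x => tendsto_zero_right_of_continuousOn hΛ (hL.cont x).2.1
  have hE3l := fun x => tendsto_zero_right_of_continuousOn hΛ (hL.cont x).2.2
  have hTc : ∀ l ∈ Set.Icc 0 Λ, Continuous (T l) := fun l hl =>
    continuous_iff_continuousAt.2 fun x => ((hR.mode l hl).deriv_fst x).continuousAt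
  have hUc : ∀ l ∈ Set.Icc 0 Λ, Continuous (U l) := fun l hl =>
    continuous_iff_continuousAt.2 fun x => ((hR.mode l hl).deriv_snd x).continuousAt
  have hE1c : ∀ l ∈ Set.Icc 0 Λ, Continuous (E₁ l) := fun l hl =>
    continuous_iff_continuousAt.2 fun x => ((hL.mode l hl).deriv_fst x).continuousAt
  have hE3c : ∀ l ∈ Set.Icc 0 Λ, Continuous (E₃ l) := fun l hl =>
    continuous_iff_continuousAt.2 fun x => ((hL.mode l hl).deriv_trd x).continuousAt
  have hYc := h.continuous_fst
  have hY1c := h.continuous_snd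
  have hY2c := h.continuous_trd
  -- Densities of the pairings with solutions at parameter 0: l F₁ is the derivative of the pairing
  -- of the right mode with the explicit adjoint solution (c Y₂ - c Y, -Y, Y₁), and -l F₂ that of
  -- the left adjoint mode with the translation mode.
  let F₁ : ℝ → ℝ → ℝ := fun l x => (Y₂ x - Y x) * T l x + Y₁ x * (U l x - c * T l x)
  let F₂ : ℝ → ℝ → ℝ := fun l x => E₁ l x * Y₁ x / c - 2 * c * (E₃ l x * Y₁ x)
  have hF₁b : ∀ l ∈ Set.Icc 0 Λ, ∀ x ∈ Set.Ioi x₀,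
      |F₁ l x| ≤ (2 * C + C * (1 + c)) * K₁ * Real.exp (-ν * |x|) := by
    intro l hl x hx
    obtain ⟨e1, e2, -⟩ := hK₁ l hl x (le_of_lt hx)
    obtain ⟨y0, y1, y2⟩ := hYb x
    set R := K₁ * Real.exp (-ν * |x|) with hRdef
    have hR0 : 0 ≤ R := (abs_nonneg _).trans e1
    have a1 : |(Y₂ x - Y x) * T l x| ≤ 2 * C * R := by
      rw [abs_mul]
      exact mul_le_mul ((abs_sub _ _).trans (by linarith)) e1 (abs_nonneg _) (by positivity)
    have a2 : |Y₁ x * (U l x - c * T l x)| ≤ C * ((1 + c) * R) := by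
      rw [abs_mul]
      refine mul_le_mul y1 ((abs_sub _ _).trans ?_) (abs_nonneg _) hC
      rw [abs_mul, abs_of_pos hc]
      nlinarith
    refine (abs_add_le _ _).trans ?_
    rw [mul_assoc, ← hRdef]
    linarith
  have hF₂b : ∀ l ∈ Set.Icc 0 Λ, ∀ x ∈ Set.Iic x₀,
      |F₂ l x| ≤ (C / c + 2 * c * C) * K' * Real.exp (-ν' * |x|) := by
    intro l hl x hx
    have hx0 : x ≤ 0 := (Set.mem_Iic.1 hx).trans hx₀0
    obtain ⟨e1, -, e3⟩ := hL.bound l hl x hx0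
    obtain ⟨y0, y1, y2⟩ := hYb x
    rw [abs_of_nonpos hx0, neg_mul_neg]
    set R := K' * Real.exp (ν' * x) with hRdef
    have hR0 : 0 ≤ R := (abs_nonneg _).trans e1
    have a1 : |E₁ l x * Y₁ x / c| ≤ R * C / c := by
      rw [abs_div, abs_of_pos hc, abs_mul]
      gcongr
    have a2 : |2 * c * (E₃ l x * Y₁ x)| ≤ 2 * c * (R * C) := by
      rw [abs_mul, abs_of_pos (by positivity : 0 < 2 * c), abs_mul]
      gcongr
    refine (abs_sub _ _).trans ((add_le_add a1 a2).trans (le_of_eq ?_))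
    rw [hRdef]
    ring
  have hint : ∀ (f : ℝ → ℝ) (S : Set ℝ) (D μ : ℝ), MeasurableSet S → 0 < μ → Continuous f →
      (∀ x ∈ S, |f x| ≤ D * Real.exp (-μ * |x|)) → IntegrableOn f S :=
    fun f S D μ hS hμ hf hfb => by
      refine (((integrable_exp_neg_mul_abs hμ).const_mul D).integrableOn (s := S)).mono'
        hf.aestronglyMeasurable ?_
      exact (ae_restrict_iff' hS).2 (Eventually.of_forall hfb)
  have hF₁c : ∀ l ∈ Set.Icc 0 Λ, Continuous (F₁ l) := fun l hl =>
    ((hY2c.sub hYc).mul (hTc l hl)).add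
      (hY1c.mul ((hUc l hl).sub (continuous_const.mul (hTc l hl))))
  have hF₂c : ∀ l ∈ Set.Icc 0 Λ, Continuous (F₂ l) := fun l hl =>
    (((hE1c l hl).mul hY1c).div_const c).sub
      (continuous_const.mul ((hE3c l hl).mul hY1c))
  have hDCT : ∀ (F : ℝ → ℝ → ℝ) (S : Set ℝ) (D μ : ℝ), MeasurableSet S → 0 < μ →
      (∀ l ∈ Set.Icc 0 Λ, Continuous (F l)) →
      (∀ l ∈ Set.Icc 0 Λ, ∀ x ∈ S, |F l x| ≤ D * Real.exp (-μ * |x|)) →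
      (∀ x, Tendsto (fun l => F l x) (𝓝[>] 0) (𝓝 (F 0 x))) →
      Tendsto (fun l => ∫ x in S, F l x) (𝓝[>] 0) (𝓝 (∫ x in S, F 0 x)) := by
    intro F S D μ hS hμ hFc hFb hF
    refine tendsto_integral_filter_of_dominated_convergence (fun x => D * Real.exp (-μ * |x|))
      ?_ ?_ ((integrable_exp_neg_mul_abs hμ).const_mul D).integrableOn
      (Eventually.of_forall fun x => hF x)
    · filter_upwards [hev] with l hl using (hFc l hl).aestronglyMeasurable
    · filter_upwards [hev] with l hl
      exact (ae_restrict_iff' hS).2 (Eventually.of_forall fun x hx => hFb l hl x hx)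
  have lim1 := hDCT F₁ (Set.Ioi x₀) _ ν measurableSet_Ioi hν hF₁c hF₁b fun x =>
    ((hTl x).const_mul _).add (((hUl x).sub ((hTl x).const_mul c)).const_mul _)
  have lim2 := hDCT F₂ (Set.Iic x₀) _ ν' measurableSet_Iic hν' hF₂c hF₂b fun x =>
    (((hE1l x).mul_const _).div_const c).sub (((hE3l x).mul_const _).const_mul _)
  have lim3 := hDCT T (Set.Ioi x₀) K₁ ν measurableSet_Ioi hν hTc
    (fun l hl x hx => (hK₁ l hl x (le_of_lt hx)).1) hTl
  set J := (∫ x in Set.Iic x₀, ((Y₂ x - Y x) * Y₁ x - 2 * c * Y₁ x ^ 2)) +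
      ∫ x in Set.Ioi x₀, ((Y₂ x - Y x) * Y₁ x - 2 * c * Y₁ x ^ 2) with hJ
  have hJneg : 0 < -J := h.integral_pairing x₀ hc
  have val1 : ∫ x in Set.Ioi x₀, F₁ 0 x =
      k * ∫ x in Set.Ioi x₀, ((Y₂ x - Y x) * Y₁ x - 2 * c * Y₁ x ^ 2) := by
    rw [← integral_const_mul]
    refine setIntegral_congr_fun measurableSet_Ioi fun x _ => ?_
    simp only [F₁]
    rw [(hk0 x).1, (hk0 x).2.1]
    ring
  have val2 : ∫ x in Set.Iic x₀, F₂ 0 x =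
      k' * ∫ x in Set.Iic x₀, ((Y₂ x - Y x) * Y₁ x - 2 * c * Y₁ x ^ 2) := by
    rw [← integral_const_mul]
    refine setIntegral_congr_fun measurableSet_Iic fun x hx => ?_
    obtain ⟨e1, -, e3⟩ := hk0' x (lt_of_le_of_lt hx hx₀M)
    simp only [F₂]
    rw [e1, e3]
    field_simp
  -- This expression turns out to be the pairing at x₀ divided by l. In the limit the coefficient of
  -- the middle integral vanishes, since E₂ = -k' Y and E₃ = k' Y₁ at l = 0, while the other two
  -- terms give the two halves of J.
  have lim : Tendsto (fun l => -(T l x₀ / Y₁ x₀ * ∫ x in Set.Iic x₀, F₂ l x) -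
      (E₂ l x₀ + E₃ l x₀ * Y x₀ / Y₁ x₀) * (∫ x in Set.Ioi x₀, T l x) -
      E₃ l x₀ / Y₁ x₀ * ∫ x in Set.Ioi x₀, F₁ l x) (𝓝[>] 0) (𝓝 (k * k' * -J)) := by
    have := ((((hTl x₀).div_const (Y₁ x₀)).mul lim2).neg.sub
      (((hE2l x₀).add (((hE3l x₀).mul_const (Y x₀)).div_const (Y₁ x₀))).mul lim3)).sub
      (((hE3l x₀).div_const (Y₁ x₀)).mul lim1)
    convert this using 2
    rw [val1, val2, (hk0 x₀).1, (hk0' x₀ hx₀M).2.1, (hk0' x₀ hx₀M).2.2, hJ]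
    generalize (∫ x in Set.Iic x₀, ((Y₂ x - Y x) * Y₁ x - 2 * c * Y₁ x ^ 2)) = I₁
    generalize (∫ x in Set.Ioi x₀, ((Y₂ x - Y x) * Y₁ x - 2 * c * Y₁ x ^ 2)) = I₂
    field_simp
    ring
  have hneg : k * k' * -J < 0 :=
    mul_neg_of_neg_of_pos (mul_neg_of_neg_of_pos hk hk') hJneg
  filter_upwards [lim.eventually_lt_const hneg, hev, self_mem_nhdsWithin] with l hl hlmem hl0 y
  have hl0' : 0 < l := hl0
  have hmode := hR.mode l hlmem
  have hadj := hL.mode l hlmem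
  obtain ⟨t1, t2, t3⟩ := hR.tendsto hlmem
  obtain ⟨s1, s2, s3⟩ := hL.tendsto hlmem
  obtain ⟨y0, y1, y2⟩ := h.tendsto_atTop
  obtain ⟨z0, z1, z2⟩ := h.tendsto_atBot
  -- The next three quantities vanish at l = 0. Each tends to 0 at one end, and integrating its
  -- derivative from that end to x₀ exhibits the factor l.
  have hφ : U l x₀ + c * T l x₀ = -(l * ∫ x in Set.Ioi x₀, T l x) := by
    have := integral_Ioi_of_hasDerivAt_of_tendsto' (f := fun x => U l x + c * T l x)
      (f' := fun x => l * T l x) (a := x₀) (m := 0)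
      (fun x _ => ((hmode.deriv_snd x).add ((hmode.deriv_fst x).const_mul c)).congr_deriv
        (by field_simp; ring))
      ((hint (T l) _ K₁ ν measurableSet_Ioi hν (hTc l hlmem)
        (fun x hx => (hK₁ l hlmem x (le_of_lt hx)).1)).const_mul l)
      (by simpa using t2.add (t1.const_mul c))
    rw [integral_const_mul] at this
    linarith
  have hζ : (c * Y₂ x₀ - c * Y x₀) * T l x₀ - Y x₀ * U l x₀ + Y₁ x₀ * P l x₀ =
      -(l * ∫ x in Set.Ioi x₀, F₁ l x) := by
    have := integral_Ioi_of_hasDerivAt_of_tendsto'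
      (f := fun x => (c * Y₂ x - c * Y x) * T l x - Y x * U l x + Y₁ x * P l x)
      (f' := fun x => l * F₁ l x) (a := x₀) (m := 0)
      (fun x _ => by
        refine (((((((h.deriv_trd x).const_mul c).sub ((h.deriv_fst x).const_mul c)).mul
          (hmode.deriv_fst x)).sub ((h.deriv_fst x).mul (hmode.deriv_snd x))).add
          ((h.deriv_snd x).mul (hmode.deriv_trd x)))).congr_deriv ?_
        simp only [F₁, Pi.sub_apply]
        field_simp
        ring)
      ((hint (F₁ l) _ _ ν measurableSet_Ioi hν (hF₁c l hlmem) (hF₁b l hlmem)).const_mul l)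
      (by simpa using (((((y2.const_mul c).sub (y0.const_mul c)).mul t1).sub (y0.mul t2)).add
        (y1.mul t3)))
    rw [integral_const_mul] at this
    linarith
  have hη : E₁ l x₀ * Y₁ x₀ - c * E₂ l x₀ * Y₁ x₀ - c * E₃ l x₀ * Y₂ x₀ =
      -(l * ∫ x in Set.Iic x₀, F₂ l x) := by
    have := integral_Iic_of_hasDerivAt_of_tendsto'
      (f := fun x => E₁ l x * Y₁ x + E₂ l x * (-c * Y₁ x) + E₃ l x * (-c * Y₂ x))
      (f' := fun x => -l * F₂ l x) (a := x₀) (m := 0)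
      (fun x _ => (hasDerivAt_pairing hadj (h.mode hc) x).congr_deriv (by simp only [F₂]; ring))
      ((hint (F₂ l) _ _ ν' measurableSet_Iic hν' (hF₂c l hlmem) (hF₂b l hlmem)).const_mul (-l))
      (by simpa using (((s1.mul z1).add (s2.mul (z1.const_mul (-c)))).add
        (s3.mul (z2.const_mul (-c)))))
    rw [integral_const_mul] at this
    linarith
  rw [pairing_eq hadj hmode y x₀]
  have hid : E₁ l x₀ * T l x₀ + E₂ l x₀ * U l x₀ + E₃ l x₀ * P l x₀ =
      l * (-(T l x₀ / Y₁ x₀ * ∫ x in Set.Iic x₀, F₂ l x) -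
      (E₂ l x₀ + E₃ l x₀ * Y x₀ / Y₁ x₀) * (∫ x in Set.Ioi x₀, T l x) -
      E₃ l x₀ / Y₁ x₀ * ∫ x in Set.Ioi x₀, F₁ l x) := by
    -- The pairing is expanded in the three quantities just computed, which is possible because Y₁
    -- x₀ ≠ 0.
    have e1 : E₁ l x₀ * T l x₀ + E₂ l x₀ * U l x₀ + E₃ l x₀ * P l x₀ =
        T l x₀ / Y₁ x₀ * (E₁ l x₀ * Y₁ x₀ - c * E₂ l x₀ * Y₁ x₀ - c * E₃ l x₀ * Y₂ x₀) +
        (E₂ l x₀ + E₃ l x₀ * Y x₀ / Y₁ x₀) * (U l x₀ + c * T l x₀) +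
        E₃ l x₀ / Y₁ x₀ *
          ((c * Y₂ x₀ - c * Y x₀) * T l x₀ - Y x₀ * U l x₀ + Y₁ x₀ * P l x₀) := by
      field_simp
      ring
    rw [e1, hφ, hζ, hη]
    ring
  rw [hid]
  exact mul_neg_of_pos_of_neg hl0' hl

end SmallParameter

/-- There is a positive spectral parameter for which the decaying solution on the right
half-line pairs to zero with the decaying adjoint solution on the left half-line. -/
theorem exists_pairing_eq_zero {c b₀ C κ C' κ' M : ℝ} {b Y Y₁ Y₂ : ℝ → ℝ} (hc : 0 < c)
    (hb₀ : b₀ < c) (hb : Continuous b) (hκ : 0 < κ)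
    (hbC : ∀ x, |b x - b₀| ≤ C * Real.exp (-κ * |x|)) (hM : 0 ≤ M)
    (h : IsWaveProfile c b C' κ' M Y Y₁ Y₂) :
    ∃ (l : ℝ) (τ u p η₁ η₂ η₃ : ℝ → ℝ), 0 < l ∧ IsRealMode c b l τ u p ∧
      IsRealAdjointMode c b l η₁ η₂ η₃ ∧
      (∃ K ν, 0 < ν ∧ ∀ x, 0 ≤ x → |τ x| ≤ K * Real.exp (-ν * x) ∧ |u x| ≤ K * Real.exp (-ν * x) ∧
        |p x| ≤ K * Real.exp (-ν * x)) ∧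
      (∃ x, τ x ≠ 0) ∧ (∃ x, η₃ x ≠ 0) ∧ Tendsto η₁ atBot (𝓝 0) ∧ Tendsto η₂ atBot (𝓝 0) ∧
      Tendsto η₃ atBot (𝓝 0) ∧ ∀ x, η₁ x * τ x + η₂ x * u x + η₃ x * p x = 0 := by
  have hC : 0 ≤ C := by
    have := (abs_nonneg _).trans (hbC 0)
    simpa using this
  have hbB : ∀ x, |b x| ≤ |b₀| + C := fun x => by
    have h1 := (hbC x).trans (mul_le_of_le_one_right hC (exp_neg_mul_abs_le_one hκ x))
    have := abs_sub_abs_le_abs_sub (b x) b₀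
    linarith
  -- The choice guarantees b x < cΛ for all x and b₀ < cΛ, as positivity of the pairing at Λ
  -- requires.
  set Λ := (|b₀| + C + 1) / c with hΛdef
  have hΛ : 0 < Λ := by positivity
  have hcΛ : c * Λ = |b₀| + C + 1 := by rw [hΛdef]; field_simp
  obtain ⟨n, hnc, hn⟩ := exists_continuous_stableRate hc hb₀
  have hnc' : ContinuousOn n (Set.Icc 0 Λ) := hnc.mono fun l hl => hl.1
  obtain ⟨T, U, P, K, ν, hR⟩ := exists_rightFamily hc hnc' hn hb hκ hbC
  obtain ⟨E₁, E₂, E₃, K', ν', hL⟩ := exists_leftFamily hc hnc' hn hb hκ hbC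
  have hlarge := pairing_pos_of_large hc hn hR hL hΛ
    (fun x => by linarith [hbB x, le_abs_self (b x)]) (by linarith [le_abs_self b₀]) 0
  obtain ⟨ε, hε, hεmem, hε0⟩ := ((pairing_neg_of_small hc hn hR hL hΛ hbB hM h).and
    ((show ∀ᶠ l in 𝓝[>] (0 : ℝ), l ∈ Set.Icc 0 Λ from Icc_mem_nhdsGT hΛ).and self_mem_nhdsWithin)).exists
  have hε0' : 0 < ε := hε0
  have hcont : ContinuousOn (fun l => E₁ l 0 * T l 0 + E₂ l 0 * U l 0 + E₃ l 0 * P l 0)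
      (Set.Icc ε Λ) := by
    have hsub : Set.Icc ε Λ ⊆ Set.Icc 0 Λ := Set.Icc_subset_Icc_left hε0'.le
    obtain ⟨r1, r2, r3⟩ := hR.cont 0
    obtain ⟨l1, l2, l3⟩ := hL.cont 0
    exact (((l1.mul r1).add (l2.mul r2)).add (l3.mul r3)).mono hsub
  obtain ⟨l, hl, hl0⟩ := intermediate_value_Icc hεmem.2 hcont ⟨(hε 0).le, hlarge.le⟩
  have hlpos : 0 < l := hε0'.trans_le hl.1
  have hlmem : l ∈ Set.Icc 0 Λ := ⟨hlpos.le, hl.2⟩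
  obtain ⟨s1, s2, s3⟩ := hL.tendsto hlmem
  refine ⟨l, T l, U l, P l, E₁ l, E₂ l, E₃ l, hlpos, hR.mode l hlmem, hL.mode l hlmem,
    ⟨K, ν, hR.rate_pos, hR.bound l hlmem⟩, ?_, ?_, s1, s2, s3, fun x => ?_⟩
  · obtain ⟨x, hx⟩ := (pos_of_tendsto_exp_mul (hR.lim l hlmem).1 one_pos).exists
    exact ⟨x, hx.ne'⟩
  · obtain ⟨x, hx⟩ := (pos_of_tendsto_exp_mul (hL.lim l hlmem).2.2
      (leftCoeff_pos hc hlpos.le (hn l hlpos.le).pos)).exists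
    exact ⟨x, hx.ne'⟩
  · rw [pairing_eq (hL.mode l hlmem) (hR.mode l hlmem) x 0]
    exact hl0

end JinXin

/-! ### Localization at both ends and reflection -/

namespace JinXin

theorem expAsymptotic_evansMatrix {cs c b₀ C κ : ℝ} {b : ℝ → ℝ} (hb : Continuous b) (hκ : 0 < κ)
    (hbC : ∀ x, |b x - b₀| ≤ C * Real.exp (-κ * |x|)) (l : ℂ) :
    ExpAsymptotic (fun x => evansMatrix cs c (b x) l) (evansMatrix cs c b₀ l) C κ where
  cont := by
    refine continuous_matrix fun i j => ?_
    fin_cases i <;> fin_cases j <;> simp [evansMatrix] <;> fun_prop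
  rate_pos := hκ
  decay x i j := by
    have h0 : 0 ≤ C * Real.exp (-κ * |x|) := (abs_nonneg _).trans (hbC x)
    have h1 : ‖(b x : ℂ) - b₀‖ ≤ C * Real.exp (-κ * |x|) := by
      rw [← Complex.ofReal_sub, Complex.norm_real]; exact hbC x
    fin_cases i <;> fin_cases j <;> simp [evansMatrix]
    all_goals first | simpa using h0 | simpa using h1

open scoped Matrix.Norms.Operator

section Left

variable {A : ℝ → Matrix (Fin 3) (Fin 3) ℂ} {A₀ V V' N : Matrix (Fin 3) (Fin 3) ℂ} {C κ : ℝ}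
  {k : ℕ} {d : Fin 3 → ℂ} {δ r : ℝ} {Pl : ℝ → Matrix (Fin 3) (Fin 3) ℂ}

/-- Reversing x about x₀ turns the growing modes into decaying ones, to which `triangular_decay`
applies. -/
theorem IsBlockForm.decay_atBot (h : IsBlockForm A₀ k d δ V V' N) (hr : 0 < r)
    (hd : ∀ j, r ≤ |(d j).re|) (hδ : δ ≤ r / 12) {Z : ℝ → Fin 3 → ℂ}
    (hZ : ∀ x, HasDerivAt Z ((Matrix.diagonal d + N) *ᵥ Z x) x) {x₀ : ℝ}
    (h0 : ∀ i : Fin 3, k ≤ i.val → Z x₀ i = 0) :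
    ∃ C, ∀ x ≤ x₀, ‖Z x‖ ≤ C * Real.exp (r / 2 * x) := by
  obtain ⟨C, hC⟩ := triangular_decay (T := {j : Fin 3 | j.val < k}) (d := -d) (N := -N)
    (Y := fun x => Z (x₀ - x)) hr (fun j hj => by
      have h1 := hd j
      rw [abs_of_pos (h.pos j hj)] at h1
      simpa using h1) hδ (fun i j => by simpa using h.small i j)
    (fun i j hij => (h.upper i j (by simpa using hij)).2) (fun x => by
      refine ((hZ (x₀ - x)).scomp x ((hasDerivAt_id x).const_sub x₀)).congr_deriv ?_
      rw [neg_one_smul, ← Matrix.neg_mulVec, neg_add, Matrix.diagonal_neg]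
      rfl)
    (fun i hi => by simpa using h0 i (not_lt.1 hi))
  refine ⟨C * Real.exp (-(r / 2) * x₀), fun x hx => ?_⟩
  have := hC (x₀ - x) (by linarith)
  rw [sub_sub_cancel] at this
  refine this.trans (le_of_eq ?_)
  rw [mul_assoc, ← Real.exp_add]
  ring_nf

theorem IsConjugator.exists_bound_atBot (hl : IsConjugator A A₀ atBot Pl) :
    ∃ B, 0 ≤ B ∧ ∀ᶠ x in atBot, ‖Pl x‖ ≤ B :=
  ⟨‖(1 : Matrix (Fin 3) (Fin 3) ℂ)‖ + 1, by positivity,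
    hl.lim.norm.eventually_le_const (lt_add_one _)⟩

/-- A solution annihilated by a nonzero adjoint solution that tends to zero at `-∞` decays
exponentially at `-∞` if there is only one decaying mode. -/
theorem exists_decay_atBot_of_pairing (hA : ExpAsymptotic A A₀ C κ)
    (h : IsBlockForm A₀ 2 d δ V V' N) (hl : IsConjugator A A₀ atBot Pl) (hr : 0 < r)
    (hd : ∀ j, r ≤ |(d j).re|) (hδ : δ ≤ r / 12) {W η : ℝ → Fin 3 → ℂ}
    (hW : ∀ x, HasDerivAt W (A x *ᵥ W x) x)
    (hη : ∀ x i, HasDerivAt (fun x => η x i) (-(η x ᵥ* A x) i) x)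
    (hη0 : ∀ i, Tendsto (fun x => η x i) atBot (𝓝 0)) {x₀ : ℝ} (hx₀ : η x₀ ≠ 0)
    (hpair : η x₀ ⬝ᵥ W x₀ = 0) :
    ∃ C, ∀ᶠ x in atBot, ‖W x‖ ≤ C * Real.exp (r / 2 * x) := by
  obtain ⟨B, hB0, hB⟩ := hl.exists_bound_atBot
  obtain ⟨Z, hZ, hWZ⟩ := exists_triangular_coordinates hA h hl hW
  have hdecay : ∀ (Z : ℝ → Fin 3 → ℂ) (x₁ : ℝ), (∃ C, ∀ x ≤ x₁, ‖Z x‖ ≤ C * Real.exp (r / 2 * x)) →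
      ∃ C, ∀ᶠ x in atBot, ‖Pl x *ᵥ (V *ᵥ Z x)‖ ≤ C * Real.exp (r / 2 * x) := by
    rintro Z x₁ ⟨C, hC⟩
    refine ⟨B * (‖V‖ * C), ?_⟩
    filter_upwards [hB, eventually_le_atBot x₁] with x hx hx1
    calc ‖Pl x *ᵥ (V *ᵥ Z x)‖ ≤ ‖Pl x‖ * (‖V‖ * ‖Z x‖) :=
          (Matrix.linfty_opNorm_mulVec _ _).trans (by
              gcongr; exact Matrix.linfty_opNorm_mulVec _ _)
      _ ≤ B * (‖V‖ * (C * Real.exp (r / 2 * x))) := by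
          gcongr
          exact hC x hx1
      _ = _ := by ring
  -- Solutions built from growing modes decay at -∞, where the adjoint solution tends to 0. Their
  -- constant pairing is therefore zero: η annihilates the two-dimensional space of solutions
  -- decaying at -∞.
  have hξ : ∀ α : Fin 3 → ℂ, (∀ i : Fin 3, 2 ≤ i.val → α i = 0) →
      η x₀ ⬝ᵥ (Pl x₀ *ᵥ (V *ᵥ α)) = 0 := by
    intro α hα
    have hVinv : V' * A₀ = (Matrix.diagonal d + N) * V' := by
      calc V' * A₀ = V' * (A₀ * V) * V' := by
            simp only [Matrix.mul_assoc, h.mul_inv, Matrix.mul_one]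
        _ = _ := by rw [h.conj, ← Matrix.mul_assoc, h.inv_mul, Matrix.one_mul]
    let E : ℝ → Fin 3 → ℂ := fun x => NormedSpace.exp ((x - x₀) • A₀) *ᵥ (V *ᵥ α)
    have hE : ∀ x, HasDerivAt E (A₀ *ᵥ E x) x := fun x => by
      have := (hasDerivAt_exp_smul_mulVec A₀ (V *ᵥ α) (x - x₀)).scomp x
        ((hasDerivAt_id x).sub_const x₀)
      rw [one_smul] at this
      exact this
    have hE0 : E x₀ = V *ᵥ α := by
      simp only [E, sub_self, zero_smul, NormedSpace.exp_zero, Matrix.one_mulVec]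
    have hY : ∀ x, HasDerivAt (fun x => V' *ᵥ E x)
        ((Matrix.diagonal d + N) *ᵥ (V' *ᵥ E x)) x := fun x => by
      have h2 : HasDerivAt (fun x => V' *ᵥ E x) (V' *ᵥ (A₀ *ᵥ E x)) x :=
        ((Matrix.mulVecLin V').restrictScalars ℝ).toContinuousLinearMap.hasFDerivAt.comp_hasDerivAt
          x (hE x)
      refine h2.congr_deriv ?_
      simp only [Matrix.mulVec_mulVec, hVinv]
    have hF : ∀ x, HasDerivAt (fun x => Pl x *ᵥ E x) (A x *ᵥ (Pl x *ᵥ E x)) x := fun x => by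
      simpa using conjugator_hasDerivAt (hl.deriv x) (hE x)
    have hVE : ∀ x, V *ᵥ (V' *ᵥ E x) = E x := fun x => by
      rw [Matrix.mulVec_mulVec, h.mul_inv, Matrix.one_mulVec]
    obtain ⟨C₁, hC₁⟩ := hdecay _ x₀ (h.decay_atBot hr hd hδ hY (x₀ := x₀) (fun i hi => by
      rw [hE0, Matrix.mulVec_mulVec, h.inv_mul, Matrix.one_mulVec]
      exact hα i hi))
    simp only [hVE] at hC₁
    have hlim : Tendsto (fun x => Pl x *ᵥ E x) atBot (𝓝 0) := by
      refine squeeze_zero_norm' hC₁ ?_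
      have := (Real.tendsto_exp_atBot.comp (tendsto_id.const_mul_atBot (half_pos hr))).const_mul C₁
      simpa using this
    have hconst : ∀ x, HasDerivAt (fun x => η x ⬝ᵥ (Pl x *ᵥ E x)) 0 x := by
      intro x
      have h1 : HasDerivAt (fun x => η x ⬝ᵥ (Pl x *ᵥ E x))
          (∑ i, (-(η x ᵥ* A x) i * (Pl x *ᵥ E x) i + η x i * (A x *ᵥ (Pl x *ᵥ E x)) i)) x :=
        HasDerivAt.fun_sum fun i _ => (hη x i).mul (hasDerivAt_pi.1 (hF x) i)
      refine h1.congr_deriv ?_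
      rw [Finset.sum_add_distrib]
      have h2 : ∑ i, η x i * (A x *ᵥ (Pl x *ᵥ E x)) i = (η x ᵥ* A x) ⬝ᵥ (Pl x *ᵥ E x) := by
        rw [← Matrix.dotProduct_mulVec]; rfl
      rw [h2]
      simp [dotProduct, Fin.sum_univ_three]
      ring
    have hlim0 : Tendsto (fun x => η x ⬝ᵥ (Pl x *ᵥ E x)) atBot (𝓝 0) := by
      have : Tendsto (fun x => ∑ i, η x i * (Pl x *ᵥ E x) i) atBot (𝓝 (∑ i : Fin 3, 0 * 0)) :=
        tendsto_finsetSum _ fun i _ => (hη0 i).mul ((continuous_apply i).tendsto' _ _ rfl |>.comp hlim)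
      simp only [mul_zero, Finset.sum_const_zero] at this
      exact this
    have hc : (fun x => η x ⬝ᵥ (Pl x *ᵥ E x)) = fun _ => η x₀ ⬝ᵥ (Pl x₀ *ᵥ E x₀) :=
      funext fun y => is_const_of_deriv_eq_zero (fun z => (hconst z).differentiableAt)
        (fun z => (hconst z).deriv) y x₀
    rw [hc] at hlim0
    have := tendsto_nhds_unique tendsto_const_nhds hlim0
    rwa [hE0] at this
  let ξ : Fin 3 → ℂ := η x₀ ᵥ* (Pl x₀ * V)
  have hξdot : ∀ α, η x₀ ⬝ᵥ (Pl x₀ *ᵥ (V *ᵥ α)) = ξ ⬝ᵥ α := fun α => by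
    rw [Matrix.mulVec_mulVec, Matrix.dotProduct_mulVec]
  have hξ0 : ξ 0 = 0 := by
    have := hξ (Pi.single 0 1) (fun i hi => by
      rw [Pi.single_eq_of_ne]; rintro rfl; simp at hi)
    rw [hξdot] at this
    simpa using this
  have hξ1 : ξ 1 = 0 := by
    have := hξ (Pi.single 1 1) (fun i hi => by
      rw [Pi.single_eq_of_ne]; rintro rfl; simp at hi)
    rw [hξdot] at this
    simpa using this
  -- In mode coordinates η is nonzero and supported on the last one, so it detects exactly the
  -- single mode that blows up at -∞.
  have hξ2 : ξ 2 ≠ 0 := by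
    intro h2
    have hξz : ξ = 0 := by ext i; fin_cases i <;> simp [hξ0, hξ1, h2]
    apply hx₀
    obtain ⟨u, hu⟩ := hl.isUnit x₀
    have h3 : ξ ᵥ* (V' * (↑u⁻¹ : Matrix (Fin 3) (Fin 3) ℂ)) = η x₀ := by
      simp only [ξ, Matrix.vecMul_vecMul, ← hu]
      rw [Matrix.mul_assoc, ← Matrix.mul_assoc V, h.mul_inv, Matrix.one_mul, Units.mul_inv,
        Matrix.vecMul_one]
    rw [← h3, hξz, Matrix.zero_vecMul]
  have hZ2 : Z x₀ 2 = 0 := by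
    rw [hWZ x₀, hξdot] at hpair
    simp only [dotProduct, Fin.sum_univ_three, hξ0, hξ1] at hpair
    simpa [hξ2] using hpair
  have := hdecay Z x₀ (h.decay_atBot hr hd hδ hZ (x₀ := x₀) (fun i hi => by
    have : i = 2 := by omega
    rw [this, hZ2]))
  simpa only [← hWZ] using this

end Left

/-- On the compact interval between the two asymptotic regions continuity suffices; the smaller of
the two rates serves everywhere. -/
theorem exists_exp_bound {E : Type*} [NormedAddCommGroup E] {W : ℝ → E} (hW : Continuous W)
    {C C' α β : ℝ} (hα : 0 < α) (hβ : 0 < β) (ht : ∀ᶠ x in atTop, ‖W x‖ ≤ C * Real.exp (-α * x))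
    (hb : ∀ᶠ x in atBot, ‖W x‖ ≤ C' * Real.exp (β * x)) :
    ∃ K κ, 0 < κ ∧ ∀ x, ‖W x‖ ≤ K * Real.exp (-κ * |x|) := by
  obtain ⟨X, hX⟩ := eventually_atTop.1 ht
  obtain ⟨X', hX'⟩ := eventually_atBot.1 hb
  set κ := min α β with hκ
  obtain ⟨B, hB⟩ := (isCompact_Icc (a := min X' 0) (b := max X 0)).bddAbove_image
    (f := fun x => ‖W x‖ * Real.exp (κ * |x|)) (by fun_prop)
  have hle : ∀ {y z K : ℝ}, y ≤ z * Real.exp (-K) → 0 ≤ y → 0 ≤ z := fun {y z K} h h0 =>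
    nonneg_of_mul_nonneg_left (h0.trans h) (Real.exp_pos _)
  refine ⟨max B (max C C'), κ, lt_min hα hβ, fun x => ?_⟩
  have key : ‖W x‖ * Real.exp (κ * |x|) ≤ max B (max C C') := by
    by_cases h1 : max X 0 ≤ x
    · have hx0 : 0 ≤ x := (le_max_right _ _).trans h1
      have h2 := hX x ((le_max_left _ _).trans h1)
      rw [neg_mul] at h2
      have hC := hle h2 (norm_nonneg _)
      refine le_trans ?_ ((le_max_left C C').trans (le_max_right _ _))
      calc ‖W x‖ * Real.exp (κ * |x|) ≤ C * Real.exp (-(α * x)) * Real.exp (α * x) := by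
            rw [abs_of_nonneg hx0]
            gcongr
            exact min_le_left _ _
        _ = C := by rw [mul_assoc, ← Real.exp_add]; simp
    · by_cases h3 : x ≤ min X' 0
      · have hx0 : x ≤ 0 := h3.trans (min_le_right _ _)
        have h2 := hX' x (h3.trans (min_le_left _ _))
        have hC := hle (K := -(β * x)) (by simpa using h2) (norm_nonneg _)
        refine le_trans ?_ ((le_max_right C C').trans (le_max_right _ _))
        calc ‖W x‖ * Real.exp (κ * |x|) ≤ C' * Real.exp (β * x) * Real.exp (β * -x) := by
              rw [abs_of_nonpos hx0]
              gcongr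
              · linarith
              · exact min_le_right _ _
          _ = C' := by rw [mul_assoc, ← Real.exp_add]; simp
      · exact (hB ⟨x, ⟨(not_le.1 h3).le, (not_le.1 h1).le⟩, rfl⟩).trans (le_max_left _ _)
  calc ‖W x‖ = ‖W x‖ * Real.exp (κ * |x|) * Real.exp (-κ * |x|) := by
        rw [mul_assoc, ← Real.exp_add]; simp
    _ ≤ _ := by gcongr

theorem exists_rate_le (d : Fin 3 → ℂ) (h : ∀ j, (d j).re ≠ 0) : ∃ r, 0 < r ∧ ∀ j, r ≤ |(d j).re| := by
  refine ⟨min |(d 0).re| (min |(d 1).re| |(d 2).re|), by simp [h], fun j => ?_⟩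
  fin_cases j <;> simp

theorem HyperbolicForm.exists_blockForm {A₀ : Matrix (Fin 3) (Fin 3) ℂ} {k : ℕ}
    {d : Fin 3 → ℂ} (h : HyperbolicForm A₀ k d) : ∃ r V V' N, 0 < r ∧ (∀ j, r ≤ |(d j).re|) ∧
      IsBlockForm A₀ k d (r / 12) V V' N := by
  obtain ⟨V, V', N, hV⟩ := h 1 one_pos
  obtain ⟨r, hr, hd⟩ := exists_rate_le d fun j => by
    rcases lt_or_ge j.val k with hj | hj
    · exact (hV.pos j hj).ne'
    · exact (hV.neg j hj).ne
  obtain ⟨V, V', N, hV⟩ := h (r / 12) (by positivity)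
  exact ⟨r, V, V', N, hr, hd, hV⟩

section Mode

variable {c l : ℝ} {b τ u p : ℝ → ℝ}

theorem IsRealMode.hasDerivAt {cs : ℝ} (h : IsRealMode c b l τ u p) (hc : c ≠ 0)
    (hcs : cs ^ 2 = c ^ 2) (x : ℝ) :
    HasDerivAt (fun x => (![(τ x : ℂ), u x, p x] : Fin 3 → ℂ))
      (evansMatrix cs c (b x) l *ᵥ ![(τ x : ℂ), u x, p x]) x := by
  rw [evansMatrix_eq hc hcs]
  refine hasDerivAt_pi.2 fun i => ?_
  have hc' : (c : ℂ) ≠ 0 := by exact_mod_cast hc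
  fin_cases i
  · refine (h.deriv_fst x).ofReal_comp.congr_deriv ?_
    simp [Matrix.mulVec, dotProduct, Fin.sum_univ_three]
    field_simp
    ring
  · refine (h.deriv_snd x).ofReal_comp.congr_deriv ?_
    simp [Matrix.mulVec, dotProduct, Fin.sum_univ_three]
  · refine (h.deriv_trd x).ofReal_comp.congr_deriv ?_
    simp [Matrix.mulVec, dotProduct, Fin.sum_univ_three]
    ring

/-- The symmetry x ↦ -x, c ↦ -c, b ↦ -b, u ↦ -u keeps the spectral parameter and reduces negative
speeds to positive ones. -/
theorem IsRealMode.reflect (h : IsRealMode c b l τ u p) :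
    IsRealMode (-c) (fun x => -b (-x)) l (fun x => τ (-x)) (fun x => -u (-x))
      (fun x => p (-x)) where
  deriv_fst x := ((h.deriv_fst (-x)).scomp x (hasDerivAt_neg x)).congr_deriv (by
    simp [div_neg])
  deriv_snd x := ((h.deriv_snd (-x)).scomp x (hasDerivAt_neg x)).neg.congr_deriv (by simp)
  deriv_trd x := ((h.deriv_trd (-x)).scomp x (hasDerivAt_neg x)).congr_deriv (by
    simp
    ring)

theorem IsWaveProfile.reflect {C κ M : ℝ} {Y Y₁ Y₂ : ℝ → ℝ}
    (h : IsWaveProfile c b C κ M Y Y₁ Y₂) :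
    IsWaveProfile (-c) (fun x => -b (-x)) C κ M (fun x => Y (-x)) (fun x => -Y₁ (-x))
      (fun x => Y₂ (-x)) where
  deriv_fst x := ((h.deriv_fst (-x)).scomp x (hasDerivAt_neg x)).congr_deriv (by simp)
  deriv_snd x := ((h.deriv_snd (-x)).scomp x (hasDerivAt_neg x)).neg.congr_deriv (by simp)
  deriv_trd x := ((h.deriv_trd (-x)).scomp x (hasDerivAt_neg x)).congr_deriv (by
    simp)
  rate_pos := h.rate_pos
  bound x := by
    obtain ⟨h1, h2, h3⟩ := h.bound (-x)
    rw [abs_neg] at h1 h2 h3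
    exact ⟨h1, by rwa [abs_neg], h3⟩
  increasing x hx := neg_pos.2 (h.decreasing (-x) (by linarith))
  decreasing x hx := neg_neg_of_pos (h.increasing (-x) (by linarith))

end Mode

/-- Vanishing of the pairing removes from the right-decaying solution the only mode that blows up at
-∞, so it is localized at both ends. -/
theorem exists_decaying_mode_of_pos {c b₀ C κ C' κ' M : ℝ} {b Y Y₁ Y₂ : ℝ → ℝ} (hc : 0 < c)
    (hb₀ : b₀ < c) (hb : Continuous b) (hκ : 0 < κ)
    (hbC : ∀ x, |b x - b₀| ≤ C * Real.exp (-κ * |x|)) (hM : 0 ≤ M)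
    (h : IsWaveProfile c b C' κ' M Y Y₁ Y₂) :
    ∃ (l : ℝ) (τ u p : ℝ → ℝ) (K ν : ℝ), 0 < l ∧ IsRealMode c b l τ u p ∧ 0 < ν ∧
      (∀ x, |τ x| ≤ K * Real.exp (-ν * |x|) ∧ |u x| ≤ K * Real.exp (-ν * |x|) ∧
        |p x| ≤ K * Real.exp (-ν * |x|)) ∧ ∃ x, τ x ≠ 0 := by
  obtain ⟨l, τ, u, p, η₁, η₂, η₃, hl, hm, ha, ⟨K, ν, hν, hK⟩, hτ, ⟨x₀, hx₀⟩, t1, t2, t3, hpair⟩ :=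
    exists_pairing_eq_zero hc hb₀ hb hκ hbC hM h
  obtain ⟨d, hd⟩ := exists_hyperbolicForm_real (cs := c) (b := b₀) hc.ne' rfl hl
  rw [show growingModes c = 2 by simp [growingModes, hc]] at hd
  have hA := expAsymptotic_evansMatrix (cs := c) (c := c) hb hκ hbC l
  obtain ⟨Pl, hPl⟩ := hA.exists_conjugator_atBot hd.nearlyDiagonalizable
  obtain ⟨r, V, V', N, hr, hrd, hV⟩ := hd.exists_blockForm
  have hc' : (c : ℂ) ≠ 0 := by exact_mod_cast hc.ne'
  have hmd := fun x => hm.hasDerivAt (cs := c) hc.ne' rfl x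
  obtain ⟨C₂, hC₂⟩ := exists_decay_atBot_of_pairing hA hV hPl hr hrd le_rfl hmd
    (η := fun x => ![(η₁ x : ℂ), η₂ x, η₃ x]) (fun x i => by
      rw [evansMatrix_eq hc.ne' rfl]
      fin_cases i
      · refine (ha.deriv_fst x).ofReal_comp.congr_deriv ?_
        simp [Matrix.vecMul, dotProduct, Fin.sum_univ_three]
        ring
      · refine (ha.deriv_snd x).ofReal_comp.congr_deriv ?_
        simp [Matrix.vecMul, dotProduct, Fin.sum_univ_three]
        ring
      · refine (ha.deriv_trd x).ofReal_comp.congr_deriv ?_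
        simp [Matrix.vecMul, dotProduct, Fin.sum_univ_three]
        field_simp
        ring)
    (fun i => by
      have hof : ∀ {f : ℝ → ℝ}, Tendsto f atBot (𝓝 0) → Tendsto (fun x => (f x : ℂ)) atBot (𝓝 0) :=
        fun {f} hf => (Complex.continuous_ofReal.tendsto' _ _ Complex.ofReal_zero).comp hf
      fin_cases i
      · simpa using hof t1
      · simpa using hof t2
      · simpa using hof t3) (x₀ := x₀) (fun h => by
        have := congrFun h 2
        simp at this
        exact hx₀ this)
    (by
      simp [dotProduct, Fin.sum_univ_three]
      exact_mod_cast hpair x₀)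
  have hcomp : ∀ x, |τ x| ≤ ‖(![(τ x : ℂ), u x, p x] : Fin 3 → ℂ)‖ ∧
      |u x| ≤ ‖(![(τ x : ℂ), u x, p x] : Fin 3 → ℂ)‖ ∧
      |p x| ≤ ‖(![(τ x : ℂ), u x, p x] : Fin 3 → ℂ)‖ := fun x => by
    refine ⟨?_, ?_, ?_⟩
    · simpa using norm_le_pi_norm (![(τ x : ℂ), u x, p x] : Fin 3 → ℂ) 0
    · simpa using norm_le_pi_norm (![(τ x : ℂ), u x, p x] : Fin 3 → ℂ) 1
    · simpa using norm_le_pi_norm (![(τ x : ℂ), u x, p x] : Fin 3 → ℂ) 2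
  obtain ⟨K', κ₁, hκ₁, hK'⟩ := exists_exp_bound
    (W := fun x => (![(τ x : ℂ), u x, p x] : Fin 3 → ℂ))
    (continuous_iff_continuousAt.2 fun x => (hmd x).continuousAt) hν (half_pos hr)
    (C := K) (by
      filter_upwards [eventually_ge_atTop 0] with x hx
      obtain ⟨k1, k2, k3⟩ := hK x hx
      refine (pi_norm_le_iff_of_nonneg ((abs_nonneg _).trans k1)).2 fun i => ?_
      fin_cases i
      · simpa using k1
      · simpa using k2
      · simpa using k3) hC₂
  exact ⟨l, τ, u, p, K', κ₁, hl, hm, hκ₁, fun x => ⟨(hcomp x).1.trans (hK' x),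
    (hcomp x).2.1.trans (hK' x), (hcomp x).2.2.trans (hK' x)⟩, hτ⟩

/-- The linearization about a wave has a real mode with positive growth rate that is exponentially
localized. -/
theorem exists_decaying_mode {c b₀ C κ C' κ' M : ℝ} {b Y Y₁ Y₂ : ℝ → ℝ} (hc : c ≠ 0)
    (hb₀ : c * b₀ < c ^ 2) (hb : Continuous b) (hκ : 0 < κ)
    (hbC : ∀ x, |b x - b₀| ≤ C * Real.exp (-κ * |x|)) (hM : 0 ≤ M)
    (h : IsWaveProfile c b C' κ' M Y Y₁ Y₂) :
    ∃ (l : ℝ) (τ u p : ℝ → ℝ) (K ν : ℝ), 0 < l ∧ IsRealMode c b l τ u p ∧ 0 < ν ∧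
      (∀ x, |τ x| ≤ K * Real.exp (-ν * |x|) ∧ |u x| ≤ K * Real.exp (-ν * |x|) ∧
        |p x| ≤ K * Real.exp (-ν * |x|)) ∧ ∃ x, τ x ≠ 0 := by
  rcases hc.lt_or_gt with hc0 | hc0
  · obtain ⟨l, τ, u, p, K, ν, hl, hm, hν, hK, x₀, hx₀⟩ :=
      exists_decaying_mode_of_pos (c := -c) (b₀ := -b₀) (b := fun x => -b (-x)) (by linarith)
        (by nlinarith) (hb.comp continuous_neg).neg hκ (fun x => by
          have := hbC (-x)
          rw [abs_neg] at this
          rw [neg_sub_neg, abs_sub_comm]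
          exact this) hM h.reflect
    have hm' := hm.reflect
    simp only [neg_neg] at hm'
    refine ⟨l, _, _, _, K, ν, hl, hm', hν, fun x => ?_, -x₀, by simpa using hx₀⟩
    have := hK (-x)
    simpa using this
  · exact exists_decaying_mode_of_pos hc0 (by nlinarith) hb hκ hbC hM h

end JinXin

/-! ### Second-order equations near a saddle -/

namespace JinXin

/-- Since y has almost converged, the mean value theorem gives a point shortly after x where y' is
small. The function y' + a y is Lipschitz near infinity and y varies little, so y' is small at x
too. -/
theorem tendsto_deriv_zero {y y₁ y₂ : ℝ → ℝ} {a B L : ℝ} (h₁ : ∀ x, HasDerivAt y (y₁ x) x)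
    (h₂ : ∀ x, HasDerivAt y₁ (y₂ x) x) (hL : Tendsto y atTop (𝓝 L))
    (hB : ∀ᶠ x in atTop, |y₂ x + a * y₁ x| ≤ B) : Tendsto y₁ atTop (𝓝 0) := by
  rw [Metric.tendsto_atTop]
  intro ε hε
  set B₁ := |B| + 1 with hB₁
  have hB₁0 : 0 < B₁ := by positivity
  set η := ε / (3 * B₁) with hη
  have hη0 : 0 < η := by positivity
  set δ := ε / (6 * (1 / η + |a| + 1)) with hδ
  have hδ0 : 0 < δ := by positivity
  have hδe : 2 * δ * (1 / η) + 2 * δ * |a| ≤ ε / 3 := by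
    have : 2 * δ * (1 / η + |a| + 1) = ε / 3 := by rw [hδ]; field_simp; ring
    nlinarith
  obtain ⟨X, hX⟩ := eventually_atTop.1 (hB.and ((Metric.tendsto_nhds.1 hL) δ hδ0))
  have hdiff : ∀ x z, X ≤ x → X ≤ z → |y x - y z| ≤ 2 * δ := by
    intro x z hx hz
    have h3 := (hX x hx).2
    have h4 := (hX z hz).2
    rw [Real.dist_eq] at h3 h4
    rw [abs_lt] at h3 h4
    rw [abs_le]
    constructor <;> linarith
  refine ⟨X, fun x hx => ?_⟩
  obtain ⟨ξ, hξ, hξe⟩ := exists_hasDerivAt_eq_slope y y₁ (a := x) (b := x + η) (by linarith)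
    (fun z _ => (h₁ z).continuousAt.continuousWithinAt) (fun z _ => h₁ z)
  have e1 : |y₁ ξ| ≤ 2 * δ * (1 / η) := by
    rw [hξe, add_sub_cancel_left, abs_div, abs_of_pos hη0, div_eq_mul_one_div]
    gcongr
    exact hdiff _ _ (by linarith) hx
  have e2 : |(y₁ ξ + a * y ξ) - (y₁ x + a * y x)| ≤ B₁ * η := by
    have := (convex_Ici x).norm_image_sub_le_of_norm_hasDerivWithin_le (x := x) (y := ξ) (C := B₁)
      (f := fun z => y₁ z + a * y z) (f' := fun z => y₂ z + a * y₁ z)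
      (fun z _ => ((h₂ z).add ((h₁ z).const_mul a)).hasDerivWithinAt)
      (fun z hz => ((hX z (hx.trans hz)).1.trans (le_abs_self B)).trans (by linarith))
      (Set.self_mem_Ici) hξ.1.le
    refine this.trans ?_
    rw [Real.norm_eq_abs, abs_of_pos (by linarith [hξ.1])]
    gcongr
    linarith [hξ.2]
  have e3 : |a * (y ξ - y x)| ≤ 2 * δ * |a| := by
    rw [abs_mul, mul_comm]
    gcongr
    exact hdiff _ _ (hx.trans hξ.1.le) hx
  have e4 : B₁ * η = ε / 3 := by rw [hη]; field_simp
  rw [Real.dist_eq, sub_zero]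
  have : y₁ x = y₁ ξ - ((y₁ ξ + a * y ξ) - (y₁ x + a * y x)) + a * (y ξ - y x) := by ring
  rw [this]
  have := abs_add_le (y₁ ξ - ((y₁ ξ + a * y ξ) - (y₁ x + a * y x))) (a * (y ξ - y x))
  have := abs_sub (y₁ ξ) ((y₁ ξ + a * y ξ) - (y₁ x + a * y x))
  linarith

/-- A function with `y'' ≥ a² y` that tends to zero at infinity satisfies `y' ≤ -a y`. -/
theorem deriv_le_of_second_deriv_ge {y y₁ y₂ : ℝ → ℝ} {a X : ℝ} (ha : 0 < a)
    (h₁ : ∀ x, HasDerivAt y (y₁ x) x) (h₂ : ∀ x, HasDerivAt y₁ (y₂ x) x)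
    (hy : Tendsto y atTop (𝓝 0)) (hy₁ : Tendsto y₁ atTop (𝓝 0))
    (h : ∀ x, X ≤ x → a ^ 2 * y x ≤ y₂ x) : ∀ x, X ≤ x → y₁ x ≤ -a * y x := by
  let w : ℝ → ℝ := fun x => Real.exp (-a * x) * (y₁ x + a * y x)
  have hexp : ∀ x, HasDerivAt (fun x => Real.exp (-a * x)) (Real.exp (-a * x) * -a) x := fun x => by
    simpa using ((hasDerivAt_id x).const_mul (-a)).exp
  have hw : ∀ x, HasDerivAt w (Real.exp (-a * x) * (y₂ x - a ^ 2 * y x)) x := fun x =>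
    ((hexp x).mul ((h₂ x).add ((h₁ x).const_mul a))).congr_deriv (by
      simp only [Pi.add_apply]; ring)
  have hmono : MonotoneOn w (Set.Ici X) := by
    refine monotoneOn_of_deriv_nonneg (convex_Ici X)
      (fun x _ => (hw x).continuousAt.continuousWithinAt)
      (fun x _ => (hw x).differentiableAt.differentiableWithinAt) fun x hx => ?_
    rw [(hw x).deriv]
    rw [interior_Ici] at hx
    exact mul_nonneg (Real.exp_pos _).le (by linarith [h x (le_of_lt hx)])
  have hlim : Tendsto w atTop (𝓝 0) := by
    have h3 : Tendsto (fun x : ℝ => Real.exp (-a * x)) atTop (𝓝 0) :=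
      Real.tendsto_exp_atBot.comp (tendsto_id.const_mul_atTop_of_neg (neg_neg_of_pos ha))
    have := h3.mul (hy₁.add (hy.const_mul a))
    rwa [mul_zero, add_zero, mul_zero] at this
  intro x hx
  have h4 : w x ≤ 0 := ge_of_tendsto hlim (by
    filter_upwards [eventually_ge_atTop x] with z hz
    exact hmono hx (hx.trans hz) hz)
  have h5 : y₁ x + a * y x ≤ 0 := by
    by_contra hcon
    exact absurd h4 (not_le.2 (mul_pos (Real.exp_pos _) (not_le.1 hcon)))
  linarith

/-- The comparison y' ≤ -a y integrates to exponential decay of y and makes y' negative. A reverse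
comparison y' ≥ -D y bounds |y'|, and hence all three quantities, by multiples of y. -/
theorem exists_exp_decay_of_second_deriv {y y₁ y₂ : ℝ → ℝ} {a B : ℝ} (ha : 0 < a)
    (h₁ : ∀ x, HasDerivAt y (y₁ x) x) (h₂ : ∀ x, HasDerivAt y₁ (y₂ x) x)
    (hy : Tendsto y atTop (𝓝 0)) (hy₁ : Tendsto y₁ atTop (𝓝 0)) (hpos : ∀ x, 0 < y x)
    (h : ∀ᶠ x in atTop, a ^ 2 * y x ≤ y₂ x) (hB : ∀ x, |y₂ x| ≤ B * y x) :
    (∀ᶠ x in atTop, y₁ x < 0) ∧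
      ∃ C, ∀ᶠ x in atTop, ‖(y x, y₁ x, y₂ x)‖ ≤ C * Real.exp (-a * x) := by
  obtain ⟨X, hX⟩ := eventually_atTop.1 h
  have hle := deriv_le_of_second_deriv_ge ha h₁ h₂ hy hy₁ hX
  set D := |B| + 1 with hD
  have hD0 : 0 < D := by positivity
  -- The same comparison for -y; D = |B| + 1 satisfies D² ≥ B.
  have hge := deriv_le_of_second_deriv_ge (y := fun x => -y x) (y₁ := fun x => -y₁ x)
    (y₂ := fun x => -y₂ x) (X := X) hD0 (fun x => (h₁ x).neg) (fun x => (h₂ x).neg)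
    (by simpa using hy.neg) (by simpa using hy₁.neg) (fun x _ => by
      have h3 := (le_abs_self _).trans (hB x)
      have h4 : B * y x ≤ D ^ 2 * y x := by
        refine mul_le_mul_of_nonneg_right ?_ (hpos x).le
        nlinarith [le_abs_self B, abs_nonneg B]
      linarith)
  refine ⟨?_, y X * Real.exp (a * X) * (1 + D), ?_⟩
  · filter_upwards [eventually_ge_atTop X] with x hx
    nlinarith [hle x hx, mul_pos ha (hpos x)]
  · have hexp : ∀ x, HasDerivAt (fun x => Real.exp (a * x)) (Real.exp (a * x) * a) x := fun x => by
      simpa using ((hasDerivAt_id x).const_mul a).exp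
    have hanti : AntitoneOn (fun x => Real.exp (a * x) * y x) (Set.Ici X) := by
      refine antitoneOn_of_deriv_nonpos (convex_Ici X)
        (fun x _ => ((hexp x).mul (h₁ x)).continuousAt.continuousWithinAt)
        (fun x _ => ((hexp x).mul (h₁ x)).differentiableAt.differentiableWithinAt) fun x hx => ?_
      refine ((hexp x).mul (h₁ x)).deriv.trans_le ?_
      rw [interior_Ici] at hx
      have := mul_le_mul_of_nonneg_left (hle x (le_of_lt hx)) (Real.exp_pos (a * x)).le
      nlinarith
    filter_upwards [eventually_ge_atTop X] with x hx
    have h3 : y x ≤ y X * Real.exp (a * X) * Real.exp (-a * x) := by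
      have h4 := mul_le_mul_of_nonneg_right (hanti Set.self_mem_Ici hx hx)
        (Real.exp_pos (-a * x)).le
      have h5 : Real.exp (a * x) * y x * Real.exp (-a * x) = y x := by
        rw [mul_right_comm, ← Real.exp_add]; simp
      simp only [h5] at h4
      linarith
    have h6 : ‖(y x, y₁ x, y₂ x)‖ ≤ (1 + D) * y x := by
      have hDy : 0 < D * y x := mul_pos hD0 (hpos x)
      refine norm_prod_le_iff.2 ⟨?_, norm_prod_le_iff.2 ⟨?_, ?_⟩⟩
      · rw [Real.norm_of_nonneg (hpos x).le]; linarith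
      · rw [Real.norm_eq_abs, abs_le]
        have h7 := hle x hx
        have h8 := hge x hx
        have := mul_pos ha (hpos x)
        have := hpos x
        constructor <;> nlinarith
      · rw [Real.norm_eq_abs]
        have := mul_le_mul_of_nonneg_right (le_abs_self B) (hpos x).le
        have := hpos x
        exact (hB x).trans (by nlinarith)
    calc ‖(y x, y₁ x, y₂ x)‖ ≤ (1 + D) * y x := h6
      _ ≤ (1 + D) * (y X * Real.exp (a * X) * Real.exp (-a * x)) := by gcongr
      _ = _ := by ring

/-- A positive function tending to zero with its derivative is not eventually concave. -/
theorem not_eventually_second_deriv_nonpos {y y₁ y₂ : ℝ → ℝ}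
    (h₁ : ∀ x, HasDerivAt y (y₁ x) x) (h₂ : ∀ x, HasDerivAt y₁ (y₂ x) x)
    (hy : Tendsto y atTop (𝓝 0)) (hy₁ : Tendsto y₁ atTop (𝓝 0)) (hpos : ∀ x, 0 < y x) :
    ¬ ∀ᶠ x in atTop, y₂ x ≤ 0 := by
  intro h
  obtain ⟨X, hX⟩ := eventually_atTop.1 h
  have h3 : AntitoneOn y₁ (Set.Ici X) := by
    refine antitoneOn_of_deriv_nonpos (convex_Ici X)
      (fun x _ => (h₂ x).continuousAt.continuousWithinAt)
      (fun x _ => (h₂ x).differentiableAt.differentiableWithinAt) fun x hx => ?_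
    rw [(h₂ x).deriv]
    rw [interior_Ici] at hx
    exact hX x (le_of_lt hx)
  have h4 : ∀ x, X ≤ x → 0 ≤ y₁ x := fun x hx => le_of_tendsto hy₁ (by
    filter_upwards [eventually_ge_atTop x] with z hz
    exact h3 hx (hx.trans hz) hz)
  have h5 : MonotoneOn y (Set.Ici X) := by
    refine monotoneOn_of_deriv_nonneg (convex_Ici X)
      (fun x _ => (h₁ x).continuousAt.continuousWithinAt)
      (fun x _ => (h₁ x).differentiableAt.differentiableWithinAt) fun x hx => ?_
    rw [(h₁ x).deriv]
    rw [interior_Ici] at hx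
    exact h4 x (le_of_lt hx)
  exact absurd (ge_of_tendsto hy (by
    filter_upwards [eventually_ge_atTop X] with z hz
    exact h5 Set.self_mem_Ici hz hz)) (not_le.2 (hpos X))

theorem exists_lipschitz_at {g : ℝ → ℝ} {I K : Set ℝ} (hI : IsOpen I) (hg : ContDiffOn ℝ 1 g I)
    (hK : IsCompact K) (hKc : Convex ℝ K) (hKI : K ⊆ I) {s₀ : ℝ} (hs₀ : s₀ ∈ K) :
    ∃ B, 0 ≤ B ∧ ∀ s ∈ K, |g s - g s₀| ≤ B * |s - s₀| := by
  obtain ⟨B, hB⟩ := hK.bddAbove_image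
    ((hg.continuousOn_deriv_of_isOpen hI le_rfl).norm.mono hKI)
  refine ⟨max B 0, le_max_right _ _, fun s hs => ?_⟩
  exact hKc.norm_image_sub_le_of_norm_deriv_le
    (fun x hx => (hg.differentiableOn one_ne_zero).differentiableAt (hI.mem_nhds (hKI hx)))
    (fun x hx => (hB ⟨x, hx, rfl⟩).trans (le_max_left _ _)) hs₀ hs

theorem convex_insert_range {τ : ℝ → ℝ} {τ₀ : ℝ} (hτ : Continuous τ)
    (h : Tendsto τ atTop (𝓝 τ₀)) : Convex ℝ (insert τ₀ (Set.range τ)) := by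
  have h1 : IsPreconnected (insert τ₀ (Set.range τ)) := by
    refine (isPreconnected_range hτ).subset_closure (Set.subset_insert _ _)
      (Set.insert_subset ?_ subset_closure)
    exact mem_closure_of_tendsto h (Eventually.of_forall fun x => Set.mem_range_self x)
  exact h1.ordConnected.convex

theorem isCompact_insert_range {τ : ℝ → ℝ} {τ₀ : ℝ} (hτ : Continuous τ)
    (hl : Tendsto τ atBot (𝓝 τ₀)) (hr : Tendsto τ atTop (𝓝 τ₀)) :
    IsCompact (insert τ₀ (Set.range τ)) := by
  refine Tendsto.isCompact_insert_range_of_cocompact ?_ hτ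
  rw [cocompact_eq_atBot_atTop]
  exact hl.sup hr

/-- A nonvanishing solution of the profile equation is a wave profile, and the end state is a
saddle. -/
theorem exists_isWaveProfile {c κ₀ τ₀ : ℝ} {I : Set ℝ} {f τ τ₁ : ℝ → ℝ} (hc : c ≠ 0)
    (hI : IsOpen I) (hf : ContDiffOn ℝ 2 f I) (hτ₀ : τ₀ ∈ I) (hτ : ∀ x, τ x ∈ I)
    (hnd : deriv f τ₀ ≠ c) (hκ₀ : c * τ₀ - κ₀ - f τ₀ = 0)
    (h₁ : ∀ x, HasDerivAt τ (τ₁ x) x)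
    (h₂ : ∀ x, HasDerivAt τ₁ ((c * τ x - κ₀ - f (τ x)) / c) x)
    (hl : Tendsto τ atBot (𝓝 τ₀)) (hr : Tendsto τ atTop (𝓝 τ₀))
    (hl₁ : Tendsto τ₁ atBot (𝓝 0)) (hr₁ : Tendsto τ₁ atTop (𝓝 0)) (hne : ∀ x, τ x ≠ τ₀) :
    c * deriv f τ₀ < c ^ 2 ∧ ∃ C κ M Y Y₁ Y₂, 0 ≤ M ∧
      IsWaveProfile c (fun x => deriv f (τ x)) C κ M Y Y₁ Y₂ ∧ ∀ x, |τ x - τ₀| = Y x := by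
  have hτc : Continuous τ := continuous_iff_continuousAt.2 fun x => (h₁ x).continuousAt
  set h : ℝ → ℝ := fun s => (c * s - κ₀ - f s) / c with hh
  have hfd : ∀ s ∈ I, HasDerivAt f (deriv f s) s := fun s hs =>
    ((hf.differentiableOn two_ne_zero).differentiableAt (hI.mem_nhds hs)).hasDerivAt
  have hhd : ∀ s ∈ I, HasDerivAt h (1 - deriv f s / c) s := fun s hs =>
    (((((hasDerivAt_id s).const_mul c).sub_const κ₀).sub (hfd s hs)).div_const c).congr_deriv
      (by field_simp)
  have hh0 : h τ₀ = 0 := by simp [hh, hκ₀]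
  obtain ⟨B, hB0, hB⟩ := exists_lipschitz_at (g := h) hI (by
    have := (hf.of_le (m := 1) (by norm_num))
    exact (((contDiffOn_const.mul contDiffOn_id).sub contDiffOn_const).sub this).div_const c)
    (isCompact_insert_range hτc hl hr) (convex_insert_range hτc hr)
    (Set.insert_subset hτ₀ (Set.range_subset_iff.2 hτ)) (Set.mem_insert _ _)
  -- constant sign
  obtain ⟨σ, hσ, hσpos⟩ : ∃ σ : ℝ, σ * σ = 1 ∧ ∀ x, 0 < σ * (τ x - τ₀) := by
    rcases lt_or_gt_of_ne (hne 0) with h0 | h0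
    · refine ⟨-1, by norm_num, fun x => ?_⟩
      by_contra hcon
      obtain ⟨z, hz⟩ := mem_range_of_exists_le_of_exists_ge hτc (c := τ₀) ⟨0, h0.le⟩
        ⟨x, by linarith⟩
      exact hne z hz
    · refine ⟨1, by norm_num, fun x => ?_⟩
      by_contra hcon
      obtain ⟨z, hz⟩ := mem_range_of_exists_le_of_exists_ge hτc (c := τ₀) ⟨x, by linarith⟩
        ⟨0, le_of_lt h0⟩
      exact hne z hz
  have hσ1 : |σ| = 1 := by
    have := congrArg abs hσ
    rw [abs_mul, abs_one] at this
    nlinarith [abs_nonneg σ]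
  set m := 1 - deriv f τ₀ / c with hm
  have hm0 : m ≠ 0 := by
    intro h0
    apply hnd
    have : deriv f τ₀ / c = 1 := by linarith
    field_simp at this
    exact this
  set Y : ℝ → ℝ := fun x => σ * (τ x - τ₀) with hY
  have hYabs : ∀ x, |τ x - τ₀| = Y x := fun x => by
    have h3 := abs_of_pos (hσpos x)
    rwa [abs_mul, hσ1, one_mul] at h3
  have d1 : ∀ x, HasDerivAt Y (σ * τ₁ x) x := fun x => ((h₁ x).sub_const τ₀).const_mul σ
  have d2 : ∀ x, HasDerivAt (fun x => σ * τ₁ x) (σ * h (τ x)) x := fun x => (h₂ x).const_mul σ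
  have d3 : ∀ x, HasDerivAt (fun x => σ * h (τ x)) ((1 - deriv f (τ x) / c) * (σ * τ₁ x)) x :=
    fun x => (((hhd _ (hτ x)).comp x (h₁ x)).const_mul σ).congr_deriv (by ring)
  have tY : ∀ {F : Filter ℝ}, Tendsto τ F (𝓝 τ₀) → Tendsto Y F (𝓝 0) := fun {F} hF => by
    simpa using (hF.sub_const τ₀).const_mul σ
  have tY₁ : ∀ {F : Filter ℝ}, Tendsto τ₁ F (𝓝 0) → Tendsto (fun x => σ * τ₁ x) F (𝓝 0) :=
    fun {F} hF => by simpa using hF.const_mul σ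
  have hY2 : ∀ x, |σ * h (τ x)| ≤ B * Y x := fun x => by
    have h3 := hB (τ x) (Set.mem_insert_of_mem _ (Set.mem_range_self x))
    rw [hh0, sub_zero, hYabs] at h3
    rwa [abs_mul, hσ1, one_mul]
  -- the second derivative near the end state
  have hnear : ∀ᶠ s in 𝓝 τ₀, |h s - m * (s - τ₀)| ≤ |m| / 2 * |s - τ₀| := by
    have h3 := (hasDerivAt_iff_isLittleO.1 (hhd τ₀ hτ₀)).bound (half_pos (abs_pos.2 hm0))
    filter_upwards [h3] with s hs
    simpa [hh0, mul_comm] using hs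
  have hev : ∀ {F : Filter ℝ}, Tendsto τ F (𝓝 τ₀) →
      ∀ᶠ x in F, |σ * h (τ x) - m * Y x| ≤ |m| / 2 * Y x := fun {F} hF => by
    filter_upwards [hF.eventually hnear] with x hx
    have : σ * h (τ x) - m * Y x = σ * (h (τ x) - m * (τ x - τ₀)) := by rw [hY]; ring
    rw [this, abs_mul, hσ1, one_mul, ← hYabs]
    exact hx
  -- Here m = h'(τ₀). If it were negative, Y would be eventually concave, which a positive function
  -- tending to 0 with its derivative cannot be.
  have hmpos : 0 < m := by
    by_contra hcon
    have hmneg : m < 0 := lt_of_le_of_ne (not_lt.1 hcon) hm0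
    refine not_eventually_second_deriv_nonpos d1 d2 (tY hr) (tY₁ hr₁) hσpos ?_
    filter_upwards [hev hr] with x hx
    rw [abs_of_neg hmneg, abs_le] at hx
    nlinarith [hx.2, hσpos x, mul_pos_of_neg_of_neg hmneg (neg_neg_of_pos (hσpos x))]
  -- Half of m is given up to the remainder of the linearization, whence the rate √(m/2).
  have hend : ∀ {F : Filter ℝ}, Tendsto τ F (𝓝 τ₀) →
      ∀ᶠ x in F, √(m / 2) ^ 2 * Y x ≤ σ * h (τ x) := fun {F} hF => by
    filter_upwards [hev hF] with x hx
    rw [abs_of_pos hmpos, abs_le] at hx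
    rw [Real.sq_sqrt (half_pos hmpos).le]
    linarith [hx.1]
  have ha : 0 < √(m / 2) := Real.sqrt_pos.2 (half_pos hmpos)
  obtain ⟨n1, C₁, hC₁⟩ := exists_exp_decay_of_second_deriv ha d1 d2 (tY hr) (tY₁ hr₁) hσpos
    (hend hr) hY2
  obtain ⟨n2, C₂, hC₂⟩ := exists_exp_decay_of_second_deriv (y := fun x => Y (-x))
    (y₁ := fun x => -(σ * τ₁ (-x))) (y₂ := fun x => σ * h (τ (-x))) ha
    (fun x => ((d1 (-x)).scomp x (hasDerivAt_neg x)).congr_deriv (by simp))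
    (fun x => ((d2 (-x)).scomp x (hasDerivAt_neg x)).neg.congr_deriv (by simp))
    ((tY hl).comp tendsto_neg_atTop_atBot)
    (by simpa using ((tY₁ hl₁).comp tendsto_neg_atTop_atBot).neg) (fun x => hσpos (-x))
    (tendsto_neg_atTop_atBot.eventually (hend hl)) (fun x => hY2 (-x))
  have n2' := tendsto_neg_atBot_atTop.eventually n2
  have hC₂' := tendsto_neg_atBot_atTop.eventually hC₂
  simp only [neg_neg] at n2' hC₂'
  obtain ⟨X, hX⟩ := eventually_atTop.1 n1
  obtain ⟨X', hX'⟩ := eventually_atBot.1 n2'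
  obtain ⟨K, κ, hκ, hK⟩ := exists_exp_bound (W := fun x => (Y x, σ * τ₁ x, σ * h (τ x)))
    (continuous_iff_continuousAt.2 fun x =>
      ((d1 x).prodMk ((d2 x).prodMk (d3 x))).continuousAt) ha ha hC₁ (C' := C₂) (by
      filter_upwards [hC₂'] with x hx
      rw [neg_mul_neg] at hx
      simpa [Prod.norm_def] using hx)
  refine ⟨?_, K, κ, max 0 (max X (-X')), Y, _, _, le_max_left _ _, ⟨d1, d2, d3, hκ, fun x => ?_,
    fun x hx => ?_, fun x hx => ?_⟩, hYabs⟩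
  · have h3 := mul_pos (sq_pos_of_ne_zero hc) hmpos
    have : c ^ 2 * m = c ^ 2 - c * deriv f τ₀ := by rw [hm]; field_simp
    linarith
  · have h3 := norm_prod_le_iff.1 (hK x)
    have h4 := norm_prod_le_iff.1 h3.2
    exact ⟨h3.1, h4.1, h4.2⟩
  · have := hX' x (by linarith [le_max_right (0 : ℝ) (max X (-X')), le_max_right X (-X')])
    linarith
  · exact hX x (by linarith [le_max_right (0 : ℝ) (max X (-X')), le_max_left X (-X')])

end JinXin

/-! ### The profile of a solitary wave -/

namespace JinXin

/-- The profile equations of a solitary wave. -/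
theorem IsSolitaryWave.profile_eqs {f : ℝ → ℝ} {cs c τ₀ u₀ : ℝ} {τ u : ℝ → ℝ}
    (h : IsSolitaryWave f cs c τ₀ u₀ τ u) :
    (∀ x, HasDerivAt τ (deriv τ x) x) ∧ (∀ x, HasDerivAt u (-c * deriv τ x) x) ∧
      ∀ x, HasDerivAt (fun x => -c * deriv τ x) (f (τ x) + u x + (c ^ 2 - cs ^ 2) * deriv τ x) x := by
  have hsol := fun x => h.solution 0 x
  simp only [mul_zero, sub_zero] at hsol
  have hτ : ∀ x, DifferentiableAt ℝ τ x := fun x => (hsol x).2.1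
  have hu : ∀ x, DifferentiableAt ℝ u x := fun x => (hsol x).2.2.2.1
  have hshift : ∀ (g : ℝ → ℝ) (x : ℝ), DifferentiableAt ℝ g x →
      deriv (fun s => g (x - c * s)) 0 = -c * deriv g x := by
    intro g x hg
    have h1 : HasDerivAt (fun s : ℝ => x - c * s) (-c) 0 := by
      simpa using ((hasDerivAt_id (0 : ℝ)).const_mul c).const_sub x
    have h2 : HasDerivAt g (deriv g x) (x - c * 0) := by simpa using hg.hasDerivAt
    have := (h2.comp 0 h1).deriv
    rw [mul_comm] at this
    exact this
  have hu' : ∀ x, deriv u x = -c * deriv τ x := fun x => by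
    have := (hsol x).2.2.2.2.2.1
    rw [hshift τ x (hτ x)] at this
    linarith
  have hue : deriv u = fun x => -c * deriv τ x := funext hu'
  refine ⟨fun x => (hτ x).hasDerivAt, fun x => by rw [← hu' x]; exact (hu x).hasDerivAt,
    fun x => ?_⟩
  have h1 := (hsol x).2.2.2.2.1.hasDerivAt
  have h2 := (hsol x).2.2.2.2.2.2
  rw [hshift u x (hu x), hu' x] at h2
  rw [hue] at h1
  refine h1.congr_deriv ?_
  rw [← hue]
  linarith

theorem hasDerivAt_primitive {g : ℝ → ℝ} {I K : Set ℝ} (hI : IsOpen I) (hg : ContinuousOn g I)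
    (hKI : K ⊆ I) (hK : Convex ℝ K) {s₀ s : ℝ} (hs₀ : s₀ ∈ K) (hs : s ∈ K) :
    HasDerivAt (fun s => ∫ t in s₀..s, g t) (g s) s := by
  have hsub : Set.uIcc s₀ s ⊆ I := by
    rw [← segment_eq_uIcc]
    exact (hK.segment_subset hs₀ hs).trans hKI
  exact intervalIntegral.integral_hasDerivAt_right (hg.mono hsub).intervalIntegrable
    (hg.stronglyMeasurableAtFilter hI s (hKI hs)) (hg.continuousAt (hI.mem_nhds (hKI hs)))

/-- A function with derivative of constant sign and equal limits at both ends is constant. -/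
theorem eq_of_monotone_of_tendsto {E : ℝ → ℝ} {L : ℝ} (hE : Monotone E)
    (hl : Tendsto E atBot (𝓝 L)) (hr : Tendsto E atTop (𝓝 L)) (x : ℝ) : E x = L :=
  le_antisymm (hE.ge_of_tendsto hr x) (hE.le_of_tendsto hl x)

/-- A monotone function with equal limits is constant. The degenerate case a = 0 is also used, to
identify a conserved quantity with its limit. -/
theorem deriv_eq_zero_of_energy {E : ℝ → ℝ} {a L : ℝ} {g : ℝ → ℝ}
    (hE : ∀ x, HasDerivAt E (a * g x ^ 2) x) (hl : Tendsto E atBot (𝓝 L))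
    (hr : Tendsto E atTop (𝓝 L)) : (∀ x, E x = L) ∧ ∀ x, a * g x ^ 2 = 0 := by
  have hconst : ∀ x, E x = L := by
    rcases le_total 0 a with ha | ha
    · exact eq_of_monotone_of_tendsto (monotone_of_deriv_nonneg
        (fun x => (hE x).differentiableAt) fun x => by
          rw [(hE x).deriv]; positivity) hl hr
    · intro x
      have h1 := eq_of_monotone_of_tendsto (E := fun x => -E x) (monotone_of_deriv_nonneg
        (fun x => (hE x).neg.differentiableAt) fun x => by
          rw [(hE x).fun_neg.deriv]; nlinarith [sq_nonneg (g x)]) hl.neg hr.neg x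
      linarith
  refine ⟨hconst, fun x => ?_⟩
  have h1 : E = fun _ => L := funext hconst
  have h2 := (hE x).deriv
  rw [h1, deriv_const] at h2
  exact h2.symm

/-- The energy c τ'²/2 - H(τ) is monotone with equal limits, hence constant, which forces c² = cs²
for a nonconstant wave. The orbit then lies on the zero level of a conservative equation and cannot
return to τ₀ at a finite point. Saddle structure, decay and monotonicity near the ends follow from
`exists_isWaveProfile`. -/
theorem IsSolitaryWave.exists_profile {f : ℝ → ℝ} {I : Set ℝ} (hI : IsOpen I)
    (hf : ContDiffOn ℝ 2 f I) {cs : ℝ} (hcs : 0 < cs) {c τ₀ u₀ : ℝ} {τ u : ℝ → ℝ}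
    (hτ₀ : τ₀ ∈ I) (hτ : ∀ x, τ x ∈ I) (hw : IsSolitaryWave f cs c τ₀ u₀ τ u)
    (hnd : deriv f τ₀ ≠ c) :
    cs ^ 2 = c ^ 2 ∧ c ≠ 0 ∧ c * deriv f τ₀ < c ^ 2 ∧ Continuous (fun x => deriv f (τ x)) ∧
      (∃ C κ, 0 < κ ∧ ∀ x, |deriv f (τ x) - deriv f τ₀| ≤ C * Real.exp (-κ * |x|)) ∧
      ∃ C κ M Y Y₁ Y₂, 0 ≤ M ∧ IsWaveProfile c (fun x => deriv f (τ x)) C κ M Y Y₁ Y₂ := by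
  obtain ⟨h₁, hu, h₂⟩ := hw.profile_eqs
  have hτc : Continuous τ := continuous_iff_continuousAt.2 fun x => (h₁ x).continuousAt
  have hl : Tendsto τ atBot (𝓝 τ₀) := (continuous_fst.tendsto _).comp hw.tendsto_left
  have hr : Tendsto τ atTop (𝓝 τ₀) := (continuous_fst.tendsto _).comp hw.tendsto_right
  have hul : Tendsto u atBot (𝓝 u₀) := (continuous_snd.tendsto _).comp hw.tendsto_left
  have hur : Tendsto u atTop (𝓝 u₀) := (continuous_snd.tendsto _).comp hw.tendsto_right
  set q := u₀ + c * τ₀ with hq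
  have huq : ∀ x, u x = q - c * τ x := fun x => by
    have := (deriv_eq_zero_of_energy (a := 0) (g := u) (E := fun x => u x + c * τ x)
      (fun x => ((hu x).add ((h₁ x).const_mul c)).congr_deriv (by ring))
      (hul.add (hl.const_mul c)) (hur.add (hr.const_mul c))).1 x
    linarith
  
  set h : ℝ → ℝ := fun s => c * s - q - f s with hh
  have h₂' : ∀ x, HasDerivAt (fun x => -c * deriv τ x)
      (-h (τ x) + (c ^ 2 - cs ^ 2) * deriv τ x) x := fun x =>
    (h₂ x).congr_deriv (by rw [huq x, hh]; ring)
  have hhc : ContinuousOn h I := by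
    have := hf.continuousOn
    fun_prop
  set K := insert τ₀ (Set.range τ) with hK
  have hKI : K ⊆ I := Set.insert_subset hτ₀ (Set.range_subset_iff.2 hτ)
  have hKc : Convex ℝ K := convex_insert_range hτc hr
  have hKcomp : IsCompact K := isCompact_insert_range hτc hl hr
  have hmem : ∀ x, τ x ∈ K := fun x => Set.mem_insert_of_mem _ (Set.mem_range_self x)
  have h0mem : τ₀ ∈ K := Set.mem_insert _ _
  set H : ℝ → ℝ := fun s => ∫ t in τ₀..s, h t with hH
  have hHd : ∀ s ∈ K, HasDerivAt H (h s) s := fun s hs =>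
    hasDerivAt_primitive hI hhc hKI hKc h0mem hs
  have hH0 : H τ₀ = 0 := by simp [hH]
  have hHl : ∀ {F : Filter ℝ}, Tendsto τ F (𝓝 τ₀) → Tendsto (fun x => H (τ x)) F (𝓝 0) :=
    fun {F} hF => by
      have := (hHd τ₀ h0mem).continuousAt.tendsto
      rw [hH0] at this
      exact this.comp hF
  have hhτ : ∀ {F : Filter ℝ}, Tendsto τ F (𝓝 τ₀) → Tendsto (fun x => h (τ x)) F (𝓝 (h τ₀)) :=
    fun {F} hF => (hhc.continuousAt (hI.mem_nhds hτ₀)).tendsto.comp hF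
  -- the second derivative when `c ≠ 0`
  have hd2 : c ≠ 0 → ∀ x, HasDerivAt (deriv τ)
      ((h (τ x) - (c ^ 2 - cs ^ 2) * deriv τ x) / c) x := fun hc x => by
    have := (h₂' x).div_const (-c)
    have he : (fun x => -c * deriv τ x / -c) = deriv τ := by
      funext y; field_simp
    rw [he] at this
    refine this.congr_deriv ?_
    field_simp
    ring
  have hbdd : ∀ {F : Filter ℝ}, Tendsto τ F (𝓝 τ₀) → ∀ᶠ x in F, |h (τ x)| ≤ |h τ₀| + 1 :=
    fun {F} hF => (hhτ hF).abs.eventually_le_const (lt_add_one _)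
  have hr₁ : c ≠ 0 → Tendsto (deriv τ) atTop (𝓝 0) := fun hc => by
    refine tendsto_deriv_zero (a := (c ^ 2 - cs ^ 2) / c) (B := (|h τ₀| + 1) / |c|) h₁ (hd2 hc) hr ?_
    filter_upwards [hbdd hr] with x hx
    have : (h (τ x) - (c ^ 2 - cs ^ 2) * deriv τ x) / c + (c ^ 2 - cs ^ 2) / c * deriv τ x =
        h (τ x) / c := by field_simp; ring
    rw [this, abs_div]
    gcongr
  have hl₁ : c ≠ 0 → Tendsto (deriv τ) atBot (𝓝 0) := fun hc => by
    have h3 := tendsto_deriv_zero (y := fun x => τ (-x)) (y₁ := fun x => -deriv τ (-x))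
      (a := -((c ^ 2 - cs ^ 2) / c)) (B := (|h τ₀| + 1) / |c|) (L := τ₀)
      (fun x => ((h₁ (-x)).scomp x (hasDerivAt_neg x)).congr_deriv (by simp))
      (fun x => ((hd2 hc (-x)).scomp x (hasDerivAt_neg x)).neg.congr_deriv (by
        rw [neg_one_smul, neg_neg]))
      (hl.comp tendsto_neg_atTop_atBot) (by
        filter_upwards [tendsto_neg_atTop_atBot.eventually (hbdd hl)] with x hx
        have : (h (τ (-x)) - (c ^ 2 - cs ^ 2) * deriv τ (-x)) / c +
            -((c ^ 2 - cs ^ 2) / c) * -deriv τ (-x) = h (τ (-x)) / c := by field_simp; ring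
        rw [this, abs_div]
        gcongr)
    have h4 := (h3.comp tendsto_neg_atBot_atTop).neg
    simpa [Function.comp_def] using h4
  -- the energy
  have hE : ∀ x, HasDerivAt (fun x => c / 2 * deriv τ x ^ 2 - H (τ x))
      ((cs ^ 2 - c ^ 2) * deriv τ x ^ 2) x := fun x => by
    have hHx := (hHd (τ x) (hmem x)).comp x (h₁ x)
    -- For c = 0 the profile equation is of first order and the kinetic term is absent, yet -H(τ)
    -- satisfies the same identity. Thus c = 0 needs no prior exclusion.
    by_cases hc : c = 0
    · have h3 : -h (τ x) + (c ^ 2 - cs ^ 2) * deriv τ x = 0 := by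
        have h4 := (h₂' x).deriv
        simp only [hc, neg_zero, zero_mul, deriv_const] at h4
        rw [hc]
        linarith
      have h5 : (fun x => c / 2 * deriv τ x ^ 2 - H (τ x)) = fun x => -H (τ x) := by
        funext y; rw [hc]; ring
      rw [h5]
      refine hHx.neg.congr_deriv ?_
      linear_combination deriv τ x * h3
    · refine ((((hd2 hc x).pow 2).const_mul (c / 2)).sub hHx).congr_deriv ?_
      field_simp
      ring
  have hElim : ∀ {F : Filter ℝ}, Tendsto τ F (𝓝 τ₀) → (c ≠ 0 → Tendsto (deriv τ) F (𝓝 0)) →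
      Tendsto (fun x => c / 2 * deriv τ x ^ 2 - H (τ x)) F (𝓝 0) := fun {F} hF hF₁ => by
    by_cases hc : c = 0
    · simpa [hc] using (hHl hF).neg
    · simpa using (((hF₁ hc).pow 2).const_mul (c / 2)).sub (hHl hF)
  obtain ⟨hE0, hE1⟩ := deriv_eq_zero_of_energy hE (hElim hl hl₁) (hElim hr hr₁)
  have hnc : ∃ x, τ x ≠ τ₀ := by
    obtain ⟨x, hx⟩ := hw.nonconstant
    refine ⟨x, fun h3 => hx ?_⟩
    rw [huq x, h3, hq]
    simp
  have hcc : cs ^ 2 = c ^ 2 := by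
    by_contra hcon
    obtain ⟨x, hx⟩ := hnc
    apply hx
    have h3 : ∀ y, deriv τ y = 0 := fun y => by
      have := hE1 y
      simpa [sub_ne_zero.2 hcon] using this
    have h4 : τ = fun _ => τ x := funext fun y => is_const_of_deriv_eq_zero
      (fun z => (h₁ z).differentiableAt) h3 y x
    rw [h4] at hr
    exact tendsto_nhds_unique tendsto_const_nhds hr
  have hc : c ≠ 0 := by
    rintro rfl
    have : cs ^ 2 ≠ 0 := by positivity
    exact this (by simpa using hcc)
  have hd2' : ∀ x, HasDerivAt (deriv τ) (h (τ x) / c) x := fun x =>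
    (hd2 hc x).congr_deriv (by rw [hcc]; ring)
  have hfd : ∀ s ∈ I, HasDerivAt f (deriv f s) s := fun s hs =>
    ((hf.differentiableOn two_ne_zero).differentiableAt (hI.mem_nhds hs)).hasDerivAt
  have hh1 : ContDiffOn ℝ 1 h I := by
    have := (hf.of_le (m := 1) (by norm_num))
    exact ((contDiffOn_const.mul contDiffOn_id).sub contDiffOn_const).sub this
  obtain ⟨B, hB0, hB⟩ := exists_lipschitz_at hI hh1 hKcomp hKc hKI h0mem
  -- The derivative lemma is applied a second time, to τ': its second derivative is bounded near +∞,
  -- so τ'' = h(τ)/c tends to 0 and the end state is an equilibrium.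
  have hh0 : h τ₀ = 0 := by
    have h3 : Tendsto (fun x => h (τ x) / c) atTop (𝓝 0) := by
      obtain ⟨B', hB'⟩ := hKcomp.bddAbove_image
        ((hh1.continuousOn_deriv_of_isOpen hI le_rfl).norm.mono hKI)
      refine tendsto_deriv_zero (y := deriv τ) (a := 0) (B := B' * 1 / |c|)
        (y₂ := fun x => deriv h (τ x) * deriv τ x / c) hd2' (fun x => ?_) (hr₁ hc) ?_
      · exact (((hh1.differentiableOn one_ne_zero).differentiableAt
          (hI.mem_nhds (hτ x))).hasDerivAt.comp x (h₁ x)).div_const c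
      · filter_upwards [(hr₁ hc).abs.eventually_le_const (by simp : |(0 : ℝ)| < 1)] with x hx
        rw [zero_mul, add_zero, abs_div, abs_mul]
        have h5 : |deriv h (τ x)| ≤ B' := hB' ⟨τ x, hmem x, rfl⟩
        have h6 := (abs_nonneg _).trans h5
        gcongr
    have h4 := tendsto_nhds_unique h3 ((hhτ hr).div_const c)
    have := h4.symm
    field_simp at this
    simpa using this
  -- At a point where τ = τ₀ the zero energy gives τ' = 0, and uniqueness for the profile equation
  -- would make the wave constant.
  have hne : ∀ x, τ x ≠ τ₀ := by
    intro x₁ hx₁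
    obtain ⟨x, hx⟩ := hnc
    apply hx
    have hd0 : deriv τ x₁ = 0 := by
      have h3 := hE0 x₁
      rw [hx₁, hH0] at h3
      simpa [hc] using h3
    have h4 := norm_le_gronwallBound_abs (d := fun x => (τ x - τ₀, deriv τ x))
      (d' := fun x => (deriv τ x, h (τ x) / c)) (δ := 0) (K := 1 + B / |c|) (ε := 0) (x₀ := x₁)
      (R := |x - x₁|) (fun x => ((h₁ x).sub_const τ₀).prodMk (hd2' x)) (by simp [hx₁, hd0])
      (fun y _ => by
        set N := ‖(τ y - τ₀, deriv τ y)‖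
        have n1 : |τ y - τ₀| ≤ N := norm_fst_le (τ y - τ₀, deriv τ y)
        have n2 : |deriv τ y| ≤ N := norm_snd_le (τ y - τ₀, deriv τ y)
        have hN : 0 ≤ N := norm_nonneg _
        have hBc : 0 ≤ B / |c| * N := by positivity
        refine norm_prod_le_iff.2 ⟨?_, ?_⟩
        · rw [Real.norm_eq_abs]; linarith
        · rw [Real.norm_eq_abs, abs_div]
          have n3 := hB (τ y) (hmem y)
          rw [hh0, sub_zero] at n3
          have : |h (τ y)| / |c| ≤ B / |c| * N := by
            rw [div_mul_eq_mul_div]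
            gcongr
            exact n3.trans (by gcongr)
          linarith) (x := x) le_rfl
    rw [gronwallBound_ε0, zero_mul] at h4
    have h5 := norm_le_zero_iff.1 h4
    have := (Prod.ext_iff.1 h5).1
    simp at this
    linarith
  obtain ⟨hlt, C, κ, M, Y, Y₁, Y₂, hM, hY, hYτ⟩ := exists_isWaveProfile hc hI hf hτ₀ hτ hnd hh0 h₁
    hd2' hl hr (hl₁ hc) (hr₁ hc) hne
  have hf1 : ContDiffOn ℝ 1 (deriv f) I := hf.deriv_of_isOpen hI (by norm_num)
  obtain ⟨B', hB'0, hB'⟩ := exists_lipschitz_at hI hf1 hKcomp hKc hKI h0mem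
  refine ⟨hcc, hc, hlt, ?_, ⟨B' * C, κ, hY.rate_pos, fun x => ?_⟩, C, κ, M, Y, Y₁, Y₂, hM, hY⟩
  · exact hf1.continuousOn.comp_continuous hτc hτ
  · have h3 := (le_abs_self _).trans (hY.bound x).1
    rw [← hYτ] at h3
    calc |deriv f (τ x) - deriv f τ₀| ≤ B' * |τ x - τ₀| := hB' _ (hmem x)
      _ ≤ B' * (C * Real.exp (-κ * |x|)) := by gcongr
      _ = _ := by ring

end JinXin

/-! ### Weak derivatives in L² -/

namespace JinXin

theorem HasCompactSupport.exists_interval {φ : ℝ → ℝ} (h : HasCompactSupport φ) :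
    ∃ R, 0 < R ∧ ∀ x, R ≤ |x| → φ x = 0 := by
  obtain ⟨R, hR⟩ := h.isCompact.isBounded.subset_closedBall 0
  refine ⟨max R 0 + 1, by positivity, fun x hx => ?_⟩
  by_contra h0
  have := hR (subset_tsupport _ h0)
  rw [mem_closedBall_zero_iff, Real.norm_eq_abs] at this
  linarith [le_max_left R 0]

theorem intervalIntegrable_of_locallyIntegrable {E : Type*} [NormedAddCommGroup E] {w : ℝ → E}
    (hw : LocallyIntegrable w) (a b : ℝ) : IntervalIntegrable w volume a b :=
  intervalIntegrable_iff.mpr <|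
    (hw.integrableOn_isCompact isCompact_uIcc).mono_set Set.uIoc_subset_uIcc

/-- The primitive is absolutely continuous with derivative w almost everywhere, which is all that
integration by parts requires; the interval is large enough for the boundary terms to vanish. -/
theorem integral_deriv_mul_primitive {w : ℝ → ℝ} (hw : LocallyIntegrable w) {φ : ℝ → ℝ}
    (hφ : ContDiff ℝ ∞ φ) (hs : HasCompactSupport φ) :
    ∫ x, deriv φ x * (∫ t in (0 : ℝ)..x, w t) = -∫ x, φ x * w x := by
  obtain ⟨R, hR0, hR⟩ := HasCompactSupport.exists_interval hs
  obtain ⟨R', hR'0, hR'⟩ := HasCompactSupport.exists_interval hs.deriv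
  set S := max R R' with hS
  have hS0 : 0 < S := hR0.trans_le (le_max_left _ _)
  have hout : ∀ x, x ∉ Set.Ioc (-S) S → S ≤ |x| := fun x hx => by
    rw [Set.mem_Ioc, not_and_or, not_lt, not_le] at hx
    rcases hx with hx | hx
    · exact (by linarith : S ≤ -x).trans (neg_le_abs x)
    · exact hx.le.trans (le_abs_self x)
  have h1 : ∫ x, deriv φ x * (∫ t in (0 : ℝ)..x, w t)
      = ∫ x in (-S)..S, deriv φ x * (∫ t in (0 : ℝ)..x, w t) := by
    refine (intervalIntegral.integral_eq_integral_of_support_subset fun x hx => ?_).symm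
    by_contra hcon
    exact hx (by simp [hR' x ((le_max_right _ _).trans (hout x hcon))])
  have h2 : ∫ x, φ x * w x = ∫ x in (-S)..S, φ x * w x := by
    refine (intervalIntegral.integral_eq_integral_of_support_subset fun x hx => ?_).symm
    by_contra hcon
    exact hx (by simp [hR x ((le_max_left _ _).trans (hout x hcon))])
  have hint : IntervalIntegrable w volume (-S) S :=
    intervalIntegrable_of_locallyIntegrable hw _ _
  have h3 := AbsolutelyContinuousOnInterval.integral_mul_deriv_eq_deriv_mul (f := φ)
    (g := fun x => ∫ t in (0 : ℝ)..x, w t) (a := -S) (b := S)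
    ((hφ.of_le (by exact_mod_cast le_top)).contDiffOn (s := Set.uIcc (-S) S)).absolutelyContinuousOnInterval
    (hint.absolutelyContinuousOnInterval_intervalIntegral (by
      rw [Set.uIcc_of_le (by linarith)]; exact ⟨by linarith, hS0.le⟩))
  have h4 : ∫ x in (-S)..S, φ x * deriv (fun x => ∫ t in (0 : ℝ)..x, w t) x
      = ∫ x in (-S)..S, φ x * w x := by
    refine intervalIntegral.integral_congr_ae ?_
    filter_upwards [LocallyIntegrable.ae_hasDerivAt_integral hw] with x hx _
    rw [(hx 0).deriv]
  rw [h1, h2, ← h4, h3, hR S ((le_max_left _ _).trans (le_abs_self _)),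
    hR (-S) ((le_max_left _ _).trans (by rw [abs_neg]; exact le_abs_self _))]
  ring

theorem integral_deriv_smul_primitive {w : ℝ → ℂ} (hw : LocallyIntegrable w) {φ : ℝ → ℝ}
    (hφ : ContDiff ℝ ∞ φ) (hs : HasCompactSupport φ) :
    ∫ x, deriv φ x • (∫ t in (0 : ℝ)..x, w t) = -∫ x, φ x • w x := by
  have hcont : Continuous fun x => ∫ t in (0 : ℝ)..x, w t :=
    intervalIntegral.continuous_primitive (intervalIntegrable_of_locallyIntegrable hw) 0
  have hi1 : Integrable fun x => deriv φ x • ∫ t in (0 : ℝ)..x, w t :=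
    ((hφ.continuous_deriv (by simp)).smul hcont).integrable_of_hasCompactSupport
      hs.deriv.smul_right
  have hi2 : Integrable fun x => φ x • w x :=
    hw.integrable_smul_left_of_hasCompactSupport hφ.continuous hs
  have hL : ∀ L : ℂ →L[ℝ] ℝ,
      L (∫ x, deriv φ x • (∫ t in (0 : ℝ)..x, w t)) = L (-∫ x, φ x • w x) := by
    intro L
    have hLw : LocallyIntegrable fun x => L (w x) := fun x => by
      obtain ⟨s, hs, hsi⟩ := hw x
      exact ⟨s, hs, L.integrable_comp hsi⟩
    rw [map_neg, ← L.integral_comp_comm hi1, ← L.integral_comp_comm hi2]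
    have := integral_deriv_mul_primitive hLw hφ hs
    simp only [map_smul, smul_eq_mul]
    rw [← this]
    congr 1
    funext x
    rw [← L.intervalIntegral_comp_comm (intervalIntegrable_of_locallyIntegrable hw _ _)]
  exact Complex.ext (hL Complex.reCLM) (hL Complex.imCLM)

/-- A locally integrable function with vanishing weak derivative is constant. -/
theorem exists_ae_eq_const {v : ℝ → ℂ} (hv : LocallyIntegrable v)
    (h : ∀ φ : ℝ → ℝ, ContDiff ℝ ∞ φ → HasCompactSupport φ → ∫ x, deriv φ x • v x = 0) :
    ∃ k : ℂ, ∀ᵐ x, v x = k := by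
  let ρ₀ : ContDiffBump (0 : ℝ) := default
  set ρ : ℝ → ℝ := ρ₀.normed volume with hρ
  have hρc : ContDiff ℝ ∞ ρ := ρ₀.contDiff_normed
  have hρs : HasCompactSupport ρ := ρ₀.hasCompactSupport_normed
  have hρ1 : ∫ x, ρ x = 1 := ρ₀.integral_normed
  have hρi : Integrable ρ := hρc.continuous.integrable_of_hasCompactSupport hρs
  set k := ∫ x, ρ x • v x with hk
  refine ⟨k, ?_⟩
  have h0 : ∀ᵐ x, v x - k = 0 := by
    refine ae_eq_zero_of_integral_contDiff_smul_eq_zero (hv.sub (locallyIntegrable_const k))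
      fun ψ hψ hψs => ?_
    have hψi : Integrable ψ := hψ.continuous.integrable_of_hasCompactSupport hψs
    set a := ∫ x, ψ x with ha
    -- Subtracting a ρ removes the mean of ψ, so the primitive of g has compact support and is an
    -- admissible test function.
    let g : ℝ → ℝ := fun x => ψ x - a * ρ x
    have hg : ContDiff ℝ ∞ g := hψ.sub (contDiff_const.mul hρc)
    have hgs : HasCompactSupport g := hψs.sub (hρs.mul_left)
    have hgi : Integrable g := hψi.sub (hρi.const_mul a)
    have hg0 : ∫ x, g x = 0 := by
      have : ∫ x, g x = (∫ x, ψ x) - ∫ x, a * ρ x := integral_sub hψi (hρi.const_mul a)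
      rw [this, integral_const_mul, hρ1, mul_one, sub_self]
    obtain ⟨R, hR0, hR⟩ := HasCompactSupport.exists_interval hgs
    let G : ℝ → ℝ := fun x => ∫ t in (-R)..x, g t
    have hGd : ∀ x, HasDerivAt G (g x) x := fun x =>
      intervalIntegral.integral_hasDerivAt_right (hg.continuous.intervalIntegrable _ _)
        (hg.continuous.stronglyMeasurableAtFilter _ _) hg.continuous.continuousAt
    have hG' : deriv G = g := funext fun x => (hGd x).deriv
    have hGc : ContDiff ℝ ∞ G := by
      rw [contDiff_infty_iff_deriv]
      exact ⟨fun x => (hGd x).differentiableAt, by rw [hG']; exact hg⟩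
    have hGs : HasCompactSupport G := by
      refine HasCompactSupport.intro (isCompact_Icc (a := -R) (b := R)) fun x hx => ?_
      rw [Set.mem_Icc, not_and_or, not_le, not_le] at hx
      rcases hx with hx | hx
      · refine intervalIntegral.integral_zero_ae (Eventually.of_forall fun t ht => hR t ?_)
        rw [Set.uIoc_of_ge hx.le] at ht
        exact (by linarith [ht.2] : R ≤ -t).trans (neg_le_abs t)
      · change ∫ t in (-R)..x, g t = 0
        rw [intervalIntegral.integral_eq_integral_of_support_subset, hg0]
        intro t ht
        by_contra hcon
        apply ht
        apply hR
        rw [Set.mem_Ioc, not_and_or, not_lt, not_le] at hcon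
        rcases hcon with hcon | hcon
        · exact (by linarith : R ≤ -t).trans (neg_le_abs t)
        · exact (by linarith : R ≤ t).trans (le_abs_self t)
    have h1 := h G hGc hGs
    rw [hG'] at h1
    have i1 : Integrable fun x => ψ x • v x :=
      hv.integrable_smul_left_of_hasCompactSupport hψ.continuous hψs
    have i2 : Integrable fun x => ρ x • v x :=
      hv.integrable_smul_left_of_hasCompactSupport hρc.continuous hρs
    have h2 : ∫ x, g x • v x = (∫ x, ψ x • v x) - a • k := by
      have h4 : ∫ x, g x • v x = ∫ x, (ψ x • v x - a • (ρ x • v x)) := by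
        congr 1
        funext x
        simp only [g, sub_smul, mul_smul]
      rw [h4, hk, ← integral_smul]
      exact integral_sub i1 (i2.smul a)
    have h3 : ∫ x, ψ x • (v x - k) = (∫ x, ψ x • v x) - a • k := by
      rw [ha, ← integral_smul_const, ← integral_sub i1 (hψi.smul_const k)]
      congr 1
      funext x
      rw [smul_sub]
    change ∫ x, ψ x • (v x - k) = 0
    rw [h3, ← h2, h1]
  filter_upwards [h0] with x hx
  exact sub_eq_zero.1 hx

theorem locallyIntegrable_L2 (v : L2) : LocallyIntegrable v :=
  (Lp.memLp v).locallyIntegrable (by norm_num)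

/-- A function in `H¹` is almost everywhere equal to a primitive of its weak derivative. -/
theorem HasWeakDeriv.exists_primitive {v w : L2} (h : HasWeakDeriv v w) :
    ∃ k : ℂ, ∀ᵐ x, v x = k + ∫ t in (0 : ℝ)..x, w t := by
  have hcont : Continuous fun x => ∫ t in (0 : ℝ)..x, w t :=
    intervalIntegral.continuous_primitive
      (intervalIntegrable_of_locallyIntegrable (locallyIntegrable_L2 w)) 0
  obtain ⟨k, hk⟩ := exists_ae_eq_const
    (v := fun x => v x - ∫ t in (0 : ℝ)..x, w t)
    ((locallyIntegrable_L2 v).sub hcont.locallyIntegrable) fun φ hφ hs => by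
      have i1 : Integrable fun x => deriv φ x • v x :=
        (locallyIntegrable_L2 v).integrable_smul_left_of_hasCompactSupport
          (hφ.continuous_deriv (by simp)) hs.deriv
      have i2 : Integrable fun x => deriv φ x • ∫ t in (0 : ℝ)..x, w t :=
        ((hφ.continuous_deriv (by simp)).smul hcont).integrable_of_hasCompactSupport
          hs.deriv.smul_right
      simp only [smul_sub]
      rw [integral_sub i1 i2, h φ hφ hs,
        integral_deriv_smul_primitive (locallyIntegrable_L2 w) hφ hs, sub_self]
  refine ⟨k, ?_⟩
  filter_upwards [hk] with x hx
  rw [← hx]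
  ring

theorem hasWeakDeriv_toLp {v v' : ℝ → ℂ} (hd : ∀ x, HasDerivAt v (v' x) x) (hv : MemLp v 2)
    (hv' : MemLp v' 2) : HasWeakDeriv (hv.toLp v) (hv'.toLp v') := by
  intro φ hφ hs
  have hl : LocallyIntegrable v := hv.locallyIntegrable (by norm_num)
  have hl' : LocallyIntegrable v' := hv'.locallyIntegrable (by norm_num)
  have e1 : ∫ x, deriv φ x • (hv.toLp v) x = ∫ x, deriv φ x • v x :=
    integral_congr_ae (by filter_upwards [hv.coeFn_toLp] with x hx; rw [hx])
  have e2 : ∫ x, φ x • (hv'.toLp v') x = ∫ x, φ x • v' x :=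
    integral_congr_ae (by filter_upwards [hv'.coeFn_toLp] with x hx; rw [hx])
  rw [e1, e2]
  have := integral_bilinear_hasDerivAt_right_eq_neg_left_of_integrable
    (L := ContinuousLinearMap.lsmul ℝ ℝ) (u := φ) (u' := deriv φ) (v := v) (v' := v')
    (fun x _ => (hφ.differentiable (by simp) x).hasDerivAt) (fun x _ => hd x)
    (hl'.integrable_smul_left_of_hasCompactSupport hφ.continuous hs)
    (hl.integrable_smul_left_of_hasCompactSupport (hφ.continuous_deriv (by simp)) hs.deriv)
    (hl.integrable_smul_left_of_hasCompactSupport hφ.continuous hs)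
  simp only [ContinuousLinearMap.lsmul_apply] at this
  rw [this, neg_neg]

/-- A compactly supported continuous function as an element of `L²`. -/
noncomputable def testFun (ψ : ℝ → ℝ) (hc : Continuous ψ) (hs : HasCompactSupport ψ) : L2 :=
  ((Complex.continuous_ofReal.comp hc).memLp_of_hasCompactSupport
    (hs.comp_left Complex.ofReal_zero)).toLp _

theorem integral_smul_eq_inner {ψ : ℝ → ℝ} (hc : Continuous ψ) (hs : HasCompactSupport ψ)
    (v : L2) : ∫ x, ψ x • v x = inner ℂ (testFun ψ hc hs) v := by
  rw [L2.inner_def]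
  refine integral_congr_ae ?_
  filter_upwards [((Complex.continuous_ofReal.comp hc).memLp_of_hasCompactSupport (μ := volume)
    (p := 2) (hs.comp_left Complex.ofReal_zero)).coeFn_toLp] with x hx
  rw [testFun, hx]
  simp [mul_comm]

theorem hasWeakDeriv_iff_inner {v w : L2} : HasWeakDeriv v w ↔
    ∀ (φ : ℝ → ℝ) (hφ : ContDiff ℝ ∞ φ) (hs : HasCompactSupport φ),
      inner ℂ (testFun (deriv φ) (hφ.continuous_deriv (by simp)) hs.deriv) v =
        -inner ℂ (testFun φ hφ.continuous hs) w := by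
  refine forall_congr' fun φ => forall_congr' fun hφ => forall_congr' fun hs => ?_
  rw [integral_smul_eq_inner (hφ.continuous_deriv (by simp)) hs.deriv,
    integral_smul_eq_inner hφ.continuous hs]

/-- Testing against a fixed function is an inner product and hence continuous on L². Closedness is
what lets the open mapping theorem bound the solution operator. -/
theorem isClosed_hasWeakDeriv : IsClosed {p : L2 × L2 | HasWeakDeriv p.1 p.2} := by
  simp only [hasWeakDeriv_iff_inner, Set.ofPred_forall]
  refine isClosed_iInter fun φ => isClosed_iInter fun hφ => isClosed_iInter fun hs => ?_
  exact isClosed_eq (by fun_prop) (by fun_prop)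

theorem HasWeakDeriv.add {v w v' w' : L2} (h : HasWeakDeriv v w) (h' : HasWeakDeriv v' w') :
    HasWeakDeriv (v + v') (w + w') := by
  rw [hasWeakDeriv_iff_inner] at *
  intro φ hφ hs
  rw [inner_add_right, inner_add_right, h φ hφ hs, h' φ hφ hs, neg_add]

theorem HasWeakDeriv.const_smul {v w : L2} (h : HasWeakDeriv v w) (a : ℂ) :
    HasWeakDeriv (a • v) (a • w) := by
  rw [hasWeakDeriv_iff_inner] at *
  intro φ hφ hs
  rw [inner_smul_right, inner_smul_right, h φ hφ hs, mul_neg]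

theorem HasWeakDeriv.zero : HasWeakDeriv 0 0 := by
  rw [hasWeakDeriv_iff_inner]
  simp

theorem HasWeakDeriv.sum {ι : Type*} {s : Finset ι} {v w : ι → L2}
    (h : ∀ i ∈ s, HasWeakDeriv (v i) (w i)) : HasWeakDeriv (∑ i ∈ s, v i) (∑ i ∈ s, w i) := by
  classical
  induction s using Finset.induction_on with
  | empty => simpa using HasWeakDeriv.zero
  | insert a s ha ih =>
    rw [Finset.sum_insert ha, Finset.sum_insert ha]
    exact (h a (Finset.mem_insert_self _ _)).add (ih fun i hi => h i (Finset.mem_insert_of_mem hi))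

end JinXin

/-! ### Constant-coefficient systems in L² -/

namespace JinXin

/-- A linear equation `⟪J s, v⟫ = ⟪ι s, h⟫` is solvable in a Hilbert space if `J` is bounded below
relative to `ι`. -/
theorem exists_inner_eq {H S : Type*} [NormedAddCommGroup H] [InnerProductSpace ℂ H]
    [CompleteSpace H] [AddCommGroup S] [Module ℂ S] (J ι : S →ₗ[ℂ] H) {a : ℝ} (ha : 0 < a)
    (hJ : ∀ s, a * ‖ι s‖ ≤ ‖J s‖) (h : H) : ∃ v : H, ∀ s, inner ℂ (J s) v = inner ℂ (ι s) h := by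
  -- The choice of preimages is harmless: by `hJ`, J s = 0 implies ι s = 0, and the same bound makes
  -- ι ∘ r continuous on the range of J.
  obtain ⟨r, hr⟩ := J.rangeRestrict.exists_rightInverse_of_surjective J.range_rangeRestrict
  have hrJ : ∀ y : J.range, J (r y) = y := fun y => by
    have := LinearMap.congr_fun hr y
    exact congrArg Subtype.val this
  let F₀ : J.range →ₗ[ℂ] ℂ := ((innerSL ℂ h : H →L[ℂ] ℂ) : H →ₗ[ℂ] ℂ) ∘ₗ ι ∘ₗ r
  let F₁ : StrongDual ℂ J.range := F₀.mkContinuous (‖h‖ * a⁻¹) fun y => by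
    have h1 : ‖ι (r y)‖ ≤ a⁻¹ * ‖y‖ := by
      have := hJ (r y)
      rw [hrJ] at this
      rw [inv_mul_eq_div, le_div_iff₀ ha, mul_comm]
      exact this
    calc ‖F₀ y‖ ≤ ‖h‖ * ‖ι (r y)‖ := norm_inner_le_norm _ _
      _ ≤ ‖h‖ * (a⁻¹ * ‖y‖) := by gcongr
      _ = _ := by ring
  obtain ⟨F, hF, -⟩ := exists_extension_norm_eq J.range F₁
  refine ⟨(InnerProductSpace.toDual ℂ H).symm F, fun s => ?_⟩
  have h2 : inner ℂ ((InnerProductSpace.toDual ℂ H).symm F) (J s) = inner ℂ h (ι s) := by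
    rw [InnerProductSpace.toDual_symm_apply]
    have h3 := hF ⟨J s, s, rfl⟩
    rw [h3]
    change inner ℂ h (ι (r ⟨J s, s, rfl⟩)) = _
    have h4 : ι (r ⟨J s, s, rfl⟩ - s) = 0 := by
      have h5 := hJ (r ⟨J s, s, rfl⟩ - s)
      rw [map_sub J, hrJ, sub_self, norm_zero] at h5
      exact norm_eq_zero.1 (le_antisymm (by nlinarith [norm_nonneg (ι (r ⟨J s, s, rfl⟩ - s))])
        (norm_nonneg _))
    rw [map_sub, sub_eq_zero] at h4
    rw [h4]
  rw [← inner_conj_symm, h2, inner_conj_symm]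

/-- The space of complex test functions on the line. -/
def testSpace : Submodule ℂ (ℝ → ℂ) where
  carrier := {φ | ContDiff ℝ ∞ φ ∧ HasCompactSupport φ}
  add_mem' h h' := ⟨h.1.add h'.1, h.2.add h'.2⟩
  zero_mem' := ⟨contDiff_const, HasCompactSupport.zero⟩
  smul_mem' _ _ h := ⟨contDiff_const.smul h.1, h.2.smul_left⟩

theorem memLp_testSpace (φ : testSpace) : MemLp (φ : ℝ → ℂ) 2 :=
  φ.2.1.continuous.memLp_of_hasCompactSupport φ.2.2

theorem memLp_deriv_testSpace (φ : testSpace) : MemLp (deriv (φ : ℝ → ℂ)) 2 :=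
  (φ.2.1.continuous_deriv (by simp)).memLp_of_hasCompactSupport φ.2.2.deriv

noncomputable def testToLp : testSpace →ₗ[ℂ] L2 where
  toFun φ := (memLp_testSpace φ).toLp _
  map_add' φ ψ := MemLp.toLp_add (memLp_testSpace φ) (memLp_testSpace ψ)
  map_smul' a φ := MemLp.toLp_const_smul a (memLp_testSpace φ)

noncomputable def testDerivToLp : testSpace →ₗ[ℂ] L2 where
  toFun φ := (memLp_deriv_testSpace φ).toLp _
  map_add' φ ψ := by
    rw [← MemLp.toLp_add]
    refine MemLp.toLp_congr _ _ (Eventually.of_forall fun x => ?_)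
    exact deriv_add (φ.2.1.differentiable (by simp) x) (ψ.2.1.differentiable (by simp) x)
  map_smul' a φ := by
    rw [RingHom.id_apply, ← MemLp.toLp_const_smul]
    refine MemLp.toLp_congr _ _ (Eventually.of_forall fun x => ?_)
    exact deriv_const_smul a (φ.2.1.differentiable (by simp) x)

/-- The real part of the integrand is half the derivative of |φ|², which integrates to zero. -/
theorem re_inner_deriv_eq_zero (φ : testSpace) :
    (inner ℂ (testToLp φ) (testDerivToLp φ)).re = 0 := by
  have hd : ∀ x, HasDerivAt (φ : ℝ → ℂ) (deriv (φ : ℝ → ℂ) x) x := fun x =>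
    (φ.2.1.differentiable (by simp) x).hasDerivAt
  have hc := φ.2.1.continuous
  have hc' : Continuous (deriv (φ : ℝ → ℂ)) := φ.2.1.continuous_deriv (by simp)
  have h1 : inner ℂ (testToLp φ) (testDerivToLp φ) =
      ∫ x, inner ℂ ((φ : ℝ → ℂ) x) (deriv (φ : ℝ → ℂ) x) := by
    rw [L2.inner_def]
    refine integral_congr_ae ?_
    filter_upwards [(memLp_testSpace φ).coeFn_toLp, (memLp_deriv_testSpace φ).coeFn_toLp]
      with x hx hx'
    simp only [testToLp, testDerivToLp, LinearMap.coe_mk, AddHom.coe_mk, hx, hx']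
  have hi : Integrable fun x => inner ℂ ((φ : ℝ → ℂ) x) (deriv (φ : ℝ → ℂ) x) := by
    refine (hc.inner hc').integrable_of_hasCompactSupport ?_
    exact φ.2.2.mono fun x hx h0 => hx (by simp [h0])
  have h2 : ∫ x, 2 * inner ℝ ((φ : ℝ → ℂ) x) (deriv (φ : ℝ → ℂ) x) = 0 := by
    refine integral_eq_zero_of_hasDerivAt_of_integrable (f := fun x => ‖(φ : ℝ → ℂ) x‖ ^ 2)
      (fun x => (hd x).norm_sq) ?_ ?_
    · refine ((hc.inner hc').const_mul 2).integrable_of_hasCompactSupport ?_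
      exact φ.2.2.mono fun x hx h0 => hx (by simp [h0])
    · refine (hc.norm.pow 2).integrable_of_hasCompactSupport ?_
      exact φ.2.2.mono fun x hx h0 => hx (by simp [h0])
  rw [integral_const_mul] at h2
  have h3 : (inner ℂ (testToLp φ) (testDerivToLp φ)).re =
      ∫ x, inner ℝ ((φ : ℝ → ℂ) x) (deriv (φ : ℝ → ℂ) x) := by
    rw [h1]
    exact (Complex.reCLM.integral_comp_comm hi).symm
  rw [h3]
  linarith

/-- Pairing with φ itself removes the derivative from the real part and leaves Re μ ‖φ‖². -/
theorem norm_le_testDeriv (μ : ℂ) (φ : testSpace) :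
    |μ.re| * ‖testToLp φ‖ ≤ ‖(testDerivToLp + μ • testToLp) φ‖ := by
  set p := testToLp φ with hp
  have h0 : inner ℂ p p = ((‖p‖ ^ 2 : ℝ) : ℂ) := by
    rw [inner_self_eq_norm_sq_to_K, Complex.ofReal_pow]
    rfl
  have h1 : (inner ℂ p ((testDerivToLp + μ • testToLp) φ)).re = μ.re * ‖p‖ ^ 2 := by
    rw [LinearMap.add_apply, LinearMap.smul_apply, inner_add_right, inner_smul_right,
      Complex.add_re, ← hp, hp, re_inner_deriv_eq_zero, ← hp, zero_add, h0, Complex.re_mul_ofReal]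
  have h2 : |μ.re| * ‖p‖ ^ 2 ≤ ‖p‖ * ‖(testDerivToLp + μ • testToLp) φ‖ := by
    calc |μ.re| * ‖p‖ ^ 2 = |(inner ℂ p ((testDerivToLp + μ • testToLp) φ)).re| := by
          rw [h1, abs_mul, abs_of_nonneg (sq_nonneg ‖p‖)]
      _ ≤ ‖inner ℂ p ((testDerivToLp + μ • testToLp) φ)‖ := Complex.abs_re_le_norm _
      _ ≤ _ := norm_inner_le_norm _ _
  rcases (norm_nonneg p).eq_or_lt with h0 | h0
  · rw [← h0, mul_zero]; exact norm_nonneg _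
  · refine le_of_mul_le_mul_left ?_ h0
    calc ‖p‖ * (|μ.re| * ‖p‖) = |μ.re| * ‖p‖ ^ 2 := by ring
      _ ≤ _ := h2

/-- The equation `v' = μ v + h` is solvable in `L²` if `μ` is not purely imaginary. -/
theorem exists_weak_solution_scalar {μ : ℂ} (hμ : μ.re ≠ 0) (h : L2) :
    ∃ v : L2, HasWeakDeriv v (μ • v + h) := by
  -- Tested against φ, the equation reads ⟨φ' + conj(μ) φ, v⟩ = -⟨φ, h⟩, whence the conjugate and
  -- the sign of h.
  obtain ⟨v, hv⟩ := exists_inner_eq (testDerivToLp + (starRingEnd ℂ) μ • testToLp) testToLp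
    (abs_pos.2 hμ) (fun φ => by simpa using norm_le_testDeriv ((starRingEnd ℂ) μ) φ) (-h)
  refine ⟨v, hasWeakDeriv_iff_inner.2 fun φ hφ hs => ?_⟩
  let Φ : testSpace := ⟨fun x => (φ x : ℂ), Complex.ofRealCLM.contDiff.comp hφ,
    hs.comp_left Complex.ofReal_zero⟩
  have e1 : testToLp Φ = testFun φ hφ.continuous hs := rfl
  have e2 : testDerivToLp Φ = testFun (deriv φ) (hφ.continuous_deriv (by simp)) hs.deriv := by
    refine MemLp.toLp_congr (memLp_deriv_testSpace Φ) _ (Eventually.of_forall fun x => ?_)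
    exact ((hφ.differentiable (by simp) x).hasDerivAt.ofReal_comp).deriv
  have h1 := hv Φ
  rw [LinearMap.add_apply, LinearMap.smul_apply, inner_add_left, inner_smul_left, e1, e2,
    inner_neg_right, Complex.conj_conj] at h1
  rw [inner_add_right, inner_smul_right]
  linear_combination h1

section System

variable {A₀ V V' N : Matrix (Fin 3) (Fin 3) ℂ} {k : ℕ} {d : Fin 3 → ℂ} {δ : ℝ}

/-- Strict upper triangularity allows the scalar equations to be solved from the last to the first.
-/
theorem IsBlockForm.exists_weak_solution_triangular (h : IsBlockForm A₀ k d δ V V' N)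
    (F : Fin 3 → L2) : ∃ Y : Fin 3 → L2,
      ∀ i, HasWeakDeriv (Y i) (d i • Y i + ∑ j, N i j • Y j + F i) := by
  have hd : ∀ j, (d j).re ≠ 0 := fun j => by
    rcases lt_or_ge j.val k with hj | hj
    · exact (h.pos j hj).ne'
    · exact (h.neg j hj).ne
  have hN : ∀ i j, j ≤ i → N i j = 0 := fun i j hij => by
    by_contra hcon
    exact absurd (h.upper i j hcon).1 (not_lt.2 hij)
  obtain ⟨y₂, hy₂⟩ := exists_weak_solution_scalar (hd 2) (F 2)
  obtain ⟨y₁, hy₁⟩ := exists_weak_solution_scalar (hd 1) (N 1 2 • y₂ + F 1)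
  obtain ⟨y₀, hy₀⟩ := exists_weak_solution_scalar (hd 0) (N 0 1 • y₁ + N 0 2 • y₂ + F 0)
  refine ⟨![y₀, y₁, y₂], fun i => ?_⟩
  fin_cases i
  · simpa [Fin.sum_univ_three, hN 0 0 le_rfl, add_assoc] using hy₀
  · simpa [Fin.sum_univ_three, hN 1 0 (by decide), hN 1 1 le_rfl, add_assoc] using hy₁
  · simpa [Fin.sum_univ_three, hN 2 0 (by decide), hN 2 1 (by decide), hN 2 2 le_rfl] using hy₂

theorem IsBlockForm.exists_weak_solution (h : IsBlockForm A₀ k d δ V V' N) (F : Fin 3 → L2) :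
    ∃ W : Fin 3 → L2, ∀ i, HasWeakDeriv (W i) (∑ j, A₀ i j • W j + F i) := by
  obtain ⟨Y, hY⟩ := h.exists_weak_solution_triangular fun i => ∑ j, V' i j • F j
  refine ⟨fun i => ∑ j, V i j • Y j, fun i => ?_⟩
  have h1 : HasWeakDeriv (∑ j, V i j • Y j)
      (∑ j, V i j • (d j • Y j + ∑ m, N j m • Y m + ∑ m, V' j m • F m)) :=
    HasWeakDeriv.sum fun j _ => (hY j).const_smul _
  convert h1 using 1
  have hA : ∀ m, ∑ j, A₀ i j * V j m = V i m * d m + ∑ j, V i j * N j m := fun m => by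
    have := congrFun (congrFun h.conj i) m
    rw [Matrix.mul_add, Matrix.add_apply, Matrix.mul_diagonal] at this
    simpa only [Matrix.mul_apply] using this
  have hI : ∀ m, ∑ j, V i j * V' j m = if i = m then 1 else 0 := fun m => by
    have := congrFun (congrFun h.mul_inv i) m
    simpa only [Matrix.mul_apply, Matrix.one_apply] using this
  have e1 : ∑ j, A₀ i j • ∑ m, V j m • Y m = ∑ m, (∑ j, A₀ i j * V j m) • Y m := by
    simp only [Finset.smul_sum, smul_smul, Finset.sum_smul]
    exact Finset.sum_comm
  have e2 : ∑ j, V i j • ∑ m, N j m • Y m = ∑ m, (∑ j, V i j * N j m) • Y m := by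
    simp only [Finset.smul_sum, smul_smul, Finset.sum_smul]
    exact Finset.sum_comm
  have e3 : ∑ j, V i j • ∑ m, V' j m • F m = ∑ m, (∑ j, V i j * V' j m) • F m := by
    simp only [Finset.smul_sum, smul_smul, Finset.sum_smul]
    exact Finset.sum_comm
  have e4 : ∑ m, (if i = m then (1 : ℂ) else 0) • F m = F i := by simp
  simp only [smul_add, Finset.sum_add_distrib, e1, e2, e3, hA, hI, e4, add_smul, smul_smul]

end System

end JinXin

/-! ### The solution operator of the variable-coefficient system -/

namespace JinXin

/-- Multiplication by a bounded function on `L²`. -/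
theorem exists_mul_operator {a : ℝ → ℂ} (ha : Continuous a) {K : ℝ} (hK : ∀ x, ‖a x‖ ≤ K) :
    ∃ M : L2 →L[ℂ] L2, ∀ v : L2, ∀ᵐ x, M v x = a x * v x := by
  have hm : MemLp a ⊤ (volume : Measure ℝ) :=
    memLp_top_of_bound ha.aestronglyMeasurable K (Eventually.of_forall hK)
  refine ⟨(ContinuousLinearMap.mul ℂ ℂ).holderL volume ⊤ 2 2 (hm.toLp a), fun v => ?_⟩
  filter_upwards [(ContinuousLinearMap.mul ℂ ℂ).coeFn_holder (r := 2) (hm.toLp a) v,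
    hm.coeFn_toLp] with x hx hx'
  change (ContinuousLinearMap.mul ℂ ℂ).holder 2 (hm.toLp a) v x = _
  rw [hx, hx']
  rfl

theorem memLp_of_exp_bound {E : Type*} [NormedAddCommGroup E] {v : ℝ → E} (hv : Continuous v)
    {C κ : ℝ} (hκ : 0 < κ) (h : ∀ x, ‖v x‖ ≤ C * Real.exp (-κ * |x|)) : MemLp v 2 := by
  rw [memLp_two_iff_integrable_sq_norm hv.aestronglyMeasurable]
  refine ((integrable_exp_neg_mul_abs (κ := 2 * κ) (by positivity)).const_mul (C ^ 2)).mono'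
    (hv.norm.pow 2).aestronglyMeasurable (Eventually.of_forall fun x => ?_)
  rw [Real.norm_of_nonneg (by positivity)]
  calc ‖v x‖ ^ 2 ≤ (C * Real.exp (-κ * |x|)) ^ 2 := by gcongr; exact h x
    _ = _ := by rw [mul_pow, ← Real.exp_nat_mul]; congr 2; push_cast; ring

/-- From |w| ≤ 1 + |w|². Linear growth is crude but harmless against the exponential decay of the
coefficients. -/
theorem exists_primitive_bound (w : L2) :
    ∃ K, 0 ≤ K ∧ ∀ x, ‖∫ t in (0 : ℝ)..x, w t‖ ≤ |x| + K := by
  have hsq : Integrable fun t => ‖w t‖ ^ 2 :=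
    (memLp_two_iff_integrable_sq_norm (Lp.memLp w).1).1 (Lp.memLp w)
  refine ⟨∫ t, ‖w t‖ ^ 2, integral_nonneg fun t => by positivity, fun x => ?_⟩
  have hi : IntegrableOn w (Set.uIoc 0 x) := intervalIntegrable_iff.1
    (intervalIntegrable_of_locallyIntegrable (locallyIntegrable_L2 w) 0 x)
  have hc : IntegrableOn (fun _ : ℝ => (1 : ℝ)) (Set.uIoc 0 x) := by
    refine (integrableOn_const_iff).2 (Or.inr ?_)
    exact (measure_mono Set.uIoc_subset_uIcc).trans_lt isCompact_uIcc.measure_lt_top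
  calc ‖∫ t in (0 : ℝ)..x, w t‖ ≤ ∫ t in Set.uIoc 0 x, ‖w t‖ :=
        intervalIntegral.norm_integral_le_integral_norm_uIoc
    _ ≤ ∫ t in Set.uIoc 0 x, (1 + ‖w t‖ ^ 2) :=
        integral_mono hi.norm (Integrable.fun_add hc hsq.integrableOn)
          fun t => by nlinarith [sq_nonneg (‖w t‖ - 1)]
    _ = (∫ t in Set.uIoc 0 x, (1 : ℝ)) + ∫ t in Set.uIoc 0 x, ‖w t‖ ^ 2 :=
        integral_add hc hsq.integrableOn
    _ ≤ |x| + ∫ t, ‖w t‖ ^ 2 := by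
        refine add_le_add (le_of_eq ?_) ?_
        · simp [Set.uIoc, Measure.real]
          rcases le_total 0 x with h | h
          · simp [abs_of_nonneg h, h]
          · simp [abs_of_nonpos h, h]
        · exact setIntegral_le_integral hsq (Eventually.of_forall fun t => by positivity)

/-- `W` solves `W' = A W + F` weakly in `L²`, with weak derivative `D`. -/
structure IsWeakSolution (A : ℝ → Matrix (Fin 3) (Fin 3) ℂ) (W D F : Fin 3 → L2) : Prop where
  weak : ∀ i, HasWeakDeriv (W i) (D i)
  eqn : ∀ᵐ x, ∀ i, D i x = (A x *ᵥ fun j => W j x) i + F i x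

theorem coeFn_linear_combination (a : Fin 3 → ℂ) (W : Fin 3 → L2) :
    ∀ᵐ x, (∑ j, a j • W j : L2) x = ∑ j, a j * W j x := by
  rw [Fin.sum_univ_three]
  filter_upwards [Lp.coeFn_add (a 0 • W 0 + a 1 • W 1) (a 2 • W 2),
    Lp.coeFn_add (a 0 • W 0) (a 1 • W 1), Lp.coeFn_smul (a 0) (W 0), Lp.coeFn_smul (a 1) (W 1),
    Lp.coeFn_smul (a 2) (W 2)] with x h1 h2 h3 h4 h5
  rw [h1, Pi.add_apply, h2, Pi.add_apply, h3, h4, h5, Fin.sum_univ_three]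
  rfl

open scoped Matrix.Norms.Operator

section Solve

variable {A Pl Pr : ℝ → Matrix (Fin 3) (Fin 3) ℂ} {A₀ V V' N : Matrix (Fin 3) (Fin 3) ℂ}
  {C κ : ℝ} {k : ℕ} {d : Fin 3 → ℂ} {δ r : ℝ}

theorem ExpAsymptotic.norm_entry_le (hA : ExpAsymptotic A A₀ C κ) (i j : Fin 3) :
    ∃ K, ∀ x, ‖A x i j‖ ≤ K := by
  refine ⟨C + ‖A₀ i j‖, fun x => ?_⟩
  have h1 := hA.decay x i j
  have hC : 0 ≤ C := nonneg_of_mul_nonneg_left ((norm_nonneg _).trans h1) (Real.exp_pos _)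
  have h2 : Real.exp (-κ * |x|) ≤ 1 := Real.exp_le_one_iff.2 (by
    have := mul_nonneg hA.rate_pos.le (abs_nonneg x); linarith)
  calc ‖A x i j‖ = ‖(A x - A₀) i j + A₀ i j‖ := by rw [Matrix.sub_apply, sub_add_cancel]
    _ ≤ ‖(A x - A₀) i j‖ + ‖A₀ i j‖ := norm_add_le _ _
    _ ≤ C + ‖A₀ i j‖ := by
        gcongr
        exact h1.trans (mul_le_of_le_one_right hC h2)

/-- A weak L² solution agrees almost everywhere with a primitive of its derivative; that
representative is continuous, hence a classical solution, to which `eq_zero_of_sq_integrable`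
applies. -/
theorem IsWeakSolution.eq_zero (hA : ExpAsymptotic A A₀ C κ) (h : IsBlockForm A₀ k d δ V V' N)
    (hl : IsConjugator A A₀ atBot Pl) (hr : IsConjugator A A₀ atTop Pr)
    (hdet : (Matrix.of fun i j => frameSolution A₀ V Pl Pr k j 0 i).det ≠ 0)
    {W D : Fin 3 → L2} (hW : IsWeakSolution A W D 0) : W = 0 := by
  choose a ha using fun i => (hW.weak i).exists_primitive
  let w : ℝ → Fin 3 → ℂ := fun x i => a i + ∫ t in (0 : ℝ)..x, D i t
  have hwae : ∀ᵐ x, ∀ i, W i x = w x i := ae_all_iff.2 ha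
  have hwc : Continuous w := continuous_pi fun i => continuous_const.add
    (intervalIntegral.continuous_primitive
      (intervalIntegrable_of_locallyIntegrable (locallyIntegrable_L2 (D i))) 0)
  have hAw : Continuous fun x => A x *ᵥ w x := hA.cont.matrix_mulVec hwc
  have hD : ∀ᵐ x, ∀ i, D i x = (A x *ᵥ w x) i := by
    have hz : ∀ᵐ x, (0 : L2) x = 0 := Lp.coeFn_zero ℂ 2 volume
    filter_upwards [hwae, hW.eqn, hz] with x h1 h2 h3 i
    rw [h2 i, Pi.zero_apply, h3, add_zero]
    congr 2
    exact funext h1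
  have hwd : ∀ x, HasDerivAt w (A x *ᵥ w x) x := fun x => hasDerivAt_pi.2 fun i => by
    have hci : Continuous fun x => (A x *ᵥ w x) i := (continuous_apply i).comp hAw
    have h1 : (fun x => w x i) = fun x => a i + ∫ t in (0 : ℝ)..x, (A t *ᵥ w t) i := by
      funext y
      simp only [w]
      congr 1
      refine intervalIntegral.integral_congr_ae ?_
      filter_upwards [hD] with t ht _
      exact ht i
    rw [h1]
    exact (intervalIntegral.integral_hasDerivAt_right (hci.intervalIntegrable _ _)
      (hci.stronglyMeasurableAtFilter _ _) hci.continuousAt).const_add _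
  have hint : Integrable fun x => ‖w x‖ ^ 2 := by
    have hsum : Integrable fun x => ∑ i, ‖W i x‖ ^ 2 := integrable_finsetSum _ fun i _ =>
      (memLp_two_iff_integrable_sq_norm (Lp.memLp (W i)).1).1 (Lp.memLp (W i))
    refine hsum.mono' (hwc.norm.pow 2).aestronglyMeasurable ?_
    filter_upwards [hwae] with x hx
    rw [Real.norm_of_nonneg (by positivity)]
    have h1 : ‖w x‖ ≤ √(∑ i, ‖W i x‖ ^ 2) := (pi_norm_le_iff_of_nonneg (by positivity)).2
      fun i => by
        rw [← hx i]
        refine Real.le_sqrt_of_sq_le ?_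
        exact Finset.single_le_sum (f := fun i => ‖W i x‖ ^ 2) (fun i _ => sq_nonneg _)
          (Finset.mem_univ i)
    calc ‖w x‖ ^ 2 ≤ √(∑ i, ‖W i x‖ ^ 2) ^ 2 := by gcongr
      _ = _ := Real.sq_sqrt (Finset.sum_nonneg fun i _ => sq_nonneg _)
  have h0 := eq_zero_of_sq_integrable hA h hl hr hdet hwd hint
  funext i
  refine (Lp.eq_zero_iff_ae_eq_zero).2 ?_
  filter_upwards [hwae] with x hx
  rw [hx i, h0]
  rfl

/-- The constant-coefficient equation is solved first, with solution W₀. The remaining error (A -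
A₀) W₀ has a continuous, exponentially decaying representative, so it is corrected by a classical
solution from `exists_decaying_solution`. -/
theorem exists_isWeakSolution (hA : ExpAsymptotic A A₀ C κ) (h : IsBlockForm A₀ k d δ V V' N)
    (hl : IsConjugator A A₀ atBot Pl) (hr : IsConjugator A A₀ atTop Pr)
    (hdet : (Matrix.of fun i j => frameSolution A₀ V Pl Pr k j 0 i).det ≠ 0)
    (hr0 : 0 < r) (hd : ∀ j, r ≤ |(d j).re|) (hδ : δ ≤ r / 12) (F : Fin 3 → L2) :
    ∃ W D, IsWeakSolution A W D F := by
  obtain ⟨W₀, hW₀⟩ := h.exists_weak_solution F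
  choose a ha using fun i => (hW₀ i).exists_primitive
  choose K hK0 hK using fun i => exists_primitive_bound (∑ j, A₀ i j • W₀ j + F i)
  let w : ℝ → Fin 3 → ℂ := fun x i =>
    a i + ∫ t in (0 : ℝ)..x, (∑ j, A₀ i j • W₀ j + F i : L2) t
  have hwae : ∀ᵐ x, ∀ i, W₀ i x = w x i := ae_all_iff.2 ha
  have hwc : Continuous w := continuous_pi fun i => continuous_const.add
    (intervalIntegral.continuous_primitive
      (intervalIntegrable_of_locallyIntegrable (locallyIntegrable_L2 _)) 0)
  set B := ∑ i, (‖a i‖ + K i) with hB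
  have hB0 : 0 ≤ B := Finset.sum_nonneg fun i _ => add_nonneg (norm_nonneg _) (hK0 i)
  have hwB : ∀ x i, ‖w x i‖ ≤ |x| + B := fun x i => by
    have h1 : ‖a i‖ + K i ≤ B := Finset.single_le_sum (f := fun i => ‖a i‖ + K i)
      (fun i _ => add_nonneg (norm_nonneg _) (hK0 i)) (Finset.mem_univ i)
    have h2 := norm_add_le (a i) (∫ t in (0 : ℝ)..x, (∑ j, A₀ i j • W₀ j + F i : L2) t)
    have h3 := hK i x
    change ‖a i + ∫ t in (0 : ℝ)..x, (∑ j, A₀ i j • W₀ j + F i : L2) t‖ ≤ _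
    linarith
  have hC : 0 ≤ C := nonneg_of_mul_nonneg_left ((norm_nonneg _).trans (hA.decay 0 0 0))
    (Real.exp_pos _)
  have hκ := hA.rate_pos
  -- Half of κ pays for the linear growth of w, and r/2 is the largest rate admitted by
  -- `exists_decaying_solution`.
  set β := min (κ / 2) (r / 2) with hβ
  have hβ0 : 0 < β := lt_min (half_pos hκ) (half_pos hr0)
  let G : ℝ → Fin 3 → ℂ := fun x => (A x - A₀) *ᵥ w x
  have hG : Continuous G := (hA.cont.sub continuous_const).matrix_mulVec hwc
  have hGb : ∀ x, ‖G x‖ ≤ 3 * (C * (2 / κ + B)) * Real.exp (-β * |x|) := fun x => by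
    have hlin : (|x| + B) * Real.exp (-κ * |x|) ≤ (2 / κ + B) * Real.exp (-β * |x|) := by
      have e1 : κ / 2 * |x| ≤ Real.exp (κ / 2 * |x|) := by
        linarith [Real.add_one_le_exp (κ / 2 * |x|)]
      have e2 : 1 ≤ Real.exp (κ / 2 * |x|) := Real.one_le_exp (by positivity)
      have e3 : |x| + B ≤ (2 / κ + B) * Real.exp (κ / 2 * |x|) := by
        have : |x| = 2 / κ * (κ / 2 * |x|) := by field_simp
        calc |x| + B = 2 / κ * (κ / 2 * |x|) + B * 1 := by rw [← this, mul_one]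
          _ ≤ 2 / κ * Real.exp (κ / 2 * |x|) + B * Real.exp (κ / 2 * |x|) := by gcongr
          _ = _ := by ring
      calc (|x| + B) * Real.exp (-κ * |x|)
          ≤ (2 / κ + B) * Real.exp (κ / 2 * |x|) * Real.exp (-κ * |x|) := by gcongr
        _ = (2 / κ + B) * Real.exp (-(κ / 2) * |x|) := by
            rw [mul_assoc, ← Real.exp_add]; congr 2; ring
        _ ≤ _ := by
            gcongr
            exact min_le_left _ _
    refine (pi_norm_le_iff_of_nonneg (by positivity)).2 fun i => ?_
    have e4 : ∀ j, ‖(A x - A₀) i j * w x j‖ ≤ C * (2 / κ + B) * Real.exp (-β * |x|) := fun j => by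
      rw [norm_mul]
      calc ‖(A x - A₀) i j‖ * ‖w x j‖ ≤ C * Real.exp (-κ * |x|) * (|x| + B) :=
            mul_le_mul (hA.decay x i j) (hwB x j) (norm_nonneg _) (by positivity)
        _ = C * ((|x| + B) * Real.exp (-κ * |x|)) := by ring
        _ ≤ C * ((2 / κ + B) * Real.exp (-β * |x|)) := by gcongr
        _ = _ := by ring
    calc ‖G x i‖ = ‖∑ j, (A x - A₀) i j * w x j‖ := rfl
      _ ≤ ∑ j : Fin 3, ‖(A x - A₀) i j * w x j‖ := norm_sum_le _ _
      _ ≤ ∑ _j : Fin 3, C * (2 / κ + B) * Real.exp (-β * |x|) :=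
          Finset.sum_le_sum fun j _ => e4 j
      _ = _ := by simp; ring
  obtain ⟨W₁, C', hW₁⟩ := exists_decaying_solution h hl hr hdet hr0 hd hδ hβ0 (min_le_right _ _)
    hG hGb
  have hW₁c : Continuous W₁ := continuous_iff_continuousAt.2 fun x => (hW₁ x).1.continuousAt
  obtain ⟨KA, hKA⟩ := hA.exists_norm_le
  have m1 : ∀ i, MemLp (fun x => W₁ x i) 2 := fun i =>
    memLp_of_exp_bound ((continuous_apply i).comp hW₁c) hβ0
      fun x => (norm_le_pi_norm (W₁ x) i).trans (hW₁ x).2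
  have m2 : ∀ i, MemLp (fun x => (A x *ᵥ W₁ x + G x) i) 2 := fun i =>
    memLp_of_exp_bound (C := KA * C' + 3 * (C * (2 / κ + B)))
      ((continuous_apply i).comp ((hA.cont.matrix_mulVec hW₁c).add hG)) hβ0 fun x => by
        calc ‖(A x *ᵥ W₁ x + G x) i‖ ≤ ‖A x *ᵥ W₁ x + G x‖ := norm_le_pi_norm _ i
          _ ≤ ‖A x *ᵥ W₁ x‖ + ‖G x‖ := norm_add_le _ _
          _ ≤ KA * (C' * Real.exp (-β * |x|)) + 3 * (C * (2 / κ + B)) * Real.exp (-β * |x|) := by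
              refine add_le_add ((Matrix.linfty_opNorm_mulVec _ _).trans ?_) (hGb x)
              exact mul_le_mul (hKA x) (hW₁ x).2 (norm_nonneg _) ((norm_nonneg _).trans (hKA x))
          _ = _ := by ring
  refine ⟨fun i => W₀ i + (m1 i).toLp _,
    fun i => (∑ j, A₀ i j • W₀ j + F i) + (m2 i).toLp _, ⟨fun i => ?_, ?_⟩⟩
  · exact (hW₀ i).add (hasWeakDeriv_toLp (fun x => hasDerivAt_pi.1 (hW₁ x).1 i) (m1 i) (m2 i))
  · have c1 : ∀ᵐ x, ∀ i, (W₀ i + (m1 i).toLp _ : L2) x = w x i + W₁ x i := by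
      rw [ae_all_iff]
      intro i
      filter_upwards [Lp.coeFn_add (W₀ i) ((m1 i).toLp _), (m1 i).coeFn_toLp, hwae]
        with x h1 h2 h3
      rw [h1, Pi.add_apply, h2, h3 i]
    have c2 : ∀ᵐ x, ∀ i, ((∑ j, A₀ i j • W₀ j + F i) + (m2 i).toLp _ : L2) x =
        (∑ j, A₀ i j * W₀ j x) + F i x + (A x *ᵥ W₁ x + G x) i := by
      rw [ae_all_iff]
      intro i
      filter_upwards [Lp.coeFn_add (∑ j, A₀ i j • W₀ j + F i) ((m2 i).toLp _),
        Lp.coeFn_add (∑ j, A₀ i j • W₀ j) (F i), (m2 i).coeFn_toLp,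
        coeFn_linear_combination (A₀ i) W₀] with x h1 h2 h3 h4
      rw [h1, Pi.add_apply, h2, Pi.add_apply, h3, h4]
    filter_upwards [c1, c2, hwae] with x h1 h2 h3 i
    have h4 : (fun j => (W₀ j + (m1 j).toLp _ : L2) x) = w x + W₁ x := funext fun j => h1 j
    rw [h2 i, h4]
    have h5 : ∑ j, A₀ i j * W₀ j x = (A₀ *ᵥ w x) i :=
      Finset.sum_congr rfl fun j _ => congrArg (A₀ i j * ·) (h3 j)
    rw [h5]
    simp only [G, Matrix.sub_mulVec, Matrix.mulVec_add, Pi.add_apply, Pi.sub_apply]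
    ring

/-- If the Evans determinant does not vanish, the inhomogeneous system has a bounded solution
operator on `L²`. -/
theorem exists_solution_operator (hA : ExpAsymptotic A A₀ C κ) (h : IsBlockForm A₀ k d δ V V' N)
    (hl : IsConjugator A A₀ atBot Pl) (hr : IsConjugator A A₀ atTop Pr)
    (hdet : (Matrix.of fun i j => frameSolution A₀ V Pl Pr k j 0 i).det ≠ 0)
    (hr0 : 0 < r) (hd : ∀ j, r ≤ |(d j).re|) (hδ : δ ≤ r / 12) :
    ∃ S : (Fin 3 → L2) →L[ℂ] (Fin 3 → L2), ∀ F, ∃ D, IsWeakSolution A (S F) D F := by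
  have hM : ∀ i j, ∃ M : L2 →L[ℂ] L2, ∀ v : L2, ∀ᵐ x, M v x = A x i j * v x := fun i j => by
    obtain ⟨K, hK⟩ := hA.norm_entry_le i j
    exact exists_mul_operator (hA.cont.matrix_elem i j) hK
  choose M hM using hM
  have hiff : ∀ W D F : Fin 3 → L2, (∀ᵐ x, ∀ i, D i x = (A x *ᵥ fun j => W j x) i + F i x) ↔
      ∀ i, D i = ∑ j, M i j (W j) + F i := by
    intro W D F
    rw [ae_all_iff]
    refine forall_congr' fun i => ?_
    have h1 : ∀ᵐ x, (∑ j, M i j (W j) + F i : L2) x = (A x *ᵥ fun j => W j x) i + F i x := by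
      filter_upwards [Lp.coeFn_add (∑ j, M i j (W j)) (F i),
        coeFn_linear_combination (fun _ => 1) (fun j => M i j (W j)),
        ae_all_iff.2 fun j => hM i j (W j)] with x h1 h2 h3
      simp only [one_smul, one_mul, h3] at h2
      rw [h1, Pi.add_apply, h2]
      rfl
    constructor
    · intro h2
      refine Lp.ext ?_
      filter_upwards [h1, h2] with x e1 e2
      rw [e1, e2]
    · intro h2
      rw [h2]
      exact h1
  -- The graph of triples (F, W, D) is closed because weak differentiation and the multiplications
  -- are. Its projection to F is bijective by existence and uniqueness, and the open mapping theorem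
  -- makes the inverse bounded.
  let Γ : Submodule ℂ ((Fin 3 → L2) × ((Fin 3 → L2) × (Fin 3 → L2))) :=
    { carrier := {q | (∀ i, HasWeakDeriv (q.2.1 i) (q.2.2 i)) ∧
        ∀ i, q.2.2 i = ∑ j, M i j (q.2.1 j) + q.1 i}
      add_mem' := fun {p q} hp hq => ⟨fun i => (hp.1 i).add (hq.1 i), fun i => by
        change p.2.2 i + q.2.2 i = ∑ j, M i j (p.2.1 j + q.2.1 j) + (p.1 i + q.1 i)
        rw [hp.2 i, hq.2 i]
        simp only [map_add, Finset.sum_add_distrib]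
        abel⟩
      zero_mem' := ⟨fun _ => HasWeakDeriv.zero, fun i => by simp⟩
      smul_mem' := fun a q hq => ⟨fun i => (hq.1 i).const_smul a, fun i => by
        change a • q.2.2 i = ∑ j, M i j (a • q.2.1 j) + a • q.1 i
        rw [hq.2 i]
        simp only [map_smul, Finset.smul_sum, smul_add]⟩ }
  have hmem : ∀ W D F, IsWeakSolution A W D F ↔ (F, (W, D)) ∈ Γ := fun W D F =>
    ⟨fun hs => ⟨hs.weak, (hiff W D F).1 hs.eqn⟩, fun hs => ⟨hs.1, (hiff W D F).2 hs.2⟩⟩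
  have hclosed : IsClosed (Γ : Set ((Fin 3 → L2) × ((Fin 3 → L2) × (Fin 3 → L2)))) := by
    have h1 : IsClosed {q : (Fin 3 → L2) × ((Fin 3 → L2) × (Fin 3 → L2)) |
        ∀ i, HasWeakDeriv (q.2.1 i) (q.2.2 i)} := by
      simp only [Set.ofPred_forall]
      refine isClosed_iInter fun i => ?_
      exact isClosed_hasWeakDeriv.preimage
        (f := fun q : (Fin 3 → L2) × ((Fin 3 → L2) × (Fin 3 → L2)) => (q.2.1 i, q.2.2 i))
        (by fun_prop)
    have h2 : IsClosed {q : (Fin 3 → L2) × ((Fin 3 → L2) × (Fin 3 → L2)) |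
        ∀ i, q.2.2 i = ∑ j, M i j (q.2.1 j) + q.1 i} := by
      simp only [Set.ofPred_forall]
      refine isClosed_iInter fun i => isClosed_eq (by fun_prop) (by fun_prop)
    exact h1.inter h2
  have : CompleteSpace Γ := hclosed.completeSpace_coe
  let π : Γ →L[ℂ] (Fin 3 → L2) := (ContinuousLinearMap.fst ℂ _ _).comp Γ.subtypeL
  have hinj : π.ker = ⊥ := by
    refine LinearMap.ker_eq_bot'.2 fun q hq => ?_
    have hq1 : (q : (Fin 3 → L2) × ((Fin 3 → L2) × (Fin 3 → L2))).1 = 0 := hq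
    have hs : IsWeakSolution A q.1.2.1 q.1.2.2 0 := by
      rw [hmem, ← hq1]
      exact q.2
    have hW := hs.eq_zero hA h hl hr hdet
    have hD : q.1.2.2 = 0 := by
      funext i
      rw [q.2.2 i, hW, hq1]
      simp
    refine Subtype.ext (Prod.ext hq1 (Prod.ext hW hD))
  have hsurj : π.range = ⊤ := by
    refine LinearMap.range_eq_top.2 fun F => ?_
    obtain ⟨W, D, hs⟩ := exists_isWeakSolution hA h hl hr hdet hr0 hd hδ F
    exact ⟨⟨(F, (W, D)), (hmem W D F).1 hs⟩, rfl⟩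
  let e := ContinuousLinearEquiv.ofBijective π hinj hsurj
  have he : ∀ F, (e.symm F : (Fin 3 → L2) × ((Fin 3 → L2) × (Fin 3 → L2))).1 = F := fun F =>
    ContinuousLinearEquiv.ofBijective_apply_symm_apply π hinj hsurj F
  refine ⟨(ContinuousLinearMap.fst ℂ _ _).comp ((ContinuousLinearMap.snd ℂ _ _).comp
    (Γ.subtypeL.comp (e.symm : (Fin 3 → L2) →L[ℂ] Γ))), fun F => ⟨(e.symm F).1.2.2, ?_⟩⟩
  rw [hmem]
  have h1 := (e.symm F).2
  have h2 : (e.symm F : (Fin 3 → L2) × ((Fin 3 → L2) × (Fin 3 → L2))) =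
      (F, ((e.symm F).1.2.1, (e.symm F).1.2.2)) := Prod.ext (he F) rfl
  rw [h2] at h1
  exact h1

end Solve

end JinXin

/-! ### Resolvent set, essential spectrum and the unstable eigenvalue -/

namespace JinXin

open scoped Matrix.Norms.Operator

/-- The right-hand side of the first-order system for the resolvent equation. -/
noncomputable def systemSource (c : ℝ) (G : L2 × L2) : Fin 3 → L2 :=
  ![-(c⁻¹ : ℂ) • G.1, 0, (c : ℂ) • G.1 - G.2]

theorem coeFn_systemSource (c : ℝ) (G : L2 × L2) :
    ∀ᵐ x, systemSource c G 0 x = -(c⁻¹ : ℂ) * G.1 x ∧ systemSource c G 1 x = 0 ∧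
      systemSource c G 2 x = c * G.1 x - G.2 x := by
  filter_upwards [Lp.coeFn_smul (-(c⁻¹ : ℂ)) G.1, Lp.coeFn_smul (c : ℂ) G.1,
    Lp.coeFn_sub ((c : ℂ) • G.1) G.2, Lp.coeFn_zero ℂ 2 (volume : Measure ℝ)] with x h1 h2 h3 h4
  refine ⟨h1, h4, ?_⟩
  change ((c : ℂ) • G.1 - G.2 : L2) x = _
  rw [h3, Pi.sub_apply, h2]
  rfl

section Resolvent

variable {cs c : ℝ} {b : ℝ → ℝ} {l : ℂ}

theorem evansMatrix_mulVec (hc : c ≠ 0) (hcs : cs ^ 2 = c ^ 2) (β : ℝ) (w : Fin 3 → ℂ) :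
    (evansMatrix cs c β l *ᵥ w) 0 = (l * w 0 - w 2) / c ∧ (evansMatrix cs c β l *ᵥ w) 1 = w 2 ∧
      (evansMatrix cs c β l *ᵥ w) 2 = (β - c * l) * w 0 + (l + 1) * w 1 := by
  rw [evansMatrix_eq hc hcs]
  refine ⟨?_, ?_, ?_⟩ <;> simp [Matrix.mulVec, dotProduct, Fin.sum_univ_three]
  ring

theorem LinearizedOp.of_isWeakSolution (hc : c ≠ 0) (hcs : cs ^ 2 = c ^ 2) {W D : Fin 3 → L2}
    {G : L2 × L2} (h : IsWeakSolution (fun x => evansMatrix cs c (b x) l) W D (systemSource c G)) :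
    LinearizedOp cs c b (W 0, W 1) (l • (W 0, W 1) - G) := by
  have hc' : (c : ℂ) ≠ 0 := by exact_mod_cast hc
  have hcs' : (cs : ℂ) ^ 2 = c ^ 2 := by exact_mod_cast hcs
  -- The second row, which has no source, identifies W 2 with the weak derivative of W 1; this puts
  -- W 1 in H².
  have h12 : W 2 = D 1 := by
    refine Lp.ext ?_
    filter_upwards [h.eqn, coeFn_systemSource c G] with x h1 h2
    rw [h1 1, h2.2.1, (evansMatrix_mulVec hc hcs _ _).2.1, add_zero]
  refine ⟨D 0, D 1, D 2, h.weak 0, h.weak 1, h12 ▸ h.weak 2, ?_, ?_⟩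
  · change ∀ᵐ x, (l • W 0 - G.1 : L2) x = _
    filter_upwards [h.eqn, coeFn_systemSource c G, Lp.coeFn_sub (l • W 0) G.1,
      Lp.coeFn_smul l (W 0)] with x h1 h2 h3 h4
    rw [h3, Pi.sub_apply, h4, h1 0, h1 1, h2.1, h2.2.1, (evansMatrix_mulVec hc hcs _ _).1,
      (evansMatrix_mulVec hc hcs _ _).2.1, Pi.smul_apply, smul_eq_mul]
    field_simp
    ring
  · change ∀ᵐ x, (l • W 1 - G.2 : L2) x = _
    filter_upwards [h.eqn, coeFn_systemSource c G, Lp.coeFn_sub (l • W 1) G.2,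
      Lp.coeFn_smul l (W 1)] with x h1 h2 h3 h4
    rw [h3, Pi.sub_apply, h4, h1 0, h1 1, h1 2, h2.1, h2.2.1, h2.2.2,
      (evansMatrix_mulVec hc hcs _ _).1, (evansMatrix_mulVec hc hcs _ _).2.1,
      (evansMatrix_mulVec hc hcs _ _).2.2, Pi.smul_apply, smul_eq_mul, hcs']
    field_simp
    ring

theorem LinearizedOp.exists_isWeakSolution (hc : c ≠ 0) (hcs : cs ^ 2 = c ^ 2) {v g : L2 × L2}
    (h : LinearizedOp cs c b v g) (l : ℂ) : ∃ W D, W 0 = v.1 ∧ W 1 = v.2 ∧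
      IsWeakSolution (fun x => evansMatrix cs c (b x) l) W D (systemSource c (l • v - g)) := by
  have hc' : (c : ℂ) ≠ 0 := by exact_mod_cast hc
  have hcs' : (cs : ℂ) ^ 2 = c ^ 2 := by exact_mod_cast hcs
  obtain ⟨dτ, du, ddu, w1, w2, w3, e1, e2⟩ := h
  refine ⟨![v.1, v.2, du], ![dτ, du, ddu], rfl, rfl, fun i => ?_, ?_⟩
  · fin_cases i
    exacts [w1, w2, w3]
  · filter_upwards [e1, e2, coeFn_systemSource c (l • v - g), Lp.coeFn_sub (l • v.1) g.1,
      Lp.coeFn_smul l v.1, Lp.coeFn_sub (l • v.2) g.2, Lp.coeFn_smul l v.2]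
      with x h1 h2 h3 h4 h5 h6 h7
    have k1 : (l • v - g).1 x = l * v.1 x - g.1 x := by
      change (l • v.1 - g.1 : L2) x = _
      rw [h4, Pi.sub_apply, h5]
      rfl
    have k2 : (l • v - g).2 x = l * v.2 x - g.2 x := by
      change (l • v.2 - g.2 : L2) x = _
      rw [h6, Pi.sub_apply, h7]
      rfl
    rw [k1, k2, h1, h2, hcs'] at h3
    intro i
    fin_cases i
    · change dτ x = (_ *ᵥ _) 0 + systemSource c (l • v - g) 0 x
      rw [h3.1, (evansMatrix_mulVec hc hcs _ _).1]
      change dτ x = (l * v.1 x - du x) / c + _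
      field_simp
      ring
    · change du x = (_ *ᵥ _) 1 + systemSource c (l • v - g) 1 x
      rw [h3.2.1, (evansMatrix_mulVec hc hcs _ _).2.1]
      change du x = du x + 0
      ring
    · change ddu x = (_ *ᵥ _) 2 + systemSource c (l • v - g) 2 x
      rw [h3.2.2, (evansMatrix_mulVec hc hcs _ _).2.2]
      change ddu x = (b x - c * l) * v.1 x + (l + 1) * v.2 x + _
      ring

theorem systemSource_zero (c : ℝ) : systemSource c 0 = 0 := by
  funext i
  fin_cases i <;> simp [systemSource]

theorem IsWeakSolution.sub {A : ℝ → Matrix (Fin 3) (Fin 3) ℂ} {W D W' D' F : Fin 3 → L2}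
    (h : IsWeakSolution A W D F) (h' : IsWeakSolution A W' D' F) :
    IsWeakSolution A (W - W') (D - D') 0 where
  weak i := by
    simpa [sub_eq_add_neg] using (h.weak i).add ((h'.weak i).const_smul (-1))
  eqn := by
    have h1 : ∀ᵐ x, ∀ i, (W - W') i x = W i x - W' i x := ae_all_iff.2 fun i =>
      Lp.coeFn_sub (W i) (W' i)
    have h2 : ∀ᵐ x, ∀ i, (D - D') i x = D i x - D' i x := ae_all_iff.2 fun i =>
      Lp.coeFn_sub (D i) (D' i)
    filter_upwards [h.eqn, h'.eqn, h1, h2, Lp.coeFn_zero ℂ 2 (volume : Measure ℝ)]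
      with x k1 k2 k3 k4 k5 i
    have e : (fun j => (W - W') j x) = (fun j => W j x) - fun j => W' j x := funext k3
    rw [k4, k1, k2, e, Matrix.mulVec_sub, Pi.sub_apply, Pi.zero_apply, k5, Pi.zero_apply]
    ring

/-- The resolvent equation and the first-order system correspond in both directions. Solvability of
the system gives the right inverse, and uniqueness of its L² solutions the left inverse. -/
theorem mem_l2Resolvent {A₀ V V' N : Matrix (Fin 3) (Fin 3) ℂ}
    {Pl Pr : ℝ → Matrix (Fin 3) (Fin 3) ℂ} {C κ r δ : ℝ} {k : ℕ} {d : Fin 3 → ℂ} (hc : c ≠ 0)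
    (hcs : cs ^ 2 = c ^ 2) (hA : ExpAsymptotic (fun x => evansMatrix cs c (b x) l) A₀ C κ)
    (h : IsBlockForm A₀ k d δ V V' N)
    (hl : IsConjugator (fun x => evansMatrix cs c (b x) l) A₀ atBot Pl)
    (hr : IsConjugator (fun x => evansMatrix cs c (b x) l) A₀ atTop Pr)
    (hdet : (Matrix.of fun i j => frameSolution A₀ V Pl Pr k j 0 i).det ≠ 0)
    (hr0 : 0 < r) (hd : ∀ j, r ≤ |(d j).re|) (hδ : δ ≤ r / 12) : l ∈ l2Resolvent cs c b := by
  obtain ⟨S, hS⟩ := exists_solution_operator hA h hl hr hdet hr0 hd hδ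
  let Φ : (L2 × L2) →L[ℂ] (Fin 3 → L2) := ContinuousLinearMap.pi
    ![-(c⁻¹ : ℂ) • ContinuousLinearMap.fst ℂ L2 L2, 0,
      (c : ℂ) • ContinuousLinearMap.fst ℂ L2 L2 - ContinuousLinearMap.snd ℂ L2 L2]
  have hΦ : ∀ G, Φ G = systemSource c G := fun G => by
    funext i
    fin_cases i <;> rfl
  refine ⟨((ContinuousLinearMap.proj 0).prod (ContinuousLinearMap.proj 1)).comp (S.comp Φ),
    fun G => ?_, fun v g hvg => ?_⟩
  · obtain ⟨D, hD⟩ := hS (systemSource c G)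
    have := LinearizedOp.of_isWeakSolution hc hcs hD
    rw [← hΦ] at this
    exact this
  · obtain ⟨W, D, h0, h1, hW⟩ := hvg.exists_isWeakSolution hc hcs l
    obtain ⟨D', hD'⟩ := hS (systemSource c (l • v - g))
    have h2 := sub_eq_zero.1 ((hD'.sub hW).eq_zero hA h hl hr hdet)
    change ((S (Φ (l • v - g))) 0, (S (Φ (l • v - g))) 1) = v
    rw [hΦ, h2, h0, h1]

theorem isEvansValue_zero {b₀ : ℝ} {V V' N : Matrix (Fin 3) (Fin 3) ℂ}
    {Pl Pr : ℝ → Matrix (Fin 3) (Fin 3) ℂ} {δ : ℝ} {d : Fin 3 → ℂ} (hc : c ≠ 0)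
    (hcs : cs ^ 2 = c ^ 2)
    (h : IsBlockForm (evansMatrix cs c b₀ l) (growingModes c) d δ V V' N)
    (hl : IsConjugator (fun x => evansMatrix cs c (b x) l) (evansMatrix cs c b₀ l) atBot Pl)
    (hr : IsConjugator (fun x => evansMatrix cs c (b x) l) (evansMatrix cs c b₀ l) atTop Pr)
    (hdet : (Matrix.of fun i j =>
      frameSolution (evansMatrix cs c b₀ l) V Pl Pr (growingModes c) j 0 i).det = 0) :
    IsEvansValue cs c b b₀ l 0 :=
  ⟨growingModes c, _, _, eventually_isHyperbolicSplitting b₀ hc hcs,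
    evansFrame_frameSolution h hl hr, by rw [hdet, zero_div]⟩

/-- Off the zero set of the Evans function the closed right half-plane without the origin belongs
to the resolvent set. -/
theorem re_neg_of_mem_essentialSpectrum {b₀ C κ : ℝ} (hc : c ≠ 0) (hcs : cs ^ 2 = c ^ 2)
    (hb₀ : |b₀| ≤ |c|) (hb : Continuous b) (hκ : 0 < κ)
    (hbC : ∀ x, |b x - b₀| ≤ C * Real.exp (-κ * |x|)) (hl : l ∈ essentialSpectrum cs c b b₀)
    (hl0 : l ≠ 0) : l.re < 0 := by
  by_contra hcon
  obtain ⟨d, hd⟩ := exists_hyperbolicForm_complex hc hcs hb₀ (not_lt.1 hcon) hl0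
  have hA := expAsymptotic_evansMatrix (cs := cs) (c := c) hb hκ hbC l
  obtain ⟨Pl, hPl⟩ := hA.exists_conjugator_atBot hd.nearlyDiagonalizable
  obtain ⟨Pr, hPr⟩ := hA.exists_conjugator_atTop hd.nearlyDiagonalizable
  obtain ⟨r, V, V', N, hr, hrd, hV⟩ := hd.exists_blockForm
  by_cases hdet : (Matrix.of fun i j =>
      frameSolution (evansMatrix cs c b₀ l) V Pl Pr (growingModes c) j 0 i).det = 0
  · exact hl.2 (isEvansValue_zero hc hcs hV hPl hPr hdet)
  · exact hl.1 (mem_l2Resolvent hc hcs hA hV hPl hPr hdet hr hrd le_rfl)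

/-- A nonzero localized real mode gives an eigenvalue in `L²` and a zero of the Evans function. -/
theorem IsRealMode.isEvansValue_and_isL2Eigenvalue {b₀ C κ K ν r : ℝ} {τ u p : ℝ → ℝ}
    (hm : IsRealMode c b r τ u p) (hc : c ≠ 0) (hcs : cs ^ 2 = c ^ 2) (hb : Continuous b)
    (hκ : 0 < κ) (hbC : ∀ x, |b x - b₀| ≤ C * Real.exp (-κ * |x|)) (hr : 0 < r) (hν : 0 < ν)
    (hK : ∀ x, |τ x| ≤ K * Real.exp (-ν * |x|) ∧ |u x| ≤ K * Real.exp (-ν * |x|) ∧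
      |p x| ≤ K * Real.exp (-ν * |x|)) (hne : ∃ x, τ x ≠ 0) :
    IsEvansValue cs c b b₀ r 0 ∧ IsL2Eigenvalue cs c b r := by
  obtain ⟨x₀, hx₀⟩ := hne
  let W : ℝ → Fin 3 → ℂ := fun x => ![(τ x : ℂ), u x, p x]
  have hW : ∀ x, HasDerivAt W (evansMatrix cs c (b x) r *ᵥ W x) x := fun x => hm.hasDerivAt hc hcs x
  have hWc : Continuous W := continuous_iff_continuousAt.2 fun x => (hW x).continuousAt
  have hWb : ∀ x, ‖W x‖ ≤ K * Real.exp (-ν * |x|) := fun x => by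
    obtain ⟨k1, k2, k3⟩ := hK x
    refine (pi_norm_le_iff_of_nonneg ((abs_nonneg _).trans k1)).2 fun i => ?_
    fin_cases i
    · simpa [W] using k1
    · simpa [W] using k2
    · simpa [W] using k3
  have hA := expAsymptotic_evansMatrix (cs := cs) (c := c) hb hκ hbC r
  obtain ⟨d, hd⟩ := exists_hyperbolicForm_real (b := b₀) hc hcs hr
  obtain ⟨Pl, hPl⟩ := hA.exists_conjugator_atBot hd.nearlyDiagonalizable
  obtain ⟨Pr, hPr⟩ := hA.exists_conjugator_atTop hd.nearlyDiagonalizable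
  obtain ⟨ρ, V, V', N, hρ, hρd, hV⟩ := hd.exists_blockForm
  constructor
  · refine isEvansValue_zero hc hcs hV hPl hPr ?_
    by_contra hdet
    have h0 := eq_zero_of_sq_integrable hA hV hPl hPr hdet hW
      ((memLp_two_iff_integrable_sq_norm hWc.aestronglyMeasurable).1
        (memLp_of_exp_bound hWc hν hWb))
    have := congrFun (congrFun h0 x₀) 0
    simp only [W, Matrix.cons_val_zero, Pi.zero_apply, Complex.ofReal_eq_zero] at this
    exact hx₀ this
  · obtain ⟨KA, hKA⟩ := hA.exists_norm_le
    have m1 : ∀ i, MemLp (fun x => W x i) 2 := fun i =>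
      memLp_of_exp_bound ((continuous_apply i).comp hWc) hν
        fun x => (norm_le_pi_norm (W x) i).trans (hWb x)
    have m2 : ∀ i, MemLp (fun x => (evansMatrix cs c (b x) r *ᵥ W x) i) 2 := fun i =>
      memLp_of_exp_bound (C := KA * K)
        ((continuous_apply i).comp (hA.cont.matrix_mulVec hWc)) hν fun x =>
          calc ‖(evansMatrix cs c (b x) r *ᵥ W x) i‖ ≤ ‖evansMatrix cs c (b x) r *ᵥ W x‖ :=
                norm_le_pi_norm _ i
            _ ≤ KA * (K * Real.exp (-ν * |x|)) := (Matrix.linfty_opNorm_mulVec _ _).trans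
                (mul_le_mul (hKA x) (hWb x) (norm_nonneg _) ((norm_nonneg _).trans (hKA x)))
            _ = _ := by ring
    have hs : IsWeakSolution (fun x => evansMatrix cs c (b x) r) (fun i => (m1 i).toLp _)
        (fun i => (m2 i).toLp _) (systemSource c 0) := by
      rw [systemSource_zero]
      refine ⟨fun i => hasWeakDeriv_toLp (fun x => hasDerivAt_pi.1 (hW x) i) (m1 i) (m2 i), ?_⟩
      have c1 : ∀ᵐ x, ∀ i, (m1 i).toLp _ x = W x i := ae_all_iff.2 fun i => (m1 i).coeFn_toLp
      have c2 : ∀ᵐ x, ∀ i, (m2 i).toLp _ x = (evansMatrix cs c (b x) r *ᵥ W x) i :=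
        ae_all_iff.2 fun i => (m2 i).coeFn_toLp
      filter_upwards [c1, c2, Lp.coeFn_zero ℂ 2 (volume : Measure ℝ)] with x h1 h2 h3 i
      have e : (fun j => (m1 j).toLp _ x) = W x := funext h1
      rw [h2, e, Pi.zero_apply, h3, Pi.zero_apply, add_zero]
    have hop := LinearizedOp.of_isWeakSolution hc hcs hs
    rw [sub_zero] at hop
    refine ⟨_, fun h0 => hx₀ ?_, hop⟩
    have h1 : (m1 0).toLp _ = 0 := congrArg Prod.fst h0
    have h2 : (fun x => W x 0) =ᵐ[volume] fun _ => 0 := by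
      filter_upwards [(m1 0).coeFn_toLp, (Lp.eq_zero_iff_ae_eq_zero).1 h1] with x k1 k2
      rw [← k1, k2]
      rfl
    have h3 := congrFun ((Continuous.ae_eq_iff_eq volume ((continuous_apply 0).comp hWc)
      continuous_const).1 h2) x₀
    simpa [W] using h3

end Resolvent

end JinXin

theorem mainTheorem1 (f : ℝ → ℝ) (I : Set ℝ) (hI : IsOpen I) (hf : ContDiffOn ℝ 2 f I)
    (cs : ℝ) (hcs : 0 < cs) (c τ₀ u₀ : ℝ) (τ u : ℝ → ℝ)
    (hτ₀ : τ₀ ∈ I) (hτ : ∀ x, τ x ∈ I)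
    (hwave : JinXin.IsSolitaryWave f cs c τ₀ u₀ τ u)
    (hnondeg : deriv f τ₀ ≠ c) :
    (|c| = cs ∧ c * deriv f τ₀ < c ^ 2) ∧
    (|deriv f τ₀| ≤ cs →
      ∀ l ∈ JinXin.essentialSpectrum cs c (fun x => deriv f (τ x)) (deriv f τ₀),
        l ≠ 0 → l.re < 0) ∧
    (∃ r : ℝ, 0 < r ∧
      JinXin.IsEvansValue cs c (fun x => deriv f (τ x)) (deriv f τ₀) r 0 ∧
      JinXin.IsL2Eigenvalue cs c (fun x => deriv f (τ x)) r) := by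
  obtain ⟨hcc, hc, hlt, hb, ⟨C, κ, hκ, hbC⟩, C', κ', M, Y, Y₁, Y₂, hM, hY⟩ :=
    hwave.exists_profile hI hf hcs hτ₀ hτ hnondeg
  have habs : |c| = cs := by
    rw [← abs_of_pos hcs]
    exact ((sq_eq_sq_iff_abs_eq_abs cs c).1 hcc).symm
  refine ⟨⟨habs, hlt⟩, fun hsub l hl hl0 => ?_, ?_⟩
  · exact JinXin.re_neg_of_mem_essentialSpectrum hc hcc (habs ▸ hsub) hb hκ hbC hl hl0
  · obtain ⟨r, v, w, p, K, ν, hr, hm, hν, hK, hne⟩ :=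
      JinXin.exists_decaying_mode hc hlt hb hκ hbC hM hY
    exact ⟨r, hr, hm.isEvansValue_and_isL2Eigenvalue hc hcc hb hκ hbC hr hν hK hne⟩
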